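/- Let $M$ be a smooth $n$-dimensional manifold (Hausdorff, second countable) and $L(M)$ the space of smooth maps $u:S^1\to M$, $S^1=\mathbb R/\mathbb Z$ with coordinate $x$. Consider operators $P$ on $L(M)$, mapping smooth sections of $u^*T^*M$ to smooth sections of $u^*TM$ for each loop $u$, which in every local coordinate system $(u^1,\dots,u^n)$ of $M$ have the form (summing over repeated indices) $$P^{ij}=a^{ij}\Big(\frac{d}{dx}\Big)^2+b^{ij}_k u^k_x\frac{d}{dx}+c^{ij}_{kl}u^k_xu^l_x+c^{ij}_k u^k_{xx},$$ where $a^{ij},b^{ij}_k,c^{ij}_{kl},c^{ij}_k$ are smooth functions of $u^1,\dots,u^n$, the matrix $(a^{ij})$ is everywhere non-degenerate, and $c^{ij}_{kl}=c^{ij}_{lk}$. Such a $P$ is called Hamiltonian if $$\{F,G\}=\int_{S^1}\frac{\delta F}{\delta u^i}\,P^{ij}\Big(\frac{\delta G}{\delta u^j}\Big)dx$$ is a Poisson bracket (skew-symmetric and satisfying the Jacobi identity) on local functionals $F[u]=\int_{S^1} f(x,u,u_x,\dots,u^{(m)})\,dx$ on $L(M)$. There is a one-to-one correspondence between Hamiltonian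 operators $P$ of this form on $L(M)$ and pairs $(a,\nabla)$ on $M$ consisting of a smooth non-degenerate bivector $a^{ij}=-a^{ji}$ and a smooth torsion-free connection $\nabla$ whose curvature vanishes and which satisfies $$a^{ir}\nabla_r a^{jk}=a^{jr}\nabla_r a^{ki}.$$ In all local coordinates the correspondence is as follows: the components of the bivector $a$ are the leading coefficients $a^{ij}$ of $P$; the Christoffel symbols $\Gamma^k_{ij}$ of $\nabla$ (with $\nabla_{\partial_i}\partial_j=\Gamma^k_{ij}\partial_k$) are related to $c^{ij}_k$ by $c^{ij}_k=-a^{ir}\Gamma^j_{rk}$; and $$b^{ij}_k=\nabla_k a^{ij}+2c^{ij}_k,\qquad c^{ij}_{kl}=\tfrac12\big(\partial_l c^{ij}_k+\partial_k c^{ij}_l\big)-\tfrac12\,a_{pr}\big(c^{ri}_k c^{pj}_l+c^{ri}_l c^{pj}_k\big),$$ where $(a_{ij})$ is the inverse matrix of $(a^{ij})$, $a_{ir}a^{rj}=\delta_i^j$. -/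

import Mathlib

open scoped Manifold ContDiff Matrix

noncomputable section

namespace DegTwo

/-- The model space of an `n`-dimensional manifold. -/
abbrev Model (n : ℕ) : Type := EuclideanSpace ℝ (Fin n)

/-- The `k`-th partial derivative of a real function of the coordinates `y = (u¹, …, uⁿ)`. -/
def pderiv {n : ℕ} (k : Fin n) (f : Model n → ℝ) (y : Model n) : ℝ :=
  fderiv ℝ f y (EuclideanSpace.single k (1 : ℝ))

/-! ### Charts, tangent vectors and covectors -/

section Charts

variable {n : ℕ} {M : Type*} [TopologicalSpace M] [ChartedSpace (Model n) M]

/-- Covectors at a point `p` of the manifold. -/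
abbrev Cotangent (n : ℕ) {M : Type*} [TopologicalSpace M] [ChartedSpace (Model n) M]
    (p : M) : Type :=
  TangentSpace (𝓡 n) p →L[ℝ] ℝ

variable (n M) in
/-- The smooth local coordinate systems of `M`: the charts of the maximal smooth atlas. -/
abbrev charts : Set (OpenPartialHomeomorph M (Model n)) :=
  IsManifold.maximalAtlas (𝓡 n) ∞ M

/-- The derivative at `p` of the coordinate map of the chart `e`. -/
def chartDeriv (e : OpenPartialHomeomorph M (Model n)) (p : M) :
    TangentSpace (𝓡 n) p →L[ℝ] Model n :=
  mfderiv (𝓡 n) (𝓡 n) e p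

/-- The coordinate vector `∂/∂uⁱ` of the chart `e` at `p` (meaningful for `p ∈ e.source`). -/
def coordVec (e : OpenPartialHomeomorph M (Model n)) (i : Fin n) (p : M) :
    TangentSpace (𝓡 n) p :=
  (chartDeriv e p).inverse (EuclideanSpace.single i (1 : ℝ))

/-- The coordinate covector `duⁱ` of the chart `e` at `p` (meaningful for `p ∈ e.source`). -/
def coordCovec (e : OpenPartialHomeomorph M (Model n)) (i : Fin n) (p : M) : Cotangent n p :=
  (EuclideanSpace.proj i : Model n →L[ℝ] ℝ).comp (chartDeriv e p)

end Charts

/-! ### Bivectors and connections on the target manifold -/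

section Target

variable (n : ℕ) (M : Type*) [TopologicalSpace M] [ChartedSpace (Model n) M]

/-- A smooth bivector field: a smooth skew-symmetric bilinear form on the cotangent spaces. -/
structure Bivector where
  /-- the bilinear form at a point -/
  toFun : ∀ p : M, LinearMap.BilinForm ℝ (Cotangent n p)
  skew : ∀ p : M, ∀ α β : Cotangent n p, toFun p α β = - toFun p β α
  smooth : ∀ e ∈ charts n M, ∀ i j : Fin n,
    ContDiffOn ℝ ∞
      (fun y : Model n =>
        toFun (e.symm y) (coordCovec e i (e.symm y)) (coordCovec e j (e.symm y))) e.target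

/-- A smooth affine connection on `M`: a covariant derivative on the tangent bundle that maps
smooth fields to smooth fields. In Mathlib's argument order `∇ Y p (X p)` is `(∇_X Y)(p)`. The
value of a Mathlib covariant derivative on fields that are not differentiable at `p` is
arbitrary; it is fixed to be `0`, so that two connections are equal if and only if they have the
same covariant derivatives of differentiable vector fields. -/
structure Connection [IsManifold (𝓡 n) ∞ M] where
  /-- the covariant derivative -/
  cov : CovariantDerivative (𝓡 n) (Model n) (TangentSpace (𝓡 n) : M → Type)
  smooth : CovariantDerivative.ContMDiffCovariantDerivative cov ∞
  eq_zero_of_not_differentiable : ∀ (Y : ∀ p : M, TangentSpace (𝓡 n) p) (p : M),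
    ¬ MDifferentiableAt (𝓡 n) ((𝓡 n).prod 𝓘(ℝ, Model n))
        (fun q : M => (⟨q, Y q⟩ : TangentBundle (𝓡 n) M)) p →
    cov Y p = 0

variable {n M}

/-- The components `aⁱʲ` of a bivector in the chart `e`, as functions of the coordinates. -/
def Bivector.comp (a : Bivector n M) (e : OpenPartialHomeomorph M (Model n)) (i j : Fin n)
    (y : Model n) : ℝ :=
  a.toFun (e.symm y) (coordCovec e i (e.symm y)) (coordCovec e j (e.symm y))

/-- The bivector is non-degenerate at every point. -/
def Bivector.IsNondegenerate (a : Bivector n M) : Prop :=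
  ∀ p : M, (a.toFun p).Nondegenerate

variable [IsManifold (𝓡 n) ∞ M]

/-- The Christoffel symbol `Γᵏᵢⱼ`, i.e. `∇_{∂ᵢ} ∂ⱼ = Γᵏᵢⱼ ∂ₖ`, in the chart `e`. The arguments
are in the order `i j k`. -/
def Connection.christoffel (D : Connection n M) (e : OpenPartialHomeomorph M (Model n))
    (i j k : Fin n) (y : Model n) : ℝ :=
  coordCovec e k (e.symm y)
    (D.cov (fun p => coordVec e j p) (e.symm y) (coordVec e i (e.symm y)))

/-- The torsion of the connection vanishes. -/
def Connection.IsTorsionFree (D : Connection n M) : Prop := D.cov.torsion = 0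

/-- The curvature of the connection vanishes: in all local coordinates
`Rᵏₛₗₜ = ∂ₛ Γᵏₗₜ - ∂ₗ Γᵏₛₜ + Γᵏₛᵣ Γʳₗₜ - Γᵏₗᵣ Γʳₛₜ = 0`. -/
def Connection.IsFlat (D : Connection n M) : Prop :=
  ∀ e ∈ charts n M, ∀ y ∈ e.target, ∀ k s l t : Fin n,
    pderiv s (D.christoffel e l t k) y - pderiv l (D.christoffel e s t k) y
      + ∑ r, D.christoffel e s r k y * D.christoffel e l t r y
      - ∑ r, D.christoffel e l r k y * D.christoffel e s t r y = 0

/-- The components `∇ₖ aⁱʲ = ∂ₖ aⁱʲ + Γⁱₖᵣ aʳʲ + Γʲₖᵣ aⁱʳ` of the covariant derivative of a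
bivector in the chart `e`. -/
def Connection.covBivector (D : Connection n M) (a : Bivector n M)
    (e : OpenPartialHomeomorph M (Model n)) (k i j : Fin n) (y : Model n) : ℝ :=
  pderiv k (a.comp e i j) y + ∑ r, D.christoffel e k r i y * a.comp e r j y
    + ∑ r, D.christoffel e k r j y * a.comp e i r y

/-- The condition `aⁱʳ ∇ᵣ aʲᵏ = aʲʳ ∇ᵣ aᵏⁱ` in all local coordinates. -/
def IsCompatible (a : Bivector n M) (D : Connection n M) : Prop :=
  ∀ e ∈ charts n M, ∀ y ∈ e.target, ∀ i j k : Fin n,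
    ∑ r, a.comp e i r y * D.covBivector a e r j k y
      = ∑ r, a.comp e j r y * D.covBivector a e r k i y

end Target

/-! ### The loop space

The circle is `ℝ/ℤ`, with coordinate `x`. A function on it is smooth if and only if it is smooth as
a function of `x ∈ ℝ`. -/

section Loops

variable (n : ℕ) (M : Type*) [TopologicalSpace M] [ChartedSpace (Model n) M]

/-- The loop space `L(M)`: smooth maps from the circle to `M`. -/
structure Loop where
  /-- the map -/
  toFun : UnitAddCircle → M
  smooth : ContMDiff 𝓘(ℝ, ℝ) (𝓡 n) ∞ (fun x : ℝ => toFun (x : UnitAddCircle))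

instance : CoeFun (Loop n M) (fun _ => UnitAddCircle → M) := ⟨Loop.toFun⟩

variable {n M}

/-- Smooth covector fields along a loop (sections of `u^* T^*M`). -/
structure CovectorAlong (u : Loop n M) where
  /-- the covector at a point of the circle -/
  toFun : ∀ z : UnitAddCircle, Cotangent n (u z)
  smooth : ∀ e ∈ charts n M, ∀ j : Fin n,
    ContDiffOn ℝ ∞ (fun x : ℝ => toFun (x : UnitAddCircle) (coordVec e j (u (x : UnitAddCircle))))
      {x : ℝ | u (x : UnitAddCircle) ∈ e.source}

/-- Smooth vector fields along a loop (sections of `u^* TM`). -/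
structure VectorAlong (u : Loop n M) where
  /-- the vector at a point of the circle -/
  toFun : ∀ z : UnitAddCircle, TangentSpace (𝓡 n) (u z)
  smooth : ∀ e ∈ charts n M, ∀ i : Fin n,
    ContDiffOn ℝ ∞
      (fun x : ℝ => coordCovec e i (u (x : UnitAddCircle)) (toFun (x : UnitAddCircle)))
      {x : ℝ | u (x : UnitAddCircle) ∈ e.source}

instance (u : Loop n M) :
    CoeFun (CovectorAlong u) (fun _ => ∀ z : UnitAddCircle, Cotangent n (u z)) :=
  ⟨CovectorAlong.toFun⟩

instance (u : Loop n M) :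
    CoeFun (VectorAlong u) (fun _ => ∀ z : UnitAddCircle, TangentSpace (𝓡 n) (u z)) :=
  ⟨VectorAlong.toFun⟩

/-- The coordinate `uᵏ(x)` of a loop in the chart `e`. -/
def Loop.coord (u : Loop n M) (e : OpenPartialHomeomorph M (Model n)) (k : Fin n) (x : ℝ) : ℝ :=
  e (u (x : UnitAddCircle)) k

/-- The component `αⱼ(x)` in the chart `e` of a covector field along a loop. -/
def CovectorAlong.coord {u : Loop n M} (α : CovectorAlong u)
    (e : OpenPartialHomeomorph M (Model n)) (j : Fin n) (x : ℝ) : ℝ :=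
  α (x : UnitAddCircle) (coordVec e j (u (x : UnitAddCircle)))

/-- The component `vⁱ(x)` in the chart `e` of a vector field along a loop. -/
def VectorAlong.coord {u : Loop n M} (v : VectorAlong u)
    (e : OpenPartialHomeomorph M (Model n)) (i : Fin n) (x : ℝ) : ℝ :=
  coordCovec e i (u (x : UnitAddCircle)) (v (x : UnitAddCircle))

/-- A local functional `F[u] = ∫ f(x, u, uₓ, …, u⁽ᵐ⁾) dx` on the loop space. The density is a
function on the circle which, in every chart, is a smooth function of `x` and of the derivatives
of the coordinates of `u` up to some fixed order `m`. -/
def IsLocalFunctional (F : Loop n M → ℝ) : Prop :=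
  ∃ (m : ℕ) (ρ : Loop n M → UnitAddCircle → ℝ),
    (∀ e ∈ charts n M, ∃ f : ℝ × (Fin (m + 1) → Model n) → ℝ,
      ContDiffOn ℝ ∞ f {q | q.2 0 ∈ e.target} ∧
      ∀ (u : Loop n M) (x : ℝ), u (x : UnitAddCircle) ∈ e.source →
        ρ u (x : UnitAddCircle) =
          f (x, fun k => iteratedDeriv k (fun s : ℝ => e (u (s : UnitAddCircle))) x)) ∧
    ∀ u : Loop n M, F u = ∫ x in (0 : ℝ)..1, ρ u (x : UnitAddCircle)

/-- `δF` is the variational derivative of `F`: for every smooth variation `U ε` of a loop,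
`d/dε F[U ε] = ∫ ⟨δF/δu, ∂U/∂ε⟩ dx` at `ε = 0`. (Every local functional has exactly one, given in
coordinates by the Euler–Lagrange expression.) -/
def HasVariationalDerivative (F : Loop n M → ℝ) (δF : ∀ u : Loop n M, CovectorAlong u) : Prop :=
  ∀ U : ℝ → Loop n M,
    ContMDiff 𝓘(ℝ, ℝ × ℝ) (𝓡 n) ∞ (fun q : ℝ × ℝ => U q.1 (q.2 : UnitAddCircle)) →
    HasDerivAt (fun ε : ℝ => F (U ε))
      (∫ x in (0 : ℝ)..1, δF (U 0) (x : UnitAddCircle)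
        (mfderiv 𝓘(ℝ, ℝ) (𝓡 n) (fun ε : ℝ => U ε (x : UnitAddCircle)) 0 (1 : ℝ))) 0

end Loops

/-! ### Hamiltonian operators of degree two -/

section Operators

variable (n : ℕ) (M : Type*) [TopologicalSpace M] [ChartedSpace (Model n) M]

/-- An operator on the loop space, mapping covector fields along each loop `u` to vector fields
along `u`. -/
abbrev LoopOperator : Type _ := ∀ u : Loop n M, CovectorAlong u → VectorAlong u

/-- Coefficient functions `aⁱʲ, bⁱʲₖ, cⁱʲₖₗ, cⁱʲₖ` of a differential operator of degree two in one
coordinate system (`c₂ i j k l` is `cⁱʲₖₗ` and `c₁ i j k` is `cⁱʲₖ`). -/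
structure Coefficients where
  /-- `aⁱʲ` -/
  a : Fin n → Fin n → Model n → ℝ
  /-- `bⁱʲₖ` -/
  b : Fin n → Fin n → Fin n → Model n → ℝ
  /-- `cⁱʲₖₗ` -/
  c₂ : Fin n → Fin n → Fin n → Fin n → Model n → ℝ
  /-- `cⁱʲₖ` -/
  c₁ : Fin n → Fin n → Fin n → Model n → ℝ

variable {n M}

/-- The coefficients are smooth on the open set `s`, and `cⁱʲₖₗ` is symmetric in `k, l`. -/
structure Coefficients.IsRegularOn (K : Coefficients n) (s : Set (Model n)) : Prop where
  smooth_a : ∀ i j, ContDiffOn ℝ ∞ (K.a i j) s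
  smooth_b : ∀ i j k, ContDiffOn ℝ ∞ (K.b i j k) s
  smooth_c₂ : ∀ i j k l, ContDiffOn ℝ ∞ (K.c₂ i j k l) s
  smooth_c₁ : ∀ i j k, ContDiffOn ℝ ∞ (K.c₁ i j k) s
  symm_c₂ : ∀ i j k l, ∀ y ∈ s, K.c₂ i j k l y = K.c₂ i j l k y

/-- The matrix `aⁱʲ` of leading coefficients at the coordinate point `y`. -/
def Coefficients.leading (K : Coefficients n) (y : Model n) : Matrix (Fin n) (Fin n) ℝ :=
  Matrix.of fun i j => K.a i j y

/-- In the chart `e` the operator `P` is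
`Pⁱʲ = aⁱʲ (d/dx)² + bⁱʲₖ uᵏₓ d/dx + cⁱʲₖₗ uᵏₓ uˡₓ + cⁱʲₖ uᵏₓₓ`, with coefficients that are smooth
functions of the coordinates. -/
def HasLocalForm (P : LoopOperator n M) (e : OpenPartialHomeomorph M (Model n))
    (K : Coefficients n) : Prop :=
  K.IsRegularOn e.target ∧
  ∀ (u : Loop n M) (α : CovectorAlong u) (x : ℝ), u (x : UnitAddCircle) ∈ e.source →
    ∀ i : Fin n, (P u α).coord e i x =
      ∑ j, (K.a i j (e (u (x : UnitAddCircle))) * iteratedDeriv 2 (α.coord e j) x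
        + (∑ k, K.b i j k (e (u (x : UnitAddCircle))) * deriv (u.coord e k) x)
            * deriv (α.coord e j) x
        + ((∑ k, ∑ l, K.c₂ i j k l (e (u (x : UnitAddCircle)))
                * deriv (u.coord e k) x * deriv (u.coord e l) x)
            + ∑ k, K.c₁ i j k (e (u (x : UnitAddCircle))) * iteratedDeriv 2 (u.coord e k) x)
            * α.coord e j x)

/-- `P` is a differential operator of degree two whose leading coefficient is non-degenerate: it
has the local form above, with `det aⁱʲ ≠ 0`, in every coordinate system. -/
def IsNondegenerateDegreeTwo (P : LoopOperator n M) : Prop :=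
  ∀ e ∈ charts n M, ∃ K : Coefficients n, HasLocalForm P e K ∧
    ∀ y ∈ e.target, (K.leading y).det ≠ 0

/-- The bracket `{F, G}[u] = ∫ ⟨δF/δu, P (δG/δu)⟩ dx`, as a function of the loop `u`, in terms of
the variational derivatives of `F` and `G`. -/
def bracket (P : LoopOperator n M) (δF δG : ∀ u : Loop n M, CovectorAlong u) (u : Loop n M) : ℝ :=
  ∫ x in (0 : ℝ)..1, δF u (x : UnitAddCircle) (P u (δG u) (x : UnitAddCircle))

/-- The bracket of `P` is a Poisson bracket on local functionals: it is skew-symmetric and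
satisfies the Jacobi identity `{{F, G}, H} + {{G, H}, F} + {{H, F}, G} = 0`. -/
structure IsPoisson (P : LoopOperator n M) : Prop where
  skew : ∀ (F G : Loop n M → ℝ) (δF δG : ∀ u : Loop n M, CovectorAlong u),
    IsLocalFunctional F → IsLocalFunctional G →
    HasVariationalDerivative F δF → HasVariationalDerivative G δG →
    ∀ u : Loop n M, bracket P δF δG u = - bracket P δG δF u
  jacobi : ∀ (F G H : Loop n M → ℝ) (δF δG δH δFG δGH δHF : ∀ u : Loop n M, CovectorAlong u),
    IsLocalFunctional F → IsLocalFunctional G → IsLocalFunctional H →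
    HasVariationalDerivative F δF → HasVariationalDerivative G δG →
    HasVariationalDerivative H δH →
    HasVariationalDerivative (bracket P δF δG) δFG →
    HasVariationalDerivative (bracket P δG δH) δGH →
    HasVariationalDerivative (bracket P δH δF) δHF →
    ∀ u : Loop n M, bracket P δFG δH u + bracket P δGH δF u + bracket P δHF δG u = 0

variable (n M)

/-- Hamiltonian operators of degree two on `L(M)`, with non-degenerate leading coefficient. -/
abbrev HamiltonianOperator : Type _ :=
  {P : LoopOperator n M // IsNondegenerateDegreeTwo P ∧ IsPoisson P}

/-- Pairs `(a, ∇)` of a non-degenerate bivector and a flat torsion-free connection with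
`aⁱʳ ∇ᵣ aʲᵏ = aʲʳ ∇ᵣ aᵏⁱ`. -/
abbrev CompatiblePair [IsManifold (𝓡 n) ∞ M] : Type _ :=
  {q : Bivector n M × Connection n M //
    q.1.IsNondegenerate ∧ q.2.IsTorsionFree ∧ q.2.IsFlat ∧ IsCompatible q.1 q.2}

end Operators

end DegTwo

end

noncomputable section

set_option linter.unusedSectionVars false
set_option maxSynthPendingDepth 3

namespace DegTwo

open EuclideanSpace (single proj)

/-! ### Smooth periodic functions -/

section Periodic

variable {F G : Type*} [NormedAddCommGroup F] [NormedSpace ℝ F]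
  [NormedAddCommGroup G] [NormedSpace ℝ G]

/-! The pair attached to an operator consists of its leading coefficient `a` and of the coefficient
`c₁` of `uₓₓ`, read as `c₁ = -aΓ`. The proof shows that these two coefficients force all others,
that the Poisson axioms say exactly that Γ is a flat torsion-free connection compatible with `a`,
and that each such pair comes from an explicit operator.

From operators to pairs. The axioms are tested on the functionals `∫ χ(u) ξ(x)(u) dx`. While a loop
stays where the cutoff χ is 1, such a functional is linear and its variational derivative is ξ,
whatever the loop. Skew-symmetry and Jacobi identity thus become integral identities for arbitrary
loops and arbitrary periodic covector functions in a coordinate domain (`IsPoisson.isSkewOn`,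
`IsPoisson.isJacobiOn`). Skew-symmetry gives the skewness of `a` and the formula for `b`
(`IsSkewOn.skew_A`, `IsSkewOn.B_eq`). The Jacobi identity at a constant loop gives the symmetry of Γ
and the compatibility condition (`IsJacobiOn.symm`, `IsJacobiOn.compat`). Its linearization at a
constant loop gives the coefficient of `uₓuₓ` and, at a point where `c₁` vanishes, a symmetry of the
derivative of `c₁` (`IsJacobiOn.S_eq`, `IsJacobiOn.symm_fderiv`). Applying the operator at a
stationary point of a loop shows that Γ transforms as a connection (`IsLocalCoeff.Γ_coordChange`).
As Γ is symmetric, a quadratic change of coordinates makes it vanish at a given point, and there the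
symmetry of its derivative is the vanishing of the curvature (`IsLocalCoeff.curv_eq_zero`).

From pairs to operators. The operator is `∇ₓ ∘ ♯ ∘ ∇ₓ`, where ♯ raises an index with `a`. Its
bracket is `-∫ a(∇ₓδF, ∇ₓδG) dx`, hence skew. Differentiating the bracket along a vector field Z
produces `-∫ (∇_Z a)(∇ₓδF, ∇ₓδG)` and two terms with covariant Hessians of F and G; flatness is what
allows `∇ₓ` to be exchanged with the derivative along the variation. The Hessians are symmetric
because the torsion vanishes, so they cancel in the cyclic sum
(`IsSmoothAlong.integral_covAlong_symm`). What remains is the cyclic sum of `(∇_{∇ₓ♯κ} a)(α, β)`,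
and this is the x-derivative of `(∇_{♯κ} a)(α, β)` by an identity for the second covariant
derivative of `a` that follows from compatibility, flatness and vanishing torsion
(`FlatPair.hess_eq`, `FlatPair.integral_loopN`). Variational derivatives are prescribed loop by loop
only; that they depend smoothly on parameters is deduced from their local agreement with
Euler–Lagrange expressions (`exists_eulerLagrange`).

The two constructions are mutually inverse because `a` and `c₁` are determined by the operator
(`HasLocalForm.toOp_eq`) and determine a Hamiltonian operator (`OpCoeff.IsHamiltonianOn.op_eq`). -/

theorem contDiff_deriv {f : ℝ → F} (hf : ContDiff ℝ ∞ f) : ContDiff ℝ ∞ (deriv f) :=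
  (contDiff_infty_iff_deriv.1 hf).2

theorem contDiff_iteratedDeriv {f : ℝ → F} (hf : ContDiff ℝ ∞ f) (k : ℕ) :
    ContDiff ℝ ∞ (iteratedDeriv k f) := by
  induction k with
  | zero => simpa using hf
  | succ k ih => rw [iteratedDeriv_succ]; exact contDiff_deriv ih

theorem hasDerivAt_of_contDiff {f : ℝ → F} (hf : ContDiff ℝ ∞ f) (x : ℝ) :
    HasDerivAt f (deriv f x) x :=
  (hf.differentiable (by simp) x).hasDerivAt

theorem periodic_deriv {f : ℝ → F} (hf : Function.Periodic f 1) :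
    Function.Periodic (deriv f) 1 := by
  intro x
  have h : (fun y => f (y + 1)) = f := funext hf
  rw [← deriv_comp_add_const, h]

theorem periodic_iteratedDeriv {f : ℝ → F} (hf : Function.Periodic f 1) (k : ℕ) :
    Function.Periodic (iteratedDeriv k f) 1 := by
  induction k with
  | zero => simpa using hf
  | succ k ih => rw [iteratedDeriv_succ]; exact periodic_deriv ih

/-- A smooth function of period `1`. -/
structure SmoothPeriodic (f : ℝ → F) : Prop where
  smooth : ContDiff ℝ ∞ f
  periodic : Function.Periodic f 1

namespace SmoothPeriodic

variable {f g : ℝ → F}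

theorem deriv (hf : SmoothPeriodic f) : SmoothPeriodic (deriv f) :=
  ⟨contDiff_deriv hf.smooth, periodic_deriv hf.periodic⟩

theorem iteratedDeriv (hf : SmoothPeriodic f) (k : ℕ) : SmoothPeriodic (iteratedDeriv k f) :=
  ⟨contDiff_iteratedDeriv hf.smooth k, periodic_iteratedDeriv hf.periodic k⟩

theorem const (c : F) : SmoothPeriodic (fun _ : ℝ => c) := ⟨contDiff_const, fun _ => rfl⟩

theorem add (hf : SmoothPeriodic f) (hg : SmoothPeriodic g) :
    SmoothPeriodic (fun x => f x + g x) :=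
  ⟨hf.smooth.add hg.smooth, fun x => by simp only [hf.periodic x, hg.periodic x]⟩

theorem sub (hf : SmoothPeriodic f) (hg : SmoothPeriodic g) :
    SmoothPeriodic (fun x => f x - g x) :=
  ⟨hf.smooth.sub hg.smooth, fun x => by simp only [hf.periodic x, hg.periodic x]⟩

theorem neg (hf : SmoothPeriodic f) : SmoothPeriodic (fun x => - f x) :=
  ⟨hf.smooth.neg, fun x => by simp only [hf.periodic x]⟩

theorem smul {c : ℝ → ℝ} (hc : SmoothPeriodic c) (hf : SmoothPeriodic f) :
    SmoothPeriodic (fun x => c x • f x) :=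
  ⟨hc.smooth.smul hf.smooth, fun x => by simp only [hf.periodic x, hc.periodic x]⟩

theorem mul {c d : ℝ → ℝ} (hc : SmoothPeriodic c) (hd : SmoothPeriodic d) :
    SmoothPeriodic (fun x => c x * d x) := hc.smul hd

theorem clm_apply {L : ℝ → F →L[ℝ] G} (hL : SmoothPeriodic L) (hf : SmoothPeriodic f) :
    SmoothPeriodic (fun x => L x (f x)) :=
  ⟨hL.smooth.clm_apply hf.smooth, fun x => by simp only [hf.periodic x, hL.periodic x]⟩

theorem continuous (hf : SmoothPeriodic f) : Continuous f := hf.smooth.continuous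

theorem hasDerivAt (hf : SmoothPeriodic f) (x : ℝ) : HasDerivAt f (_root_.deriv f x) x :=
  hasDerivAt_of_contDiff hf.smooth x

theorem sin (k : ℕ) : SmoothPeriodic (fun x : ℝ => Real.sin (k * (2 * Real.pi * x))) := by
  refine ⟨by fun_prop, fun x => ?_⟩
  rw [show (k : ℝ) * (2 * Real.pi * (x + 1)) = k * (2 * Real.pi * x) + k * (2 * Real.pi) by ring]
  exact Real.sin_add_nat_mul_two_pi _ _

theorem cos (k : ℕ) : SmoothPeriodic (fun x : ℝ => Real.cos (k * (2 * Real.pi * x))) := by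
  refine ⟨by fun_prop, fun x => ?_⟩
  rw [show (k : ℝ) * (2 * Real.pi * (x + 1)) = k * (2 * Real.pi * x) + k * (2 * Real.pi) by ring]
  exact Real.cos_add_nat_mul_two_pi _ _

theorem integral_deriv (hf : SmoothPeriodic f) [CompleteSpace F] :
    ∫ x in (0 : ℝ)..1, _root_.deriv f x = 0 := by
  rw [intervalIntegral.integral_eq_sub_of_hasDerivAt (fun x _ => hf.hasDerivAt x)
    (hf.deriv.continuous.intervalIntegrable _ _)]
  have := hf.periodic 0
  rw [zero_add] at this
  rw [this, sub_self]

/-- The integral over a period of a derivative vanishes. -/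
theorem integral_eq_zero {h h' : ℝ → ℝ} (hh : SmoothPeriodic h)
    (hd : ∀ x, HasDerivAt h (h' x) x) : ∫ x in (0 : ℝ)..1, h' x = 0 := by
  refine Eq.trans ?_ hh.integral_deriv
  exact intervalIntegral.integral_congr fun x _ => (hd x).deriv.symm

theorem integral_clm_deriv {φ : ℝ → F →L[ℝ] ℝ} (hφ : SmoothPeriodic φ)
    (hf : SmoothPeriodic f) :
    ∫ x in (0 : ℝ)..1, φ x (_root_.deriv f x) = - ∫ x in (0 : ℝ)..1, _root_.deriv φ x (f x) := by
  have h := (hφ.clm_apply hf).integral_eq_zero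
    (fun x => (hφ.hasDerivAt x).clm_apply (hf.hasDerivAt x))
  rw [intervalIntegral.integral_add
    ((hφ.deriv.clm_apply hf).continuous.intervalIntegrable _ _)
    ((hφ.clm_apply hf.deriv).continuous.intervalIntegrable _ _)] at h
  linarith

theorem integral_clm_iteratedDeriv {φ : ℝ → F →L[ℝ] ℝ} (hφ : SmoothPeriodic φ)
    (hf : SmoothPeriodic f) (k : ℕ) :
    ∫ x in (0 : ℝ)..1, φ x (_root_.iteratedDeriv k f x)
      = (-1) ^ k * ∫ x in (0 : ℝ)..1, _root_.iteratedDeriv k φ x (f x) := by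
  induction k generalizing f with
  | zero => simp
  | succ k ih =>
    simp only [iteratedDeriv_succ' (f := f), iteratedDeriv_succ (f := φ)]
    rw [ih hf.deriv, integral_clm_deriv (hφ.iteratedDeriv k) hf]
    ring

theorem eq_zero_of_integral_sq {g : ℝ → ℝ} (hg : SmoothPeriodic g)
    (h : ∫ x in (0 : ℝ)..1, g x * g x = 0) (x : ℝ) : g x = 0 := by
  have hc : Continuous fun x => g x * g x := hg.continuous.mul hg.continuous
  have h0 : ∀ y ∈ Set.Icc (0 : ℝ) 1, g y = 0 := by
    intro y hy
    by_contra hne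
    have : 0 < ∫ x in (0 : ℝ)..1, g x * g x := by
      refine intervalIntegral.integral_pos one_pos hc.continuousOn
        (fun z _ => mul_self_nonneg _) ⟨y, hy, mul_self_pos.2 hne⟩
    exact this.ne' h
  have h1 : g (x - ⌊x⌋) = g x := by simpa using hg.periodic.sub_zsmul_eq (x := x) ⌊x⌋
  rw [← h1]
  exact h0 _ ⟨Int.fract_nonneg x, (Int.fract_lt_one x).le⟩

theorem eq_zero_of_forall_integral {g : ℝ → ℝ} (hg : SmoothPeriodic g)
    (h : ∀ f : ℝ → ℝ, SmoothPeriodic f → ∫ x in (0 : ℝ)..1, f x * g x = 0) (x : ℝ) : g x = 0 :=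
  hg.eq_zero_of_integral_sq (h g hg) x

end SmoothPeriodic

end Periodic

/-! ### Differentiation under the integral sign -/

theorem hasDerivAt_integral_of_contDiff {G : ℝ × ℝ → ℝ} (hG : ContDiff ℝ ∞ G) :
    HasDerivAt (fun ε : ℝ => ∫ x in (0 : ℝ)..1, G (ε, x))
      (∫ x in (0 : ℝ)..1, fderiv ℝ G (0, x) (1, 0)) 0 := by
  have hG' : Continuous fun q : ℝ × ℝ => fderiv ℝ G q (1, 0) :=
    (hG.continuous_fderiv (by simp)).clm_apply continuous_const
  -- The derivative is bounded on a compact rectangle; this constant dominates it under the integral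
  -- sign for parameters in `[-1, 1]`.
  obtain ⟨C, hC⟩ := ((isCompact_Icc (a := (-1 : ℝ)) (b := 1)).prod
    (isCompact_Icc (a := (0 : ℝ)) (b := 1))).exists_bound_of_continuousOn hG'.continuousOn
  refine (intervalIntegral.hasDerivAt_integral_of_dominated_loc_of_deriv_le
    (F := fun ε x => G (ε, x)) (F' := fun ε x => fderiv ℝ G (ε, x) (1, 0))
    (s := Set.Icc (-1) 1) (bound := fun _ => C) (Icc_mem_nhds (by norm_num) (by norm_num))
    (Filter.Eventually.of_forall fun ε => ?_) ?_ ?_ ?_ intervalIntegrable_const ?_).2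
  · exact (hG.continuous.comp (by fun_prop : Continuous fun x : ℝ => (ε, x))).aestronglyMeasurable
  · exact (hG.continuous.comp
      (by fun_prop : Continuous fun x : ℝ => ((0 : ℝ), x))).intervalIntegrable _ _
  · exact (hG'.comp
      (by fun_prop : Continuous fun x : ℝ => ((0 : ℝ), x))).aestronglyMeasurable
  · refine Filter.Eventually.of_forall fun x hx ε hε => hC (ε, x) ⟨hε, ?_⟩
    rw [Set.uIoc_of_le zero_le_one] at hx
    exact ⟨hx.1.le, hx.2⟩
  · refine Filter.Eventually.of_forall fun x _ ε _ => ?_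
    have h1 : HasDerivAt (fun ε : ℝ => (ε, x)) ((1 : ℝ), (0 : ℝ)) ε :=
      (hasDerivAt_id ε).prodMk (hasDerivAt_const ε x)
    exact ((hG.differentiable (by simp) (ε, x)).hasFDerivAt.comp_hasDerivAt ε h1)

theorem hasDerivAt_left_of_contDiff {F : Type*} [NormedAddCommGroup F] [NormedSpace ℝ F]
    {G : ℝ × ℝ → F} {ε x : ℝ} (hG : DifferentiableAt ℝ G (ε, x)) :
    HasDerivAt (fun s : ℝ => G (s, x)) (fderiv ℝ G (ε, x) (1, 0)) ε :=
  hG.hasFDerivAt.comp_hasDerivAt ε ((hasDerivAt_id ε).prodMk (hasDerivAt_const ε x))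

theorem hasDerivAt_right_of_contDiff {E F : Type*} [NormedAddCommGroup E] [NormedSpace ℝ E]
    [NormedAddCommGroup F] [NormedSpace ℝ F] {G : E × ℝ → F} {ε : E} {x : ℝ}
    (hG : DifferentiableAt ℝ G (ε, x)) :
    HasDerivAt (fun s : ℝ => G (ε, s)) (fderiv ℝ G (ε, x) (0, 1)) x :=
  hG.hasFDerivAt.comp_hasDerivAt x ((hasDerivAt_const x ε).prodMk (hasDerivAt_id x))

/-- Derivative under the integral sign, when the derivative of the integrand is known. -/
theorem hasDerivAt_integral_of_hasDerivAt {G : ℝ × ℝ → ℝ} (hG : ContDiff ℝ ∞ G) {g : ℝ → ℝ}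
    (hg : ∀ x, HasDerivAt (fun ε => G (ε, x)) (g x) 0) :
    HasDerivAt (fun ε : ℝ => ∫ x in (0 : ℝ)..1, G (ε, x)) (∫ x in (0 : ℝ)..1, g x) 0 := by
  convert hasDerivAt_integral_of_contDiff hG using 1
  refine intervalIntegral.integral_congr fun x _ => ?_
  exact (hg x).unique (hasDerivAt_left_of_contDiff (hG.differentiable (by simp) _))

/-- A smooth bounded reparametrization of the line: `|s| ≤ δ`, `s 0 = 0`, `s' 0 = 1`. -/
def damp (δ ε : ℝ) : ℝ := δ * Real.sin (ε / δ)

theorem contDiff_damp (δ : ℝ) : ContDiff ℝ ∞ (damp δ) := by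
  unfold damp; fun_prop

@[simp] theorem damp_zero (δ : ℝ) : damp δ 0 = 0 := by simp [damp]

/-- A variation has to be defined for every real parameter although it must stay inside a chart.
Replacing the parameter ε by `damp δ ε` keeps the displacement small without changing the velocity
at 0. -/
theorem abs_damp_le {δ : ℝ} (hδ : 0 < δ) (ε : ℝ) : |damp δ ε| ≤ δ := by
  rw [damp, abs_mul, abs_of_pos hδ]
  exact mul_le_of_le_one_right hδ.le (Real.abs_sin_le_one _)

theorem hasDerivAt_damp {δ : ℝ} (hδ : 0 < δ) : HasDerivAt (damp δ) 1 0 := by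
  have h := ((Real.hasDerivAt_sin ((0 : ℝ) / δ)).comp 0
    ((hasDerivAt_id (0 : ℝ)).div_const δ)).const_mul δ
  refine HasDerivAt.congr_deriv (f := damp δ) h ?_
  simp [hδ.ne']

/-! ### Bump functions and partitions of unity on the circle -/

section Circle

/-- On the circle `cos (2π(x - x₀))` equals 1 at `x₀` only, so its superlevel sets close to 1 are
small neighbourhoods of `x₀`; the bump is a smooth step function of this cosine. -/
theorem exists_circle_bump {N : Set UnitAddCircle} (hN : IsOpen N) {x₀ : ℝ}
    (h0 : (x₀ : UnitAddCircle) ∈ N) :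
    ∃ (χ : ℝ → ℝ) (S : Set UnitAddCircle), SmoothPeriodic χ ∧ IsClosed S ∧ S ⊆ N ∧
      (∀ x, 0 ≤ χ x) ∧ (∀ x : ℝ, (x : UnitAddCircle) ∉ S → χ x = 0) ∧
      ∃ O : Set UnitAddCircle, IsOpen O ∧ (x₀ : UnitAddCircle) ∈ O ∧
        ∀ x : ℝ, (x : UnitAddCircle) ∈ O → χ x = 1 := by
  have hper : Function.Periodic (fun x : ℝ => Real.cos (2 * Real.pi * (x - x₀))) 1 := fun x => by
    beta_reduce
    rw [show 2 * Real.pi * (x + 1 - x₀) = 2 * Real.pi * (x - x₀) + 2 * Real.pi by ring]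
    exact Real.cos_add_two_pi _
  let c : UnitAddCircle → ℝ := hper.lift
  have hc : ∀ x : ℝ, c (x : UnitAddCircle) = Real.cos (2 * Real.pi * (x - x₀)) :=
    fun x => hper.lift_coe x
  have hcont : Continuous c := by
    refine continuous_coinduced_dom.2 ?_
    exact (by fun_prop : Continuous fun x : ℝ => Real.cos (2 * Real.pi * (x - x₀)))
  have hlt : ∀ z ∈ Nᶜ, c z < 1 := by
    intro z hz
    induction z using QuotientAddGroup.induction_on with
    | H x =>
      refine lt_of_le_of_ne ((hc x).trans_le (Real.cos_le_one _)) fun h => hz ?_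
      have h1 : Real.cos (2 * Real.pi * (x - x₀)) = 1 := (hc x).symm.trans h
      obtain ⟨k, hk⟩ := (Real.cos_eq_one_iff _).1 h1
      have h2 : x = x₀ + k := by
        have := Real.pi_pos
        have h3 : (k : ℝ) * (2 * Real.pi) = (x - x₀) * (2 * Real.pi) := by linarith
        have := mul_right_cancel₀ (by positivity) h3
        linarith
      have h4 : (x : UnitAddCircle) = x₀ := by
        rw [h2, AddCircle.coe_add]
        have : ((k : ℝ) : UnitAddCircle) = 0 := AddCircle.coe_eq_zero_iff (1 : ℝ) |>.2 ⟨k, by simp⟩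
        rw [this, add_zero]
      exact h4 ▸ h0
  -- Compactness of the complement of N turns the strict inequality `hlt` into a gap. Half of the
  -- gap is taken, so that even the closed superlevel set misses the complement.
  obtain ⟨δ, hδ, hδN⟩ : ∃ δ > 0, ∀ z, 1 - δ ≤ c z → z ∈ N := by
    by_cases hne : (Nᶜ).Nonempty
    · obtain ⟨z, hz, hmax⟩ := hN.isClosed_compl.isCompact.exists_isMaxOn hne hcont.continuousOn
      refine ⟨(1 - c z) / 2, by linarith [hlt z hz], fun w hw => ?_⟩
      by_contra hwN
      have := hmax hwN
      simp only [Set.mem_ofPred_eq] at this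
      linarith [hlt z hz]
    · refine ⟨1, one_pos, fun z _ => ?_⟩
      by_contra hz
      exact hne ⟨z, hz⟩
  -- The step rises from 0 to 1 while the cosine grows from `1 - δ` to `1 - δ / 2`.
  refine ⟨fun x => Real.smoothTransition ((Real.cos (2 * Real.pi * (x - x₀)) - (1 - δ)) / (δ / 2)),
    {z | 1 - δ ≤ c z}, ⟨?_, fun x => ?_⟩, isClosed_le continuous_const hcont, hδN,
    fun x => Real.smoothTransition.nonneg _, fun x hx => ?_,
    {z | 1 - δ / 2 < c z}, isOpen_lt continuous_const hcont, ?_, fun x hx => ?_⟩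
  · exact Real.smoothTransition.contDiff.comp (by fun_prop)
  · simp only [hper x]
  · refine Real.smoothTransition.zero_of_nonpos (div_nonpos_of_nonpos_of_nonneg ?_ (by positivity))
    simp only [Set.mem_ofPred_eq, hc, not_le] at hx
    linarith
  · simp only [Set.mem_ofPred_eq, hc, sub_self, mul_zero, Real.cos_zero]
    linarith
  · refine Real.smoothTransition.one_of_one_le ?_
    simp only [Set.mem_ofPred_eq, hc] at hx
    rw [le_div_iff₀ (by positivity)]
    linarith

/-- By compactness finitely many of the sets where a bump equals 1 cover the circle; dividing by the
then positive sum of these bumps normalizes them. -/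
theorem exists_circle_partition {N : UnitAddCircle → Set UnitAddCircle} (hN : ∀ z, IsOpen (N z))
    (hz : ∀ z, z ∈ N z) :
    ∃ (s : Finset UnitAddCircle) (θ : UnitAddCircle → ℝ → ℝ)
      (S : UnitAddCircle → Set UnitAddCircle),
      (∀ z, SmoothPeriodic (θ z)) ∧ (∀ z, IsClosed (S z)) ∧ (∀ z, S z ⊆ N z) ∧
      (∀ z, ∀ x : ℝ, (x : UnitAddCircle) ∉ S z → θ z x = 0) ∧ ∀ x, ∑ z ∈ s, θ z x = 1 := by
  have hex : ∀ z : UnitAddCircle, ∃ (χ : ℝ → ℝ) (S : Set UnitAddCircle), SmoothPeriodic χ ∧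
      IsClosed S ∧ S ⊆ N z ∧ (∀ x, 0 ≤ χ x) ∧ (∀ x : ℝ, (x : UnitAddCircle) ∉ S → χ x = 0) ∧
      ∃ O : Set UnitAddCircle, IsOpen O ∧ z ∈ O ∧ ∀ x : ℝ, (x : UnitAddCircle) ∈ O → χ x = 1 := by
    intro z
    induction z using QuotientAddGroup.induction_on with
    | H x => exact exists_circle_bump (hN _) (hz _)
  choose χ S hχ hS hSN hpos hχ0 O hO hzO hχ1 using hex
  obtain ⟨s, hs⟩ := isCompact_univ.elim_finite_subcover O hO
    (fun z _ => Set.mem_iUnion.2 ⟨z, hzO z⟩)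
  have hsum : ∀ x : ℝ, 0 < ∑ z ∈ s, χ z x := by
    intro x
    obtain ⟨z, hz⟩ := Set.mem_iUnion.1 (hs (Set.mem_univ (x : UnitAddCircle)))
    obtain ⟨hzs, hxz⟩ := Set.mem_iUnion.1 hz
    exact Finset.sum_pos' (fun z _ => hpos z x) ⟨z, hzs, by rw [hχ1 z x hxz]; exact one_pos⟩
  refine ⟨s, fun z x => χ z x / ∑ w ∈ s, χ w x, S, fun z => ⟨?_, fun x => ?_⟩, hS, hSN,
    fun z x hx => by simp only [hχ0 z x hx, zero_div], fun x => ?_⟩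
  · exact (hχ z).smooth.div (ContDiff.sum fun w _ => (hχ w).smooth) fun x => (hsum x).ne'
  · simp only [fun w => (hχ w).periodic x]
  · rw [← Finset.sum_div, div_self (hsum x).ne']

/-- A cutoff function which is `1` near a closed subset of the circle. -/
theorem exists_circle_cutoff {S N : Set UnitAddCircle} (hS : IsClosed S) (hN : IsOpen N)
    (hSN : S ⊆ N) :
    ∃ (χ : ℝ → ℝ) (S' O : Set UnitAddCircle), SmoothPeriodic χ ∧ IsClosed S' ∧ S' ⊆ N ∧
      (∀ x : ℝ, (x : UnitAddCircle) ∉ S' → χ x = 0) ∧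
      IsOpen O ∧ S ⊆ O ∧ ∀ x : ℝ, (x : UnitAddCircle) ∈ O → χ x = 1 := by
  classical
  -- A partition of unity subordinate to the cover by N and the complement of S. The members
  -- attached to points of S add up to the cutoff; the others vanish near S.
  obtain ⟨s, θ, T, hθ, hT, hTN, hθ0, hsum⟩ := exists_circle_partition
    (N := fun z => if z ∈ S then N else Sᶜ)
    (fun z => by split_ifs; exacts [hN, hS.isOpen_compl])
    (fun z => by split_ifs with h; exacts [hSN h, h])
  refine ⟨fun x => ∑ z ∈ s with z ∈ S, θ z x, ⋃ z ∈ s.filter (· ∈ S), T z,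
    (⋃ z ∈ s.filter (· ∉ S), T z)ᶜ, ⟨?_, fun x => ?_⟩, ?_, ?_, fun x hx => ?_, ?_, ?_,
    fun x hx => ?_⟩
  · exact ContDiff.sum fun w _ => (hθ w).smooth
  · simp only [fun w => (hθ w).periodic x]
  · exact Set.Finite.isClosed_biUnion (Finset.finite_toSet _) fun z _ => hT z
  · refine Set.iUnion₂_subset fun z hz => ?_
    have := hTN z
    rwa [if_pos (Finset.mem_filter.1 hz).2] at this
  · refine Finset.sum_eq_zero fun z hz => hθ0 z x fun hxz => hx ?_
    exact Set.mem_biUnion hz hxz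
  · exact (Set.Finite.isClosed_biUnion (Finset.finite_toSet _) fun z _ => hT z).isOpen_compl
  · intro y hy hy'
    obtain ⟨z, hz, hyz⟩ := Set.mem_iUnion₂.1 hy'
    have := hTN z hyz
    rw [if_neg (Finset.mem_filter.1 hz).2] at this
    exact this hy
  · rw [← hsum x, ← Finset.sum_filter_add_sum_filter_not s (· ∈ S)]
    rw [Finset.sum_eq_zero (s := s.filter (· ∉ S)), add_zero]
    exact fun z hz => hθ0 z x fun hxz => hx (Set.mem_biUnion hz hxz)

theorem continuous_coe_circle : Continuous (fun x : ℝ => (x : UnitAddCircle)) :=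
  AddCircle.continuous_mk' 1

end Circle

/-! ### Charts -/

/-- Covectors of the model space. -/
abbrev Dual (n : ℕ) : Type := Model n →L[ℝ] ℝ

theorem eq_sum_single {n : ℕ} (y : Model n) :
    y = ∑ j, y j • single j (1 : ℝ) := by
  ext i
  simp [Pi.single_apply]

theorem clm_eq_sum_single {n : ℕ} {F : Type*} [NormedAddCommGroup F] [NormedSpace ℝ F]
    (L : Model n →L[ℝ] F) (y : Model n) :
    L y = ∑ j, y j • L (single j (1 : ℝ)) := by
  conv_lhs => rw [eq_sum_single y]
  simp

theorem contDiffOn_clm_of_single {n : ℕ} {X F : Type*} [NormedAddCommGroup X] [NormedSpace ℝ X]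
    [NormedAddCommGroup F] [NormedSpace ℝ F] {L : X → Model n →L[ℝ] F} {s : Set X}
    (h : ∀ j, ContDiffOn ℝ ∞ (fun x => L x (single j (1 : ℝ))) s) :
    ContDiffOn ℝ ∞ L s := by
  refine contDiffOn_clm_apply.2 fun y => ?_
  simp only [fun x => clm_eq_sum_single (L x) y]
  exact ContDiffOn.sum fun j _ => contDiffOn_const.smul (h j)

section Manifold

variable {n : ℕ} {M : Type*} [TopologicalSpace M] [ChartedSpace (Model n) M]

/-- The derivative of the coordinate map, with the tangent space read as the model space. -/
def toModel (e : OpenPartialHomeomorph M (Model n)) (p : M) : Model n →L[ℝ] Model n :=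
  chartDeriv e p

/-- The inverse of the derivative of the coordinate map. -/
def ofModel (e : OpenPartialHomeomorph M (Model n)) (p : M) : Model n →L[ℝ] Model n :=
  (toModel e p).inverse

/-- The coordinate change from the chart `e` to the chart `e'`. -/
def coordChange (e e' : OpenPartialHomeomorph M (Model n)) (y : Model n) : Model n :=
  e' (e.symm y)

variable [IsManifold (𝓡 n) ∞ M] {e e' : OpenPartialHomeomorph M (Model n)}

theorem mdifferentiable_of_mem_charts (he : e ∈ charts n M) : e.MDifferentiable (𝓡 n) (𝓡 n) :=
  ⟨(contMDiffOn_of_mem_maximalAtlas he).mdifferentiableOn (by simp),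
    (contMDiffOn_symm_of_mem_maximalAtlas he).mdifferentiableOn (by simp)⟩

theorem chartAt_mem_charts (p : M) : chartAt (Model n) p ∈ charts n M :=
  IsManifold.chart_mem_maximalAtlas p

theorem toModel_isInvertible (he : e ∈ charts n M) {p : M} (hp : p ∈ e.source) :
    (toModel e p).IsInvertible :=
  ⟨(mdifferentiable_of_mem_charts he).mfderiv hp, rfl⟩

theorem toModel_ofModel (he : e ∈ charts n M) {p : M} (hp : p ∈ e.source) (v : Model n) :
    toModel e p (ofModel e p v) = v :=
  (toModel_isInvertible he hp).self_apply_inverse v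

theorem ofModel_toModel (he : e ∈ charts n M) {p : M} (hp : p ∈ e.source) (v : Model n) :
    ofModel e p (toModel e p v) = v :=
  (toModel_isInvertible he hp).inverse_apply_self v

theorem contDiffAt_coordChange (he : e ∈ charts n M) (he' : e' ∈ charts n M) {y : Model n}
    (hy : y ∈ e.target) (hy' : e.symm y ∈ e'.source) : ContDiffAt ℝ ∞ (coordChange e e') y :=
  ((contMDiffAt_of_mem_maximalAtlas he' hy').comp y
    (contMDiffAt_symm_of_mem_maximalAtlas he hy)).contDiffAt

theorem toModel_eq (he : e ∈ charts n M) (he' : e' ∈ charts n M) {p : M} (hp : p ∈ e.source)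
    (hp' : p ∈ e'.source) :
    toModel e' p = (fderiv ℝ (coordChange e e') (e p)).comp (toModel e p) := by
  have h1 := (mdifferentiable_of_mem_charts he).mdifferentiableAt hp
  have h2 : MDifferentiableAt (𝓡 n) (𝓡 n) (coordChange e e') (e p) :=
    ((contDiffAt_coordChange he he' (e.map_source hp)
      (by rwa [e.left_inv hp])).differentiableAt (by simp)).mdifferentiableAt
  have h3 : (e' : M → Model n) =ᶠ[nhds p] coordChange e e' ∘ e := by
    filter_upwards [e.open_source.mem_nhds hp] with q hq
    simp [coordChange, e.left_inv hq]
  have h4 := h3.mfderiv_eq (I := 𝓡 n) (I' := 𝓡 n)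
  rw [mfderiv_comp p h2 h1, mfderiv_eq_fderiv] at h4
  exact h4

theorem toModel_apply (he : e ∈ charts n M) (he' : e' ∈ charts n M) {p : M} (hp : p ∈ e.source)
    (hp' : p ∈ e'.source) (v : Model n) :
    toModel e' p v = fderiv ℝ (coordChange e e') (e p) (toModel e p v) := by
  rw [toModel_eq he he' hp hp']; rfl

theorem toModel_velocity (he : e ∈ charts n M) {c : ℝ → M} {t : ℝ}
    (hc : MDifferentiableAt 𝓘(ℝ, ℝ) (𝓡 n) c t) (ht : c t ∈ e.source) {v : Model n}
    (hv : HasDerivAt (fun s => e (c s)) v t) :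
    toModel e (c t) (mfderiv 𝓘(ℝ, ℝ) (𝓡 n) c t (1 : ℝ)) = v := by
  have h1 := (mdifferentiable_of_mem_charts he).mdifferentiableAt ht
  have h4 := mfderiv_comp t h1 hc
  rw [mfderiv_eq_fderiv] at h4
  have h5 : fderiv ℝ (e ∘ c) t 1 = v := hv.hasFDerivAt.fderiv ▸ (by simp)
  rw [← h5, h4]; rfl

end Manifold

/-! ### Loops and fields along loops, in a chart -/

section Reps

variable {n : ℕ} {M : Type*} [TopologicalSpace M] [ChartedSpace (Model n) M]
  {e e' : OpenPartialHomeomorph M (Model n)}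

@[ext] theorem Loop.ext {u v : Loop n M} (h : ∀ x : ℝ, u (x : UnitAddCircle) = v x) : u = v := by
  cases u; cases v
  congr
  funext z
  induction z using QuotientAddGroup.induction_on with
  | H x => exact h x

theorem Loop.continuous (u : Loop n M) : Continuous u.toFun :=
  continuous_coinduced_dom.2 u.smooth.continuous

/-- The loop in the chart `e`. -/
def Loop.rep (u : Loop n M) (e : OpenPartialHomeomorph M (Model n)) (x : ℝ) : Model n :=
  e (u (x : UnitAddCircle))

/-- The parameters whose points lie in the domain of the chart `e`. -/
def Loop.dom (u : Loop n M) (e : OpenPartialHomeomorph M (Model n)) : Set ℝ :=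
  {x : ℝ | u (x : UnitAddCircle) ∈ e.source}

theorem Loop.isOpen_dom (u : Loop n M) (e : OpenPartialHomeomorph M (Model n)) :
    IsOpen (u.dom e) :=
  e.open_source.preimage u.smooth.continuous

/-- A covector field along a loop in the chart `e`. -/
def CovectorAlong.rep {u : Loop n M} (α : CovectorAlong u)
    (e : OpenPartialHomeomorph M (Model n)) (x : ℝ) : Dual n :=
  ContinuousLinearMap.comp (α (x : UnitAddCircle) : Model n →L[ℝ] ℝ)
    (ofModel e (u (x : UnitAddCircle)))

/-- A vector field along a loop in the chart `e`. -/
def VectorAlong.rep {u : Loop n M} (X : VectorAlong u)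
    (e : OpenPartialHomeomorph M (Model n)) (x : ℝ) : Model n :=
  toModel e (u (x : UnitAddCircle)) (X (x : UnitAddCircle))

theorem Loop.rep_add_one (u : Loop n M) (x : ℝ) : u.rep e (x + 1) = u.rep e x := by
  simp only [Loop.rep, AddCircle.coe_add_period]

theorem CovectorAlong.rep_add_one {u : Loop n M} (α : CovectorAlong u) (x : ℝ) :
    α.rep e (x + 1) = α.rep e x := by
  unfold CovectorAlong.rep; rw [AddCircle.coe_add_period]

theorem VectorAlong.rep_add_one {u : Loop n M} (X : VectorAlong u) (x : ℝ) :
    X.rep e (x + 1) = X.rep e x := by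
  unfold VectorAlong.rep; rw [AddCircle.coe_add_period]

theorem VectorAlong.rep_apply {u : Loop n M} (X : VectorAlong u) (i : Fin n) (x : ℝ) :
    X.rep e x i = X.coord e i x := rfl

theorem CovectorAlong.contDiffOn_rep {u : Loop n M} (α : CovectorAlong u) (he : e ∈ charts n M) :
    ContDiffOn ℝ ∞ (α.rep e) (u.dom e) :=
  contDiffOn_clm_of_single fun j => α.smooth e he j

theorem VectorAlong.contDiffOn_rep {u : Loop n M} (X : VectorAlong u) (he : e ∈ charts n M) :
    ContDiffOn ℝ ∞ (X.rep e) (u.dom e) :=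
  (contDiffOn_euclidean).2 fun i => X.smooth e he i

variable [IsManifold (𝓡 n) ∞ M]

theorem Loop.contDiffOn_rep (u : Loop n M) (he : e ∈ charts n M) :
    ContDiffOn ℝ ∞ (u.rep e) (u.dom e) :=
  ((contMDiffOn_of_mem_maximalAtlas he).comp u.smooth.contMDiffOn
    (fun _ hx => hx)).contDiffOn

theorem CovectorAlong.rep_comp {u : Loop n M} (α : CovectorAlong u) (he : e ∈ charts n M) {x : ℝ}
    (hx : x ∈ u.dom e) :
    (α.rep e x).comp (toModel e (u (x : UnitAddCircle))) = α (x : UnitAddCircle) := by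
  ext v
  exact congrArg (α (x : UnitAddCircle)) (ofModel_toModel he hx v)

/-- The pairing of covectors and vectors in a chart. -/
theorem pairing_eq {u : Loop n M} (α : CovectorAlong u) (X : VectorAlong u) (he : e ∈ charts n M)
    {x : ℝ} (hx : x ∈ u.dom e) :
    α (x : UnitAddCircle) (X (x : UnitAddCircle)) = α.rep e x (X.rep e x) :=
  (congrArg (α (x : UnitAddCircle)) (ofModel_toModel he hx (X (x : UnitAddCircle)))).symm

theorem Loop.rep_coordChange (u : Loop n M) {x : ℝ} (hx : x ∈ u.dom e) :
    u.rep e' x = coordChange e e' (u.rep e x) := by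
  simp only [Loop.rep, coordChange, e.left_inv hx]

theorem VectorAlong.rep_coordChange {u : Loop n M} (X : VectorAlong u) (he : e ∈ charts n M)
    (he' : e' ∈ charts n M) {x : ℝ} (hx : x ∈ u.dom e) (hx' : x ∈ u.dom e') :
    X.rep e' x = fderiv ℝ (coordChange e e') (u.rep e x) (X.rep e x) :=
  toModel_apply he he' hx hx' _

theorem CovectorAlong.rep_coordChange {u : Loop n M} (α : CovectorAlong u) (he : e ∈ charts n M)
    (he' : e' ∈ charts n M) {x : ℝ} (hx : x ∈ u.dom e) (hx' : x ∈ u.dom e') :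
    α.rep e x = (α.rep e' x).comp (fderiv ℝ (coordChange e e') (u.rep e x)) := by
  ext v
  change _ = α.rep e' x _
  have h := toModel_apply he he' hx hx' (ofModel e (u (x : UnitAddCircle)) v)
  rw [toModel_ofModel he hx] at h
  refine Eq.trans ?_ (congrArg (α.rep e' x) h)
  exact (congrArg (α (x : UnitAddCircle))
    (ofModel_toModel he' hx' (ofModel e (u (x : UnitAddCircle)) v))).symm

theorem VectorAlong.ext_rep {u : Loop n M} {X Y : VectorAlong u}
    (h : ∀ x : ℝ, ∃ e ∈ charts n M, x ∈ u.dom e ∧ X.rep e x = Y.rep e x) : X = Y := by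
  cases hα : X with | mk a _ => cases hβ : Y with | mk b _ =>
  congr
  funext z
  induction z using QuotientAddGroup.induction_on with
  | H x =>
    obtain ⟨e, he, hx, hr⟩ := h x
    have h1 := congrArg (ofModel e (u (x : UnitAddCircle))) hr
    subst hα hβ
    exact ((ofModel_toModel he hx _).symm.trans h1).trans (ofModel_toModel he hx _)

theorem mem_dom_chartAt (u : Loop n M) (x : ℝ) :
    x ∈ u.dom (chartAt (Model n) (u (x : UnitAddCircle))) := mem_chart_source _ _

/-- A loop from a smooth periodic curve. -/
def Loop.mk' (c : ℝ → M) (hc : ContMDiff 𝓘(ℝ, ℝ) (𝓡 n) ∞ c) (hp : Function.Periodic c 1) :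
    Loop n M where
  toFun := hp.lift
  smooth := hc

theorem out_coe (z : UnitAddCircle) : ((Quotient.out z : ℝ) : UnitAddCircle) = z :=
  Quotient.out_eq z

/-- Fields along a loop live on the circle and are evaluated through an arbitrary real
representative; periodicity makes this choice immaterial. -/
theorem apply_out_of_periodic {α : Type*} {f : ℝ → α} (hf : Function.Periodic f 1) (x : ℝ) :
    f (Quotient.out (x : UnitAddCircle)) = f x := by
  have h := out_coe (x : UnitAddCircle)
  have := (hf.lift_coe (Quotient.out (x : UnitAddCircle))).symm
  rw [this, h]; rfl

/-- A covector field along a loop from its values, given in all charts. -/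
def CovectorAlong.ofReps (u : Loop n M) (r : OpenPartialHomeomorph M (Model n) → ℝ → Dual n)
    (hper : ∀ e x, r e (x + 1) = r e x)
    (hsm : ∀ e ∈ charts n M, ContDiffOn ℝ ∞ (r e) (u.dom e))
    (hcomp : ∀ e ∈ charts n M, ∀ e' ∈ charts n M, ∀ x ∈ u.dom e, x ∈ u.dom e' →
      r e x = (r e' x).comp (fderiv ℝ (coordChange e e') (u.rep e x))) : CovectorAlong u where
  toFun z := (r (chartAt (Model n) (u z)) (Quotient.out z)).comp
    (toModel (chartAt (Model n) (u z)) (u z))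
  smooth := by
    intro e he j
    refine ((hsm e he).clm_apply (contDiffOn_const
      (c := single j (1 : ℝ)))).congr fun x hx => ?_
    change r _ _ (toModel (chartAt (Model n) (u (x : UnitAddCircle))) (u (x : UnitAddCircle))
      (ofModel e (u (x : UnitAddCircle)) (single j 1))) = _
    rw [apply_out_of_periodic (hper _), hcomp e he _ (chartAt_mem_charts (u (x : UnitAddCircle)))
      x hx (mem_dom_chartAt u x), toModel_apply he (chartAt_mem_charts _) hx (mem_dom_chartAt u x),
      toModel_ofModel he hx]
    rfl

theorem CovectorAlong.rep_ofReps {u : Loop n M}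
    {r : OpenPartialHomeomorph M (Model n) → ℝ → Dual n} (hper) (hsm) (hcomp)
    (he : e ∈ charts n M) {x : ℝ} (hx : x ∈ u.dom e) :
    (CovectorAlong.ofReps u r hper hsm hcomp).rep e x = r e x := by
  ext v
  change r _ _ (toModel (chartAt (Model n) (u (x : UnitAddCircle))) (u (x : UnitAddCircle))
      (ofModel e (u (x : UnitAddCircle)) v)) = _
  rw [apply_out_of_periodic (hper _), hcomp e he _ (chartAt_mem_charts (u (x : UnitAddCircle)))
    x hx (mem_dom_chartAt u x), toModel_apply he (chartAt_mem_charts _) hx (mem_dom_chartAt u x),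
    toModel_ofModel he hx]
  rfl

/-- A vector field along a loop from its values, given in all charts. -/
def VectorAlong.ofReps (u : Loop n M) (r : OpenPartialHomeomorph M (Model n) → ℝ → Model n)
    (hper : ∀ e x, r e (x + 1) = r e x)
    (hsm : ∀ e ∈ charts n M, ContDiffOn ℝ ∞ (r e) (u.dom e))
    (hcomp : ∀ e ∈ charts n M, ∀ e' ∈ charts n M, ∀ x ∈ u.dom e, x ∈ u.dom e' →
      r e' x = fderiv ℝ (coordChange e e') (u.rep e x) (r e x)) : VectorAlong u where
  toFun z := ofModel (chartAt (Model n) (u z)) (u z) (r (chartAt (Model n) (u z)) (Quotient.out z))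
  smooth := by
    intro e he i
    refine (contDiffOn_euclidean.1 (hsm e he) i).congr fun x hx => ?_
    change toModel e (u (x : UnitAddCircle)) (ofModel (chartAt (Model n) (u (x : UnitAddCircle)))
      (u (x : UnitAddCircle)) (r _ _)) i = _
    rw [apply_out_of_periodic (hper _), toModel_apply (chartAt_mem_charts _) he
      (mem_dom_chartAt u x) hx, toModel_ofModel (chartAt_mem_charts _) (mem_dom_chartAt u x),
      hcomp _ (chartAt_mem_charts (u (x : UnitAddCircle))) e he x (mem_dom_chartAt u x) hx]
    rfl

theorem VectorAlong.rep_ofReps {u : Loop n M}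
    {r : OpenPartialHomeomorph M (Model n) → ℝ → Model n} (hper) (hsm) (hcomp)
    (he : e ∈ charts n M) {x : ℝ} (hx : x ∈ u.dom e) :
    (VectorAlong.ofReps u r hper hsm hcomp).rep e x = r e x := by
  change toModel e (u (x : UnitAddCircle)) (ofModel (chartAt (Model n) (u (x : UnitAddCircle)))
    (u (x : UnitAddCircle)) (r _ _)) = _
  rw [apply_out_of_periodic (hper _), toModel_apply (chartAt_mem_charts _) he
    (mem_dom_chartAt u x) hx, toModel_ofModel (chartAt_mem_charts _) (mem_dom_chartAt u x),
    hcomp _ (chartAt_mem_charts (u (x : UnitAddCircle))) e he x (mem_dom_chartAt u x) hx]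
  rfl

end Reps

/-- Each point has a neighbourhood inside O or inside the complement of S. This is the form in which
objects defined in one chart are extended by zero. -/
theorem contDiff_of_eq_zero {X F : Type*} [NormedAddCommGroup X] [NormedSpace ℝ X]
    [NormedAddCommGroup F] [NormedSpace ℝ F] {f : X → F} {O S : Set X} (hO : IsOpen O)
    (hS : IsClosed S) (hSO : S ⊆ O) (hf : ContDiffOn ℝ ∞ f O) (h0 : ∀ x ∉ S, f x = 0) :
    ContDiff ℝ ∞ f := by
  rw [contDiff_iff_contDiffAt]
  intro x
  by_cases hx : x ∈ S
  · exact hf.contDiffAt (hO.mem_nhds (hSO hx))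
  · refine (contDiffAt_const (c := (0 : F))).congr_of_eventuallyEq ?_
    filter_upwards [hS.isOpen_compl.mem_nhds hx] with y hy using h0 y hy

section Localize

variable {n : ℕ} {M : Type*} [TopologicalSpace M] [ChartedSpace (Model n) M]
  {e e' e'' : OpenPartialHomeomorph M (Model n)} {u : Loop n M}

theorem isClosed_preimage_coe {S : Set UnitAddCircle} (hS : IsClosed S) :
    IsClosed {x : ℝ | (x : UnitAddCircle) ∈ S} := hS.preimage continuous_coe_circle

theorem smoothPeriodic_of_eq_zero {F : Type*} [NormedAddCommGroup F] [NormedSpace ℝ F]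
    {S : Set UnitAddCircle} (hS : IsClosed S) (hSu : ∀ z ∈ S, u z ∈ e.source) {g : ℝ → F}
    (hg : ContDiffOn ℝ ∞ g (u.dom e)) (hper : Function.Periodic g 1)
    (h0 : ∀ x : ℝ, (x : UnitAddCircle) ∉ S → g x = 0) : SmoothPeriodic g :=
  ⟨contDiff_of_eq_zero (u.isOpen_dom e) (isClosed_preimage_coe hS) (fun _ hx => hSu _ hx) hg h0,
    hper⟩

theorem smoothPeriodic_smul {F : Type*} [NormedAddCommGroup F] [NormedSpace ℝ F]
    {S : Set UnitAddCircle} (hS : IsClosed S) (hSu : ∀ z ∈ S, u z ∈ e.source)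
    {χ : ℝ → ℝ} (hχ : SmoothPeriodic χ) (h0 : ∀ x : ℝ, (x : UnitAddCircle) ∉ S → χ x = 0)
    {g : ℝ → F} (hg : ContDiffOn ℝ ∞ g (u.dom e)) (hper : Function.Periodic g 1) :
    SmoothPeriodic (fun x => χ x • g x) :=
  smoothPeriodic_of_eq_zero hS hSu (hχ.smooth.contDiffOn.smul hg)
    (fun x => by simp only [hχ.periodic x, hper x]) fun x hx => by simp only [h0 x hx, zero_smul]

theorem Loop.coe_add_one_mem_dom {x : ℝ} : x + 1 ∈ u.dom e ↔ x ∈ u.dom e := by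
  simp only [Loop.dom, Set.mem_ofPred_eq, AddCircle.coe_add_period]

variable [IsManifold (𝓡 n) ∞ M]

theorem contDiffAt_fderiv_coordChange (he : e ∈ charts n M) (he' : e' ∈ charts n M) {y : Model n}
    (hy : y ∈ e.target) (hy' : e.symm y ∈ e'.source) :
    ContDiffAt ℝ ∞ (fderiv ℝ (coordChange e e')) y :=
  (contDiffAt_coordChange he he' hy hy').fderiv_right (by simp)

theorem contDiffOn_fderiv_coordChange_rep (he : e ∈ charts n M) (he' : e' ∈ charts n M) :
    ContDiffOn ℝ ∞ (fun x => fderiv ℝ (coordChange e e') (u.rep e x)) (u.dom e ∩ u.dom e') := by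
  intro x hx
  refine ContDiffAt.comp_contDiffWithinAt x (contDiffAt_fderiv_coordChange he he'
    (e.map_source hx.1) ?_) ((u.contDiffOn_rep he).mono Set.inter_subset_left x hx)
  rw [Loop.rep, e.left_inv hx.1]; exact hx.2

theorem fderiv_coordChange_comp (he : e ∈ charts n M) (he' : e' ∈ charts n M)
    (he'' : e'' ∈ charts n M) {p : M} (hp : p ∈ e.source) (hp' : p ∈ e'.source)
    (hp'' : p ∈ e''.source) :
    fderiv ℝ (coordChange e e'') (e p)
      = (fderiv ℝ (coordChange e' e'') (e' p)).comp (fderiv ℝ (coordChange e e') (e p)) := by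
  ext1 v
  have h1 := toModel_apply he he'' hp hp'' (ofModel e p v)
  have h2 := toModel_apply he he' hp hp' (ofModel e p v)
  have h3 := toModel_apply he' he'' hp' hp'' (ofModel e p v)
  rw [toModel_ofModel he hp] at h1 h2
  rw [← h1, h3, h2]; rfl

theorem fderiv_coordChange_self (he : e ∈ charts n M) {p : M} (hp : p ∈ e.source) :
    fderiv ℝ (coordChange e e) (e p) = ContinuousLinearMap.id ℝ _ := by
  ext1 v
  have h1 := toModel_apply he he hp hp (ofModel e p v)
  rw [toModel_ofModel he hp] at h1
  exact h1.symm

theorem fderiv_coordChange_inv (he : e ∈ charts n M) (he' : e' ∈ charts n M) {p : M}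
    (hp : p ∈ e.source) (hp' : p ∈ e'.source) :
    (fderiv ℝ (coordChange e' e) (e' p)).comp (fderiv ℝ (coordChange e e') (e p))
      = ContinuousLinearMap.id ℝ _ := by
  rw [← fderiv_coordChange_comp he he' he hp hp' hp, fderiv_coordChange_self he hp]

open Classical in
/-- A covector field along a loop with support in the domain of one chart. -/
def CovectorAlong.ofChart (u : Loop n M) (he : e ∈ charts n M) (w : ℝ → Dual n)
    (hper : Function.Periodic w 1) (hw : ContDiffOn ℝ ∞ w (u.dom e)) (S : Set UnitAddCircle)
    (hS : IsClosed S) (hSu : ∀ z ∈ S, u z ∈ e.source)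
    (h0 : ∀ x : ℝ, (x : UnitAddCircle) ∉ S → w x = 0) : CovectorAlong u :=
  CovectorAlong.ofReps u
    (fun e' x => if x ∈ u.dom e then (w x).comp (fderiv ℝ (coordChange e' e) (u.rep e' x)) else 0)
    (fun e' x => by simp only [Loop.coe_add_one_mem_dom, hper x, Loop.rep_add_one])
    (by
      intro e' he' x hx
      by_cases hxS : (x : UnitAddCircle) ∈ S
      · have hxe : x ∈ u.dom e := hSu _ hxS
        have hmem : u.dom e' ∩ u.dom e ∈ nhds x :=
          ((u.isOpen_dom e').inter (u.isOpen_dom e)).mem_nhds ⟨hx, hxe⟩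
        refine ContDiffAt.contDiffWithinAt ?_
        refine ((hw.mono Set.inter_subset_right).clm_comp
          (contDiffOn_fderiv_coordChange_rep he' he)).contDiffAt hmem |>.congr_of_eventuallyEq ?_
        filter_upwards [hmem] with y hy
        rw [if_pos hy.2]
      · refine ((contDiffAt_const (c := (0 : Dual n))).congr_of_eventuallyEq
          ?_).contDiffWithinAt
        filter_upwards [(isClosed_preimage_coe hS).isOpen_compl.mem_nhds hxS] with y hy
        rw [h0 y hy]
        simp)
    (by
      intro e₁ he₁ e₂ he₂ x hx₁ hx₂
      split_ifs with hx
      · have h := fderiv_coordChange_comp he₁ he₂ he hx₁ hx₂ hx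
        simp only [Loop.rep]
        rw [h]
        rfl
      · simp)

theorem CovectorAlong.rep_ofChart {u : Loop n M} (he : e ∈ charts n M) (w : ℝ → Dual n)
    (hper : Function.Periodic w 1) (hw : ContDiffOn ℝ ∞ w (u.dom e)) (S : Set UnitAddCircle)
    (hS : IsClosed S) (hSu : ∀ z ∈ S, u z ∈ e.source)
    (h0 : ∀ x : ℝ, (x : UnitAddCircle) ∉ S → w x = 0) {x : ℝ} (hx : x ∈ u.dom e) :
    (CovectorAlong.ofChart u he w hper hw S hS hSu h0).rep e x = w x := by
  refine (CovectorAlong.rep_ofReps _ _ _ he hx).trans ?_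
  rw [if_pos hx, Loop.rep, fderiv_coordChange_self he hx]
  rfl

theorem CovectorAlong.ofChart_apply_eq_zero {u : Loop n M} (he : e ∈ charts n M) (w : ℝ → Dual n)
    (hper : Function.Periodic w 1) (hw : ContDiffOn ℝ ∞ w (u.dom e)) (S : Set UnitAddCircle)
    (hS : IsClosed S) (hSu : ∀ z ∈ S, u z ∈ e.source)
    (h0 : ∀ x : ℝ, (x : UnitAddCircle) ∉ S → w x = 0) {x : ℝ} (hx : (x : UnitAddCircle) ∉ S) :
    (CovectorAlong.ofChart u he w hper hw S hS hSu h0) (x : UnitAddCircle) = 0 := by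
  have h := (CovectorAlong.ofChart u he w hper hw S hS hSu h0).rep_comp
    (chartAt_mem_charts (u (x : UnitAddCircle))) (mem_dom_chartAt u x)
  rw [← h]
  have h1 : (CovectorAlong.ofChart u he w hper hw S hS hSu h0).rep
      (chartAt (Model n) (u (x : UnitAddCircle))) x = 0 := by
    refine (CovectorAlong.rep_ofReps _ _ _ (chartAt_mem_charts _) (mem_dom_chartAt u x)).trans ?_
    rw [h0 x hx]
    simp
  rw [h1]
  exact ContinuousLinearMap.zero_comp _

/-- The loop with a given expression in a chart. -/
def chartLoop (he : e ∈ charts n M) (γ : ℝ → Model n) (hγ : SmoothPeriodic γ)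
    (hmem : ∀ x, γ x ∈ e.target) : Loop n M :=
  Loop.mk' (fun x => e.symm (γ x))
    ((contMDiffOn_symm_of_mem_maximalAtlas he).comp_contMDiff hγ.smooth.contMDiff hmem)
    (fun x => by simp only [hγ.periodic x])

theorem chartLoop_apply (he : e ∈ charts n M) {γ : ℝ → Model n} (hγ : SmoothPeriodic γ)
    (hmem : ∀ x, γ x ∈ e.target) (x : ℝ) :
    chartLoop he γ hγ hmem (x : UnitAddCircle) = e.symm (γ x) := rfl

theorem mem_dom_chartLoop (he : e ∈ charts n M) {γ : ℝ → Model n} (hγ : SmoothPeriodic γ)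
    (hmem : ∀ x, γ x ∈ e.target) (x : ℝ) : x ∈ (chartLoop he γ hγ hmem).dom e :=
  e.map_target (hmem x)

theorem rep_chartLoop (he : e ∈ charts n M) {γ : ℝ → Model n} (hγ : SmoothPeriodic γ)
    (hmem : ∀ x, γ x ∈ e.target) (x : ℝ) : (chartLoop he γ hγ hmem).rep e x = γ x :=
  e.right_inv (hmem x)

/-- The covector field with a given expression in a chart, along a loop inside the chart. -/
def chartCovector (he : e ∈ charts n M) (u : Loop n M) (hu : ∀ x, x ∈ u.dom e) (ξ : ℝ → Dual n)
    (hξ : SmoothPeriodic ξ) : CovectorAlong u :=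
  CovectorAlong.ofChart u he ξ hξ.periodic hξ.smooth.contDiffOn Set.univ isClosed_univ
    (fun z _ => by
      induction z using QuotientAddGroup.induction_on with
      | H x => exact hu x) (fun x hx => absurd (Set.mem_univ _) hx)

theorem rep_chartCovector (he : e ∈ charts n M) (u : Loop n M) (hu : ∀ x, x ∈ u.dom e)
    {ξ : ℝ → Dual n} (hξ : SmoothPeriodic ξ) (x : ℝ) :
    (chartCovector he u hu ξ hξ).rep e x = ξ x :=
  CovectorAlong.rep_ofChart he _ _ _ _ _ _ _ (hu x)

/-- The compact image of γ has a uniform distance to the complement of T, and V is bounded on K, so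
a damping constant below the quotient of the two suffices. -/
theorem exists_damp_mem {Y : Type*} [TopologicalSpace Y] {K : Set Y} (hK : IsCompact K)
    {γ V : Y → Model n} (hγ : ContinuousOn γ K) (hV : ContinuousOn V K) {T : Set (Model n)}
    (hT : IsOpen T) (hγT : ∀ x ∈ K, γ x ∈ T) :
    ∃ δ > 0, ∀ ε, ∀ x ∈ K, γ x + damp δ ε • V x ∈ T := by
  obtain ⟨r, hr, hrT⟩ := (hK.image_of_continuousOn hγ).exists_thickening_subset_open hT
    (by rintro _ ⟨x, hx, rfl⟩; exact hγT x hx)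
  obtain ⟨C, hC⟩ := hK.exists_bound_of_continuousOn hV
  have hC1 : 0 < |C| + 1 := by positivity
  refine ⟨r / (|C| + 1), by positivity, fun ε x hx => hrT ?_⟩
  rw [Metric.mem_thickening_iff]
  refine ⟨γ x, ⟨x, hx, rfl⟩, ?_⟩
  rw [dist_eq_norm, add_sub_cancel_left, norm_smul, Real.norm_eq_abs]
  calc |damp (r / (|C| + 1)) ε| * ‖V x‖ ≤ r / (|C| + 1) * |C| :=
        mul_le_mul (abs_damp_le (by positivity) ε) ((hC x hx).trans (le_abs_self C))
          (norm_nonneg _) (by positivity)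
    _ < r := by
        rw [div_mul_eq_mul_div, div_lt_iff₀ hC1]
        nlinarith

open Classical in
/-- A loop can be varied inside a chart in a prescribed direction. -/
theorem exists_chartVariation (u : Loop n M) (he : e ∈ charts n M) {V : ℝ → Model n}
    (hV : SmoothPeriodic V) {S : Set UnitAddCircle} (hS : IsClosed S)
    (hSu : ∀ z ∈ S, u z ∈ e.source) (h0 : ∀ x : ℝ, (x : UnitAddCircle) ∉ S → V x = 0) :
    ∃ δ > 0, ∃ U : ℝ → Loop n M,
      ContMDiff 𝓘(ℝ, ℝ × ℝ) (𝓡 n) ∞ (fun q : ℝ × ℝ => U q.1 (q.2 : UnitAddCircle)) ∧ U 0 = u ∧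
      (∀ ε, ∀ x : ℝ, (x : UnitAddCircle) ∉ S → U ε (x : UnitAddCircle) = u (x : UnitAddCircle)) ∧
      ∀ ε, ∀ x ∈ u.dom e, x ∈ (U ε).dom e ∧ (U ε).rep e x = u.rep e x + damp δ ε • V x := by
  have hK : IsCompact (Set.Icc (0 : ℝ) 1 ∩ {x : ℝ | (x : UnitAddCircle) ∈ S}) :=
    isCompact_Icc.inter_right (isClosed_preimage_coe hS)
  obtain ⟨δ, hδ, hmem⟩ := exists_damp_mem hK
    ((u.contDiffOn_rep he).continuousOn.mono fun x hx => hSu _ hx.2)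
    hV.continuous.continuousOn e.open_target fun x hx => e.map_source (hSu _ hx.2)
  have hfr : ∀ x : ℝ, ((Int.fract x : ℝ) : UnitAddCircle) = x := fun x => AddCircle.coe_fract x
  have hVfr : ∀ x : ℝ, V (Int.fract x) = V x := fun x => by
    simpa using hV.periodic.sub_zsmul_eq (x := x) ⌊x⌋
  have hT : ∀ ε, ∀ x ∈ u.dom e, u.rep e x + damp δ ε • V x ∈ e.target := by
    intro ε x hx
    by_cases hxS : (x : UnitAddCircle) ∈ S
    · have := hmem ε (Int.fract x) ⟨⟨Int.fract_nonneg x, (Int.fract_lt_one x).le⟩,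
        by rw [Set.mem_ofPred_eq, hfr]; exact hxS⟩
      rwa [hVfr, Loop.rep, hfr] at this
    · rw [h0 x hxS, smul_zero, add_zero]
      exact e.map_source hx
  -- Off S the two branches agree, because V vanishes there; hence the varied loop is smooth
  -- although the chart covers only a part of it.
  let c : ℝ → ℝ → M := fun ε x =>
    if x ∈ u.dom e then e.symm (u.rep e x + damp δ ε • V x) else u (x : UnitAddCircle)
  have hcS : ∀ ε, ∀ x : ℝ, (x : UnitAddCircle) ∉ S → c ε x = u (x : UnitAddCircle) := by
    intro ε x hx
    by_cases hxe : x ∈ u.dom e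
    · simp only [c, if_pos hxe, h0 x hx, smul_zero, add_zero]
      exact e.left_inv hxe
    · simp only [c, if_neg hxe]
  have hc : ContMDiff 𝓘(ℝ, ℝ × ℝ) (𝓡 n) ∞ (fun q : ℝ × ℝ => c q.1 q.2) := by
    rintro ⟨ε, x⟩
    by_cases hxS : (x : UnitAddCircle) ∈ S
    · have hxe : x ∈ u.dom e := hSu _ hxS
      have h1 : ContDiffAt ℝ ∞ (fun q : ℝ × ℝ => u.rep e q.2 + damp δ q.1 • V q.2) (ε, x) := by
        refine ContDiffAt.add ?_ ?_
        · exact ContDiffAt.comp (g := u.rep e) (f := fun q : ℝ × ℝ => q.2) (ε, x)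
            ((u.contDiffOn_rep he).contDiffAt ((u.isOpen_dom e).mem_nhds hxe)) contDiffAt_snd
        · exact (((contDiff_damp δ).comp contDiff_fst).smul
            (hV.smooth.comp contDiff_snd)).contDiffAt
      refine ((contMDiffAt_symm_of_mem_maximalAtlas he (hT ε x hxe)).comp (ε, x)
        h1.contMDiffAt).congr_of_eventuallyEq ?_
      have : {q : ℝ × ℝ | q.2 ∈ u.dom e} ∈ nhds (ε, x) :=
        ((u.isOpen_dom e).preimage continuous_snd).mem_nhds hxe
      filter_upwards [this] with q hq
      simp only [c, Function.comp]
      rw [if_pos hq]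
    · refine ((u.smooth.comp contDiff_snd.contMDiff) (ε, x)).congr_of_eventuallyEq ?_
      have : {q : ℝ × ℝ | (q.2 : UnitAddCircle) ∉ S} ∈ nhds (ε, x) :=
        ((isClosed_preimage_coe hS).isOpen_compl.preimage continuous_snd).mem_nhds hxS
      filter_upwards [this] with q hq using hcS _ _ hq
  refine ⟨δ, hδ, fun ε => Loop.mk' (c ε) ?_ ?_, hc, ?_, hcS, fun ε x hx => ?_⟩
  · exact hc.comp (g := fun q : ℝ × ℝ => c q.1 q.2) (f := fun x : ℝ => (ε, x))
      (by fun_prop : ContDiff ℝ ∞ fun x : ℝ => (ε, x)).contMDiff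
  · intro x
    simp only [c, Loop.coe_add_one_mem_dom, Loop.rep_add_one, hV.periodic x,
      AddCircle.coe_add_period]
  · ext x
    change c 0 x = _
    by_cases hxe : x ∈ u.dom e
    · simp only [c, if_pos hxe, damp_zero, zero_smul, add_zero]
      exact e.left_inv hxe
    · simp only [c, if_neg hxe]
  · have h1 : c ε x = e.symm (u.rep e x + damp δ ε • V x) := by simp only [c, if_pos hx]
    refine ⟨?_, ?_⟩
    · change c ε x ∈ e.source
      rw [h1]; exact e.map_target (hT ε x hx)
    · change e (c ε x) = _
      rw [h1]; exact e.right_inv (hT ε x hx)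

/-- The derivative of a functional along a variation, with the velocity computed in charts. -/
theorem HasVariationalDerivative.hasDerivAt {F : Loop n M → ℝ}
    {δF : ∀ u : Loop n M, CovectorAlong u}
    (h : HasVariationalDerivative F δF) {U : ℝ → Loop n M}
    (hU : ContMDiff 𝓘(ℝ, ℝ × ℝ) (𝓡 n) ∞ (fun q : ℝ × ℝ => U q.1 (q.2 : UnitAddCircle)))
    (hU0 : U 0 = u) {g : ℝ → ℝ}
    (hg : ∀ x : ℝ, ∃ e ∈ charts n M, x ∈ u.dom e ∧ ∃ v,
      HasDerivAt (fun ε => (U ε).rep e x) v 0 ∧ g x = (δF u).rep e x v) :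
    HasDerivAt (fun ε => F (U ε)) (∫ x in (0 : ℝ)..1, g x) 0 := by
  subst hU0
  convert h U hU using 1
  refine intervalIntegral.integral_congr fun x _ => ?_
  obtain ⟨e, he, hx, v, hv, hgx⟩ := hg x
  have hc : MDifferentiableAt 𝓘(ℝ, ℝ) (𝓡 n) (fun ε : ℝ => U ε (x : UnitAddCircle)) 0 := by
    have : ContMDiff 𝓘(ℝ, ℝ) (𝓡 n) ∞ (fun ε : ℝ => U ε (x : UnitAddCircle)) :=
      hU.comp (f := fun ε : ℝ => (ε, x)) (by fun_prop : ContDiff ℝ ∞ fun ε : ℝ => (ε, x)).contMDiff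
    exact this.mdifferentiable (by simp) 0
  have h1 := toModel_velocity he hc hx hv
  have h2 := (δF (U 0)).rep_comp he hx
  rw [hgx, ← h1]
  exact congrArg (fun L : Dual n => L (mfderiv 𝓘(ℝ, ℝ) (𝓡 n)
    (fun ε : ℝ => U ε (x : UnitAddCircle)) 0 (1 : ℝ))) h2

end Localize

/-! ### Functions of two variables -/

section TwoVariables

variable {E F : Type*} [NormedAddCommGroup E] [NormedSpace ℝ E] [NormedAddCommGroup F]
  [NormedSpace ℝ F]

/-- The partial derivative in the first variable. -/
def dε (g : ℝ × ℝ → F) (q : ℝ × ℝ) : F := fderiv ℝ g q (1, 0)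

/-- The partial derivative in the second variable. -/
def dx (g : E × ℝ → F) (q : E × ℝ) : F := fderiv ℝ g q (0, 1)

variable {g : ℝ × ℝ → F} {O : Set (ℝ × ℝ)} {q : ℝ × ℝ}

theorem contDiffOn_dε (hO : IsOpen O) (hg : ContDiffOn ℝ ∞ g O) : ContDiffOn ℝ ∞ (dε g) O :=
  (hg.fderiv_of_isOpen hO (by simp)).clm_apply contDiffOn_const

theorem contDiffOn_dx {g : E × ℝ → F} {O : Set (E × ℝ)} (hO : IsOpen O)
    (hg : ContDiffOn ℝ ∞ g O) : ContDiffOn ℝ ∞ (dx g) O :=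
  (hg.fderiv_of_isOpen hO (by simp)).clm_apply contDiffOn_const

theorem contDiffOn_dx_iterate {g : E × ℝ → F} {O : Set (E × ℝ)} (hO : IsOpen O)
    (hg : ContDiffOn ℝ ∞ g O) (k : ℕ) :
    ContDiffOn ℝ ∞ (dx^[k] g) O := by
  induction k with
  | zero => exact hg
  | succ k ih => rw [Function.iterate_succ_apply']; exact contDiffOn_dx hO ih

theorem differentiableAt_of_contDiffOn {X : Type*} [NormedAddCommGroup X] [NormedSpace ℝ X]
    {g : X → F} {O : Set X} {q : X} (hO : IsOpen O) (hg : ContDiffOn ℝ ∞ g O) (hq : q ∈ O) :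
    DifferentiableAt ℝ g q :=
  (hg.contDiffAt (hO.mem_nhds hq)).differentiableAt (by simp)

theorem dε_dx (hO : IsOpen O) (hg : ContDiffOn ℝ ∞ g O) (hq : q ∈ O) :
    dε (dx g) q = dx (dε g) q := by
  have h1 : DifferentiableAt ℝ (fderiv ℝ g) q :=
    differentiableAt_of_contDiffOn hO (hg.fderiv_of_isOpen hO (by simp)) hq
  have hs : IsSymmSndFDerivAt ℝ g q :=
    (hg.contDiffAt (hO.mem_nhds hq)).isSymmSndFDerivAt
      (by simpa using WithTop.coe_le_coe.2 (le_top (a := (2 : ℕ∞))))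
  have h2 : ∀ v w : ℝ × ℝ, fderiv ℝ (fun y => fderiv ℝ g y v) q w = fderiv ℝ (fderiv ℝ g) q w v :=
    fun v w => by rw [fderiv_clm_apply h1 (differentiableAt_const _)]; simp
  exact (h2 _ _).trans ((hs (1, 0) (0, 1)).trans (h2 _ _).symm)

theorem dx_congr {g h : E × ℝ → F} {O : Set (E × ℝ)} {q : E × ℝ} (hO : IsOpen O)
    (hgh : Set.EqOn g h O) (hq : q ∈ O) :
    dx g q = dx h q := by
  rw [dx, dx, (hgh.eventuallyEq_of_mem (hO.mem_nhds hq)).fderiv_eq]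

theorem dε_dx_iterate (hO : IsOpen O) (hg : ContDiffOn ℝ ∞ g O) (k : ℕ) :
    Set.EqOn (dε (dx^[k] g)) (dx^[k] (dε g)) O := by
  induction k with
  | zero => exact fun _ _ => rfl
  | succ k ih =>
    intro q hq
    rw [Function.iterate_succ_apply', Function.iterate_succ_apply',
      dε_dx hO (contDiffOn_dx_iterate hO hg k) hq]
    exact dx_congr hO ih hq

theorem hasDerivAt_dε (hO : IsOpen O) (hg : ContDiffOn ℝ ∞ g O) {ε x : ℝ} (hq : (ε, x) ∈ O) :
    HasDerivAt (fun s => g (s, x)) (dε g (ε, x)) ε :=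
  hasDerivAt_left_of_contDiff (differentiableAt_of_contDiffOn hO hg hq)

theorem hasDerivAt_dx {g : E × ℝ → F} {O : Set (E × ℝ)} (hO : IsOpen O)
    (hg : ContDiffOn ℝ ∞ g O) {ε : E} {x : ℝ} (hq : (ε, x) ∈ O) :
    HasDerivAt (fun s => g (ε, s)) (dx g (ε, x)) x :=
  hasDerivAt_right_of_contDiff (differentiableAt_of_contDiffOn hO hg hq)

theorem iteratedDeriv_eq_dx_iterate {g : E × ℝ → F} {O : Set (E × ℝ)} (hO : IsOpen O)
    (hg : ContDiffOn ℝ ∞ g O) (k : ℕ) {ε : E} {x : ℝ}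
    (hq : (ε, x) ∈ O) : iteratedDeriv k (fun s => g (ε, s)) x = (dx^[k] g) (ε, x) := by
  induction k generalizing x with
  | zero => simp
  | succ k ih =>
    rw [iteratedDeriv_succ, Function.iterate_succ_apply']
    have hev : iteratedDeriv k (fun s => g (ε, s)) =ᶠ[nhds x] fun s => (dx^[k] g) (ε, s) := by
      have : {s : ℝ | (ε, s) ∈ O} ∈ nhds x :=
        (hO.preimage (by fun_prop : Continuous fun s : ℝ => (ε, s))).mem_nhds hq
      filter_upwards [this] with s hs using ih hs
    rw [hev.deriv_eq]
    exact (hasDerivAt_dx hO (contDiffOn_dx_iterate hO hg k) hq).deriv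

theorem contDiffOn_iteratedDeriv {f : ℝ → F} {s : Set ℝ} (hs : IsOpen s)
    (hf : ContDiffOn ℝ ∞ f s) (k : ℕ) : ContDiffOn ℝ ∞ (iteratedDeriv k f) s := by
  induction k with
  | zero => simpa using hf
  | succ k ih =>
    rw [iteratedDeriv_succ]
    exact ((contDiffOn_infty_iff_deriv_of_isOpen hs).1 ih).2

theorem contDiffOn_deriv {f : ℝ → F} {s : Set ℝ} (hs : IsOpen s)
    (hf : ContDiffOn ℝ ∞ f s) : ContDiffOn ℝ ∞ (deriv f) s :=
  ((contDiffOn_infty_iff_deriv_of_isOpen hs).1 hf).2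

theorem iteratedDeriv_eq_zero {f : ℝ → F} {x : ℝ} (h : f =ᶠ[nhds x] fun _ => 0) (k : ℕ) :
    iteratedDeriv k f x = 0 := by
  rw [h.iteratedDeriv_eq]
  simp

end TwoVariables

/-! ### Jets and densities -/

section Densities

variable {n : ℕ} {E F : Type*} [NormedAddCommGroup E] [NormedSpace ℝ E] [NormedAddCommGroup F]
  [NormedSpace ℝ F]

/-- The jet of order `m` of a curve. -/
def jet (m : ℕ) (γ : ℝ → Model n) (x : ℝ) : Fin (m + 1) → Model n := fun k => iteratedDeriv k γ x

/-- The derivative of a density in the direction of the derivative of order `k` of the curve. -/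
def jetDeriv {m : ℕ} (f : ℝ × (Fin (m + 1) → Model n) → F) (k : Fin (m + 1))
    (q : ℝ × (Fin (m + 1) → Model n)) : Model n →L[ℝ] F :=
  (fderiv ℝ f q).comp ((ContinuousLinearMap.inr ℝ ℝ (Fin (m + 1) → Model n)).comp
    (ContinuousLinearMap.single ℝ (fun _ : Fin (m + 1) => Model n) k))

variable {m : ℕ} {f : ℝ × (Fin (m + 1) → Model n) → F} {T : Set (Model n)}

theorem jetDeriv_apply (k : Fin (m + 1)) (q : ℝ × (Fin (m + 1) → Model n)) (w : Model n) :
    jetDeriv f k q w = fderiv ℝ f q (0, Pi.single k w) := rfl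

theorem isOpen_jets (hT : IsOpen T) : IsOpen {q : ℝ × (Fin (m + 1) → Model n) | q.2 0 ∈ T} :=
  hT.preimage (by fun_prop)

theorem contDiffOn_jetDeriv (hT : IsOpen T) (hf : ContDiffOn ℝ ∞ f {q | q.2 0 ∈ T})
    (k : Fin (m + 1)) : ContDiffOn ℝ ∞ (jetDeriv f k) {q | q.2 0 ∈ T} :=
  (hf.fderiv_of_isOpen (isOpen_jets hT) (by simp)).clm_comp contDiffOn_const

theorem fderiv_jet_eq_sum (q : ℝ × (Fin (m + 1) → Model n)) (w : Fin (m + 1) → Model n) :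
    fderiv ℝ f q (0, w) = ∑ k, jetDeriv f k q (w k) := by
  simp only [jetDeriv_apply, ← map_sum]
  congr 1
  refine Prod.ext (by simp [Prod.fst_sum]) ?_
  simp only [Prod.snd_sum]
  exact (Finset.univ_sum_single w).symm

theorem contDiffOn_jet (m : ℕ) {γ : ℝ → Model n} {s : Set ℝ} (hs : IsOpen s)
    (hγ : ContDiffOn ℝ ∞ γ s) : ContDiffOn ℝ ∞ (jet m γ) s :=
  contDiffOn_pi.2 fun k => contDiffOn_iteratedDeriv hs hγ k

theorem contDiffOn_density {γ : ℝ → Model n} {s : Set ℝ} (hs : IsOpen s)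
    (hγ : ContDiffOn ℝ ∞ γ s) (hf : ContDiffOn ℝ ∞ f {q | q.2 0 ∈ T}) (hT : ∀ x ∈ s, γ x ∈ T) :
    ContDiffOn ℝ ∞ (fun x => f (x, jet m γ x)) s :=
  hf.comp (contDiffOn_id.prodMk (contDiffOn_jet m hs hγ)) fun x hx => by
    simpa [jet] using hT x hx

variable {g : ℝ × ℝ → Model n} {O : Set (ℝ × ℝ)}

theorem contDiffOn_jet_family {g : E × ℝ → Model n} {O : Set (E × ℝ)} (m : ℕ) (hO : IsOpen O)
    (hg : ContDiffOn ℝ ∞ g O) :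
    ContDiffOn ℝ ∞ (fun q => jet m (fun s => g (q.1, s)) q.2) O := by
  refine contDiffOn_pi.2 fun k => ?_
  exact (contDiffOn_dx_iterate hO hg k).congr fun q hq =>
    iteratedDeriv_eq_dx_iterate hO hg k hq

theorem contDiffOn_density_family {g : E × ℝ → Model n} {O : Set (E × ℝ)} (hO : IsOpen O)
    (hg : ContDiffOn ℝ ∞ g O)
    (hf : ContDiffOn ℝ ∞ f {q | q.2 0 ∈ T}) (hT : ∀ q ∈ O, g q ∈ T) :
    ContDiffOn ℝ ∞ (fun q => f (q.2, jet m (fun s => g (q.1, s)) q.2)) O :=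
  hf.comp (contDiff_snd.contDiffOn.prodMk (contDiffOn_jet_family m hO hg)) fun q hq => by
    simpa [jet] using hT q hq

/-- The derivative of a density along a family of curves. -/
theorem hasDerivAt_density (hO : IsOpen O) (hg : ContDiffOn ℝ ∞ g O) (hTo : IsOpen T)
    (hf : ContDiffOn ℝ ∞ f {q | q.2 0 ∈ T}) {ε x : ℝ} (hq : (ε, x) ∈ O)
    (hT : ∀ q ∈ O, g q ∈ T) :
    HasDerivAt (fun s => f (x, jet m (fun y => g (s, y)) x))
      (∑ k : Fin (m + 1), jetDeriv f k (x, jet m (fun y => g (ε, y)) x)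
        (iteratedDeriv k (fun y => dε g (ε, y)) x)) ε := by
  rw [← fderiv_jet_eq_sum (f := f) _ (fun k : Fin (m + 1) => iteratedDeriv k (fun y => dε g (ε, y)) x)]
  have hf' : DifferentiableAt ℝ f (x, jet m (fun y => g (ε, y)) x) :=
    differentiableAt_of_contDiffOn (isOpen_jets hTo) hf (by simpa [jet] using hT _ hq)
  have h1 : HasDerivAt (fun s => jet m (fun y => g (s, y)) x)
      (fun k : Fin (m + 1) => iteratedDeriv k (fun y => dε g (ε, y)) x) ε := by
    refine hasDerivAt_pi.2 fun k => ?_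
    rw [iteratedDeriv_eq_dx_iterate hO (contDiffOn_dε hO hg) k hq, ← dε_dx_iterate hO hg k hq]
    refine (hasDerivAt_dε hO (contDiffOn_dx_iterate hO hg k) hq).congr_of_eventuallyEq ?_
    have : {s : ℝ | (s, x) ∈ O} ∈ nhds ε :=
      (hO.preimage (by fun_prop : Continuous fun s : ℝ => (s, x))).mem_nhds hq
    filter_upwards [this] with s hs using iteratedDeriv_eq_dx_iterate hO hg k hs
  exact hf'.hasFDerivAt.comp_hasDerivAt ε ((hasDerivAt_const ε x).prodMk h1)

end Densities

/-! ### Functionals whose density is supported in one chart -/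

/-- A density of order `m` on the loops in an open set `T`, with compact support. -/
structure CompactDensity (n m : ℕ) (T : Set (Model n)) where
  /-- the density -/
  toFun : ℝ × (Fin (m + 1) → Model n) → ℝ
  smooth : ContDiffOn ℝ ∞ toFun {q | q.2 0 ∈ T}
  periodic : ∀ x q, toFun (x + 1, q) = toFun (x, q)
  /-- the support -/
  supp : Set (Model n)
  isCompact_supp : IsCompact supp
  supp_subset : supp ⊆ T
  eq_zero : ∀ q, q.2 0 ∉ supp → toFun q = 0

section

variable {n m : ℕ} {M : Type*} [TopologicalSpace M] [T2Space M] [ChartedSpace (Model n) M]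
  [IsManifold (𝓡 n) ∞ M] {e : OpenPartialHomeomorph M (Model n)}

theorem jet_add_one {γ : ℝ → Model n} (hγ : Function.Periodic γ 1) (x : ℝ) :
    jet m γ (x + 1) = jet m γ x :=
  funext fun k => periodic_iteratedDeriv hγ k x

theorem jet_zero_apply (γ : ℝ → Model n) (x : ℝ) : jet m γ x 0 = γ x := by simp [jet]

theorem CompactDensity.jetDeriv_eq_zero {T : Set (Model n)} (f : CompactDensity n m T)
    (k : Fin (m + 1)) {q : ℝ × (Fin (m + 1) → Model n)} (hq : q.2 0 ∉ f.supp) :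
    jetDeriv f.toFun k q = 0 := by
  have h : f.toFun =ᶠ[nhds q] fun _ => 0 := by
    filter_upwards [(isOpen_jets f.isCompact_supp.isClosed.isOpen_compl).mem_nhds hq] with p hp
      using f.eq_zero p hp
  rw [jetDeriv, h.fderiv_eq]
  simp

variable (f : CompactDensity n m e.target)

open Classical in
/-- The density evaluated on a loop of the manifold. -/
def CompactDensity.eval (u : Loop n M) (x : ℝ) : ℝ :=
  if x ∈ u.dom e then f.toFun (x, jet m (u.rep e) x) else 0

/-- The functional with the given density. -/
def CompactDensity.functional (u : Loop n M) : ℝ := ∫ x in (0 : ℝ)..1, f.eval u x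

/-- The points of the circle which a loop maps to the support of the density. -/
def CompactDensity.suppAlong (u : Loop n M) : Set UnitAddCircle := {z | u z ∈ e.symm '' f.supp}

theorem CompactDensity.isClosed_image_supp : IsClosed (e.symm '' f.supp) :=
  (f.isCompact_supp.image_of_continuousOn
    (e.continuousOn_symm.mono f.supp_subset)).isClosed

theorem CompactDensity.image_supp_subset : e.symm '' f.supp ⊆ e.source := by
  rintro _ ⟨y, hy, rfl⟩
  exact e.map_target (f.supp_subset hy)

theorem CompactDensity.isClosed_suppAlong (u : Loop n M) : IsClosed (f.suppAlong u) :=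
  f.isClosed_image_supp.preimage u.continuous

theorem CompactDensity.suppAlong_subset (u : Loop n M) :
    ∀ z ∈ f.suppAlong u, u z ∈ e.source := fun _ hz => f.image_supp_subset hz

theorem CompactDensity.rep_notMem_supp {u : Loop n M} {x : ℝ} (hx : x ∈ u.dom e)
    (h : (x : UnitAddCircle) ∉ f.suppAlong u) : u.rep e x ∉ f.supp :=
  fun hm => h ⟨_, hm, e.left_inv hx⟩

open Classical in
/-- The derivatives of the density along a loop. -/
def CompactDensity.partials (u : Loop n M) (k : Fin (m + 1)) (x : ℝ) : Dual n :=
  if x ∈ u.dom e then jetDeriv f.toFun k (x, jet m (u.rep e) x) else 0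

theorem CompactDensity.partials_eq_zero (u : Loop n M) (k : Fin (m + 1)) {x : ℝ}
    (h : (x : UnitAddCircle) ∉ f.suppAlong u) : f.partials u k x = 0 := by
  unfold CompactDensity.partials
  split_ifs with hx
  · exact f.jetDeriv_eq_zero k (by simpa [jet] using f.rep_notMem_supp hx h)
  · rfl

theorem periodic_rep (u : Loop n M) : Function.Periodic (u.rep e) 1 := fun x => u.rep_add_one x

theorem CompactDensity.jetDeriv_add_one {T : Set (Model n)} (f : CompactDensity n m T)
    (k : Fin (m + 1)) (x : ℝ) (q : Fin (m + 1) → Model n) :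
    jetDeriv f.toFun k (x + 1, q) = jetDeriv f.toFun k (x, q) := by
  have h : (fun p : ℝ × (Fin (m + 1) → Model n) => f.toFun (p + ((1 : ℝ), 0))) = f.toFun := by
    funext p
    obtain ⟨y, p⟩ := p
    simpa using f.periodic y p
  have h2 := fderiv_comp_add_right (𝕜 := ℝ) (f := f.toFun) (x := (x, q)) ((1 : ℝ), 0)
  rw [h] at h2
  simp only [jetDeriv, h2]
  simp

theorem CompactDensity.smoothPeriodic_partials (he : e ∈ charts n M) (u : Loop n M)
    (k : Fin (m + 1)) : SmoothPeriodic (f.partials u k) := by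
  refine smoothPeriodic_of_eq_zero (f.isClosed_suppAlong u) (f.suppAlong_subset u) ?_
    (fun x => ?_) fun x hx => f.partials_eq_zero u k hx
  · refine (contDiffOn_density (u.isOpen_dom e) (u.contDiffOn_rep he)
      (contDiffOn_jetDeriv e.open_target f.smooth k) fun x hx => e.map_source hx).congr
      fun x hx => ?_
    simp only [CompactDensity.partials, if_pos hx]
  · simp only [CompactDensity.partials, Loop.coe_add_one_mem_dom, jet_add_one (periodic_rep u),
      f.jetDeriv_add_one]
    by_cases hx : x ∈ u.dom e
    · rw [if_pos hx, if_pos (Loop.coe_add_one_mem_dom.2 hx)]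
    · rw [if_neg hx, if_neg fun h => hx (Loop.coe_add_one_mem_dom.1 h)]

/-- The Euler–Lagrange expression in the chart. -/
def CompactDensity.eulerLagrange (u : Loop n M) (x : ℝ) : Dual n :=
  ∑ k : Fin (m + 1), (-1 : ℝ) ^ (k : ℕ) • iteratedDeriv k (f.partials u k) x

theorem SmoothPeriodic.sum {ι F : Type*} [NormedAddCommGroup F] [NormedSpace ℝ F] (s : Finset ι)
    {φ : ι → ℝ → F} (h : ∀ i, SmoothPeriodic (φ i)) :
    SmoothPeriodic (fun x => ∑ i ∈ s, φ i x) :=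
  ⟨ContDiff.sum fun i _ => (h i).smooth, fun x => by simp only [fun i => (h i).periodic x]⟩

theorem SmoothPeriodic.const_smul {F : Type*} [NormedAddCommGroup F] [NormedSpace ℝ F]
    {f : ℝ → F} (h : SmoothPeriodic f) (c : ℝ) : SmoothPeriodic (fun x => c • f x) :=
  (SmoothPeriodic.const c).smul h

theorem CompactDensity.smoothPeriodic_eulerLagrange (he : e ∈ charts n M) (u : Loop n M) :
    SmoothPeriodic (f.eulerLagrange u) :=
  SmoothPeriodic.sum _ fun k =>
    ((f.smoothPeriodic_partials he u k).iteratedDeriv k).const_smul _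

theorem eventually_notMem_of_isClosed {S : Set UnitAddCircle} (hS : IsClosed S) {x : ℝ}
    (hx : (x : UnitAddCircle) ∉ S) : ∀ᶠ y : ℝ in nhds x, (y : UnitAddCircle) ∉ S :=
  (isClosed_preimage_coe hS).isOpen_compl.mem_nhds hx

theorem CompactDensity.eulerLagrange_eq_zero (u : Loop n M) {x : ℝ}
    (h : (x : UnitAddCircle) ∉ f.suppAlong u) : f.eulerLagrange u x = 0 := by
  refine Finset.sum_eq_zero fun k _ => ?_
  rw [iteratedDeriv_eq_zero, smul_zero]
  filter_upwards [eventually_notMem_of_isClosed (f.isClosed_suppAlong u) h] with y hy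
    using f.partials_eq_zero u k hy

/-- The variational derivative of the functional with a given density. -/
def CompactDensity.variation (he : e ∈ charts n M) (u : Loop n M) : CovectorAlong u :=
  CovectorAlong.ofChart u he (f.eulerLagrange u) (f.smoothPeriodic_eulerLagrange he u).periodic
    (f.smoothPeriodic_eulerLagrange he u).smooth.contDiffOn (f.suppAlong u)
    (f.isClosed_suppAlong u) (f.suppAlong_subset u) fun _ hx => f.eulerLagrange_eq_zero u hx

theorem CompactDensity.rep_variation (he : e ∈ charts n M) (u : Loop n M) {x : ℝ}
    (hx : x ∈ u.dom e) : (f.variation he u).rep e x = f.eulerLagrange u x :=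
  CovectorAlong.rep_ofChart he _ _ _ _ _ _ _ hx

theorem CompactDensity.variation_eq_zero (he : e ∈ charts n M) (u : Loop n M) {x : ℝ}
    (hx : (x : UnitAddCircle) ∉ f.suppAlong u) : f.variation he u (x : UnitAddCircle) = 0 :=
  CovectorAlong.ofChart_apply_eq_zero he _ _ _ _ _ _ _ hx

/-- The term of order k is integrated by parts k times, which accounts for the alternating signs of
the Euler–Lagrange expression. -/
theorem CompactDensity.integral_partials (he : e ∈ charts n M) (u : Loop n M) {V : ℝ → Model n}
    (hV : SmoothPeriodic V) :
    ∫ x in (0 : ℝ)..1, ∑ k : Fin (m + 1), f.partials u k x (iteratedDeriv k V x)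
      = ∫ x in (0 : ℝ)..1, f.eulerLagrange u x (V x) := by
  have h1 : ∀ k : Fin (m + 1), SmoothPeriodic (f.partials u k) :=
    fun k => f.smoothPeriodic_partials he u k
  rw [intervalIntegral.integral_finsetSum fun (k : Fin (m + 1)) _ =>
    ((h1 k).clm_apply (hV.iteratedDeriv k)).continuous.intervalIntegrable _ _]
  simp only [CompactDensity.eulerLagrange, sum_apply, smul_apply]
  rw [intervalIntegral.integral_finsetSum fun (k : Fin (m + 1)) _ =>
    ((((h1 k).iteratedDeriv k).clm_apply hV).const_smul _).continuous.intervalIntegrable _ _]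
  refine Finset.sum_congr rfl fun k _ => ?_
  rw [(h1 k).integral_clm_iteratedDeriv hV k, intervalIntegral.integral_smul, smul_eq_mul]

variable {E : Type*} [NormedAddCommGroup E] [NormedSpace ℝ E]

theorem isOpen_family_dom {U : E → Loop n M}
    (hU : ContMDiff 𝓘(ℝ, E × ℝ) (𝓡 n) ∞ (fun q : E × ℝ => U q.1 (q.2 : UnitAddCircle)))
    (e : OpenPartialHomeomorph M (Model n)) : IsOpen {q : E × ℝ | q.2 ∈ (U q.1).dom e} :=
  e.open_source.preimage hU.continuous

theorem contDiffOn_family_rep (he : e ∈ charts n M) {U : E → Loop n M}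
    (hU : ContMDiff 𝓘(ℝ, E × ℝ) (𝓡 n) ∞ (fun q : E × ℝ => U q.1 (q.2 : UnitAddCircle))) :
    ContDiffOn ℝ ∞ (fun q : E × ℝ => (U q.1).rep e q.2) {q | q.2 ∈ (U q.1).dom e} :=
  ((contMDiffOn_of_mem_maximalAtlas he).comp hU.contMDiffOn (fun _ hx => hx)).contDiffOn

theorem CompactDensity.eval_eq_zero (u : Loop n M) {x : ℝ}
    (h : u (x : UnitAddCircle) ∉ e.symm '' f.supp) : f.eval u x = 0 := by
  unfold CompactDensity.eval
  split_ifs with hx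
  · exact f.eq_zero _ (by simpa [jet] using f.rep_notMem_supp hx h)
  · rfl

theorem CompactDensity.contDiff_eval_family (he : e ∈ charts n M) {U : ℝ → Loop n M}
    (hU : ContMDiff 𝓘(ℝ, ℝ × ℝ) (𝓡 n) ∞ (fun q : ℝ × ℝ => U q.1 (q.2 : UnitAddCircle))) :
    ContDiff ℝ ∞ (fun q : ℝ × ℝ => f.eval (U q.1) q.2) := by
  refine contDiff_of_eq_zero (isOpen_family_dom hU e)
    (f.isClosed_image_supp.preimage hU.continuous) (fun q hq => f.image_supp_subset hq) ?_
    fun q hq => f.eval_eq_zero _ hq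
  refine (contDiffOn_density_family (isOpen_family_dom hU e) (contDiffOn_family_rep he hU)
    f.smooth fun q hq => e.map_source hq).congr fun q hq => ?_
  exact if_pos hq

/-- Differentiation under the integral followed by integration by parts. The chart sees only a part
of the loop, so the velocity is first cut off to a periodic function; this changes nothing near the
support of the density. -/
theorem CompactDensity.hasVariationalDerivative (he : e ∈ charts n M) :
    HasVariationalDerivative f.functional (fun u : Loop n M => f.variation he u) := by
  classical
  intro U hU
  have hO := isOpen_family_dom hU e
  have hg := contDiffOn_family_rep he hU
  let v : ℝ → Model n := fun x => dε (fun q : ℝ × ℝ => (U q.1).rep e q.2) (0, x)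
  have hv : ContDiffOn ℝ ∞ v ((U 0).dom e) :=
    (contDiffOn_dε hO hg).comp (contDiff_prodMk_right (0 : ℝ)).contDiffOn
      (fun x hx => hx)
  have hvper : Function.Periodic v 1 := by
    intro x
    have h := fderiv_comp_add_right (𝕜 := ℝ) (f := fun q : ℝ × ℝ => (U q.1).rep e q.2)
      (x := ((0 : ℝ), x)) ((0 : ℝ), (1 : ℝ))
    simp only [Prod.snd_add, Prod.fst_add, add_zero, Loop.rep_add_one, Prod.mk_add_mk] at h
    simp only [v, dε, h]
  have hNo : IsOpen {z : UnitAddCircle | U 0 z ∈ e.source} :=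
    e.open_source.preimage (U 0).continuous
  obtain ⟨χ, S', O, hχ, hS', hS'N, hχ0, hOo, hSO, hχ1⟩ :=
    exists_circle_cutoff (f.isClosed_suppAlong (U 0)) hNo (f.suppAlong_subset (U 0))
  -- The velocity v is meaningful only where the loop lies in the chart. The function V is smooth on
  -- the whole line, and all its derivatives agree with those of v on the support of the density.
  let V : ℝ → Model n := fun x => χ x • v x
  have hV : SmoothPeriodic V := smoothPeriodic_smul hS' (fun z hz => hS'N hz) hχ hχ0 hv hvper
  have key : HasDerivAt (fun ε => f.functional (U ε))
      (∫ x in (0 : ℝ)..1, ∑ k : Fin (m + 1), f.partials (U 0) k x (iteratedDeriv k V x)) 0 := by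
    refine hasDerivAt_integral_of_hasDerivAt (f.contDiff_eval_family he hU) fun x => ?_
    by_cases hxS : (x : UnitAddCircle) ∈ f.suppAlong (U 0)
    · have hxe : x ∈ (U 0).dom e := f.suppAlong_subset _ _ hxS
      have h1 := hasDerivAt_density hO hg e.open_target f.smooth (ε := 0) (x := x) hxe
        fun q hq => e.map_source hq
      have h2 : ∀ k : Fin (m + 1), iteratedDeriv k V x = iteratedDeriv k v x := by
        intro k
        refine Filter.EventuallyEq.iteratedDeriv_eq _ ?_
        filter_upwards [(hOo.preimage continuous_coe_circle).mem_nhds (hSO hxS)] with y hy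
        simp only [V, hχ1 y hy, one_smul]
      refine HasDerivAt.congr_of_eventuallyEq ?_ (?_ : _ =ᶠ[nhds (0 : ℝ)]
        fun s => f.toFun (x, jet m (fun y => (U s).rep e y) x))
      · refine HasDerivAt.congr_deriv h1 (Finset.sum_congr rfl fun k _ => ?_)
        rw [h2, CompactDensity.partials, if_pos hxe]
      · have : {s : ℝ | x ∈ (U s).dom e} ∈ nhds (0 : ℝ) :=
          (hO.preimage (by fun_prop : Continuous fun s : ℝ => (s, x))).mem_nhds hxe
        filter_upwards [this] with s hs
        exact if_pos hs
    · have h1 : ∑ k : Fin (m + 1), f.partials (U 0) k x (iteratedDeriv k V x) = 0 := by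
        refine Finset.sum_eq_zero fun k _ => ?_
        rw [f.partials_eq_zero _ _ hxS]; rfl
      rw [h1]
      refine (hasDerivAt_const (0 : ℝ) (0 : ℝ)).congr_of_eventuallyEq ?_
      have : {s : ℝ | U s (x : UnitAddCircle) ∉ e.symm '' f.supp} ∈ nhds (0 : ℝ) := by
        refine (f.isClosed_image_supp.isOpen_compl.preimage
          (hU.continuous.comp (by fun_prop : Continuous fun s : ℝ => (s, x)))).mem_nhds ?_
        exact hxS
      filter_upwards [this] with s hs using f.eval_eq_zero _ hs
  rw [f.integral_partials he (U 0) hV] at key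
  convert key using 1
  refine intervalIntegral.integral_congr fun x _ => ?_
  beta_reduce
  by_cases hxS : (x : UnitAddCircle) ∈ f.suppAlong (U 0)
  · have hxe : x ∈ (U 0).dom e := f.suppAlong_subset _ _ hxS
    have hc : MDifferentiableAt 𝓘(ℝ, ℝ) (𝓡 n) (fun ε : ℝ => U ε (x : UnitAddCircle)) 0 := by
      have : ContMDiff 𝓘(ℝ, ℝ) (𝓡 n) ∞ (fun ε : ℝ => U ε (x : UnitAddCircle)) :=
        hU.comp (f := fun ε : ℝ => (ε, x)) (by fun_prop : ContDiff ℝ ∞ fun ε : ℝ => (ε, x)).contMDiff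
      exact this.mdifferentiable (by simp) 0
    have h3 : HasDerivAt (fun s => e (U s (x : UnitAddCircle))) (v x) 0 :=
      hasDerivAt_dε hO hg (ε := 0) (x := x) hxe
    have h1 := toModel_velocity he hc hxe h3
    have h2 := (f.variation he (U 0)).rep_comp he hxe
    have h4 : V x = v x := by simp only [V, hχ1 x (hSO hxS), one_smul]
    rw [h4, ← h1, ← f.rep_variation he (U 0) hxe]
    exact congrArg (fun L : Dual n => L (mfderiv 𝓘(ℝ, ℝ) (𝓡 n)
      (fun ε : ℝ => U ε (x : UnitAddCircle)) 0 (1 : ℝ))) h2.symm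
  · rw [f.variation_eq_zero he (U 0) hxS, f.eulerLagrange_eq_zero (U 0) hxS]
    rfl

end

/-! ### Skew-symmetric operators of degree two in a coordinate domain -/

section Scalar

theorem SmoothPeriodic.integral_congr {f g h : ℝ → ℝ} (hf : Continuous f) (hg : Continuous g)
    (hh : SmoothPeriodic h) (hd : ∀ x, HasDerivAt h (f x - g x) x) :
    ∫ x in (0 : ℝ)..1, f x = ∫ x in (0 : ℝ)..1, g x := by
  have := hh.integral_eq_zero hd
  rw [intervalIntegral.integral_sub (hf.intervalIntegrable _ _) (hg.intervalIntegrable _ _)] at this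
  exact sub_eq_zero.1 this

theorem hasDerivAt_cos_mul (k : ℕ) (x : ℝ) :
    HasDerivAt (fun x : ℝ => Real.cos (k * (2 * Real.pi * x)))
      (-(k * (2 * Real.pi)) * Real.sin (k * (2 * Real.pi * x))) x := by
  have h := (((hasDerivAt_id x).const_mul (2 * Real.pi)).const_mul (k : ℝ)).cos
  refine h.congr_deriv ?_
  simp only [id]; ring

theorem hasDerivAt_sin_mul (k : ℕ) (x : ℝ) :
    HasDerivAt (fun x : ℝ => Real.sin (k * (2 * Real.pi * x)))
      (k * (2 * Real.pi) * Real.cos (k * (2 * Real.pi * x))) x := by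
  have h := (((hasDerivAt_id x).const_mul (2 * Real.pi)).const_mul (k : ℝ)).sin
  refine h.congr_deriv ?_
  simp only [id]; ring

theorem deriv_cos_mul (k : ℕ) : deriv (fun x : ℝ => Real.cos (k * (2 * Real.pi * x)))
    = fun x => -(k * (2 * Real.pi)) * Real.sin (k * (2 * Real.pi * x)) :=
  funext fun x => (hasDerivAt_cos_mul k x).deriv

theorem deriv_sin_mul (k : ℕ) : deriv (fun x : ℝ => Real.sin (k * (2 * Real.pi * x)))
    = fun x => k * (2 * Real.pi) * Real.cos (k * (2 * Real.pi * x)) :=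
  funext fun x => (hasDerivAt_sin_mul k x).deriv

theorem SmoothPeriodic.deriv_smul_const {F : Type*} [NormedAddCommGroup F] [NormedSpace ℝ F]
    {f : ℝ → ℝ} (hf : SmoothPeriodic f) (p : F) :
    _root_.deriv (fun x => f x • p) = fun x => _root_.deriv f x • p :=
  funext fun x => ((hf.hasDerivAt x).smul_const p).deriv

theorem SmoothPeriodic.smul_const {F : Type*} [NormedAddCommGroup F] [NormedSpace ℝ F]
    {f : ℝ → ℝ} (hf : SmoothPeriodic f) (p : F) : SmoothPeriodic fun x => f x • p :=
  hf.smul (.const p)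

/-- The pairs `(sin, f cos)` and `(cos, f sin)` are inserted: since `sin' cos - cos' sin` is the
constant `2π`, the difference of the two integrals is `2π ∫ f a`. -/
theorem SmoothPeriodic.eq_zero_of_forall_integral_mul_deriv {a : ℝ → ℝ} (ha : SmoothPeriodic a)
    (h : ∀ f g : ℝ → ℝ, SmoothPeriodic f → SmoothPeriodic g →
      ∫ x in (0 : ℝ)..1, g x * _root_.deriv f x * a x = 0) (x : ℝ) : a x = 0 := by
  have hs := SmoothPeriodic.sin 1
  have hc := SmoothPeriodic.cos 1
  refine ha.eq_zero_of_forall_integral (fun f hf => ?_) x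
  have h1 := h _ _ hs (hf.mul hc)
  have h2 := h _ _ hc (hf.mul hs)
  have h3 := congrArg₂ (· - ·) h1 h2
  rw [sub_zero, ← intervalIntegral.integral_sub
    ((((hf.mul hc).mul hs.deriv).mul ha).continuous.intervalIntegrable _ _)
    ((((hf.mul hs).mul hc.deriv).mul ha).continuous.intervalIntegrable _ _),
    deriv_sin_mul, deriv_cos_mul] at h3
  have h4 : ∫ x in (0 : ℝ)..1, (2 * Real.pi) * (f x * a x) = 0 := by
    refine Eq.trans ?_ h3
    refine intervalIntegral.integral_congr fun x _ => ?_
    have := Real.sin_sq_add_cos_sq (1 * (2 * Real.pi * x))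
    simp only [Nat.cast_one]
    linear_combination (-2 * Real.pi * f x * a x) * this
  rw [intervalIntegral.integral_const_mul] at h4
  exact (mul_eq_zero.1 h4).resolve_left (by positivity)

/-- The relations between the coefficients of a skew-adjoint scalar operator. -/
theorem eq_of_skewAdjoint {a b c b' c' : ℝ → ℝ} (ha : SmoothPeriodic a) (hb : SmoothPeriodic b)
    (hc : SmoothPeriodic c) (hb' : SmoothPeriodic b') (hc' : SmoothPeriodic c')
    (h : ∀ f g : ℝ → ℝ, SmoothPeriodic f → SmoothPeriodic g →
      ∫ x in (0 : ℝ)..1, f x * (deriv (deriv g) x * a x + deriv g x * b x + g x * c x)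
        = - ∫ x in (0 : ℝ)..1, g x * (-(deriv (deriv f) x * a x) + deriv f x * b' x + f x * c' x)) :
    (∀ x, b' x = b x - 2 * deriv a x) ∧
      ∀ x, c x + c' x = deriv b x - deriv (deriv a) x := by
  -- Subtracting the total derivative of `(g f' - f g') a` removes the second derivatives of f and
  -- g.
  have key : ∀ f g : ℝ → ℝ, SmoothPeriodic f → SmoothPeriodic g →
      ∫ x in (0 : ℝ)..1, (f x * deriv g x * (b x - deriv a x) + g x * deriv f x * (b' x + deriv a x)
        + f x * g x * (c x + c' x)) = 0 := by
    intro f g hf hg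
    have h1 := h f g hf hg
    rw [← intervalIntegral.integral_neg] at h1
    have h2 := sub_eq_zero.2 h1
    rw [← intervalIntegral.integral_sub
      ((hf.mul (((hg.deriv.deriv.mul ha).add (hg.deriv.mul hb)).add
        (hg.mul hc))).continuous.intervalIntegrable _ _)
      ((hg.mul (((hf.deriv.deriv.mul ha).neg.add (hf.deriv.mul hb')).add
        (hf.mul hc'))).neg.continuous.intervalIntegrable _ _)] at h2
    refine Eq.trans ?_ h2
    refine SmoothPeriodic.integral_congr
      ((((hf.mul hg.deriv).mul (hb.sub ha.deriv)).add ((hg.mul hf.deriv).mul (hb'.add ha.deriv))).add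
        ((hf.mul hg).mul (hc.add hc'))).continuous
      ((hf.mul (((hg.deriv.deriv.mul ha).add (hg.deriv.mul hb)).add (hg.mul hc))).sub
        (hg.mul (((hf.deriv.deriv.mul ha).neg.add (hf.deriv.mul hb')).add
        (hf.mul hc'))).neg).continuous
      (h := fun x => (g x * deriv f x - f x * deriv g x) * a x)
      (((hg.mul hf.deriv).sub (hf.mul hg.deriv)).mul ha) fun x => ?_
    refine ((((hg.hasDerivAt x).mul (hf.deriv.hasDerivAt x)).sub
      ((hf.hasDerivAt x).mul (hg.deriv.hasDerivAt x))).mul (ha.hasDerivAt x)).congr_deriv ?_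
    simp only [Pi.mul_apply, Pi.sub_apply]
    ring
  -- Comparing the pair `(f, g)` with `(1, f g)` eliminates `c + c'` and leaves `∫ g f' (b' - b +
  -- 2a')`.
  have hb1 : ∀ x, b' x = b x - 2 * deriv a x := by
    have : SmoothPeriodic fun x => b' x - b x + 2 * deriv a x :=
      (hb'.sub hb).add ((SmoothPeriodic.const 2).mul ha.deriv)
    have h3 := this.eq_zero_of_forall_integral_mul_deriv fun f g hf hg => by
      have h1 := key f g hf hg
      have h2 := key (fun _ => 1) (fun x => f x * g x) (.const 1) (hf.mul hg)
      have h4 := congrArg₂ (· - ·) h1 h2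
      rw [sub_zero, ← intervalIntegral.integral_sub] at h4
      · refine Eq.trans ?_ h4
        refine intervalIntegral.integral_congr fun x _ => ?_
        simp only [deriv_const', ((hf.hasDerivAt x).fun_mul (hg.hasDerivAt x)).deriv]
        ring
      · exact ((((hf.mul hg.deriv).mul (hb.sub ha.deriv)).add
          ((hg.mul hf.deriv).mul (hb'.add ha.deriv))).add
          ((hf.mul hg).mul (hc.add hc'))).continuous.intervalIntegrable _ _
      · have h1 := SmoothPeriodic.const (1 : ℝ)
        exact ((((h1.mul (hf.mul hg).deriv).mul (hb.sub ha.deriv)).add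
          (((hf.mul hg).mul h1.deriv).mul (hb'.add ha.deriv))).add
          ((h1.mul (hf.mul hg)).mul (hc.add hc'))).continuous.intervalIntegrable _ _
    intro x
    linarith [h3 x]
  refine ⟨hb1, fun x => ?_⟩
  have hd : SmoothPeriodic fun x => c x + c' x - (deriv b x - deriv (deriv a) x) :=
    (hc.add hc').sub (hb.deriv.sub ha.deriv.deriv)
  -- With `f = 1` only `∫ (g' (b - a') + g (c + c'))` is left, and g' is integrated by parts.
  have h3 := hd.eq_zero_of_forall_integral fun g hg => by
    have h1 := key (fun _ => 1) g (.const 1) hg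
    refine Eq.trans ?_ h1
    have hone := SmoothPeriodic.const (1 : ℝ)
    refine SmoothPeriodic.integral_congr (hg.mul hd).continuous
      ((((hone.mul hg.deriv).mul (hb.sub ha.deriv)).add
          ((hg.mul hone.deriv).mul (hb'.add ha.deriv))).add
          ((hone.mul hg).mul (hc.add hc'))).continuous
      (hg.mul (hb.sub ha.deriv)).neg fun x => ?_
    refine ((hg.hasDerivAt x).fun_mul
      ((hb.hasDerivAt x).fun_sub (ha.deriv.hasDerivAt x))).fun_neg.congr_deriv ?_
    simp only [deriv_const']
    ring
  linarith [h3 x]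

theorem SmoothPeriodic.exists_damp_mem {n : ℕ} {γ V : ℝ → Model n} (hγ : SmoothPeriodic γ)
    (hV : SmoothPeriodic V) {W : Set (Model n)} (hW : IsOpen W) (hγW : ∀ x, γ x ∈ W) :
    ∃ δ > 0, ∀ ε x, γ x + damp δ ε • V x ∈ W := by
  obtain ⟨δ, hδ, h⟩ := DegTwo.exists_damp_mem (isCompact_Icc (a := (0 : ℝ)) (b := 1))
    hγ.continuous.continuousOn hV.continuous.continuousOn hW fun x _ => hγW x
  refine ⟨δ, hδ, fun ε x => ?_⟩
  have h1 : γ (Int.fract x) = γ x := by simpa using hγ.periodic.sub_zsmul_eq (x := x) ⌊x⌋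
  have h2 : V (Int.fract x) = V x := by simpa using hV.periodic.sub_zsmul_eq (x := x) ⌊x⌋
  rw [← h1, ← h2]
  exact h ε _ ⟨Int.fract_nonneg x, (Int.fract_lt_one x).le⟩

theorem SmoothPeriodic.exists_smul_mem {n : ℕ} {y : Model n} {V : ℝ → Model n}
    (hV : SmoothPeriodic V) {W : Set (Model n)} (hW : IsOpen W) (hy : y ∈ W) :
    ∃ s > (0 : ℝ), ∀ x, y + s • V x ∈ W := by
  obtain ⟨δ, hδ, h⟩ := (SmoothPeriodic.const y).exists_damp_mem hV hW fun _ => hy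
  refine ⟨δ, hδ, fun x => ?_⟩
  -- At this parameter the sine in `damp` is 1, so the damped parameter attains its maximum δ.
  have := h (δ * (Real.pi / 2)) x
  rwa [damp, mul_div_cancel_left₀ _ hδ.ne', Real.sin_pi_div_two, mul_one] at this

end Scalar

/-- Bilinear forms on covectors. -/
abbrev Bil (n : ℕ) : Type := Dual n →L[ℝ] Dual n →L[ℝ] ℝ

section

variable (n : ℕ)

instance : NormedAddCommGroup (Bil n) := ContinuousLinearMap.toNormedAddCommGroup
instance : NormedSpace ℝ (Bil n) := ContinuousLinearMap.toNormedSpace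
instance : NormedAddCommGroup (Model n →L[ℝ] Bil n) := ContinuousLinearMap.toNormedAddCommGroup
instance : NormedSpace ℝ (Model n →L[ℝ] Bil n) := ContinuousLinearMap.toNormedSpace
instance : NormedAddCommGroup (Model n →L[ℝ] Model n →L[ℝ] Bil n) :=
  ContinuousLinearMap.toNormedAddCommGroup
instance : NormedSpace ℝ (Model n →L[ℝ] Model n →L[ℝ] Bil n) := ContinuousLinearMap.toNormedSpace

end

/-- The vector which represents a linear form on covectors. -/
def vecOf {n : ℕ} : (Dual n →L[ℝ] ℝ) →L[ℝ] Model n :=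
  ∑ i, (ContinuousLinearMap.apply ℝ ℝ (proj i : Dual n)).smulRight
    (single i (1 : ℝ))

theorem apply_vecOf {n : ℕ} (p : Dual n) (L : Dual n →L[ℝ] ℝ) : p (vecOf L) = L p := by
  have h : p = ∑ i, p (single i (1 : ℝ)) • (proj i : Dual n) := by
    ext y
    rw [clm_eq_sum_single p y]
    simp [sum_apply, mul_comm]
  conv_rhs => rw [h]
  simp [vecOf, sum_apply, mul_comm]

/-- The coefficients of an operator of degree two in a coordinate domain. -/
structure OpCoeff (n : ℕ) where
  /-- the leading coefficient -/
  A : Model n → Bil n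
  /-- the coefficient of `uₓ d/dx` -/
  B : Model n → Model n →L[ℝ] Bil n
  /-- the coefficient of `uₓ uₓ` -/
  C₂ : Model n → Model n →L[ℝ] Model n →L[ℝ] Bil n
  /-- the coefficient of `uₓₓ` -/
  C₁ : Model n → Model n →L[ℝ] Bil n

namespace OpCoeff

variable {n : ℕ}

/-- The coefficients are smooth, and `C₂` is symmetric. -/
structure IsSmooth (c : OpCoeff n) : Prop where
  A : ContDiff ℝ ∞ c.A
  B : ContDiff ℝ ∞ c.B
  C₂ : ContDiff ℝ ∞ c.C₂
  C₁ : ContDiff ℝ ∞ c.C₁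
  symm : ∀ y v w, c.C₂ y v w = c.C₂ y w v

/-- The operator on the jets of a curve and of a covector field along it. -/
def op (c : OpCoeff n) (y v w : Model n) (α α₁ α₂ : Dual n) : Model n :=
  vecOf ((c.A y).flip α₂ + (c.B y v).flip α₁ + (c.C₂ y v v).flip α + (c.C₁ y w).flip α)

theorem apply_op (c : OpCoeff n) (y v w : Model n) (α α₁ α₂ ξ : Dual n) :
    ξ (c.op y v w α α₁ α₂)
      = c.A y ξ α₂ + c.B y v ξ α₁ + c.C₂ y v v ξ α + c.C₁ y w ξ α := by
  simp [op, apply_vecOf]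

/-- The operator along a curve. -/
def along (c : OpCoeff n) (γ : ℝ → Model n) (α : ℝ → Dual n) (x : ℝ) : Model n :=
  c.op (γ x) (deriv γ x) (deriv (deriv γ) x) (α x) (deriv α x) (deriv (deriv α) x)

variable {c : OpCoeff n}

theorem _root_.DegTwo.SmoothPeriodic.flip {F G H : Type*} [NormedAddCommGroup F] [NormedSpace ℝ F]
    [NormedAddCommGroup G] [NormedSpace ℝ G] [NormedAddCommGroup H] [NormedSpace ℝ H]
    {L : ℝ → F →L[ℝ] G →L[ℝ] H} (hL : SmoothPeriodic L) : SmoothPeriodic fun x => (L x).flip :=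
  ⟨(ContinuousLinearMap.flipₗᵢ ℝ F G H).contDiff.comp hL.smooth,
    fun x => by simp only [hL.periodic x]⟩

theorem _root_.DegTwo.SmoothPeriodic.comp_of {F G : Type*} [NormedAddCommGroup F] [NormedSpace ℝ F]
    [NormedAddCommGroup G] [NormedSpace ℝ G] {φ : F → G} (hφ : ContDiff ℝ ∞ φ) {f : ℝ → F}
    (hf : SmoothPeriodic f) : SmoothPeriodic fun x => φ (f x) :=
  ⟨hφ.comp hf.smooth, fun x => by simp only [hf.periodic x]⟩

theorem IsSmooth.along (hc : c.IsSmooth) {γ : ℝ → Model n} {α : ℝ → Dual n}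
    (hγ : SmoothPeriodic γ) (hα : SmoothPeriodic α) : SmoothPeriodic (c.along γ α) := by
  have h1 : SmoothPeriodic fun x => (c.A (γ x)).flip (deriv (deriv α) x) :=
    (SmoothPeriodic.comp_of hc.A hγ).flip.clm_apply hα.deriv.deriv
  have h2 : SmoothPeriodic fun x => (c.B (γ x) (deriv γ x)).flip (deriv α x) :=
    ((SmoothPeriodic.comp_of hc.B hγ).clm_apply hγ.deriv).flip.clm_apply hα.deriv
  have h3 : SmoothPeriodic fun x => (c.C₂ (γ x) (deriv γ x) (deriv γ x)).flip (α x) :=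
    (((SmoothPeriodic.comp_of hc.C₂ hγ).clm_apply hγ.deriv).clm_apply
      hγ.deriv).flip.clm_apply hα
  have h4 : SmoothPeriodic fun x => (c.C₁ (γ x) (deriv (deriv γ) x)).flip (α x) :=
    ((SmoothPeriodic.comp_of hc.C₁ hγ).clm_apply hγ.deriv.deriv).flip.clm_apply hα
  exact (SmoothPeriodic.const (vecOf (n := n))).clm_apply (((h1.add h2).add h3).add h4)

/-- The operator is skew-adjoint along the loops in `W`. -/
def IsSkewOn (c : OpCoeff n) (W : Set (Model n)) : Prop :=
  ∀ γ : ℝ → Model n, SmoothPeriodic γ → (∀ x, γ x ∈ W) →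
    ∀ ξ η : ℝ → Dual n, SmoothPeriodic ξ → SmoothPeriodic η →
      ∫ x in (0 : ℝ)..1, ξ x (c.along γ η x) = - ∫ x in (0 : ℝ)..1, η x (c.along γ ξ x)

variable {W : Set (Model n)}

/-- Along a constant loop only the leading term acts. With `cos · p` and `cos · q` as test covectors
both sides are nonzero multiples of `∫ cos²`, which is positive. -/
theorem IsSkewOn.skew_A (h : c.IsSkewOn W) {y : Model n} (hy : y ∈ W) (p q : Dual n) :
    c.A y p q = - c.A y q p := by
  have hf := SmoothPeriodic.cos 1
  have hd : ∀ p : Dual n, deriv (fun x : ℝ => Real.cos ((1 : ℕ) * (2 * Real.pi * x)) • p)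
      = fun x => (-(2 * Real.pi) * Real.sin ((1 : ℕ) * (2 * Real.pi * x))) • p := by
    intro p
    refine (hf.deriv_smul_const p).trans ?_
    rw [deriv_cos_mul]; simp
  have hd2 : ∀ p : Dual n,
      deriv (fun x : ℝ => (-(2 * Real.pi) * Real.sin ((1 : ℕ) * (2 * Real.pi * x))) • p)
      = fun x => (-(2 * Real.pi) ^ 2 * Real.cos ((1 : ℕ) * (2 * Real.pi * x))) • p := by
    intro p
    funext x
    refine (((hasDerivAt_sin_mul 1 x).const_mul _).smul_const p).deriv.trans ?_
    congr 1
    simp; ring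
  have h1 := h (fun _ => y) (.const y) (fun _ => hy) _ _ (hf.smul_const p) (hf.smul_const q)
  simp only [OpCoeff.along, apply_op, hd, hd2, deriv_const', map_zero, map_smul,
    zero_apply, smul_apply, add_zero, smul_eq_mul, mul_zero] at h1
  have h2 : ∀ p q : Dual n, ∫ x in (0 : ℝ)..1, Real.cos ((1 : ℕ) * (2 * Real.pi * x)) *
      (-(2 * Real.pi) ^ 2 * Real.cos ((1 : ℕ) * (2 * Real.pi * x)) * c.A y p q)
      = (∫ x in (0 : ℝ)..1, Real.cos ((1 : ℕ) * (2 * Real.pi * x)) *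
        Real.cos ((1 : ℕ) * (2 * Real.pi * x))) * (-(2 * Real.pi) ^ 2 * c.A y p q) := by
    intro p q
    rw [← intervalIntegral.integral_mul_const]
    exact intervalIntegral.integral_congr fun x _ => by ring
  rw [h2, h2] at h1
  have h3 : (∫ x in (0 : ℝ)..1, Real.cos ((1 : ℕ) * (2 * Real.pi * x)) *
      Real.cos ((1 : ℕ) * (2 * Real.pi * x))) ≠ 0 := fun h0 => by
    simpa using hf.eq_zero_of_integral_sq h0 0
  have h4 : (2 * Real.pi) ^ 2 ≠ 0 := by positivity
  have h5 : (∫ x in (0 : ℝ)..1, Real.cos ((1 : ℕ) * (2 * Real.pi * x)) *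
      Real.cos ((1 : ℕ) * (2 * Real.pi * x))) * (2 * Real.pi) ^ 2 * (c.A y p q + c.A y q p) = 0 := by
    linear_combination -h1
  rcases mul_eq_zero.1 h5 with h6 | h6
  · exact absurd h6 (mul_ne_zero h3 h4)
  · linarith

/-- For covectors `f p` and `g q` with p, q fixed, skew-adjointness is a statement about scalar
operators with coefficients depending on x, and `eq_of_skewAdjoint` applies. This is its relation of
order zero. -/
theorem IsSkewOn.relation (h : c.IsSkewOn W) (hc : c.IsSmooth) {γ : ℝ → Model n}
    (hγ : SmoothPeriodic γ) (hγW : ∀ x, γ x ∈ W) (p q : Dual n) (x : ℝ) :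
    c.C₂ (γ x) (deriv γ x) (deriv γ x) p q + c.C₁ (γ x) (deriv (deriv γ) x) p q
      + (c.C₂ (γ x) (deriv γ x) (deriv γ x) q p + c.C₁ (γ x) (deriv (deriv γ) x) q p)
      = deriv (fun x => c.B (γ x) (deriv γ x) p q - fderiv ℝ c.A (γ x) (deriv γ x) p q) x := by
  have hA : ∀ p q, SmoothPeriodic fun x => c.A (γ x) p q := fun p q =>
    ((SmoothPeriodic.comp_of hc.A hγ).clm_apply (.const p)).clm_apply (.const q)
  have hB : ∀ p q, SmoothPeriodic fun x => c.B (γ x) (deriv γ x) p q := fun p q =>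
    (((SmoothPeriodic.comp_of hc.B hγ).clm_apply hγ.deriv).clm_apply (.const p)).clm_apply (.const q)
  have hC : ∀ p q, SmoothPeriodic fun x => c.C₂ (γ x) (deriv γ x) (deriv γ x) p q
      + c.C₁ (γ x) (deriv (deriv γ) x) p q := fun p q =>
    (((((SmoothPeriodic.comp_of hc.C₂ hγ).clm_apply hγ.deriv).clm_apply hγ.deriv).clm_apply
      (.const p)).clm_apply (.const q)).add
    ((((SmoothPeriodic.comp_of hc.C₁ hγ).clm_apply hγ.deriv.deriv).clm_apply
      (.const p)).clm_apply (.const q))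
  have h1 := eq_of_skewAdjoint (hA p q) (hB p q) (hC p q) (hB q p) (hC q p) fun f g hf hg => by
    have h2 := h γ hγ hγW _ _ (hf.smul_const p) (hg.smul_const q)
    simp only [OpCoeff.along, apply_op, hf.deriv_smul_const, hg.deriv_smul_const,
      hf.deriv.deriv_smul_const, hg.deriv.deriv_smul_const, map_smul, smul_apply,
      smul_eq_mul] at h2
    have h3 : ∀ (f g : ℝ → ℝ) (p q : Dual n) (x : ℝ), f x * (deriv (deriv g) x * c.A (γ x) p q
        + deriv g x * c.B (γ x) (deriv γ x) p q
        + g x * (c.C₂ (γ x) (deriv γ x) (deriv γ x) p q + c.C₁ (γ x) (deriv (deriv γ) x) p q)) =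
        f x * (deriv (deriv g) x * c.A (γ x) p q + deriv g x * c.B (γ x) (deriv γ x) p q
        + g x * c.C₂ (γ x) (deriv γ x) (deriv γ x) p q
        + g x * c.C₁ (γ x) (deriv (deriv γ) x) p q) := fun f g p q x => by ring
    have h4 : ∀ x, -(deriv (deriv f) x * c.A (γ x) p q) = deriv (deriv f) x * c.A (γ x) q p :=
      fun x => by rw [h.skew_A (hγW x) p q]; ring
    simp only [h4, h3]
    exact h2
  rw [h1.2 x]
  have h5 : (fun x => fderiv ℝ c.A (γ x) (deriv γ x) p q) = deriv fun x => c.A (γ x) p q := by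
    funext x
    have := ((hc.A.differentiable (by simp) (γ x)).hasFDerivAt.comp_hasDerivAt x
      (hγ.hasDerivAt x)).clm_apply (hasDerivAt_const x p) |>.clm_apply (hasDerivAt_const x q)
    simpa using this.deriv.symm
  have h6 := ((hB p q).hasDerivAt x).fun_sub ((hA p q).deriv.hasDerivAt x)
  rw [← h6.deriv, ← h5]

/-- The relation is evaluated at a stationary point of the loop `y + s (cos - 1) v`: there the terms
quadratic in the velocity drop out and the acceleration is a nonzero multiple of v, so that only the
coefficients linear in `uₓₓ` or `uₓ` remain. -/
theorem IsSkewOn.B_eq (h : c.IsSkewOn W) (hc : c.IsSmooth) (hW : IsOpen W) {y : Model n}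
    (hy : y ∈ W) (v : Model n) (p q : Dual n) :
    c.B y v p q = fderiv ℝ c.A y v p q + c.C₁ y v p q + c.C₁ y v q p := by
  have hV : SmoothPeriodic fun x : ℝ => (Real.cos ((1 : ℕ) * (2 * Real.pi * x)) - 1) • v :=
    ((SmoothPeriodic.cos 1).sub (.const 1)).smul (.const v)
  obtain ⟨s, hs, hmem⟩ := hV.exists_smul_mem hW hy
  set γ : ℝ → Model n := fun x => y + s • (Real.cos ((1 : ℕ) * (2 * Real.pi * x)) - 1) • v with hγd
  have hγ : SmoothPeriodic γ := (SmoothPeriodic.const y).add (hV.const_smul s)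
  have hd : deriv γ = fun x =>
      (s * (-(2 * Real.pi) * Real.sin ((1 : ℕ) * (2 * Real.pi * x)))) • v := by
    funext x
    refine (((((hasDerivAt_cos_mul 1 x).sub_const 1).smul_const v).const_smul s).const_add y).deriv
      |>.trans ?_
    simp [smul_smul]
  have hd2 : deriv (deriv γ) 0 = (-(s * (2 * Real.pi) ^ 2)) • v := by
    rw [hd]
    refine ((((hasDerivAt_sin_mul 1 0).const_mul _).const_mul s).smul_const v).deriv.trans ?_
    simp only [Nat.cast_one, mul_zero, Real.cos_zero]
    congr 1
    ring
  have hγ0 : γ 0 = y := by simp [hγd]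
  have hd0 : deriv γ 0 = 0 := by simp [hd]
  have hrel := h.relation hc hγ hmem p q 0
  have hM : ContDiff ℝ ∞ fun y => c.B y - fderiv ℝ c.A y :=
    hc.B.sub (hc.A.fderiv_right (by simp))
  have h1 := ((((hM.differentiable (by simp) (γ 0)).hasFDerivAt.comp_hasDerivAt 0
    (hγ.hasDerivAt 0)).clm_apply (hγ.deriv.hasDerivAt 0)).clm_apply
    (hasDerivAt_const (0 : ℝ) p)).clm_apply (hasDerivAt_const (0 : ℝ) q)
  have h2 := h1.deriv
  simp only [Function.comp_apply, sub_apply, hd0, hγ0, hd2, map_zero,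
    zero_apply, map_smul, smul_apply, zero_add, add_zero, smul_eq_mul] at h2 hrel
  have h3 : s * (2 * Real.pi) ^ 2 ≠ 0 := by positivity
  refine mul_left_cancel₀ h3 ?_
  rw [h2] at hrel
  linear_combination hrel

/-- The coefficient of `uₓ uₓ` in the first order form of the operator. -/
def S (c : OpCoeff n) (y : Model n) : Model n →L[ℝ] Model n →L[ℝ] Bil n :=
  c.C₂ y - (1 / 2 : ℝ) • (fderiv ℝ c.C₁ y + (fderiv ℝ c.C₁ y).flip)

theorem S_apply (y v w : Model n) : c.S y v w
    = c.C₂ y v w - (1 / 2 : ℝ) • (fderiv ℝ c.C₁ y v w + fderiv ℝ c.C₁ y w v) := rfl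

theorem IsSmooth.contDiff_S (hc : c.IsSmooth) : ContDiff ℝ ∞ c.S := by
  have h1 : ContDiff ℝ ∞ (fderiv ℝ c.C₁) := hc.C₁.fderiv_right (by simp)
  have h2 : ContDiff ℝ ∞ fun y => (fderiv ℝ c.C₁ y).flip :=
    (ContinuousLinearMap.flipₗᵢ ℝ (Model n) (Model n) (Bil n)).contDiff.comp h1
  exact hc.C₂.sub ((h1.add h2).const_smul (1 / 2 : ℝ))

theorem IsSmooth.symm_S (hc : c.IsSmooth) (y v w : Model n) : c.S y v w = c.S y w v := by
  rw [S_apply, S_apply, hc.symm, add_comm (fderiv ℝ c.C₁ y v w)]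

end OpCoeff

namespace OpCoeff

variable {n : ℕ} {c : OpCoeff n} {W : Set (Model n)}

/-! ### The first order form of the bracket and its variation -/

/-- The density of `∫ ⟨ξ, P η⟩` after integration by parts. -/
def weak (c : OpCoeff n) (y v : Model n) (ξ ξ₁ η η₁ : Dual n) : ℝ :=
  - c.A y ξ₁ η₁ + c.C₁ y v η₁ ξ - c.C₁ y v ξ₁ η + c.S y v v ξ η

/-- The derivative of `weak` along a vector field `V` with derivative `V₁`. -/
def weakVar (c : OpCoeff n) (y v V V₁ : Model n) (ξ ξ₁ η η₁ : Dual n) : ℝ :=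
  - fderiv ℝ c.A y V ξ₁ η₁ + (fderiv ℝ c.C₁ y V v + c.C₁ y V₁) η₁ ξ
    - (fderiv ℝ c.C₁ y V v + c.C₁ y V₁) ξ₁ η
    + (fderiv ℝ c.S y V v v + (2 : ℝ) • c.S y V₁ v) ξ η

theorem hasDerivAt_bil {Φ : ℝ → Bil n} {ξ η : ℝ → Dual n} {Φ' : Bil n} {ξ' η' : Dual n} {x : ℝ}
    (hΦ : HasDerivAt Φ Φ' x) (hξ : HasDerivAt ξ ξ' x) (hη : HasDerivAt η η' x) :
    HasDerivAt (fun x => Φ x (ξ x) (η x)) (Φ' (ξ x) (η x) + Φ x ξ' (η x) + Φ x (ξ x) η') x :=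
  ((hΦ.clm_apply hξ).clm_apply hη).congr_deriv (by simp)

theorem hasDerivAt_comp {F : Type*} [NormedAddCommGroup F] [NormedSpace ℝ F] {f : Model n → F}
    (hf : ContDiff ℝ ∞ f) {γ : ℝ → Model n} {v : Model n} {x : ℝ} (hγ : HasDerivAt γ v x) :
    HasDerivAt (fun x => f (γ x)) (fderiv ℝ f (γ x) v) x :=
  (hf.differentiable (by simp) (γ x)).hasFDerivAt.comp_hasDerivAt x hγ

theorem _root_.DegTwo.SmoothPeriodic.bil {Φ : ℝ → Bil n} {ξ η : ℝ → Dual n}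
    (hΦ : SmoothPeriodic Φ) (hξ : SmoothPeriodic ξ) (hη : SmoothPeriodic η) :
    SmoothPeriodic fun x => Φ x (ξ x) (η x) := (hΦ.clm_apply hξ).clm_apply hη

theorem IsSmooth.smoothPeriodic_weak (hc : c.IsSmooth) {γ : ℝ → Model n} (hγ : SmoothPeriodic γ)
    {ξ η : ℝ → Dual n} (hξ : SmoothPeriodic ξ) (hη : SmoothPeriodic η) :
    SmoothPeriodic fun x => c.weak (γ x) (deriv γ x) (ξ x) (deriv ξ x) (η x) (deriv η x) := by
  have hC := (SmoothPeriodic.comp_of hc.C₁ hγ).clm_apply hγ.deriv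
  have hS := ((SmoothPeriodic.comp_of hc.contDiff_S hγ).clm_apply hγ.deriv).clm_apply hγ.deriv
  exact ((((SmoothPeriodic.comp_of hc.A hγ).bil hξ.deriv hη.deriv).neg.add
    (hC.bil hη.deriv hξ)).sub (hC.bil hξ.deriv hη)).add (hS.bil hξ hη)

/-- The two integrands differ by the derivative of `A(ξ, η') + C₁(γ')(ξ, η)`; the formula for B
turns the remaining coefficient of `ξ η'` into `C₁` with exchanged arguments. The gain is an
integrand containing first derivatives only. -/
theorem IsSkewOn.integral_along (h : c.IsSkewOn W) (hc : c.IsSmooth) (hW : IsOpen W)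
    {γ : ℝ → Model n} (hγ : SmoothPeriodic γ) (hγW : ∀ x, γ x ∈ W) {ξ η : ℝ → Dual n}
    (hξ : SmoothPeriodic ξ) (hη : SmoothPeriodic η) :
    ∫ x in (0 : ℝ)..1, ξ x (c.along γ η x)
      = ∫ x in (0 : ℝ)..1, c.weak (γ x) (deriv γ x) (ξ x) (deriv ξ x) (η x) (deriv η x) := by
  have hA := SmoothPeriodic.comp_of hc.A hγ
  have hC := (SmoothPeriodic.comp_of hc.C₁ hγ).clm_apply hγ.deriv
  refine SmoothPeriodic.integral_congr (hξ.clm_apply (hc.along hγ hη)).continuous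
    (hc.smoothPeriodic_weak hγ hξ hη).continuous
    (h := fun x => c.A (γ x) (ξ x) (deriv η x) + c.C₁ (γ x) (deriv γ x) (ξ x) (η x))
    ((hA.bil hξ hη.deriv).add (hC.bil hξ hη)) fun x => ?_
  have h1 := hasDerivAt_bil (hasDerivAt_comp hc.A (hγ.hasDerivAt x)) (hξ.hasDerivAt x)
    (hη.deriv.hasDerivAt x)
  have h2 := hasDerivAt_bil ((hasDerivAt_comp hc.C₁ (hγ.hasDerivAt x)).clm_apply
    (hγ.deriv.hasDerivAt x)) (hξ.hasDerivAt x) (hη.hasDerivAt x)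
  refine (h1.fun_add h2).congr_deriv ?_
  simp only [OpCoeff.along, apply_op, weak, S_apply, h.B_eq hc hW (hγW x), add_apply, sub_apply,
    smul_apply, smul_eq_mul]
  ring

theorem IsSmooth.hasDerivAt_weak (hc : c.IsSmooth) {u v : ℝ → Model n} {V V₁ : Model n} {s : ℝ}
    (hu : HasDerivAt u V s) (hv : HasDerivAt v V₁ s) (ξ ξ₁ η η₁ : Dual n) :
    HasDerivAt (fun s => c.weak (u s) (v s) ξ ξ₁ η η₁)
      (c.weakVar (u s) (v s) V V₁ ξ ξ₁ η η₁) s := by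
  have hconst : ∀ p : Dual n, HasDerivAt (fun _ : ℝ => p) 0 s := fun p => hasDerivAt_const s p
  have hC := (hasDerivAt_comp hc.C₁ hu).clm_apply hv
  have hS := ((hasDerivAt_comp hc.contDiff_S hu).clm_apply hv).clm_apply hv
  refine ((((hasDerivAt_bil (hasDerivAt_comp hc.A hu) (hconst ξ₁) (hconst η₁)).fun_neg.fun_add
    (hasDerivAt_bil hC (hconst η₁) (hconst ξ))).fun_sub
    (hasDerivAt_bil hC (hconst ξ₁) (hconst η))).fun_add
    (hasDerivAt_bil hS (hconst ξ) (hconst η))).congr_deriv ?_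
  simp only [weakVar, map_zero, zero_apply, add_zero, add_apply, smul_apply, smul_eq_mul,
    hc.symm_S (u s) (v s) V₁]
  ring

/-- The derivative of the bracket of two linear functionals along a vector field. -/
def bracketVar (c : OpCoeff n) (γ V : ℝ → Model n) (ξ η : ℝ → Dual n) : ℝ :=
  ∫ x in (0 : ℝ)..1, c.weakVar (γ x) (deriv γ x) (V x) (deriv V x) (ξ x) (deriv ξ x) (η x)
    (deriv η x)

theorem IsSkewOn.hasDerivAt_bracket (h : c.IsSkewOn W) (hc : c.IsSmooth) (hW : IsOpen W)
    {γ V : ℝ → Model n} (hγ : SmoothPeriodic γ) (hV : SmoothPeriodic V) {ξ η : ℝ → Dual n}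
    (hξ : SmoothPeriodic ξ) (hη : SmoothPeriodic η) {δ : ℝ} (hδ : 0 < δ)
    (hmem : ∀ ε x, γ x + damp δ ε • V x ∈ W) :
    HasDerivAt (fun ε => ∫ x in (0 : ℝ)..1, ξ x (c.along (fun x => γ x + damp δ ε • V x) η x))
      (c.bracketVar γ V ξ η) 0 := by
  have hfam : ∀ ε, SmoothPeriodic fun x => γ x + damp δ ε • V x := fun ε =>
    hγ.add (hV.const_smul _)
  have hd : ∀ ε, deriv (fun x => γ x + damp δ ε • V x) = fun x => deriv γ x + damp δ ε • deriv V x :=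
    fun ε => funext fun x => ((hγ.hasDerivAt x).fun_add ((hV.hasDerivAt x).fun_const_smul _)).deriv
  simp only [fun ε => h.integral_along hc hW (hfam ε) (hmem ε) hξ hη, hd]
  have hG : ContDiff ℝ ∞ fun q : ℝ × ℝ => c.weak (γ q.2 + damp δ q.1 • V q.2)
      (deriv γ q.2 + damp δ q.1 • deriv V q.2) (ξ q.2) (deriv ξ q.2) (η q.2) (deriv η q.2) := by
    have h0 : ContDiff ℝ ∞ fun q : ℝ × ℝ => damp δ q.1 := (contDiff_damp δ).comp contDiff_fst
    -- Smoothness of the integrand in both variables is assembled from functions of x alone and from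
    -- the damped parameter.
    have h1 : ∀ {F : Type} [NormedAddCommGroup F] [NormedSpace ℝ F] {f : ℝ → F},
        SmoothPeriodic f → ContDiff ℝ ∞ fun q : ℝ × ℝ => f q.2 := fun hf =>
      hf.smooth.comp contDiff_snd
    have hu := (h1 hγ).add (h0.smul (h1 hV))
    have hv := (h1 hγ.deriv).add (h0.smul (h1 hV.deriv))
    have hC := (hc.C₁.comp hu).clm_apply hv
    have hS := ((hc.contDiff_S.comp hu).clm_apply hv).clm_apply hv
    exact (((((hc.A.comp hu).clm_apply (h1 hξ.deriv)).clm_apply (h1 hη.deriv)).neg.add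
      ((hC.clm_apply (h1 hη.deriv)).clm_apply (h1 hξ))).sub
      ((hC.clm_apply (h1 hξ.deriv)).clm_apply (h1 hη))).add
      ((hS.clm_apply (h1 hξ)).clm_apply (h1 hη))
  refine hasDerivAt_integral_of_hasDerivAt hG fun x => ?_
  have h2 : ∀ a b : Model n, HasDerivAt (fun ε => a + damp δ ε • b) b 0 := fun a b =>
    (((hasDerivAt_damp hδ).smul_const b).const_add a).congr_deriv (one_smul ℝ b)
  have h3 := hc.hasDerivAt_weak (h2 (γ x) (V x)) (h2 (deriv γ x) (deriv V x)) (ξ x) (deriv ξ x)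
    (η x) (deriv η x)
  simpa only [damp_zero, zero_smul, add_zero] using h3

/-- The Jacobi identity for linear functionals on the loops in `W`. -/
def IsJacobiOn (c : OpCoeff n) (W : Set (Model n)) : Prop :=
  ∀ γ : ℝ → Model n, SmoothPeriodic γ → (∀ x, γ x ∈ W) → ∀ ξ η ζ : ℝ → Dual n,
    SmoothPeriodic ξ → SmoothPeriodic η → SmoothPeriodic ζ →
    c.bracketVar γ (c.along γ ζ) ξ η + c.bracketVar γ (c.along γ ξ) η ζ
      + c.bracketVar γ (c.along γ η) ζ ξ = 0

/-- Raising an index with the leading coefficient. -/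
def sharp (c : OpCoeff n) (y : Model n) : Dual n →L[ℝ] Model n := vecOf.comp (c.A y).flip

theorem apply_sharp (y : Model n) (p q : Dual n) : p (c.sharp y q) = c.A y p q := by
  simp [sharp, apply_vecOf]

theorem along_const (y : Model n) (ζ : ℝ → Dual n) :
    c.along (fun _ => y) ζ = fun x => c.sharp y (deriv (deriv ζ) x) := by
  funext x
  simp [OpCoeff.along, op, sharp]

/-- The derivative of `weakVar` in the direction of a loop through a constant loop. -/
def weakVarLin (c : OpCoeff n) (y w w₁ V V₁ V' V₁' : Model n) (ξ ξ₁ η η₁ : Dual n) : ℝ :=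
  - (fderiv ℝ (fderiv ℝ c.A) y w V + fderiv ℝ c.A y V') ξ₁ η₁
    + (fderiv ℝ c.C₁ y V w₁ + fderiv ℝ c.C₁ y w V₁ + c.C₁ y V₁') η₁ ξ
    - (fderiv ℝ c.C₁ y V w₁ + fderiv ℝ c.C₁ y w V₁ + c.C₁ y V₁') ξ₁ η
    + (2 : ℝ) * c.S y V₁ w₁ ξ η

/-- The base loop is constant, so its velocity `v 0` is zero; terms quadratic in the velocity
contribute nothing to first order, and the derivative of S does not enter. -/
theorem IsSmooth.hasDerivAt_weakVar (hc : c.IsSmooth) {u v V V₁ : ℝ → Model n}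
    {w w₁ V' V₁' : Model n} (hu : HasDerivAt u w 0) (hv : HasDerivAt v w₁ 0) (hv0 : v 0 = 0)
    (hV : HasDerivAt V V' 0) (hV₁ : HasDerivAt V₁ V₁' 0) (ξ ξ₁ η η₁ : Dual n) :
    HasDerivAt (fun s => c.weakVar (u s) (v s) (V s) (V₁ s) ξ ξ₁ η η₁)
      (c.weakVarLin (u 0) w w₁ (V 0) (V₁ 0) V' V₁' ξ ξ₁ η η₁) 0 := by
  have hconst : ∀ p : Dual n, HasDerivAt (fun _ : ℝ => p) 0 0 := fun p => hasDerivAt_const 0 p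
  have hA := (hasDerivAt_comp (hc.A.fderiv_right (m := ∞) (by simp)) hu).clm_apply hV
  have hC := (((hasDerivAt_comp (hc.C₁.fderiv_right (m := ∞) (by simp)) hu).clm_apply
    hV).clm_apply hv).fun_add ((hasDerivAt_comp hc.C₁ hu).clm_apply hV₁)
  have hS := ((((hasDerivAt_comp (hc.contDiff_S.fderiv_right (m := ∞) (by simp)) hu).clm_apply
    hV).clm_apply hv).clm_apply hv).fun_add
    (((hasDerivAt_comp hc.contDiff_S hu).clm_apply hV₁).clm_apply hv |>.fun_const_smul (2 : ℝ))
  refine ((((hasDerivAt_bil hA (hconst ξ₁) (hconst η₁)).fun_neg.fun_add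
    (hasDerivAt_bil hC (hconst η₁) (hconst ξ))).fun_sub
    (hasDerivAt_bil hC (hconst ξ₁) (hconst η))).fun_add
    (hasDerivAt_bil hS (hconst ξ) (hconst η))).congr_deriv ?_
  simp only [weakVarLin, hv0, map_zero, zero_apply, add_zero, add_apply, smul_apply, smul_eq_mul]
  ring

end OpCoeff

/-! ### Linearization of the operator and of the Jacobi identity at a constant loop -/

namespace OpCoeff

variable {n : ℕ} {c : OpCoeff n} {W : Set (Model n)}

theorem contDiff_vecOf_comp {X : Type*} [NormedAddCommGroup X] [NormedSpace ℝ X]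
    {f : X → Dual n →L[ℝ] ℝ} (hf : ContDiff ℝ ∞ f) : ContDiff ℝ ∞ fun x => vecOf (f x) :=
  vecOf.contDiff.comp hf

theorem _root_.DegTwo.contDiff_flip_apply {X : Type*} [NormedAddCommGroup X] [NormedSpace ℝ X]
    {Φ : X → Bil n} {α : X → Dual n} (hΦ : ContDiff ℝ ∞ Φ) (hα : ContDiff ℝ ∞ α) :
    ContDiff ℝ ∞ fun x => (Φ x).flip (α x) :=
  ContDiff.clm_apply ((ContinuousLinearMap.flipₗᵢ ℝ (Dual n) (Dual n) ℝ).contDiff.comp hΦ) hα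

/-- The derivative of `P ζ` in the direction of a loop `w` through a constant loop. -/
def alongLin (c : OpCoeff n) (y : Model n) (w : ℝ → Model n) (ζ : ℝ → Dual n) (x : ℝ) : Model n :=
  vecOf ((fderiv ℝ c.A y (w x)).flip (deriv (deriv ζ) x) + (c.B y (deriv w x)).flip (deriv ζ x)
    + (c.C₁ y (deriv (deriv w) x)).flip (ζ x))

theorem IsSmooth.hasDerivAt_op (hc : c.IsSmooth) {u v a : ℝ → Model n} {w w₁ w₂ : Model n}
    (hu : HasDerivAt u w 0) (hv : HasDerivAt v w₁ 0) (hv0 : v 0 = 0) (ha : HasDerivAt a w₂ 0)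
    (ha0 : a 0 = 0) (ζ ζ₁ ζ₂ : Dual n) :
    HasDerivAt (fun s => c.op (u s) (v s) (a s) ζ ζ₁ ζ₂)
      (vecOf ((fderiv ℝ c.A (u 0) w).flip ζ₂ + (c.B (u 0) w₁).flip ζ₁ + (c.C₁ (u 0) w₂).flip ζ)) 0 := by
  have hflip : ∀ {Φ : ℝ → Bil n} {Φ' : Bil n} (p : Dual n), HasDerivAt Φ Φ' 0 →
      HasDerivAt (fun s => (Φ s).flip p) (Φ'.flip p) 0 := fun p h => by
    have := ((ContinuousLinearMap.flipₗᵢ ℝ (Dual n) (Dual n) ℝ).toContinuousLinearEquiv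
      |>.toContinuousLinearMap.hasFDerivAt.comp_hasDerivAt 0 h).clm_apply (hasDerivAt_const 0 p)
    simpa using this
  have h := vecOf.hasFDerivAt.comp_hasDerivAt (0 : ℝ)
    ((((hflip ζ₂ (hasDerivAt_comp hc.A hu)).fun_add
    (hflip ζ₁ ((hasDerivAt_comp hc.B hu).clm_apply hv))).fun_add
    (hflip ζ (((hasDerivAt_comp hc.C₂ hu).clm_apply hv).clm_apply hv))).fun_add
    (hflip ζ ((hasDerivAt_comp hc.C₁ hu).clm_apply ha)))
  refine HasDerivAt.congr_deriv (f := fun s => c.op (u s) (v s) (a s) ζ ζ₁ ζ₂) h ?_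
  congr 1
  ext p
  simp [hv0, ha0]

section Family

variable (c) (y : Model n) (w : ℝ → Model n) (δ : ℝ)

/-- The loops `y + s w`, with bounded parameter `s`. -/
abbrev ray (s : ℝ) (x : ℝ) : Model n := y + damp δ s • w x

variable {w δ}

theorem smoothPeriodic_ray (hw : SmoothPeriodic w) (s : ℝ) : SmoothPeriodic (ray y w δ s) :=
  (SmoothPeriodic.const y).add (hw.const_smul _)

theorem deriv_ray (hw : SmoothPeriodic w) (s : ℝ) :
    deriv (ray y w δ s) = fun x => damp δ s • deriv w x :=
  funext fun x => (((hw.hasDerivAt x).fun_const_smul (damp δ s)).const_add y).deriv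

theorem deriv_smul_deriv (hw : SmoothPeriodic w) (r : ℝ) :
    deriv (fun x => r • deriv w x) = fun x => r • deriv (deriv w) x :=
  funext fun x => ((hw.deriv.hasDerivAt x).fun_const_smul r).deriv

variable {c}

theorem contDiff_snd_of {F : Type*} [NormedAddCommGroup F] [NormedSpace ℝ F] {f : ℝ → F}
    (hf : SmoothPeriodic f) : ContDiff ℝ ∞ fun q : ℝ × ℝ => f q.2 := hf.smooth.comp contDiff_snd

theorem IsSmooth.contDiff_along_ray (hc : c.IsSmooth) (hw : SmoothPeriodic w) {ζ : ℝ → Dual n}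
    (hζ : SmoothPeriodic ζ) : ContDiff ℝ ∞ fun q : ℝ × ℝ => c.along (ray y w δ q.1) ζ q.2 := by
  have h0 : ContDiff ℝ ∞ fun q : ℝ × ℝ => damp δ q.1 := (contDiff_damp δ).comp contDiff_fst
  have hu : ContDiff ℝ ∞ fun q : ℝ × ℝ => y + damp δ q.1 • w q.2 :=
    contDiff_const.add (h0.smul (contDiff_snd_of hw))
  have hv : ContDiff ℝ ∞ fun q : ℝ × ℝ => damp δ q.1 • deriv w q.2 :=
    h0.smul (contDiff_snd_of hw.deriv)
  have ha : ContDiff ℝ ∞ fun q : ℝ × ℝ => damp δ q.1 • deriv (deriv w) q.2 :=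
    h0.smul (contDiff_snd_of hw.deriv.deriv)
  simp only [OpCoeff.along, deriv_ray y hw, deriv_smul_deriv hw, op]
  exact contDiff_vecOf_comp ((((contDiff_flip_apply (hc.A.comp hu)
    (contDiff_snd_of hζ.deriv.deriv)).add (contDiff_flip_apply ((hc.B.comp hu).clm_apply hv)
    (contDiff_snd_of hζ.deriv))).add (contDiff_flip_apply
    (((hc.C₂.comp hu).clm_apply hv).clm_apply hv) (contDiff_snd_of hζ))).add
    (contDiff_flip_apply ((hc.C₁.comp hu).clm_apply ha) (contDiff_snd_of hζ)))

theorem IsSmooth.hasDerivAt_along_ray (hc : c.IsSmooth) (hw : SmoothPeriodic w) (hδ : 0 < δ)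
    (ζ : ℝ → Dual n) (x : ℝ) :
    HasDerivAt (fun s => c.along (ray y w δ s) ζ x) (c.alongLin y w ζ x) 0 := by
  have h1 : ∀ b : Model n, HasDerivAt (fun s => damp δ s • b) b 0 := fun b =>
    ((hasDerivAt_damp hδ).smul_const b).congr_deriv (one_smul ℝ b)
  have h := hc.hasDerivAt_op ((h1 (w x)).const_add y) (h1 (deriv w x)) (by simp)
    (h1 (deriv (deriv w) x)) (by simp) (ζ x) (deriv ζ x) (deriv (deriv ζ) x)
  simp only [OpCoeff.along, deriv_ray y hw, deriv_smul_deriv hw]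
  simpa only [alongLin, damp_zero, zero_smul, add_zero] using h

/-- The derivative of `bracketVar` at a constant loop. -/
def bracketVarLin (c : OpCoeff n) (y : Model n) (w : ℝ → Model n) (ξ η ζ : ℝ → Dual n) : ℝ :=
  ∫ x in (0 : ℝ)..1, c.weakVarLin y (w x) (deriv w x) (c.sharp y (deriv (deriv ζ) x))
    (c.sharp y (deriv (deriv (deriv ζ)) x)) (c.alongLin y w ζ x) (deriv (c.alongLin y w ζ) x)
    (ξ x) (deriv ξ x) (η x) (deriv η x)

/-- The direction of variation `P ζ` itself changes with the loop; its derivative `alongLin`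
therefore enters together with that of the coefficients. -/
theorem IsSmooth.hasDerivAt_bracketVar (hc : c.IsSmooth) (hw : SmoothPeriodic w) (hδ : 0 < δ)
    {ξ η ζ : ℝ → Dual n} (hξ : SmoothPeriodic ξ) (hη : SmoothPeriodic η) (hζ : SmoothPeriodic ζ) :
    HasDerivAt (fun s => c.bracketVar (ray y w δ s) (c.along (ray y w δ s) ζ) ξ η)
      (c.bracketVarLin y w ξ η ζ) 0 := by
  set V : ℝ × ℝ → Model n := fun q => c.along (ray y w δ q.1) ζ q.2 with hVd
  have hV : ContDiff ℝ ∞ V := hc.contDiff_along_ray y hw hζ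
  have hVu := contDiffOn_univ.2 hV
  have hV1 : ∀ s x, deriv (c.along (ray y w δ s) ζ) x = dx V (s, x) := fun s x =>
    (hasDerivAt_dx isOpen_univ hVu (Set.mem_univ (s, x))).deriv
  have hdx : ContDiff ℝ ∞ (dx V) := contDiffOn_univ.1 (contDiffOn_dx isOpen_univ hVu)
  have h0 : ContDiff ℝ ∞ fun q : ℝ × ℝ => damp δ q.1 := (contDiff_damp δ).comp contDiff_fst
  have hu : ContDiff ℝ ∞ fun q : ℝ × ℝ => y + damp δ q.1 • w q.2 :=
    contDiff_const.add (h0.smul (contDiff_snd_of hw))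
  have hv : ContDiff ℝ ∞ fun q : ℝ × ℝ => damp δ q.1 • deriv w q.2 :=
    h0.smul (contDiff_snd_of hw.deriv)
  have hG : ContDiff ℝ ∞ fun q : ℝ × ℝ => c.weakVar (y + damp δ q.1 • w q.2)
      (damp δ q.1 • deriv w q.2) (V q) (dx V q) (ξ q.2) (deriv ξ q.2) (η q.2) (deriv η q.2) := by
    have hA := ((hc.A.fderiv_right (m := ∞) (by simp)).comp hu).clm_apply hV
    have hC := ((((hc.C₁.fderiv_right (m := ∞) (by simp)).comp hu).clm_apply hV).clm_apply hv).add
      ((hc.C₁.comp hu).clm_apply hdx)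
    have hS := (((((hc.contDiff_S.fderiv_right (m := ∞) (by simp)).comp hu).clm_apply
      hV).clm_apply hv).clm_apply hv).add
      ((((hc.contDiff_S.comp hu).clm_apply hdx).clm_apply hv).const_smul (2 : ℝ))
    exact ((((hA.clm_apply (contDiff_snd_of hξ.deriv)).clm_apply
      (contDiff_snd_of hη.deriv)).neg.add
      ((hC.clm_apply (contDiff_snd_of hη.deriv)).clm_apply (contDiff_snd_of hξ))).sub
      ((hC.clm_apply (contDiff_snd_of hξ.deriv)).clm_apply (contDiff_snd_of hη))).add
      ((hS.clm_apply (contDiff_snd_of hξ)).clm_apply (contDiff_snd_of hη))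
  have hd0 : ∀ x, dε V (0, x) = c.alongLin y w ζ x := fun x =>
    (hasDerivAt_dε isOpen_univ hVu (Set.mem_univ ((0 : ℝ), x))).unique
      (hc.hasDerivAt_along_ray y hw hδ ζ x)
  have hray0 : ray y w δ 0 = fun _ => y := funext fun x => by simp
  have key := hasDerivAt_integral_of_hasDerivAt hG (g := fun x =>
    c.weakVarLin y (w x) (deriv w x) (c.sharp y (deriv (deriv ζ) x))
    (c.sharp y (deriv (deriv (deriv ζ)) x)) (c.alongLin y w ζ x) (deriv (c.alongLin y w ζ) x)
    (ξ x) (deriv ξ x) (η x) (deriv η x)) fun x => by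
      have h1 : ∀ b : Model n, HasDerivAt (fun s => damp δ s • b) b 0 := fun b =>
        ((hasDerivAt_damp hδ).smul_const b).congr_deriv (one_smul ℝ b)
      have h2 : HasDerivAt (fun s => V (s, x)) (c.alongLin y w ζ x) 0 :=
        hc.hasDerivAt_along_ray y hw hδ ζ x
      -- The x-derivative of the direction is differentiated in s by exchanging mixed partial
      -- derivatives.
      have h3 : HasDerivAt (fun s => dx V (s, x)) (deriv (c.alongLin y w ζ) x) 0 := by
        refine (hasDerivAt_dε isOpen_univ (contDiffOn_dx isOpen_univ hVu)
          (Set.mem_univ ((0 : ℝ), x))).congr_deriv ?_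
        rw [dε_dx isOpen_univ hVu (Set.mem_univ _), ← funext hd0]
        exact (hasDerivAt_dx isOpen_univ (contDiffOn_dε isOpen_univ hVu)
          (Set.mem_univ ((0 : ℝ), x))).deriv.symm
      have h4 := hc.hasDerivAt_weakVar ((h1 (w x)).const_add y) (h1 (deriv w x)) (by simp) h2 h3
        (ξ x) (deriv ξ x) (η x) (deriv η x)
      have h5 : V (0, x) = c.sharp y (deriv (deriv ζ) x) := by
        rw [hVd]; simp only [hray0, along_const]
      have h6 : dx V (0, x) = c.sharp y (deriv (deriv (deriv ζ)) x) := by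
        rw [← hV1, hray0, along_const]
        refine HasDerivAt.deriv ?_
        exact ((c.sharp y).hasFDerivAt.comp_hasDerivAt x (hζ.deriv.deriv.hasDerivAt x))
      simpa only [damp_zero, zero_smul, add_zero, h5, h6] using h4
  simp only [bracketVar, hV1, deriv_ray y hw]
  exact key

end Family

/-- The Jacobi expression vanishes on the whole ray of loops `y + s w`, hence so does its derivative
at `s = 0`. Constant loops alone do not see the coefficient S nor the second derivatives of the
data. -/
theorem IsJacobiOn.lin (h : c.IsJacobiOn W) (hc : c.IsSmooth) (hW : IsOpen W) {y : Model n}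
    (hy : y ∈ W) {w : ℝ → Model n} (hw : SmoothPeriodic w) {ξ η ζ : ℝ → Dual n}
    (hξ : SmoothPeriodic ξ) (hη : SmoothPeriodic η) (hζ : SmoothPeriodic ζ) :
    c.bracketVarLin y w ξ η ζ + c.bracketVarLin y w η ζ ξ + c.bracketVarLin y w ζ ξ η = 0 := by
  obtain ⟨δ, hδ, hmem⟩ := (SmoothPeriodic.const y).exists_damp_mem hw hW fun _ => hy
  have h1 := ((hc.hasDerivAt_bracketVar y hw hδ hξ hη hζ).fun_add
    (hc.hasDerivAt_bracketVar y hw hδ hη hζ hξ)).fun_add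
    (hc.hasDerivAt_bracketVar y hw hδ hζ hξ hη)
  have h2 := h1.congr_of_eventuallyEq (f₁ := fun _ => 0)
    (Filter.Eventually.of_forall fun s =>
      (h _ (smoothPeriodic_ray y hw s) (hmem s) ξ η ζ hξ hη hζ).symm)
  exact h2.unique (hasDerivAt_const _ _)

end OpCoeff

/-! ### Trigonometric test functions -/

section Trig

open Real

theorem integral_cos_mul_cos_mul_cos : ∫ x in (0 : ℝ)..1, cos ((1 : ℕ) * (2 * π * x)) *
    cos ((1 : ℕ) * (2 * π * x)) * cos ((2 : ℕ) * (2 * π * x)) = 1 / 4 := by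
  have h := SmoothPeriodic.integral_congr (f := fun x => cos ((1 : ℕ) * (2 * π * x)) *
    cos ((1 : ℕ) * (2 * π * x)) * cos ((2 : ℕ) * (2 * π * x))) (g := fun _ => 1 / 4)
    (h := fun x => (8 * π)⁻¹ * sin ((2 : ℕ) * (2 * π * x))
      + (32 * π)⁻¹ * sin ((4 : ℕ) * (2 * π * x)))
    (by fun_prop) (by fun_prop)
    (((SmoothPeriodic.sin 2).const_smul _).add ((SmoothPeriodic.sin 4).const_smul _)) fun x => by
      refine (((hasDerivAt_sin_mul 2 x).const_mul _).fun_add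
        ((hasDerivAt_sin_mul 4 x).const_mul _)).congr_deriv ?_
      have h4 : cos ((4 : ℕ) * (2 * π * x)) = 2 * cos ((2 : ℕ) * (2 * π * x)) ^ 2 - 1 := by
        rw [← cos_two_mul]; push_cast; ring_nf
      have h2 : cos ((2 : ℕ) * (2 * π * x)) = 2 * cos ((1 : ℕ) * (2 * π * x)) ^ 2 - 1 := by
        rw [← cos_two_mul]; push_cast; ring_nf
      rw [h4, h2]
      have := pi_ne_zero
      field_simp
      push_cast
      ring
  rw [h]; simp

theorem integral_sin_mul_sin_mul_cos : ∫ x in (0 : ℝ)..1, sin ((1 : ℕ) * (2 * π * x)) *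
    sin ((1 : ℕ) * (2 * π * x)) * cos ((2 : ℕ) * (2 * π * x)) = -(1 / 4) := by
  have h := SmoothPeriodic.integral_congr (f := fun x => sin ((1 : ℕ) * (2 * π * x)) *
    sin ((1 : ℕ) * (2 * π * x)) * cos ((2 : ℕ) * (2 * π * x))) (g := fun _ => -(1 / 4))
    (h := fun x => (8 * π)⁻¹ * sin ((2 : ℕ) * (2 * π * x))
      + -(32 * π)⁻¹ * sin ((4 : ℕ) * (2 * π * x)))
    (by fun_prop) (by fun_prop)
    (((SmoothPeriodic.sin 2).const_smul _).add ((SmoothPeriodic.sin 4).const_smul _)) fun x => by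
      refine (((hasDerivAt_sin_mul 2 x).const_mul _).fun_add
        ((hasDerivAt_sin_mul 4 x).const_mul _)).congr_deriv ?_
      have h4 : cos ((4 : ℕ) * (2 * π * x)) = 2 * cos ((2 : ℕ) * (2 * π * x)) ^ 2 - 1 := by
        rw [← cos_two_mul]; push_cast; ring_nf
      have h2 : sin ((1 : ℕ) * (2 * π * x)) * sin ((1 : ℕ) * (2 * π * x))
          = (1 - cos ((2 : ℕ) * (2 * π * x))) / 2 := by
        rw [← sq, sin_sq_eq_half_sub]; push_cast; ring_nf
      rw [h4, h2]
      have := pi_ne_zero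
      field_simp
      push_cast
      ring
  rw [h]; simp

theorem integral_sin_mul_cos_mul_sin : ∫ x in (0 : ℝ)..1, sin ((1 : ℕ) * (2 * π * x)) *
    cos ((1 : ℕ) * (2 * π * x)) * sin ((2 : ℕ) * (2 * π * x)) = 1 / 4 := by
  have h := SmoothPeriodic.integral_congr (f := fun x => sin ((1 : ℕ) * (2 * π * x)) *
    cos ((1 : ℕ) * (2 * π * x)) * sin ((2 : ℕ) * (2 * π * x))) (g := fun _ => 1 / 4)
    (h := fun x => -(32 * π)⁻¹ * sin ((4 : ℕ) * (2 * π * x)))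
    (by fun_prop) (by fun_prop)
    ((SmoothPeriodic.sin 4).const_smul _) fun x => by
      refine ((hasDerivAt_sin_mul 4 x).const_mul _).congr_deriv ?_
      have h4 : cos ((4 : ℕ) * (2 * π * x)) = 1 - 2 * sin ((2 : ℕ) * (2 * π * x)) ^ 2 := by
        rw [← cos_two_mul_eq_one_sub]; push_cast; ring_nf
      have h2 : sin ((2 : ℕ) * (2 * π * x))
          = 2 * sin ((1 : ℕ) * (2 * π * x)) * cos ((1 : ℕ) * (2 * π * x)) := by
        rw [← sin_two_mul]; push_cast; ring_nf
      rw [h4, h2]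
      have := pi_ne_zero
      field_simp
      push_cast
      ring
  rw [h]; simp

/-- The three integrals always add up to zero, their sum being the integral of `(f' g' h')'`. Values
in the ratio `2 : -1 : -1` suffice to separate coefficients once the functions are permuted; cos,
sin and the sine of the double angle provide them. -/
theorem exists_trig_triple : ∃ (f g h : ℝ → ℝ) (k : ℝ), SmoothPeriodic f ∧ SmoothPeriodic g ∧
    SmoothPeriodic h ∧ k ≠ 0 ∧
    ∫ x in (0 : ℝ)..1, deriv f x * deriv g x * deriv (deriv h) x = 2 * k ∧
    ∫ x in (0 : ℝ)..1, deriv g x * deriv h x * deriv (deriv f) x = -k ∧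
    ∫ x in (0 : ℝ)..1, deriv h x * deriv f x * deriv (deriv g) x = -k := by
  have hs2 : ∀ (k : ℕ) (a : ℝ), deriv (fun x => a * sin (k * (2 * π * x)))
      = fun x => a * (k * (2 * π)) * cos (k * (2 * π * x)) := fun k a => funext fun x =>
    ((hasDerivAt_sin_mul k x).const_mul a).deriv.trans (by ring)
  have hc2 : ∀ (k : ℕ) (a : ℝ), deriv (fun x => a * cos (k * (2 * π * x)))
      = fun x => -(a * (k * (2 * π))) * sin (k * (2 * π * x)) := fun k a => funext fun x =>
    ((hasDerivAt_cos_mul k x).const_mul a).deriv.trans (by ring)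
  refine ⟨fun x => cos ((1 : ℕ) * (2 * π * x)), fun x => sin ((1 : ℕ) * (2 * π * x)),
    fun x => sin ((2 : ℕ) * (2 * π * x)), (2 * π) ^ 4 / 2, .cos 1, .sin 1, .sin 2,
    by positivity, ?_, ?_, ?_⟩
  · simp only [deriv_cos_mul, deriv_sin_mul, hc2]
    refine Eq.trans ?_ ((congrArg (fun z => 4 * (2 * π) ^ 4 * z)
      integral_sin_mul_cos_mul_sin).trans (by ring))
    rw [← intervalIntegral.integral_const_mul]
    exact intervalIntegral.integral_congr fun x _ => by push_cast; ring
  · simp only [deriv_cos_mul, deriv_sin_mul, hs2]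
    refine Eq.trans ?_ ((congrArg (fun z => -2 * (2 * π) ^ 4 * z)
      integral_cos_mul_cos_mul_cos).trans (by ring))
    rw [← intervalIntegral.integral_const_mul]
    exact intervalIntegral.integral_congr fun x _ => by push_cast; ring
  · simp only [deriv_cos_mul, deriv_sin_mul, hc2]
    refine Eq.trans ?_ ((congrArg (fun z => 2 * (2 * π) ^ 4 * z)
      integral_sin_mul_sin_mul_cos).trans (by ring))
    rw [← intervalIntegral.integral_const_mul]
    exact intervalIntegral.integral_congr fun x _ => by push_cast; ring

/-- By parts the integral is `-∫ (f'')²`; the sine has nonzero second derivative at 1/4. -/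
theorem exists_integral_sq_ne_zero : ∃ f : ℝ → ℝ, SmoothPeriodic f ∧
    ∫ x in (0 : ℝ)..1, deriv f x * deriv (deriv (deriv f)) x ≠ 0 := by
  have hs := SmoothPeriodic.sin 1
  refine ⟨_, hs, fun h0 => ?_⟩
  have h1 := SmoothPeriodic.integral_congr (hs.deriv.mul hs.deriv.deriv.deriv).continuous
    (hs.deriv.deriv.mul hs.deriv.deriv).neg.continuous (hs.deriv.mul hs.deriv.deriv) fun x =>
      ((hs.deriv.hasDerivAt x).fun_mul (hs.deriv.deriv.hasDerivAt x)).congr_deriv (by ring)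
  rw [h0, intervalIntegral.integral_neg, zero_eq_neg] at h1
  have h2 := hs.deriv.deriv.eq_zero_of_integral_sq h1 (1 / 4)
  rw [deriv_sin_mul, ((hasDerivAt_cos_mul 1 _).const_mul _).deriv,
    show ((1 : ℕ) : ℝ) * (2 * π * (1 / 4)) = π / 2 by push_cast; ring, sin_pi_div_two] at h2
  simp at h2

end Trig

/-! ### The Jacobi identity at constant loops: vanishing torsion and compatibility -/

namespace OpCoeff

variable {n : ℕ} {c : OpCoeff n} {W : Set (Model n)}

theorem bracketVar_const (y : Model n) {f g h : ℝ → ℝ} (hf : SmoothPeriodic f)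
    (hg : SmoothPeriodic g) (hh : SmoothPeriodic h) (p q r : Dual n) :
    c.bracketVar (fun _ => y) (c.along (fun _ => y) fun x => h x • r) (fun x => f x • p)
      (fun x => g x • q) = ∫ x in (0 : ℝ)..1, (-(fderiv ℝ c.A y (c.sharp y r) p q *
        (deriv f x * deriv g x * deriv (deriv h) x))
        + c.C₁ y (c.sharp y r) q p * (f x * (deriv g x * deriv (deriv (deriv h)) x))
        - c.C₁ y (c.sharp y r) p q * (g x * (deriv f x * deriv (deriv (deriv h)) x))) := by
  simp only [bracketVar, along_const, hf.deriv_smul_const p,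
    hg.deriv_smul_const q, hh.deriv_smul_const r, hh.deriv.deriv_smul_const r,
    hh.deriv.deriv.deriv_smul_const (c.sharp y r), weakVar, deriv_const', map_zero, map_smul, smul_apply,
    zero_apply, zero_add, add_zero, smul_eq_mul, mul_zero]
  exact intervalIntegral.integral_congr fun x _ => by ring

theorem IsJacobiOn.const (h : c.IsJacobiOn W) {y : Model n} (hy : y ∈ W) (p q r : Dual n)
    {f g k : ℝ → ℝ} (hf : SmoothPeriodic f) (hg : SmoothPeriodic g) (hk : SmoothPeriodic k) :
    ∫ x in (0 : ℝ)..1, ((-(fderiv ℝ c.A y (c.sharp y r) p q *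
        (deriv f x * deriv g x * deriv (deriv k) x))
        + c.C₁ y (c.sharp y r) q p * (f x * (deriv g x * deriv (deriv (deriv k)) x))
        - c.C₁ y (c.sharp y r) p q * (g x * (deriv f x * deriv (deriv (deriv k)) x)))
      + (-(fderiv ℝ c.A y (c.sharp y p) q r *
        (deriv g x * deriv k x * deriv (deriv f) x))
        + c.C₁ y (c.sharp y p) r q * (g x * (deriv k x * deriv (deriv (deriv f)) x))
        - c.C₁ y (c.sharp y p) q r * (k x * (deriv g x * deriv (deriv (deriv f)) x)))
      + (-(fderiv ℝ c.A y (c.sharp y q) r p *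
        (deriv k x * deriv f x * deriv (deriv g) x))
        + c.C₁ y (c.sharp y q) p r * (k x * (deriv f x * deriv (deriv (deriv g)) x))
        - c.C₁ y (c.sharp y q) r p * (f x * (deriv k x * deriv (deriv (deriv g)) x)))) = 0 := by
  have key := h (fun _ => y) (.const y) (fun _ => hy) _ _ _ (hf.smul_const p) (hg.smul_const q)
    (hk.smul_const r)
  rw [bracketVar_const y hf hg hk, bracketVar_const y hg hk hf, bracketVar_const y hk hf hg] at key
  have hi : ∀ {f g k : ℝ → ℝ} (_ : SmoothPeriodic f) (_ : SmoothPeriodic g) (_ : SmoothPeriodic k)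
      (a b d : ℝ), IntervalIntegrable (fun x => -(a * (deriv f x * deriv g x * deriv (deriv k) x))
        + b * (f x * (deriv g x * deriv (deriv (deriv k)) x))
        - d * (g x * (deriv f x * deriv (deriv (deriv k)) x))) MeasureTheory.volume 0 1 :=
    fun hf hg hk a b d =>
    (((((hf.deriv.mul hg.deriv).mul hk.deriv.deriv).const_smul a).neg.add
      ((hf.mul (hg.deriv.mul hk.deriv.deriv.deriv)).const_smul b)).sub
      ((hg.mul (hf.deriv.mul hk.deriv.deriv.deriv)).const_smul d)).continuous.intervalIntegrable _ _
  rw [intervalIntegral.integral_add ((hi hf hg hk _ _ _).add (hi hg hk hf _ _ _))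
    (hi hk hf hg _ _ _), intervalIntegral.integral_add (hi hf hg hk _ _ _) (hi hg hk hf _ _ _)]
  exact key

/-- With the first test function constant, all terms containing its derivatives vanish, and the two
survivors are the same integral with opposite signs. In terms of Christoffel symbols this is the
vanishing of the torsion. -/
theorem IsJacobiOn.symm (h : c.IsJacobiOn W) {y : Model n} (hy : y ∈ W) (p q r : Dual n) :
    c.C₁ y (c.sharp y r) q p = c.C₁ y (c.sharp y q) r p := by
  obtain ⟨f, hf, hf0⟩ := exists_integral_sq_ne_zero
  have h1 := h.const hy p q r (.const (1 : ℝ)) hf hf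
  simp only [deriv_const', zero_mul, mul_zero, neg_zero, one_mul, add_zero, zero_add, sub_zero,
    zero_sub] at h1
  have h2 : (∫ x in (0 : ℝ)..1, deriv f x * deriv (deriv (deriv f)) x)
      * (c.C₁ y (c.sharp y r) q p - c.C₁ y (c.sharp y q) r p) = 0 := by
    rw [← intervalIntegral.integral_mul_const]
    refine Eq.trans ?_ h1
    exact intervalIntegral.integral_congr fun x _ => by ring
  exact sub_eq_zero.1 ((mul_eq_zero.1 h2).resolve_left hf0)

/-- By the symmetry just found, the terms with third derivatives combine into total derivatives
modulo products of one second and two first derivatives. The three coefficients of these products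
are thereby tested by the trigonometric triple. In invariant terms they are the values `(∇_{♯r}
a)(p, q)` and their cyclic permutations. -/
theorem IsJacobiOn.compat (h : c.IsJacobiOn W) {y : Model n} (hy : y ∈ W) (p q r : Dual n) :
    fderiv ℝ c.A y (c.sharp y r) p q + c.C₁ y (c.sharp y r) q p - c.C₁ y (c.sharp y r) p q
      = fderiv ℝ c.A y (c.sharp y p) q r + c.C₁ y (c.sharp y p) r q
        - c.C₁ y (c.sharp y p) q r := by
  set t₁ := fderiv ℝ c.A y (c.sharp y r) p q + c.C₁ y (c.sharp y r) q p - c.C₁ y (c.sharp y r) p q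
  set t₂ := fderiv ℝ c.A y (c.sharp y p) q r + c.C₁ y (c.sharp y p) r q - c.C₁ y (c.sharp y p) q r
  set t₃ := fderiv ℝ c.A y (c.sharp y q) r p + c.C₁ y (c.sharp y q) p r - c.C₁ y (c.sharp y q) r p
  have key : ∀ {f g k : ℝ → ℝ}, SmoothPeriodic f → SmoothPeriodic g → SmoothPeriodic k →
      t₁ * (∫ x in (0 : ℝ)..1, deriv f x * deriv g x * deriv (deriv k) x)
      + t₂ * (∫ x in (0 : ℝ)..1, deriv g x * deriv k x * deriv (deriv f) x)
      + t₃ * (∫ x in (0 : ℝ)..1, deriv k x * deriv f x * deriv (deriv g) x) = 0 := by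
    intro f g k hf hg hk
    have hi : ∀ {f g k : ℝ → ℝ} (_ : SmoothPeriodic f) (_ : SmoothPeriodic g)
        (_ : SmoothPeriodic k) (a : ℝ), SmoothPeriodic
          (fun x => a * (deriv f x * deriv g x * deriv (deriv k) x)) :=
      fun hf hg hk a => ((hf.deriv.mul hg.deriv).mul hk.deriv.deriv).const_smul a
    simp only [← intervalIntegral.integral_const_mul]
    rw [← intervalIntegral.integral_add ((hi hf hg hk _).continuous.intervalIntegrable _ _)
      ((hi hg hk hf _).continuous.intervalIntegrable _ _),
      ← intervalIntegral.integral_add (((hi hf hg hk _).add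
        (hi hg hk hf _)).continuous.intervalIntegrable _ _)
      ((hi hk hf hg _).continuous.intervalIntegrable _ _)]
    have h1 := h.const hy p q r hf hg hk
    rw [← neg_eq_zero, ← intervalIntegral.integral_neg] at h1
    refine Eq.trans ?_ h1
    have hj : ∀ {f g k : ℝ → ℝ} (_ : SmoothPeriodic f) (_ : SmoothPeriodic g) (_ : SmoothPeriodic k)
      (a b d : ℝ), SmoothPeriodic (fun x => -(a * (deriv f x * deriv g x * deriv (deriv k) x))
        + b * (f x * (deriv g x * deriv (deriv (deriv k)) x))
        - d * (g x * (deriv f x * deriv (deriv (deriv k)) x))) :=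
      fun hf hg hk a b d =>
      (((((hf.deriv.mul hg.deriv).mul hk.deriv.deriv).const_smul a).neg.add
      ((hf.mul (hg.deriv.mul hk.deriv.deriv.deriv)).const_smul b)).sub
      ((hg.mul (hf.deriv.mul hk.deriv.deriv.deriv)).const_smul d))
    -- The functions `f (g' k'' - k' g'')`, whose derivatives absorb the third-order terms.
    have hq : ∀ {f g k : ℝ → ℝ} (_ : SmoothPeriodic f) (_ : SmoothPeriodic g)
        (_ : SmoothPeriodic k) (a : ℝ), SmoothPeriodic fun x => a * (f x * (deriv g x *
          deriv (deriv k) x - deriv k x * deriv (deriv g) x)) := fun hf hg hk a =>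
      (hf.mul ((hg.deriv.mul hk.deriv.deriv).sub (hk.deriv.mul hg.deriv.deriv))).const_smul a
    have hqd : ∀ {f g k : ℝ → ℝ} (_ : SmoothPeriodic f) (_ : SmoothPeriodic g)
        (_ : SmoothPeriodic k) (a x : ℝ), HasDerivAt (fun x => a * (f x * (deriv g x *
          deriv (deriv k) x - deriv k x * deriv (deriv g) x)))
          (a * (deriv f x * (deriv g x * deriv (deriv k) x - deriv k x * deriv (deriv g) x)
            + f x * (deriv g x * deriv (deriv (deriv k)) x
              - deriv k x * deriv (deriv (deriv g)) x))) x := fun hf hg hk a x =>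
      (((hf.hasDerivAt x).fun_mul (((hg.deriv.hasDerivAt x).fun_mul
        (hk.deriv.deriv.hasDerivAt x)).fun_sub ((hk.deriv.hasDerivAt x).fun_mul
        (hg.deriv.deriv.hasDerivAt x)))).const_mul a).congr_deriv (by ring)
    refine SmoothPeriodic.integral_congr
      (((hi hf hg hk _).add (hi hg hk hf _)).add (hi hk hf hg _)).continuous
      (((hj hf hg hk _ _ _).add (hj hg hk hf _ _ _)).add (hj hk hf hg _ _ _)).neg.continuous
      (((hq hf hg hk (c.C₁ y (c.sharp y r) q p)).add
        (hq hg hk hf (c.C₁ y (c.sharp y p) r q))).add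
        (hq hk hf hg (c.C₁ y (c.sharp y q) p r))) fun x => ?_
    refine (((hqd hf hg hk _ x).fun_add (hqd hg hk hf _ x)).fun_add
      (hqd hk hf hg _ x)).congr_deriv ?_
    simp only [t₁, t₂, t₃, h.symm hy p r q, h.symm hy q r p, h.symm hy r p q]
    ring
  -- The triple and one of its cyclic permutations give two equations whose difference is `3a (t₁ -
  -- t₂) = 0`.
  obtain ⟨f, g, k, a, hf, hg, hk, ha, h1, h2, h3⟩ := exists_trig_triple
  have e1 := key hf hg hk
  have e2 := key hk hf hg
  rw [h1, h2, h3] at e1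
  have h1' : ∫ x in (0 : ℝ)..1, deriv k x * deriv f x * deriv (deriv g) x = -a := h3
  rw [h1', h1, h2] at e2
  have : 3 * a * (t₁ - t₂) = 0 := by linear_combination e1 - e2
  exact sub_eq_zero.1 ((mul_eq_zero.1 this).resolve_left (by positivity))

end OpCoeff

/-! ### The linearized Jacobi identity: the coefficient of `uₓuₓ` and the curvature -/

namespace OpCoeff

variable {n : ℕ} {c : OpCoeff n} {W : Set (Model n)}

/-- The formula for the coefficient of `uₓ uₓ`. -/
theorem IsJacobiOn.S_eq (h : c.IsJacobiOn W) (hc : c.IsSmooth) (hW : IsOpen W) {y : Model n}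
    (hy : y ∈ W) (s p q : Dual n) (v : Model n) :
    2 * c.S y (c.sharp y s) v p q = c.C₁ y (vecOf ((c.C₁ y v).flip q)) s p
      - c.C₁ y (vecOf ((c.C₁ y v).flip p)) s q := by
  obtain ⟨f, hf, hf0⟩ := exists_integral_sq_ne_zero
  -- Two of the three covectors are constant, the third is `f s`, and the direction is `f v`. In
  -- each cyclic term exactly one coefficient survives, always multiplied by the same integral of
  -- `f' f'''` up to sign.
  have hlin := h.lin hc hW hy (hf.smul_const v) (.const p) (.const q) (hf.smul_const s)
  have hal : ∀ p : Dual n, c.alongLin y (fun x => f x • v) (fun _ => p)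
      = fun x => deriv (deriv f) x • vecOf ((c.C₁ y v).flip p) := by
    intro p
    funext x
    simp only [alongLin, hf.deriv_smul_const v, hf.deriv.deriv_smul_const v, deriv_const', map_zero,
      zero_add, map_smul, ContinuousLinearMap.flip_smul, smul_apply]
  have h1 : c.bracketVarLin y (fun x => f x • v) (fun _ => p) (fun _ => q) (fun x => f x • s)
      = (∫ x in (0 : ℝ)..1, deriv f x * deriv (deriv (deriv f)) x)
        * (2 * c.S y (c.sharp y s) v p q) := by
    rw [← intervalIntegral.integral_mul_const]
    simp only [bracketVarLin, weakVarLin, hf.deriv_smul_const, hf.deriv.deriv_smul_const,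
      hf.deriv.deriv.deriv_smul_const, deriv_const', map_zero, zero_apply, neg_zero, zero_add,
      add_zero, sub_zero, map_smul, smul_apply, smul_eq_mul]
    exact intervalIntegral.integral_congr fun x _ => by ring
  have h2 : c.bracketVarLin y (fun x => f x • v) (fun _ => q) (fun x => f x • s) (fun _ => p)
      = (∫ x in (0 : ℝ)..1, deriv f x * deriv (deriv (deriv f)) x)
        * c.C₁ y (vecOf ((c.C₁ y v).flip p)) s q := by
    rw [← intervalIntegral.integral_mul_const]
    simp only [bracketVarLin, weakVarLin, hal, hf.deriv_smul_const, smul_zero,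
      hf.deriv.deriv.deriv_smul_const, deriv_const', map_zero, zero_apply, neg_zero, zero_add,
      add_zero, sub_zero, map_smul, smul_apply, smul_eq_mul, mul_zero]
    exact intervalIntegral.integral_congr fun x _ => by ring
  have h3 : c.bracketVarLin y (fun x => f x • v) (fun x => f x • s) (fun _ => p) (fun _ => q)
      = -((∫ x in (0 : ℝ)..1, deriv f x * deriv (deriv (deriv f)) x)
        * c.C₁ y (vecOf ((c.C₁ y v).flip q)) s p) := by
    rw [← intervalIntegral.integral_mul_const, ← intervalIntegral.integral_neg]
    simp only [bracketVarLin, weakVarLin, hal, hf.deriv_smul_const, smul_zero,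
      hf.deriv.deriv.deriv_smul_const, deriv_const', map_zero, zero_apply, neg_zero, zero_add,
      add_zero, map_smul, smul_apply, smul_eq_mul, mul_zero]
    exact intervalIntegral.integral_congr fun x _ => by ring
  rw [h1, h2, h3] at hlin
  refine mul_left_cancel₀ hf0 ?_
  linear_combination hlin

/-- Where `C₁` vanishes, its derivative is symmetric. -/
theorem IsJacobiOn.symm_fderiv (h : c.IsJacobiOn W) (hc : c.IsSmooth) (hW : IsOpen W) {y : Model n}
    (hy : y ∈ W) (h0 : c.C₁ y = 0) (s p q : Dual n) (v : Model n) :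
    fderiv ℝ c.C₁ y (c.sharp y s) v q p = fderiv ℝ c.C₁ y v (c.sharp y s) q p := by
  -- Where `C₁` vanishes, S vanishes on the image of `sharp`, because it is quadratic in `C₁`.
  have hS : ∀ (s p q : Dual n) (v : Model n), c.S y (c.sharp y s) v p q = 0 := fun s p q v => by
    have := h.S_eq hc hW hy s p q v
    simp only [h0, zero_apply, sub_zero] at this
    linarith
  -- The symmetry of `C₁` holds near y and is differentiated in the direction v. The derivative of
  -- `sharp` does not contribute, since `C₁` is zero at y.
  have hsymm : ∀ q s : Dual n, fderiv ℝ c.C₁ y v (c.sharp y s) q p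
      = fderiv ℝ c.C₁ y v (c.sharp y q) s p := by
    have hd : ∀ q s : Dual n, HasDerivAt
        (fun t : ℝ => c.C₁ (y + t • v) (c.sharp (y + t • v) s) q p)
        (fderiv ℝ c.C₁ y v (c.sharp y s) q p) 0 := by
      intro q s
      have hu : HasDerivAt (fun t : ℝ => y + t • v) v 0 :=
        (((hasDerivAt_id (0 : ℝ)).smul_const v).const_add y).congr_deriv (one_smul ℝ v)
      have hsh : ContDiff ℝ ∞ fun y => c.sharp y s :=
        contDiff_vecOf_comp (contDiff_flip_apply hc.A contDiff_const)
      have := (((hasDerivAt_comp hc.C₁ hu).clm_apply (hasDerivAt_comp hsh hu)).clm_apply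
        (hasDerivAt_const (0 : ℝ) q)).clm_apply (hasDerivAt_const (0 : ℝ) p)
      refine this.congr_deriv ?_
      simp [h0]
    intro q s
    have hev : (fun t : ℝ => c.C₁ (y + t • v) (c.sharp (y + t • v) s) q p)
        =ᶠ[nhds 0] fun t : ℝ => c.C₁ (y + t • v) (c.sharp (y + t • v) q) s p := by
      have : ∀ᶠ t : ℝ in nhds 0, y + t • v ∈ W :=
        ContinuousAt.eventually_mem (by fun_prop) (hW.mem_nhds (by simpa using hy))
      filter_upwards [this] with t ht using h.symm ht p q s
    exact ((hd q s).congr_of_eventuallyEq hev.symm).unique (hd s q)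
  set α := fderiv ℝ c.C₁ y (c.sharp y s) v q p
  set β := fderiv ℝ c.C₁ y (c.sharp y q) v s p
  set κ := fderiv ℝ c.C₁ y v (c.sharp y s) q p
  have key : ∀ {f g k : ℝ → ℝ}, SmoothPeriodic f → SmoothPeriodic g → SmoothPeriodic k →
      (∫ x in (0 : ℝ)..1, deriv f x * deriv g x * deriv (deriv k) x) * (α - κ)
      - (∫ x in (0 : ℝ)..1, deriv k x * deriv f x * deriv (deriv g) x) * (β - κ) = 0 := by
    intro f g k hf hg hk
    have hlin := h.lin hc hW hy (hf.smul_const v) (.const p) (hg.smul_const q) (hk.smul_const s)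
    -- As `C₁` vanishes at y, the image under P of a constant covector vanishes to first order along
    -- the ray; one of the three cyclic terms disappears.
    have hal : c.alongLin y (fun x => f x • v) (fun _ => p) = fun _ => 0 := by
      funext x
      simp [alongLin, h0]
    have h1 : c.bracketVarLin y (fun x => f x • v) (fun _ => p) (fun x => g x • q)
        (fun x => k x • s) = ∫ x in (0 : ℝ)..1, (deriv (deriv k) x * deriv f x * deriv g x * α
          + f x * deriv (deriv (deriv k)) x * deriv g x * κ) := by
      simp only [bracketVarLin, weakVarLin, hf.deriv_smul_const, hg.deriv_smul_const,
        hk.deriv_smul_const, hk.deriv.deriv_smul_const, hk.deriv.deriv.deriv_smul_const,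
        deriv_const', map_zero, zero_apply, neg_zero, zero_add, h0, hS,
        add_zero, sub_zero, map_smul, smul_apply, smul_eq_mul, mul_zero, add_apply]
      exact intervalIntegral.integral_congr fun x _ => by ring
    have h2 : c.bracketVarLin y (fun x => f x • v) (fun x => g x • q) (fun x => k x • s)
        (fun _ => p) = 0 := by
      simp only [bracketVarLin, weakVarLin, hal, deriv_const', map_zero, zero_apply, neg_zero,
        add_zero, sub_zero, mul_zero, intervalIntegral.integral_zero]
    have h3 : c.bracketVarLin y (fun x => f x • v) (fun x => k x • s) (fun _ => p)
        (fun x => g x • q) = ∫ x in (0 : ℝ)..1, -(deriv (deriv g) x * deriv f x * deriv k x * β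
          + f x * deriv (deriv (deriv g)) x * deriv k x * κ) := by
      simp only [bracketVarLin, weakVarLin, hf.deriv_smul_const, hg.deriv_smul_const,
        hk.deriv_smul_const, hg.deriv.deriv_smul_const, hg.deriv.deriv.deriv_smul_const,
        deriv_const', map_zero, zero_apply, neg_zero, h0, hS,
        add_zero, zero_sub, map_smul, smul_apply, smul_eq_mul, mul_zero, add_apply, κ, hsymm q s]
      exact intervalIntegral.integral_congr fun x _ => by ring
    rw [h1, h2, h3, add_zero, ← intervalIntegral.integral_add
      ((((((hk.deriv.deriv.mul hf.deriv).mul hg.deriv).mul (.const α)).add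
        (((hf.mul hk.deriv.deriv.deriv).mul hg.deriv).mul (.const κ)))).continuous.intervalIntegrable
        _ _)
      ((((((hg.deriv.deriv.mul hf.deriv).mul hk.deriv).mul (.const β)).add
        (((hf.mul hg.deriv.deriv.deriv).mul hk.deriv).mul
        (.const κ)))).neg.continuous.intervalIntegrable _ _)] at hlin
    rw [← intervalIntegral.integral_mul_const, ← intervalIntegral.integral_mul_const,
      ← intervalIntegral.integral_sub
      ((((hf.deriv.mul hg.deriv).mul hk.deriv.deriv).mul
        (.const (α - κ))).continuous.intervalIntegrable _ _)
      ((((hk.deriv.mul hf.deriv).mul hg.deriv.deriv).mul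
        (.const (β - κ))).continuous.intervalIntegrable _ _)]
    refine Eq.trans (Eq.symm ?_) hlin
    -- The terms with third derivatives carry the common coefficient κ thanks to `hsymm`, and form a
    -- total derivative up to products of the kind tested by the trigonometric triple.
    refine SmoothPeriodic.integral_congr
      ((((((hk.deriv.deriv.mul hf.deriv).mul hg.deriv).mul (.const α)).add
        (((hf.mul hk.deriv.deriv.deriv).mul hg.deriv).mul (.const κ)))).add
      (((((hg.deriv.deriv.mul hf.deriv).mul hk.deriv).mul (.const β)).add
        (((hf.mul hg.deriv.deriv.deriv).mul hk.deriv).mul (.const κ)))).neg).continuous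
      ((((hf.deriv.mul hg.deriv).mul hk.deriv.deriv).mul (.const (α - κ))).sub
      (((hk.deriv.mul hf.deriv).mul hg.deriv.deriv).mul (.const (β - κ)))).continuous
      (h := fun x => κ * (f x * (deriv (deriv k) x * deriv g x - deriv (deriv g) x * deriv k x)))
      ((hf.mul ((hk.deriv.deriv.mul hg.deriv).sub (hg.deriv.deriv.mul hk.deriv))).const_smul κ)
      fun x => ?_
    refine (((hf.hasDerivAt x).fun_mul (((hk.deriv.deriv.hasDerivAt x).fun_mul
      (hg.deriv.hasDerivAt x)).fun_sub ((hg.deriv.deriv.hasDerivAt x).fun_mul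
      (hk.deriv.hasDerivAt x)))).const_mul κ).congr_deriv ?_
    ring
  obtain ⟨f, g, k, a, hf, hg, hk, ha, h1, h2, h3⟩ := exists_trig_triple
  have e1 := key hf hg hk
  have e2 := key hk hf hg
  rw [h1, h3] at e1
  rw [h3, h2] at e2
  have : 3 * a * (α - κ) = 0 := by linear_combination e1 - e2
  exact sub_eq_zero.1 ((mul_eq_zero.1 this).resolve_left (by positivity))

end OpCoeff

/-! ### The coefficients of an operator as multilinear maps -/

section Tensor

variable {n : ℕ}

/-- The bilinear form `(p, q) ↦ pᵢ qⱼ` on covectors. -/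
def unitBil (i j : Fin n) : Bil n :=
  (ContinuousLinearMap.apply ℝ ℝ (single i (1 : ℝ))).smulRight
    (ContinuousLinearMap.apply ℝ ℝ (single j (1 : ℝ)))

theorem unitBil_apply (i j : Fin n) (p q : Dual n) : unitBil i j p q
    = p (single i (1 : ℝ)) * q (single j (1 : ℝ)) := rfl

/-- The coefficients of an operator as multilinear maps. -/
def Coefficients.toOp (K : Coefficients n) : OpCoeff n where
  A y := ∑ i, ∑ j, K.a i j y • unitBil i j
  B y := ∑ i, ∑ j, ∑ k, K.b i j k y •
    (proj k : Dual n).smulRight (unitBil i j)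
  C₂ y := ∑ i, ∑ j, ∑ k, ∑ l, K.c₂ i j k l y • (proj k : Dual n).smulRight
    ((proj l : Dual n).smulRight (unitBil i j))
  C₁ y := ∑ i, ∑ j, ∑ k, K.c₁ i j k y •
    (proj k : Dual n).smulRight (unitBil i j)

variable (K : Coefficients n) (y v w : Model n) (p q : Dual n)

theorem Coefficients.toOp_A : K.toOp.A y p q = ∑ i, ∑ j, K.a i j y *
    (p (single i (1 : ℝ)) * q (single j (1 : ℝ))) := by
  simp only [Coefficients.toOp, sum_apply, smul_apply, unitBil_apply, smul_eq_mul]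

theorem Coefficients.toOp_B : K.toOp.B y v p q = ∑ i, ∑ j, (∑ k, K.b i j k y * v k) *
    (p (single i (1 : ℝ)) * q (single j (1 : ℝ))) := by
  simp only [Coefficients.toOp, sum_apply, smul_apply, unitBil_apply, smul_eq_mul,
    ContinuousLinearMap.smulRight_apply, PiLp.proj_apply, Finset.sum_mul, mul_assoc]

theorem Coefficients.toOp_C₁ : K.toOp.C₁ y v p q = ∑ i, ∑ j, (∑ k, K.c₁ i j k y * v k) *
    (p (single i (1 : ℝ)) * q (single j (1 : ℝ))) := by
  simp only [Coefficients.toOp, sum_apply, smul_apply, unitBil_apply, smul_eq_mul,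
    ContinuousLinearMap.smulRight_apply, PiLp.proj_apply, Finset.sum_mul, mul_assoc]

theorem Coefficients.toOp_C₂ : K.toOp.C₂ y v w p q
    = ∑ i, ∑ j, (∑ k, ∑ l, K.c₂ i j k l y * v k * w l) *
    (p (single i (1 : ℝ)) * q (single j (1 : ℝ))) := by
  simp only [Coefficients.toOp, sum_apply, smul_apply, unitBil_apply, smul_eq_mul,
    ContinuousLinearMap.smulRight_apply, PiLp.proj_apply, Finset.sum_mul, mul_assoc]

theorem sum_sum_proj (a : Fin n → Fin n → ℝ) (i : Fin n) (q : Dual n) :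
    ∑ i', ∑ j, a i' j * ((proj i : Dual n) (single i' (1 : ℝ)) *
      q (single j (1 : ℝ))) = ∑ j, a i j * q (single j (1 : ℝ)) := by
  rw [Finset.sum_eq_single i]
  · simp
  · intro b _ hb
    simp [hb.symm]
  · simp

theorem Coefficients.op_toOp_apply (α α₁ α₂ : Dual n) (i : Fin n) :
    K.toOp.op y v w α α₁ α₂ i = ∑ j, (K.a i j y * α₂ (single j (1 : ℝ))
      + (∑ k, K.b i j k y * v k) * α₁ (single j (1 : ℝ))
      + ((∑ k, ∑ l, K.c₂ i j k l y * v k * v l) + ∑ k, K.c₁ i j k y * w k)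
        * α (single j (1 : ℝ))) := by
  have h := K.toOp.apply_op y v w α α₁ α₂ (proj i)
  rw [K.toOp_A, K.toOp_B, K.toOp_C₂, K.toOp_C₁, sum_sum_proj, sum_sum_proj, sum_sum_proj,
    sum_sum_proj, ← Finset.sum_add_distrib, ← Finset.sum_add_distrib,
    ← Finset.sum_add_distrib] at h
  refine h.trans (Finset.sum_congr rfl fun j _ => ?_)
  ring

/-- The coefficients multiplied by a function. -/
def OpCoeff.cut (c : OpCoeff n) (χ : Model n → ℝ) : OpCoeff n where
  A y := χ y • c.A y
  B y := χ y • c.B y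
  C₂ y := χ y • c.C₂ y
  C₁ y := χ y • c.C₁ y

variable {K} {T : Set (Model n)}

theorem _root_.ContDiffOn.smul_const' {F : Type*} [NormedAddCommGroup F] [NormedSpace ℝ F]
    {a : Model n → ℝ} (h : ContDiffOn ℝ ∞ a T) (v : F) : ContDiffOn ℝ ∞ (fun y => a y • v) T :=
  h.smul contDiffOn_const

theorem Coefficients.IsRegularOn.contDiffOn_A (hK : K.IsRegularOn T) :
    ContDiffOn ℝ ∞ K.toOp.A T := by
  change ContDiffOn ℝ ∞ (fun y => ∑ i, ∑ j, K.a i j y • unitBil i j) T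
  refine ContDiffOn.sum fun i _ => .sum fun j _ => ?_
  exact (hK.smooth_a i j).smul_const' _

theorem Coefficients.IsRegularOn.contDiffOn_B (hK : K.IsRegularOn T) :
    ContDiffOn ℝ ∞ K.toOp.B T := by
  change ContDiffOn ℝ ∞ (fun y => ∑ i, ∑ j, ∑ k, K.b i j k y •
    (proj k : Dual n).smulRight (unitBil i j)) T
  refine ContDiffOn.sum fun i _ => .sum fun j _ => .sum fun k _ => ?_
  exact (hK.smooth_b i j k).smul_const' _

theorem Coefficients.IsRegularOn.contDiffOn_C₂ (hK : K.IsRegularOn T) :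
    ContDiffOn ℝ ∞ K.toOp.C₂ T := by
  change ContDiffOn ℝ ∞ (fun y => ∑ i, ∑ j, ∑ k, ∑ l, K.c₂ i j k l y •
    (proj k : Dual n).smulRight
    ((proj l : Dual n).smulRight (unitBil i j))) T
  refine ContDiffOn.sum fun i _ => .sum fun j _ => .sum fun k _ => .sum fun l _ => ?_
  exact (hK.smooth_c₂ i j k l).smul_const' _

theorem Coefficients.IsRegularOn.contDiffOn_C₁ (hK : K.IsRegularOn T) :
    ContDiffOn ℝ ∞ K.toOp.C₁ T := by
  change ContDiffOn ℝ ∞ (fun y => ∑ i, ∑ j, ∑ k, K.c₁ i j k y •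
    (proj k : Dual n).smulRight (unitBil i j)) T
  refine ContDiffOn.sum fun i _ => .sum fun j _ => .sum fun k _ => ?_
  exact (hK.smooth_c₁ i j k).smul_const' _

theorem contDiff_cut {F : Type*} [NormedAddCommGroup F] [NormedSpace ℝ F] {χ : Model n → ℝ}
    (hχ : ContDiff ℝ ∞ χ) (hT : IsOpen T) (hs : tsupport χ ⊆ T) {f : Model n → F}
    (hf : ContDiffOn ℝ ∞ f T) : ContDiff ℝ ∞ fun y => χ y • f y :=
  contDiff_of_eq_zero hT (isClosed_tsupport χ) hs (hχ.contDiffOn.smul hf) fun y hy => by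
    rw [image_eq_zero_of_notMem_tsupport hy, zero_smul]

/-- The coefficients are known on the chart target only. Multiplied by a cutoff they are smooth
everywhere, and where the cutoff is 1 they are unchanged, which is enough for identities at a point.
-/
theorem Coefficients.IsRegularOn.isSmooth_cut (hK : K.IsRegularOn T) {χ : Model n → ℝ}
    (hχ : ContDiff ℝ ∞ χ) (hT : IsOpen T) (hs : tsupport χ ⊆ T) : (K.toOp.cut χ).IsSmooth where
  A := contDiff_cut hχ hT hs hK.contDiffOn_A
  B := contDiff_cut hχ hT hs hK.contDiffOn_B
  C₂ := contDiff_cut hχ hT hs hK.contDiffOn_C₂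
  C₁ := contDiff_cut hχ hT hs hK.contDiffOn_C₁
  symm y v w := by
    by_cases hy : y ∈ tsupport χ
    · ext p q
      simp only [OpCoeff.cut, smul_apply, K.toOp_C₂]
      congr 1
      refine Finset.sum_congr rfl fun i _ => Finset.sum_congr rfl fun j _ => ?_
      congr 1
      rw [Finset.sum_comm]
      refine Finset.sum_congr rfl fun k _ => Finset.sum_congr rfl fun l _ => ?_
      rw [hK.symm_c₂ i j l k y (hs hy)]
      ring
    · simp only [OpCoeff.cut, image_eq_zero_of_notMem_tsupport hy, zero_smul, zero_apply]

end Tensor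

/-! ### Local forms in terms of multilinear coefficients -/

section Chart

variable {n : ℕ} {M : Type*} [TopologicalSpace M] [ChartedSpace (Model n) M]
  {e : OpenPartialHomeomorph M (Model n)}

theorem deriv_clm_comp {F G : Type*} [NormedAddCommGroup F] [NormedSpace ℝ F]
    [NormedAddCommGroup G] [NormedSpace ℝ G] (L : F →L[ℝ] G) {f : ℝ → F} {s : Set ℝ}
    (hs : IsOpen s) (hf : ContDiffOn ℝ ∞ f s) {x : ℝ} (hx : x ∈ s) :
    deriv (fun y => L (f y)) x = L (deriv f x) :=
  (L.hasFDerivAt.comp_hasDerivAt x (differentiableAt_of_contDiffOn hs hf hx).hasDerivAt).deriv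

theorem iteratedDeriv_two_clm_comp {F G : Type*} [NormedAddCommGroup F] [NormedSpace ℝ F]
    [NormedAddCommGroup G] [NormedSpace ℝ G] (L : F →L[ℝ] G) {f : ℝ → F} {s : Set ℝ}
    (hs : IsOpen s) (hf : ContDiffOn ℝ ∞ f s) {x : ℝ} (hx : x ∈ s) :
    iteratedDeriv 2 (fun y => L (f y)) x = L (deriv (deriv f) x) := by
  rw [iteratedDeriv_succ, iteratedDeriv_one]
  have h : deriv (fun y => L (f y)) =ᶠ[nhds x] fun y => L (deriv f y) := by
    filter_upwards [hs.mem_nhds hx] with y hy using deriv_clm_comp L hs hf hy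
  rw [h.deriv_eq]
  exact deriv_clm_comp L hs (contDiffOn_deriv hs hf) hx

variable [IsManifold (𝓡 n) ∞ M]

theorem Coefficients.along_toOp_apply (K : Coefficients n) (he : e ∈ charts n M) (u : Loop n M)
    (α : CovectorAlong u) {x : ℝ} (hx : x ∈ u.dom e) (i : Fin n) :
    K.toOp.along (u.rep e) (α.rep e) x i
      = ∑ j, (K.a i j (e (u (x : UnitAddCircle))) * iteratedDeriv 2 (α.coord e j) x
        + (∑ k, K.b i j k (e (u (x : UnitAddCircle))) * deriv (u.coord e k) x)
            * deriv (α.coord e j) x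
        + ((∑ k, ∑ l, K.c₂ i j k l (e (u (x : UnitAddCircle)))
                * deriv (u.coord e k) x * deriv (u.coord e l) x)
            + ∑ k, K.c₁ i j k (e (u (x : UnitAddCircle))) * iteratedDeriv 2 (u.coord e k) x)
            * α.coord e j x) := by
  rw [OpCoeff.along, K.op_toOp_apply]
  have hα := α.contDiffOn_rep he
  have hu := u.contDiffOn_rep he
  have h1 : ∀ j, deriv (α.coord e j) x = deriv (α.rep e) x (single j (1 : ℝ)) :=
    fun j => deriv_clm_comp (ContinuousLinearMap.apply ℝ ℝ (single j (1 : ℝ)))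
      (u.isOpen_dom e) hα hx
  have h2 : ∀ j, iteratedDeriv 2 (α.coord e j) x
      = deriv (deriv (α.rep e)) x (single j (1 : ℝ)) :=
    fun j => iteratedDeriv_two_clm_comp
      (ContinuousLinearMap.apply ℝ ℝ (single j (1 : ℝ))) (u.isOpen_dom e) hα hx
  have h3 : ∀ k, deriv (u.coord e k) x = deriv (u.rep e) x k := fun k =>
    deriv_clm_comp (proj k : Dual n) (u.isOpen_dom e) hu hx
  have h4 : ∀ k, iteratedDeriv 2 (u.coord e k) x = deriv (deriv (u.rep e)) x k := fun k =>
    iteratedDeriv_two_clm_comp (proj k : Dual n) (u.isOpen_dom e) hu hx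
  simp only [h1, h2, h3, h4]
  rfl

/-- The local form of an operator in terms of multilinear maps. -/
theorem HasLocalForm.rep_eq {P : LoopOperator n M} {K : Coefficients n} (h : HasLocalForm P e K)
    (he : e ∈ charts n M) (u : Loop n M) (α : CovectorAlong u) {x : ℝ} (hx : x ∈ u.dom e) :
    (P u α).rep e x = K.toOp.along (u.rep e) (α.rep e) x := by
  ext i
  rw [VectorAlong.rep_apply, h.2 u α x hx i, K.along_toOp_apply he u α hx]

theorem HasLocalForm.of_rep_eq {P : LoopOperator n M} {K : Coefficients n} (he : e ∈ charts n M)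
    (hK : K.IsRegularOn e.target) (h : ∀ (u : Loop n M) (α : CovectorAlong u), ∀ x ∈ u.dom e,
      (P u α).rep e x = K.toOp.along (u.rep e) (α.rep e) x) : HasLocalForm P e K :=
  ⟨hK, fun u α x hx i => by
    rw [← VectorAlong.rep_apply, h u α x hx, K.along_toOp_apply he u α hx]⟩

end Chart

/-! ### Linear functionals in a chart and their brackets -/

section Test

variable {n : ℕ} {T : Set (Model n)} {χ : Model n → ℝ} {ξ η : ℝ → Dual n}

/-- The density `χ(u) ξ(x)(u)`. -/
def testDensity (hχ : ContDiff ℝ ∞ χ) (hc : HasCompactSupport χ) (hs : tsupport χ ⊆ T)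
    (hξ : SmoothPeriodic ξ) : CompactDensity n 0 T where
  toFun q := χ (q.2 0) * ξ q.1 (q.2 0)
  smooth := by
    have h0 : ContDiff ℝ ∞ fun q : ℝ × (Fin (0 + 1) → Model n) => q.2 0 := by fun_prop
    exact ((hχ.comp h0).mul ((hξ.smooth.comp contDiff_fst).clm_apply h0)).contDiffOn
  periodic x q := by simp only [hξ.periodic x]
  supp := tsupport χ
  isCompact_supp := hc
  supp_subset := hs
  eq_zero q hq := by simp only [image_eq_zero_of_notMem_tsupport hq, zero_mul]

/-- The derivative of `χ(y) ξ(x)(y)` with respect to `y`. -/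
def testCovec (χ : Model n → ℝ) (ξ : ℝ → Dual n) (p : ℝ × Model n) : Dual n :=
  χ p.2 • ξ p.1 + ξ p.1 p.2 • fderiv ℝ χ p.2

theorem contDiff_testCovec (hχ : ContDiff ℝ ∞ χ) (hξ : SmoothPeriodic ξ) :
    ContDiff ℝ ∞ (testCovec χ ξ) := by
  have h1 : ContDiff ℝ ∞ fun p : ℝ × Model n => ξ p.1 := hξ.smooth.comp contDiff_fst
  exact ((hχ.comp contDiff_snd).smul h1).add ((h1.clm_apply contDiff_snd).smul
    ((hχ.fderiv_right (m := ∞) (by simp)).comp contDiff_snd))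

theorem testCovec_eq_zero {p : ℝ × Model n} (hp : p.2 ∉ tsupport χ) : testCovec χ ξ p = 0 := by
  have h : fderiv ℝ χ p.2 = 0 := by
    have := support_fderiv_subset ℝ (f := χ)
    by_contra h0
    exact hp (this h0)
  simp only [testCovec, image_eq_zero_of_notMem_tsupport hp, h, zero_smul, smul_zero, add_zero]

/-- Where the cutoff is locally 1 the test functional is linear, and its variational derivative is ξ
independently of the loop. -/
theorem testCovec_of_eventually_eq_one {p : ℝ × Model n} (hp : ∀ᶠ y in nhds p.2, χ y = 1) :
    testCovec χ ξ p = ξ p.1 := by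
  have h : χ =ᶠ[nhds p.2] fun _ => 1 := hp
  simp only [testCovec, hp.self_of_nhds, h.fderiv_eq]
  simp

theorem testCovec_add_one (hξ : SmoothPeriodic ξ) (p : ℝ × Model n) :
    testCovec χ ξ (p + ((1 : ℝ), 0)) = testCovec χ ξ p := by
  simp [testCovec, hξ.periodic p.1]

theorem jetDeriv_testDensity (hχ : ContDiff ℝ ∞ χ) (hc : HasCompactSupport χ)
    (hs : tsupport χ ⊆ T) (hξ : SmoothPeriodic ξ) (x : ℝ) (q : Fin (0 + 1) → Model n) :
    jetDeriv (testDensity hχ hc hs hξ).toFun 0 (x, q) = testCovec χ ξ (x, q 0) := by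
  ext w
  have hd : HasFDerivAt (testDensity hχ hc hs hξ).toFun
      (fderiv ℝ (testDensity hχ hc hs hξ).toFun (x, q)) (x, q) := by
    have h0 : ContDiff ℝ ∞ fun q : ℝ × (Fin (0 + 1) → Model n) => q.2 0 := by fun_prop
    exact (((hχ.comp h0).mul ((hξ.smooth.comp contDiff_fst).clm_apply h0)).differentiable
      (by simp) (x, q)).hasFDerivAt
  have hc1 : HasDerivAt (fun t : ℝ => (x, q + t • Pi.single (M := fun _ : Fin 1 => Model n) 0 w))
      ((0 : ℝ), Pi.single (M := fun _ : Fin 1 => Model n) 0 w) 0 :=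
    (hasDerivAt_const 0 x).prodMk ((((hasDerivAt_id (0 : ℝ)).smul_const _).const_add q).congr_deriv
      (one_smul ℝ _))
  have h1 := HasFDerivAt.comp_hasDerivAt_of_eq (0 : ℝ) hd hc1 (by simp)
  have hu : HasDerivAt (fun t : ℝ => q 0 + t • w) w 0 :=
    (((hasDerivAt_id (0 : ℝ)).smul_const w).const_add (q 0)).congr_deriv (one_smul ℝ w)
  have h2 := (OpCoeff.hasDerivAt_comp hχ hu).fun_mul ((hasDerivAt_const (0 : ℝ) (ξ x)).clm_apply hu)
  have h3 : (testDensity hχ hc hs hξ).toFun ∘ (fun t : ℝ =>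
      (x, q + t • Pi.single (M := fun _ : Fin 1 => Model n) 0 w))
      = fun t : ℝ => χ (q 0 + t • w) * ξ x (q 0 + t • w) := by
    funext t
    simp [testDensity]
  rw [h3] at h1
  have h4 := h1.unique h2
  rw [jetDeriv_apply]
  refine h4.trans ?_
  simp [testCovec]; ring

theorem hasDerivAt_total {F : Type*} [NormedAddCommGroup F] [NormedSpace ℝ F]
    {g : ℝ × Model n → F} (hg : ContDiff ℝ ∞ g) {γ : ℝ → Model n} {v : Model n} {x : ℝ}
    (hγ : HasDerivAt γ v x) : HasDerivAt (fun x => g (x, γ x)) (fderiv ℝ g (x, γ x) (1, v)) x :=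
  (hg.differentiable (by simp) (x, γ x)).hasFDerivAt.comp_hasDerivAt x
    ((hasDerivAt_id x).prodMk hγ)

/-- The density of the bracket of two linear functionals. -/
def bracketFun (c : OpCoeff n) (χ : Model n → ℝ) (ξ η : ℝ → Dual n)
    (q : ℝ × (Fin (2 + 1) → Model n)) : ℝ :=
  testCovec χ ξ (q.1, q.2 0) (c.op (q.2 0) (q.2 1) (q.2 2) (testCovec χ η (q.1, q.2 0))
    (fderiv ℝ (testCovec χ η) (q.1, q.2 0) (1, q.2 1))
    (fderiv ℝ (fderiv ℝ (testCovec χ η)) (q.1, q.2 0) (1, q.2 1) (1, q.2 1)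
      + fderiv ℝ (testCovec χ η) (q.1, q.2 0) (0, q.2 2)))

theorem contDiffOn_flip_apply {X : Type*} [NormedAddCommGroup X] [NormedSpace ℝ X]
    {Φ : X → Bil n} {α : X → Dual n} {s : Set X} (hΦ : ContDiffOn ℝ ∞ Φ s)
    (hα : ContDiff ℝ ∞ α) : ContDiffOn ℝ ∞ (fun x => (Φ x).flip (α x)) s :=
  ContDiffOn.clm_apply ((ContinuousLinearMap.flipₗᵢ ℝ (Dual n) (Dual n) ℝ).contDiff.comp_contDiffOn
    hΦ) hα.contDiffOn

theorem contDiffOn_bracketFun {K : Coefficients n} (hK : K.IsRegularOn T) (hχ : ContDiff ℝ ∞ χ)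
    (hξ : SmoothPeriodic ξ) (hη : SmoothPeriodic η) :
    ContDiffOn ℝ ∞ (bracketFun K.toOp χ ξ η) {q | q.2 0 ∈ T} := by
  have hq : ∀ k, ContDiff ℝ ∞ fun q : ℝ × (Fin (2 + 1) → Model n) => q.2 k := fun k => by fun_prop
  have hp : ContDiff ℝ ∞ fun q : ℝ × (Fin (2 + 1) → Model n) => (q.1, q.2 0) :=
    contDiff_fst.prodMk (hq 0)
  have hN := contDiff_testCovec hχ hη
  have hN1 : ContDiff ℝ ∞ (fderiv ℝ (testCovec χ η)) := hN.fderiv_right (by simp)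
  have hN2 : ContDiff ℝ ∞ (fderiv ℝ (fderiv ℝ (testCovec χ η))) := hN1.fderiv_right (by simp)
  have h1 : ∀ k, ContDiff ℝ ∞ fun q : ℝ × (Fin (2 + 1) → Model n) => ((1 : ℝ), q.2 k) :=
    fun k => contDiff_const.prodMk (hq k)
  have h0 : ∀ k, ContDiff ℝ ∞ fun q : ℝ × (Fin (2 + 1) → Model n) => ((0 : ℝ), q.2 k) :=
    fun k => contDiff_const.prodMk (hq k)
  have hm : Set.MapsTo (fun q : ℝ × (Fin (2 + 1) → Model n) => q.2 0) {q | q.2 0 ∈ T} T :=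
    fun q hq => hq
  refine ((contDiff_testCovec hχ hξ).comp hp).contDiffOn.clm_apply
    (vecOf.contDiff.comp_contDiffOn (((ContDiffOn.add ?_ ?_).add ?_).add ?_))
  · exact contDiffOn_flip_apply (hK.contDiffOn_A.comp (hq 0).contDiffOn hm)
      (((((hN2.comp hp).clm_apply (h1 1)).clm_apply (h1 1))).add ((hN1.comp hp).clm_apply (h0 2)))
  · exact contDiffOn_flip_apply ((hK.contDiffOn_B.comp (hq 0).contDiffOn hm).clm_apply
      (hq 1).contDiffOn) ((hN1.comp hp).clm_apply (h1 1))
  · exact contDiffOn_flip_apply (((hK.contDiffOn_C₂.comp (hq 0).contDiffOn hm).clm_apply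
      (hq 1).contDiffOn).clm_apply (hq 1).contDiffOn) (hN.comp hp)
  · exact contDiffOn_flip_apply ((hK.contDiffOn_C₁.comp (hq 0).contDiffOn hm).clm_apply
      (hq 2).contDiffOn) (hN.comp hp)

theorem fderiv_periodic {F : Type*} [NormedAddCommGroup F] [NormedSpace ℝ F]
    {g : ℝ × Model n → F} (hg : ∀ p, g (p + ((1 : ℝ), 0)) = g p) (p : ℝ × Model n) :
    fderiv ℝ g (p + ((1 : ℝ), 0)) = fderiv ℝ g p := by
  have h2 := fderiv_comp_add_right (𝕜 := ℝ) (f := g) (x := p) ((1 : ℝ), 0)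
  rw [show (fun x => g (x + ((1 : ℝ), 0))) = g from funext hg] at h2
  exact h2.symm

/-- The bracket of two linear functionals as a functional with compactly supported density. -/
def bracketDensity {K : Coefficients n} (hK : K.IsRegularOn T) (hχ : ContDiff ℝ ∞ χ)
    (hc : HasCompactSupport χ) (hs : tsupport χ ⊆ T)
    (hξ : SmoothPeriodic ξ) (hη : SmoothPeriodic η) : CompactDensity n 2 T where
  toFun := bracketFun K.toOp χ ξ η
  smooth := contDiffOn_bracketFun hK hχ hξ hη
  periodic x q := by
    have h1 : ((x + 1, q 0) : ℝ × Model n) = (x, q 0) + ((1 : ℝ), 0) := by simp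
    simp only [bracketFun, h1, testCovec_add_one hξ, testCovec_add_one hη,
      fderiv_periodic (testCovec_add_one hη), fderiv_periodic (fderiv_periodic (testCovec_add_one hη))]
  supp := tsupport χ
  isCompact_supp := hc
  supp_subset := hs
  eq_zero q hq := by
    rw [bracketFun, testCovec_eq_zero hq, zero_apply]

end Test

section Bracket

variable {n : ℕ} {M : Type*} [TopologicalSpace M] [T2Space M] [ChartedSpace (Model n) M]
  [IsManifold (𝓡 n) ∞ M] {e : OpenPartialHomeomorph M (Model n)} {χ : Model n → ℝ}
  {ξ η : ℝ → Dual n}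

theorem rep_variation_testDensity (he : e ∈ charts n M) (hχ : ContDiff ℝ ∞ χ)
    (hc : HasCompactSupport χ) (hs : tsupport χ ⊆ e.target) (hξ : SmoothPeriodic ξ)
    (u : Loop n M) {x : ℝ} (hx : x ∈ u.dom e) :
    ((testDensity hχ hc hs hξ).variation he u).rep e x = testCovec χ ξ (x, u.rep e x) := by
  rw [CompactDensity.rep_variation _ he u hx, CompactDensity.eulerLagrange]
  refine (Fin.sum_univ_one _).trans ?_
  simp only [Fin.val_zero, pow_zero, one_smul, iteratedDeriv_zero]
  rw [CompactDensity.partials, if_pos hx, jetDeriv_testDensity, jet_zero_apply]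

theorem deriv_rep_variation (he : e ∈ charts n M) (hχ : ContDiff ℝ ∞ χ)
    (hc : HasCompactSupport χ) (hs : tsupport χ ⊆ e.target) (hξ : SmoothPeriodic ξ)
    (u : Loop n M) {x : ℝ} (hx : x ∈ u.dom e) :
    deriv (((testDensity hχ hc hs hξ).variation he u).rep e) x
      = fderiv ℝ (testCovec χ ξ) (x, u.rep e x) (1, deriv (u.rep e) x) := by
  have h : ((testDensity hχ hc hs hξ).variation he u).rep e
      =ᶠ[nhds x] fun x => testCovec χ ξ (x, u.rep e x) := by
    filter_upwards [(u.isOpen_dom e).mem_nhds hx] with y hy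
      using rep_variation_testDensity he hχ hc hs hξ u hy
  rw [h.deriv_eq]
  exact (hasDerivAt_total (contDiff_testCovec hχ hξ)
    (differentiableAt_of_contDiffOn (u.isOpen_dom e) (u.contDiffOn_rep he) hx).hasDerivAt).deriv

theorem deriv_deriv_rep_variation (he : e ∈ charts n M) (hχ : ContDiff ℝ ∞ χ)
    (hc : HasCompactSupport χ) (hs : tsupport χ ⊆ e.target) (hξ : SmoothPeriodic ξ)
    (u : Loop n M) {x : ℝ} (hx : x ∈ u.dom e) :
    deriv (deriv (((testDensity hχ hc hs hξ).variation he u).rep e)) x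
      = fderiv ℝ (fderiv ℝ (testCovec χ ξ)) (x, u.rep e x) (1, deriv (u.rep e) x)
          (1, deriv (u.rep e) x)
        + fderiv ℝ (testCovec χ ξ) (x, u.rep e x) (0, deriv (deriv (u.rep e)) x) := by
  have h : deriv (((testDensity hχ hc hs hξ).variation he u).rep e)
      =ᶠ[nhds x] fun x => fderiv ℝ (testCovec χ ξ) (x, u.rep e x) (1, deriv (u.rep e) x) := by
    filter_upwards [(u.isOpen_dom e).mem_nhds hx] with y hy
      using deriv_rep_variation he hχ hc hs hξ u hy
  rw [h.deriv_eq]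
  have hu := (differentiableAt_of_contDiffOn (u.isOpen_dom e) (u.contDiffOn_rep he) hx).hasDerivAt
  have hu' := (differentiableAt_of_contDiffOn (u.isOpen_dom e)
    (contDiffOn_deriv (u.isOpen_dom e) (u.contDiffOn_rep he)) hx).hasDerivAt
  exact ((hasDerivAt_total ((contDiff_testCovec hχ hξ).fderiv_right (m := ∞) (by simp))
    hu).clm_apply ((hasDerivAt_const x (1 : ℝ)).prodMk hu')).deriv

/-- The bracket of two test functionals is again given by a compactly supported density, now of
order 2, and so has a variational derivative. The Jacobi axiom applies only to brackets for which
one is supplied. -/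
theorem bracket_testDensity {P : LoopOperator n M} {K : Coefficients n} (h : HasLocalForm P e K)
    (he : e ∈ charts n M) (hχ : ContDiff ℝ ∞ χ) (hc : HasCompactSupport χ)
    (hs : tsupport χ ⊆ e.target) (hξ : SmoothPeriodic ξ) (hη : SmoothPeriodic η) :
    bracket P (fun u => (testDensity hχ hc hs hξ).variation he u)
      (fun u => (testDensity hχ hc hs hη).variation he u)
      = (bracketDensity h.1 hχ hc hs hξ hη).functional := by
  funext u
  refine intervalIntegral.integral_congr fun x _ => ?_
  by_cases hx : x ∈ u.dom e
  · beta_reduce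
    rw [CompactDensity.eval, if_pos hx, pairing_eq _ _ he hx, h.rep_eq he u _ hx, OpCoeff.along,
      deriv_deriv_rep_variation he hχ hc hs hη u hx, deriv_rep_variation he hχ hc hs hη u hx,
      rep_variation_testDensity he hχ hc hs hη u hx, rep_variation_testDensity he hχ hc hs hξ u hx]
    simp [bracketDensity, bracketFun, jet, iteratedDeriv_succ]
  · beta_reduce
    rw [CompactDensity.eval, if_neg hx, CompactDensity.variation_eq_zero _ he u fun h =>
      hx (CompactDensity.suppAlong_subset _ u _ h)]
    rfl

end Bracket

/-! ### Consequences of the Poisson axioms for linear functionals -/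

section

variable {n : ℕ} {M : Type*} [TopologicalSpace M] [T2Space M] [ChartedSpace (Model n) M]
  [IsManifold (𝓡 n) ∞ M] {e : OpenPartialHomeomorph M (Model n)}

theorem CompactDensity.eval_add_one {m : ℕ} (f : CompactDensity n m e.target) (u : Loop n M)
    (x : ℝ) : f.eval u (x + 1) = f.eval u x := by
  simp only [CompactDensity.eval, jet_add_one (periodic_rep u), f.periodic]
  by_cases hx : x ∈ u.dom e
  · rw [if_pos hx, if_pos (Loop.coe_add_one_mem_dom.2 hx)]
  · rw [if_neg hx, if_neg fun h => hx (Loop.coe_add_one_mem_dom.1 h)]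

-- A density of order zero transforms to another chart by substitution of the coordinate change,
-- with no transformation of derivatives. This suffices, since only the test functionals themselves
-- have to be local functionals in the sense of the axioms.
open Classical in
theorem CompactDensity.isLocalFunctional (he : e ∈ charts n M) (f : CompactDensity n 0 e.target) :
    IsLocalFunctional (f.functional : Loop n M → ℝ) := by
  have hev : ∀ (u : Loop n M) (x : ℝ), f.eval u (Quotient.out (x : UnitAddCircle)) = f.eval u x :=
    fun u x => apply_out_of_periodic (fun y => f.eval_add_one u y) x
  refine ⟨0, fun u z => f.eval u (Quotient.out z), fun e' he' => ?_, fun u => ?_⟩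
  · refine ⟨fun q => if e'.symm (q.2 0) ∈ e.source then
      f.toFun (q.1, fun _ => coordChange e' e (q.2 0)) else 0, ?_, fun u x hx => ?_⟩
    · intro q hq
      refine ContDiffAt.contDiffWithinAt ?_
      have h0 : ContDiff ℝ ∞ fun q : ℝ × (Fin (0 + 1) → Model n) => q.2 0 := by fun_prop
      have hcont : ContinuousAt (fun q : ℝ × (Fin (0 + 1) → Model n) => e'.symm (q.2 0)) q :=
        (e'.continuousAt_symm hq).comp_of_eq h0.continuous.continuousAt rfl
      by_cases hS : e'.symm (q.2 0) ∈ e.symm '' f.supp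
      · have hs := f.image_supp_subset hS
        have h1 : ContDiffAt ℝ ∞ (fun q : ℝ × (Fin (0 + 1) → Model n) =>
            coordChange e' e (q.2 0)) q :=
          ContDiffAt.comp (g := coordChange e' e) q (contDiffAt_coordChange he' he hq hs)
            h0.contDiffAt
        have h2 : ContDiffAt ℝ ∞ (fun q : ℝ × (Fin (0 + 1) → Model n) =>
            (q.1, fun _ : Fin (0 + 1) => coordChange e' e (q.2 0))) q :=
          contDiffAt_fst.prodMk (contDiffAt_pi.2 fun _ => h1)
        refine ContDiffAt.congr_of_eventuallyEq (ContDiffAt.comp (g := f.toFun) q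
          (f.smooth.contDiffAt ((isOpen_jets e.open_target).mem_nhds ?_)) h2) ?_
        · exact e.map_source hs
        · filter_upwards [hcont.eventually_mem (e.open_source.mem_nhds hs)] with p hp
          exact if_pos hp
      · refine contDiffAt_const (c := (0 : ℝ)) |>.congr_of_eventuallyEq ?_
        filter_upwards [hcont.eventually_mem (f.isClosed_image_supp.isOpen_compl.mem_nhds hS)]
          with p hp
        split_ifs with hs
        · refine f.eq_zero _ fun hm => hp ⟨_, hm, ?_⟩
          exact e.left_inv hs
        · rfl
    · have h1 : e'.symm (e' (u (x : UnitAddCircle))) = u (x : UnitAddCircle) := e'.left_inv hx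
      refine (hev u x).trans ?_
      have h3 : iteratedDeriv (((0 : Fin (0 + 1)) : ℕ)) (fun s : ℝ => e' (u (s : UnitAddCircle))) x
          = e' (u (x : UnitAddCircle)) := by simp
      simp only [CompactDensity.eval, h3, h1]
      by_cases hxe : x ∈ u.dom e
      · rw [if_pos hxe, if_pos (show u (x : UnitAddCircle) ∈ e.source from hxe)]
        congr 2
        funext k
        have hk : k = 0 := Subsingleton.elim (α := Fin 1) _ _
        rw [hk, jet_zero_apply, coordChange, h1]
        rfl
      · rw [if_neg hxe, if_neg (show u (x : UnitAddCircle) ∉ e.source from hxe)]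
  · exact intervalIntegral.integral_congr fun x _ => (hev u x).symm

variable {P : LoopOperator n M} {K : Coefficients n} {χ : Model n → ℝ} {W : Set (Model n)}

theorem exists_cutoff {T : Set (Model n)} (hT : IsOpen T) {y : Model n} (hy : y ∈ T) :
    ∃ (χ : Model n → ℝ) (W : Set (Model n)), ContDiff ℝ ∞ χ ∧ HasCompactSupport χ ∧
      tsupport χ ⊆ T ∧ IsOpen W ∧ y ∈ W ∧ W ⊆ T ∧ ∀ z ∈ W, χ z = 1 := by
  obtain ⟨r, hr, hrT⟩ := Metric.nhds_basis_closedBall.mem_iff.1 (hT.mem_nhds hy)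
  let χ : ContDiffBump y := ⟨r / 2, r, by positivity, by linarith⟩
  refine ⟨χ, Metric.ball y (r / 2), χ.contDiff, χ.hasCompactSupport, ?_, Metric.isOpen_ball,
    Metric.mem_ball_self (by positivity), fun z hz => hrT ?_, fun z hz => ?_⟩
  · rw [χ.tsupport_eq]; exact hrT
  · exact Metric.ball_subset_closedBall (Metric.ball_subset_ball (by linarith) hz)
  · exact χ.one_of_mem_closedBall (Metric.ball_subset_closedBall hz)

theorem bracket_chartLoop (h : HasLocalForm P e K) (he : e ∈ charts n M) (hχ : ContDiff ℝ ∞ χ)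
    (hc : HasCompactSupport χ) (hs : tsupport χ ⊆ e.target) (hW : IsOpen W) (hWT : W ⊆ e.target)
    (hW1 : ∀ z ∈ W, χ z = 1) {ξ η : ℝ → Dual n} (hξ : SmoothPeriodic ξ) (hη : SmoothPeriodic η)
    {γ : ℝ → Model n} (hγ : SmoothPeriodic γ) (hγW : ∀ x, γ x ∈ W) :
    bracket P (fun u => (testDensity hχ hc hs hξ).variation he u)
      (fun u => (testDensity hχ hc hs hη).variation he u)
      (chartLoop he γ hγ fun x => hWT (hγW x))
      = ∫ x in (0 : ℝ)..1, ξ x ((K.toOp.cut χ).along γ η x) := by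
  set u := chartLoop he γ hγ fun x => hWT (hγW x)
  have hrep : u.rep e = γ := funext fun x => rep_chartLoop he hγ _ x
  have hdom : ∀ x, x ∈ u.dom e := mem_dom_chartLoop he hγ _
  have hcov : ∀ {ξ : ℝ → Dual n} (hξ : SmoothPeriodic ξ),
      ((testDensity hχ hc hs hξ).variation he u).rep e = ξ := fun hξ => funext fun x => by
    rw [rep_variation_testDensity he hχ hc hs hξ u (hdom x), hrep,
      testCovec_of_eventually_eq_one]
    filter_upwards [hW.mem_nhds (hγW x)] with z hz using hW1 z hz
  refine intervalIntegral.integral_congr fun x _ => ?_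
  beta_reduce
  rw [pairing_eq _ _ he (hdom x), h.rep_eq he u _ (hdom x), hcov, hcov, hrep]
  simp only [OpCoeff.along, OpCoeff.op, OpCoeff.cut, hW1 _ (hγW x), one_smul]

theorem along_cut (h : HasLocalForm P e K) (he : e ∈ charts n M) (hχ : ContDiff ℝ ∞ χ)
    (hc : HasCompactSupport χ) (hs : tsupport χ ⊆ e.target) (hW : IsOpen W) (hWT : W ⊆ e.target)
    (hW1 : ∀ z ∈ W, χ z = 1) {ξ : ℝ → Dual n} (hξ : SmoothPeriodic ξ)
    {γ : ℝ → Model n} (hγ : SmoothPeriodic γ) (hγW : ∀ x, γ x ∈ W) (x : ℝ) :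
    (P _ ((testDensity hχ hc hs hξ).variation he
      (chartLoop he γ hγ fun x => hWT (hγW x)))).rep e x = (K.toOp.cut χ).along γ ξ x := by
  set u := chartLoop he γ hγ fun x => hWT (hγW x)
  have hrep : u.rep e = γ := funext fun x => rep_chartLoop he hγ _ x
  have hdom : ∀ x, x ∈ u.dom e := mem_dom_chartLoop he hγ _
  have hcov : ((testDensity hχ hc hs hξ).variation he u).rep e = ξ := funext fun x => by
    rw [rep_variation_testDensity he hχ hc hs hξ u (hdom x), hrep,
      testCovec_of_eventually_eq_one]
    filter_upwards [hW.mem_nhds (hγW x)] with z hz using hW1 z hz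
  rw [h.rep_eq he u _ (hdom x), hcov, hrep]
  simp only [OpCoeff.along, OpCoeff.op, OpCoeff.cut, hW1 _ (hγW x), one_smul]

theorem IsPoisson.isSkewOn (hP : IsPoisson P) (h : HasLocalForm P e K) (he : e ∈ charts n M)
    (hχ : ContDiff ℝ ∞ χ) (hc : HasCompactSupport χ) (hs : tsupport χ ⊆ e.target) (hW : IsOpen W)
    (hWT : W ⊆ e.target) (hW1 : ∀ z ∈ W, χ z = 1) : (K.toOp.cut χ).IsSkewOn W := by
  intro γ hγ hγW ξ η hξ hη
  rw [← bracket_chartLoop h he hχ hc hs hW hWT hW1 hξ hη hγ hγW,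
    ← bracket_chartLoop h he hχ hc hs hW hWT hW1 hη hξ hγ hγW]
  exact hP.skew _ _ _ _ ((testDensity hχ hc hs hξ).isLocalFunctional he)
    ((testDensity hχ hc hs hη).isLocalFunctional he)
    ((testDensity hχ hc hs hξ).hasVariationalDerivative he)
    ((testDensity hχ hc hs hη).hasVariationalDerivative he) _

/-- The iterated bracket pairs the variational derivative of the inner bracket with `P ζ`, so it is
the derivative of the inner bracket along the variation `γ + ε P ζ`. Uniqueness of derivatives
identifies it with `bracketVar`. -/
theorem bracket_bracketDensity (hskew : (K.toOp.cut χ).IsSkewOn W) (h : HasLocalForm P e K)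
    (he : e ∈ charts n M)
    (hχ : ContDiff ℝ ∞ χ) (hc : HasCompactSupport χ) (hs : tsupport χ ⊆ e.target) (hW : IsOpen W)
    (hWT : W ⊆ e.target) (hW1 : ∀ z ∈ W, χ z = 1) {ξ η ζ : ℝ → Dual n} (hξ : SmoothPeriodic ξ)
    (hη : SmoothPeriodic η) (hζ : SmoothPeriodic ζ)
    {γ : ℝ → Model n} (hγ : SmoothPeriodic γ) (hγW : ∀ x, γ x ∈ W) :
    bracket P (fun u => (bracketDensity h.1 hχ hc hs hξ hη).variation he u)
      (fun u => (testDensity hχ hc hs hζ).variation he u)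
      (chartLoop he γ hγ fun x => hWT (hγW x))
      = (K.toOp.cut χ).bracketVar γ ((K.toOp.cut χ).along γ ζ) ξ η := by
  have hsm := h.1.isSmooth_cut hχ e.open_target hs
  set V := (K.toOp.cut χ).along γ ζ with hVd
  have hV : SmoothPeriodic V := hsm.along hγ hζ
  obtain ⟨δ, hδ, hmem⟩ := hγ.exists_damp_mem hV hW hγW
  have hfam : ∀ ε, SmoothPeriodic fun x => γ x + damp δ ε • V x := fun ε =>
    hγ.add (hV.const_smul _)
  have h1 := hskew.hasDerivAt_bracket hsm hW hγ hV hξ hη hδ hmem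
  set U : ℝ → Loop n M := fun ε => chartLoop he _ (hfam ε) fun x => hWT (hmem ε x) with hUd
  have hU0 : U 0 = chartLoop he γ hγ fun x => hWT (hγW x) := by
    ext x
    rw [hUd]
    simp only [chartLoop_apply, damp_zero, zero_smul, add_zero]
  have hU : ContMDiff 𝓘(ℝ, ℝ × ℝ) (𝓡 n) ∞ (fun q : ℝ × ℝ => U q.1 (q.2 : UnitAddCircle)) := by
    have h0 : ContDiff ℝ ∞ fun q : ℝ × ℝ => γ q.2 + damp δ q.1 • V q.2 :=
      (hγ.smooth.comp contDiff_snd).add (((contDiff_damp δ).comp contDiff_fst).smul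
        (hV.smooth.comp contDiff_snd))
    exact (contMDiffOn_symm_of_mem_maximalAtlas he).comp_contMDiff h0.contMDiff
      fun q => hWT (hmem q.1 q.2)
  have h2 := ((bracketDensity h.1 hχ hc hs hξ hη).hasVariationalDerivative he).hasDerivAt hU hU0
    (g := fun x => ((bracketDensity h.1 hχ hc hs hξ hη).variation he
      (chartLoop he γ hγ fun x => hWT (hγW x))).rep e x (V x)) fun x =>
      ⟨e, he, mem_dom_chartLoop he hγ _ x, V x, by
        have : (fun ε => (U ε).rep e x) = fun ε => γ x + damp δ ε • V x :=
          funext fun ε => rep_chartLoop he (hfam ε) _ x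
        rw [this]
        exact (((hasDerivAt_damp hδ).smul_const (V x)).const_add (γ x)).congr_deriv
          (one_smul ℝ _), rfl⟩
  rw [← bracket_testDensity h he hχ hc hs hξ hη] at h2
  have h3 : (fun ε => bracket P (fun u => (testDensity hχ hc hs hξ).variation he u)
      (fun u => (testDensity hχ hc hs hη).variation he u) (U ε))
      = fun ε => ∫ x in (0 : ℝ)..1,
        ξ x ((K.toOp.cut χ).along (fun x => γ x + damp δ ε • V x) η x) :=
    funext fun ε => bracket_chartLoop h he hχ hc hs hW hWT hW1 hξ hη (hfam ε) (hmem ε)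
  rw [h3] at h2
  rw [← h2.unique h1]
  refine intervalIntegral.integral_congr fun x _ => ?_
  beta_reduce
  rw [pairing_eq _ _ he (mem_dom_chartLoop he hγ _ x),
    along_cut h he hχ hc hs hW hWT hW1 hζ hγ hγW x]

theorem IsPoisson.isJacobiOn (hP : IsPoisson P) (h : HasLocalForm P e K) (he : e ∈ charts n M)
    (hχ : ContDiff ℝ ∞ χ) (hc : HasCompactSupport χ) (hs : tsupport χ ⊆ e.target) (hW : IsOpen W)
    (hWT : W ⊆ e.target) (hW1 : ∀ z ∈ W, χ z = 1) : (K.toOp.cut χ).IsJacobiOn W := by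
  intro γ hγ hγW ξ η ζ hξ hη hζ
  have hskew := hP.isSkewOn h he hχ hc hs hW hWT hW1
  have hB : ∀ {ξ η : ℝ → Dual n} (hξ : SmoothPeriodic ξ) (hη : SmoothPeriodic η),
      HasVariationalDerivative (bracket P (fun u => (testDensity hχ hc hs hξ).variation he u)
        (fun u => (testDensity hχ hc hs hη).variation he u))
        (fun u : Loop n M => (bracketDensity h.1 hχ hc hs hξ hη).variation he u) := by
    intro ξ η hξ hη
    rw [bracket_testDensity h he hχ hc hs hξ hη]
    exact CompactDensity.hasVariationalDerivative _ he
  rw [← bracket_bracketDensity hskew h he hχ hc hs hW hWT hW1 hξ hη hζ hγ hγW,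
    ← bracket_bracketDensity hskew h he hχ hc hs hW hWT hW1 hη hζ hξ hγ hγW,
    ← bracket_bracketDensity hskew h he hχ hc hs hW hWT hW1 hζ hξ hη hγ hγW]
  exact hP.jacobi _ _ _ _ _ _ _ _ _ ((testDensity hχ hc hs hξ).isLocalFunctional he)
    ((testDensity hχ hc hs hη).isLocalFunctional he)
    ((testDensity hχ hc hs hζ).isLocalFunctional he)
    ((testDensity hχ hc hs hξ).hasVariationalDerivative he)
    ((testDensity hχ hc hs hη).hasVariationalDerivative he)
    ((testDensity hχ hc hs hζ).hasVariationalDerivative he) (hB hξ hη) (hB hη hζ) (hB hζ hξ) _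

end

/-! ### The local relations between the coefficients -/

section

/-- The relations between the coefficients of a Hamiltonian operator on a coordinate domain. -/
structure OpCoeff.IsHamiltonianOn {n : ℕ} (c : OpCoeff n) (T : Set (Model n)) : Prop where
  skew : ∀ y ∈ T, ∀ p q, c.A y p q = - c.A y q p
  B_eq : ∀ y ∈ T, ∀ v p q, c.B y v p q = fderiv ℝ c.A y v p q + c.C₁ y v p q + c.C₁ y v q p
  symm : ∀ y ∈ T, ∀ p q r, c.C₁ y (c.sharp y r) q p = c.C₁ y (c.sharp y q) r p
  compat : ∀ y ∈ T, ∀ p q r,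
    fderiv ℝ c.A y (c.sharp y r) p q + c.C₁ y (c.sharp y r) q p - c.C₁ y (c.sharp y r) p q
      = fderiv ℝ c.A y (c.sharp y p) q r + c.C₁ y (c.sharp y p) r q - c.C₁ y (c.sharp y p) q r
  S_eq : ∀ y ∈ T, ∀ s p q v, 2 * c.S y (c.sharp y s) v p q
    = c.C₁ y (vecOf ((c.C₁ y v).flip q)) s p - c.C₁ y (vecOf ((c.C₁ y v).flip p)) s q
  symm_fderiv : ∀ y ∈ T, c.C₁ y = 0 → ∀ s p q v,
    fderiv ℝ c.C₁ y (c.sharp y s) v q p = fderiv ℝ c.C₁ y v (c.sharp y s) q p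

variable {n : ℕ} {M : Type*} [TopologicalSpace M] [T2Space M] [ChartedSpace (Model n) M]
  [IsManifold (𝓡 n) ∞ M] {e : OpenPartialHomeomorph M (Model n)}
  {P : LoopOperator n M} {K : Coefficients n}

/-- All six relations are local: near each point the coefficients agree with cut-off ones, to which
the results on linear functionals apply. -/
theorem IsPoisson.isHamiltonianOn (hP : IsPoisson P) (h : HasLocalForm P e K)
    (he : e ∈ charts n M) : K.toOp.IsHamiltonianOn e.target := by
  have key : ∀ y ∈ e.target, ∃ (c : OpCoeff n) (W : Set (Model n)), c.IsSmooth ∧ IsOpen W ∧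
      y ∈ W ∧ c.IsSkewOn W ∧ c.IsJacobiOn W ∧ K.toOp.A =ᶠ[nhds y] c.A ∧
      K.toOp.B y = c.B y ∧ K.toOp.C₂ y = c.C₂ y ∧ K.toOp.C₁ =ᶠ[nhds y] c.C₁ := by
    intro y hy
    obtain ⟨χ, W, hχ, hc, hs, hW, hyW, hWT, hW1⟩ := exists_cutoff e.open_target hy
    refine ⟨K.toOp.cut χ, W, h.1.isSmooth_cut hχ e.open_target hs, hW, hyW,
      hP.isSkewOn h he hχ hc hs hW hWT hW1, hP.isJacobiOn h he hχ hc hs hW hWT hW1, ?_, ?_, ?_, ?_⟩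
    · filter_upwards [hW.mem_nhds hyW] with z hz
      simp only [OpCoeff.cut, hW1 z hz, one_smul]
    · simp only [OpCoeff.cut, hW1 y hyW, one_smul]
    · simp only [OpCoeff.cut, hW1 y hyW, one_smul]
    · filter_upwards [hW.mem_nhds hyW] with z hz
      simp only [OpCoeff.cut, hW1 z hz, one_smul]
  refine ⟨fun y hy => ?_, fun y hy => ?_, fun y hy => ?_, fun y hy => ?_, fun y hy => ?_,
    fun y hy => ?_⟩ <;>
  obtain ⟨c, W, hc, hW, hyW, hskew, hjac, hA, hB, hC₂, hC₁⟩ := key y hy <;>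
  simp only [OpCoeff.S, OpCoeff.sharp, hA.self_of_nhds, hB, hC₂, hC₁.self_of_nhds,
    hA.fderiv_eq, hC₁.fderiv_eq]
  · exact hskew.skew_A hyW
  · exact hskew.B_eq hc hW hyW
  · exact hjac.symm hyW
  · exact hjac.compat hyW
  · exact hjac.S_eq hc hW hyW
  · exact hjac.symm_fderiv hc hW hyW

end

/-! ### Transformation laws of the coefficients -/

section

/-- At a stationary point the second-order chain rule loses its quadratic term. -/
theorem deriv_comp_of_deriv_eq_zero {n : ℕ} {F : Type*} [NormedAddCommGroup F] [NormedSpace ℝ F]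
    {f : Model n → F} {γ : ℝ → Model n} {x : ℝ} (hγ : ContDiff ℝ ∞ γ)
    (hf : ContDiffAt ℝ ∞ f (γ x)) (h0 : deriv γ x = 0) :
    deriv (fun t => f (γ t)) x = 0 ∧
      deriv (deriv fun t => f (γ t)) x = fderiv ℝ f (γ x) (deriv (deriv γ) x) := by
  have hd : ∀ᶠ t in nhds x, deriv (fun t => f (γ t)) t = fderiv ℝ f (γ t) (deriv γ t) := by
    have h1 : ∀ᶠ z in nhds (γ x), ContDiffAt ℝ 1 f z :=
      (hf.of_le (by norm_cast)).eventually (by simp)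
    filter_upwards [hγ.continuous.continuousAt.eventually h1] with t ht
    exact ((ht.differentiableAt (by simp)).hasFDerivAt.comp_hasDerivAt t
      (hasDerivAt_of_contDiff hγ t)).deriv
  have h2 : HasDerivAt (fun t => fderiv ℝ f (γ t)) (fderiv ℝ (fderiv ℝ f) (γ x) (deriv γ x)) x :=
    ((hf.fderiv_right (m := ∞) (by simp)).differentiableAt (by simp)).hasFDerivAt.comp_hasDerivAt x
      (hasDerivAt_of_contDiff hγ x)
  refine ⟨by rw [hd.self_of_nhds, h0, map_zero], ?_⟩
  rw [Filter.EventuallyEq.deriv_eq hd, (h2.clm_apply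
    (hasDerivAt_of_contDiff (contDiff_deriv hγ) x)).deriv, h0]
  simp

variable {n : ℕ} {M : Type*} [TopologicalSpace M] [T2Space M] [ChartedSpace (Model n) M]
  [IsManifold (𝓡 n) ∞ M] {e e' : OpenPartialHomeomorph M (Model n)}
  {P : LoopOperator n M} {K K' : Coefficients n}

theorem isOpen_overlap (e e' : OpenPartialHomeomorph M (Model n)) :
    IsOpen (e.target ∩ e.symm ⁻¹' e'.source) :=
  e.isOpen_inter_preimage_symm e'.open_source

/-- The loop `y + s (cos - 1) w` with small s is used; its acceleration at 0 is `-s (2π)² w`. -/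
theorem exists_smoothPeriodic_velocity {T : Set (Model n)} (hT : IsOpen T) {y : Model n}
    (hy : y ∈ T) (w : Model n) : ∃ (s : ℝ) (γ : ℝ → Model n), s ≠ 0 ∧ SmoothPeriodic γ ∧
      (∀ x, γ x ∈ T) ∧ γ 0 = y ∧ deriv γ 0 = 0 ∧ deriv (deriv γ) 0 = s • w := by
  have hV : SmoothPeriodic fun x => (Real.cos ((1 : ℕ) * (2 * Real.pi * x)) - 1) • w :=
    ((SmoothPeriodic.cos 1).sub (SmoothPeriodic.const 1)).smul_const w
  obtain ⟨s, hs, h⟩ := hV.exists_smul_mem hT hy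
  have hd : ∀ x : ℝ, HasDerivAt
      (fun x => y + s • ((Real.cos ((1 : ℕ) * (2 * Real.pi * x)) - 1) • w)) (s •
      ((-((1 : ℕ) * (2 * Real.pi)) * Real.sin ((1 : ℕ) * (2 * Real.pi * x))) • w)) x := fun x => by
    exact ((((hasDerivAt_cos_mul 1 x).sub_const 1).smul_const w).fun_const_smul s).const_add y
  have hd2 : HasDerivAt (fun x : ℝ => s •
      ((-((1 : ℕ) * (2 * Real.pi)) * Real.sin ((1 : ℕ) * (2 * Real.pi * x))) • w))
      (s • ((-((1 : ℕ) * (2 * Real.pi)) * ((1 : ℕ) * (2 * Real.pi) *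
        Real.cos ((1 : ℕ) * (2 * Real.pi * 0)))) • w)) 0 := by
    exact (((hasDerivAt_sin_mul 1 0).const_mul (-((1 : ℕ) * (2 * Real.pi)))).smul_const
      w).fun_const_smul s
  refine ⟨s * (-(2 * Real.pi) ^ 2), _, ?_, (SmoothPeriodic.const y).add
    ((SmoothPeriodic.const s).smul hV), h, ?_, ?_, ?_⟩
  · have := Real.pi_pos
    exact mul_ne_zero hs.ne' (neg_ne_zero.2 (by positivity))
  · simp
  · rw [(hd 0).deriv]; simp
  · rw [show deriv _ = _ from funext fun x => (hd x).deriv, hd2.deriv, smul_smul]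
    congr 1
    rw [mul_zero, mul_zero, Real.cos_zero]
    push_cast
    ring

theorem HasLocalForm.along_coordChange (h : HasLocalForm P e K) (h' : HasLocalForm P e' K')
    (he : e ∈ charts n M) (he' : e' ∈ charts n M) (u : Loop n M) (α : CovectorAlong u) {x : ℝ}
    (hx : x ∈ u.dom e) (hx' : x ∈ u.dom e') :
    K'.toOp.along (u.rep e') (α.rep e') x
      = fderiv ℝ (coordChange e e') (u.rep e x) (K.toOp.along (u.rep e) (α.rep e) x) := by
  rw [← h.rep_eq he u α hx, ← h'.rep_eq he' u α hx', VectorAlong.rep_coordChange _ he he' hx hx']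

section

variable (h : HasLocalForm P e K) (h' : HasLocalForm P e' K') (he : e ∈ charts n M)
  (he' : e' ∈ charts n M) {y : Model n} (hy : y ∈ e.target) (hy' : e.symm y ∈ e'.source)

include h h' he he' hy hy'

/-- The operator is applied along a constant loop to `cos · q`, whose second derivative at 0 is a
nonzero multiple of q. In the other chart the covector is multiplied by a constant matrix, so the
law is tensorial. -/
theorem HasLocalForm.A_coordChange (p q : Dual n) :
    K'.toOp.A (coordChange e e' y) p q = K.toOp.A y (p.comp (fderiv ℝ (coordChange e e') y))
      (q.comp (fderiv ℝ (coordChange e e') y)) := by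
  have hc : SmoothPeriodic fun _ : ℝ => y := SmoothPeriodic.const y
  let u := chartLoop he _ hc fun _ => hy
  have hu : ∀ x, x ∈ u.dom e := mem_dom_chartLoop he _ _
  have hu' : ∀ x, x ∈ u.dom e' := fun _ => hy'
  have hξ := (SmoothPeriodic.cos 1).smul_const q
  let α := chartCovector he' u hu' _ hξ
  have hrep : u.rep e = fun _ => y := funext fun x => rep_chartLoop he hc _ x
  have hrep' : u.rep e' = fun _ => coordChange e e' y := funext fun x => by
    rw [Loop.rep_coordChange u (hu x), hrep]
  have hα' : α.rep e' = fun x => Real.cos ((1 : ℕ) * (2 * Real.pi * x)) • q :=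
    funext fun x => rep_chartCovector he' u hu' hξ x
  have hα : α.rep e = fun x => Real.cos ((1 : ℕ) * (2 * Real.pi * x)) •
      q.comp (fderiv ℝ (coordChange e e') y) := funext fun x => by
    rw [CovectorAlong.rep_coordChange α he he' (hu x) (hu' x), hα', hrep]
    exact ContinuousLinearMap.smul_comp _ _ _
  have key := congrArg p (h.along_coordChange h' he he' u α (hu 0) (hu' 0))
  have hcd : ∀ r : Dual n, deriv (deriv fun x : ℝ =>
      Real.cos ((1 : ℕ) * (2 * Real.pi * x)) • r) 0 = (-(2 * Real.pi) ^ 2) • r := fun r => by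
    rw [(SmoothPeriodic.cos 1).deriv_smul_const, deriv_cos_mul,
      (((hasDerivAt_sin_mul 1 0).const_mul _).smul_const r).deriv]
    congr 1; simp; ring
  rw [hrep, hrep', hα, hα', OpCoeff.along_const, OpCoeff.along_const] at key
  beta_reduce at key
  rw [hcd, hcd, map_smul, map_smul, map_smul, map_smul, map_smul, OpCoeff.apply_sharp] at key
  have hpi := Real.pi_pos
  have := mul_left_cancel₀ (neg_ne_zero.2 (pow_ne_zero 2 (by positivity : 2 * Real.pi ≠ 0))) key
  rw [this, ← OpCoeff.apply_sharp]; rfl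

/-- A covector field that is constant in the second chart is used along a loop with a stationary
point. In the first chart this field has a second derivative, caused by the second derivative of the
coordinate change, on which the leading coefficient acts; this is the inhomogeneous term. -/
theorem HasLocalForm.C₁_coordChange (w : Model n) (p q : Dual n) :
    K'.toOp.C₁ (coordChange e e' y) (fderiv ℝ (coordChange e e') y w) p q
      = K.toOp.C₁ y w (p.comp (fderiv ℝ (coordChange e e') y))
          (q.comp (fderiv ℝ (coordChange e e') y))
        + K.toOp.A y (p.comp (fderiv ℝ (coordChange e e') y))
          (q.comp (fderiv ℝ (fderiv ℝ (coordChange e e')) y w)) := by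
  obtain ⟨s, γ, hs, hγ, hmem, h0, h1, h2⟩ :=
    exists_smoothPeriodic_velocity (isOpen_overlap e e') ⟨hy, hy'⟩ w
  let u := chartLoop he γ hγ fun x => (hmem x).1
  have hu : ∀ x, x ∈ u.dom e := mem_dom_chartLoop he _ _
  have hu' : ∀ x, x ∈ u.dom e' := fun x => (hmem x).2
  have hξ := SmoothPeriodic.const (F := Dual n) q
  let α := chartCovector he' u hu' _ hξ
  have hrep : u.rep e = γ := funext fun x => rep_chartLoop he hγ _ x
  have hrep' : u.rep e' = fun x => coordChange e e' (γ x) := funext fun x => by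
    rw [Loop.rep_coordChange u (hu x), hrep]
  have hα' : α.rep e' = fun x => q :=
    funext fun x => rep_chartCovector he' u hu' hξ x
  have hα : α.rep e = fun x => q.comp (fderiv ℝ (coordChange e e') (γ x)) := funext fun x => by
    rw [CovectorAlong.rep_coordChange α he he' (hu x) (hu' x), hα', hrep]
  have key := congrArg p (h.along_coordChange h' he he' u α (hu 0) (hu' 0))
  subst h0
  have hφ := contDiffAt_coordChange he he' hy hy'
  have hφ' := contDiffAt_fderiv_coordChange he he' hy hy'
  obtain ⟨d1, d2⟩ := deriv_comp_of_deriv_eq_zero hγ.smooth hφ h1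
  have hψ : ContDiffAt ℝ ∞ (fun z => q.comp (fderiv ℝ (coordChange e e') z)) (γ 0) :=
    contDiffAt_const.clm_comp hφ'
  obtain ⟨d3, d4⟩ := deriv_comp_of_deriv_eq_zero hγ.smooth hψ h1
  have hdψ : fderiv ℝ (fun z => q.comp (fderiv ℝ (coordChange e e') z)) (γ 0) w
      = q.comp (fderiv ℝ (fderiv ℝ (coordChange e e')) (γ 0) w) := by
    rw [((hasFDerivAt_const q _).clm_comp
      (hφ'.differentiableAt (by simp)).hasFDerivAt).fderiv]
    simp
  rw [hrep, hrep', hα, hα', OpCoeff.along, OpCoeff.along] at key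
  rw [h1, d1, d2, d3, d4, h2, map_smul, map_smul, hdψ, OpCoeff.apply_op] at key
  have key2 := key.trans (OpCoeff.apply_op _ _ _ _ _ _ _
    (p.comp (fderiv ℝ (coordChange e e') (γ 0))))
  simp only [map_zero, zero_apply, map_smul, smul_apply, smul_eq_mul, deriv_const', add_zero,
    zero_add] at key2
  refine mul_left_cancel₀ hs ?_
  linear_combination key2

end

end

/-! ### Coordinates adapted to a symmetric connection form at a point -/

section Quadratic

variable {n : ℕ}

/-- The polynomial map with value `0`, derivative `1` and second derivative `G` at `y`. -/
def quadMap (y : Model n) (G : Model n →L[ℝ] Model n →L[ℝ] Model n) (z : Model n) : Model n :=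
  (z - y) + (1 / 2 : ℝ) • G (z - y) (z - y)

variable {y : Model n} {G : Model n →L[ℝ] Model n →L[ℝ] Model n}

theorem hasFDerivAt_quadMap (hG : ∀ v w, G v w = G w v) (z : Model n) :
    HasFDerivAt (quadMap y G) (ContinuousLinearMap.id ℝ _ + G (z - y)) z := by
  have h1 : HasFDerivAt (fun z : Model n => z - y) (ContinuousLinearMap.id ℝ _) z :=
    (hasFDerivAt_id z).sub_const y
  have h2 := h1.add (((G.hasFDerivAt.comp z h1).clm_apply h1).fun_const_smul (1 / 2 : ℝ))
  refine h2.congr_fderiv ?_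
  ext1 v
  simp only [add_apply, smul_apply, ContinuousLinearMap.comp_apply, ContinuousLinearMap.flip_apply,
    ContinuousLinearMap.id_apply, Function.comp_apply, hG v (z - y)]
  rw [← two_smul ℝ (G (z - y) v), smul_smul]
  norm_num

theorem contDiff_quadMap : ContDiff ℝ ∞ (quadMap y G) := by
  have h1 : ContDiff ℝ ∞ fun z : Model n => z - y := contDiff_id.sub contDiff_const
  exact h1.add (((G.contDiff.comp h1).clm_apply h1).const_smul (1 / 2 : ℝ))

/-- Inverse function theorem at y, where the derivative is the identity. -/
theorem exists_quadChart (hG : ∀ v w, G v w = G w v) :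
    ∃ ψ : OpenPartialHomeomorph (Model n) (Model n), y ∈ ψ.source ∧
      (ψ : Model n → Model n) = quadMap y G ∧
      ContDiffOn ℝ ∞ ψ.symm ψ.target := by
  have hy : HasFDerivAt (quadMap y G)
      ((ContinuousLinearEquiv.refl ℝ (Model n) : Model n ≃L[ℝ] Model n) : Model n →L[ℝ] Model n) y := by
    refine (hasFDerivAt_quadMap hG y).congr_fderiv ?_
    ext1 v
    simp
  let ψ₀ := (contDiff_quadMap (y := y) (G := G)).contDiffAt.toOpenPartialHomeomorph (quadMap y G)
    hy (by simp : (∞ : WithTop ℕ∞) ≠ 0)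
  -- Restricting to the points with invertible derivative makes the inverse smooth on its whole
  -- domain, not only near the image of y.
  have hO : IsOpen {z : Model n | (ContinuousLinearMap.id ℝ (Model n) + G (z - y)).IsInvertible} := by
    have hc : Continuous fun z : Model n => ContinuousLinearMap.id ℝ (Model n) + G (z - y) := by
      fun_prop
    have : {L : Model n →L[ℝ] Model n | L.IsInvertible}
        = Set.range ((↑) : (Model n ≃L[ℝ] Model n) → Model n →L[ℝ] Model n) := by
      ext L; rfl
    exact (this ▸ ContinuousLinearEquiv.isOpen : IsOpen {L : Model n →L[ℝ] Model n |
      L.IsInvertible}).preimage hc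
  refine ⟨ψ₀.restrOpen _ hO, ⟨(contDiff_quadMap (y := y)
    (G := G)).contDiffAt.mem_toOpenPartialHomeomorph_source
    hy (by simp : (∞ : WithTop ℕ∞) ≠ 0), ?_⟩, rfl, fun z hz => ?_⟩
  · exact ⟨ContinuousLinearEquiv.refl ℝ _, by ext1 v; simp⟩
  · have hz' := (ψ₀.restrOpen _ hO).map_target hz
    obtain ⟨L, hL⟩ := hz'.2
    refine ((ψ₀.restrOpen _ hO).contDiffAt_symm hz (f₀' := L) ?_
      contDiff_quadMap.contDiffAt).contDiffWithinAt
    rw [hL]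
    exact hasFDerivAt_quadMap hG _

variable {M : Type*} [TopologicalSpace M] [ChartedSpace (Model n) M] [IsManifold (𝓡 n) ∞ M]
  {e : OpenPartialHomeomorph M (Model n)}

/-- Taking for G the Christoffel symbols at y, the transformation law shows that the symbols vanish
at that point in the new chart. The symmetry of G is needed for it to be a second derivative. -/
theorem exists_chart_quadMap (he : e ∈ charts n M) (hy : y ∈ e.target)
    (hG : ∀ v w, G v w = G w v) : ∃ e' ∈ charts n M, e.symm y ∈ e'.source ∧
      coordChange e e' =ᶠ[nhds y] quadMap y G := by
  obtain ⟨ψ, hyψ, hψ, hsm⟩ := exists_quadChart (y := y) hG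
  refine ⟨e ≫ₕ ψ, OpenPartialHomeomorph.mem_maximalAtlas_of_contMDiffOn _ ?_ ?_, ?_, ?_⟩
  · rw [OpenPartialHomeomorph.coe_trans, hψ]
    exact contDiff_quadMap.contMDiff.comp_contMDiffOn
      ((contMDiffOn_of_mem_maximalAtlas he).mono fun p hp => hp.1)
  · rw [OpenPartialHomeomorph.coe_trans_symm]
    exact (contMDiffOn_symm_of_mem_maximalAtlas he).comp
      (hsm.contMDiffOn.mono fun z hz => hz.1) fun z hz => hz.2
  · simpa [e.map_target hy, e.right_inv hy] using hyψ
  · filter_upwards [e.open_target.mem_nhds hy] with z hz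
    rw [coordChange, OpenPartialHomeomorph.coe_trans, Function.comp_apply, e.right_inv hz, hψ]

theorem fderiv_of_eventuallyEq_quadMap {φ : Model n → Model n} (hG : ∀ v w, G v w = G w v)
    (h : φ =ᶠ[nhds y] quadMap y G) :
    (fderiv ℝ φ =ᶠ[nhds y] fun z => ContinuousLinearMap.id ℝ (Model n) + G (z - y)) ∧
      fderiv ℝ (fderiv ℝ φ) =ᶠ[nhds y] fun _ => G := by
  have h1 : fderiv ℝ φ =ᶠ[nhds y] fun z => ContinuousLinearMap.id ℝ (Model n) + G (z - y) := by
    filter_upwards [h.fderiv (𝕜 := ℝ)] with z hz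
    rw [hz, (hasFDerivAt_quadMap hG z).fderiv]
  refine ⟨h1, ?_⟩
  filter_upwards [h1.fderiv (𝕜 := ℝ)] with z hz
  have h2 : HasFDerivAt (fun z : Model n => z - y) (ContinuousLinearMap.id ℝ _) z :=
    (hasFDerivAt_id z).sub_const y
  rw [hz]
  exact ((G.hasFDerivAt.comp z h2).const_add (ContinuousLinearMap.id ℝ (Model n))).fderiv.trans
    (ContinuousLinearMap.comp_id G)

end Quadratic

section

/-! ### Pairs of a bivector and a connection, given by their expressions in the charts -/

section Local

variable {n : ℕ}

theorem contDiffOn_flip {X F G H : Type*} [NormedAddCommGroup X] [NormedSpace ℝ X]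
    [NormedAddCommGroup F] [NormedSpace ℝ F] [NormedAddCommGroup G] [NormedSpace ℝ G]
    [NormedAddCommGroup H] [NormedSpace ℝ H] {L : X → F →L[ℝ] G →L[ℝ] H} {s : Set X}
    (hL : ContDiffOn ℝ ∞ L s) : ContDiffOn ℝ ∞ (fun x => (L x).flip) s :=
  (ContinuousLinearMap.flipₗᵢ ℝ F G H).contDiff.comp_contDiffOn hL

/-- Christoffel symbols at a point, as a bilinear map. -/
abbrev Chris (n : ℕ) : Type := Model n →L[ℝ] Model n →L[ℝ] Model n

/-- Raising an index with a bilinear form on covectors. -/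
def raise (a : Bil n) : Dual n →L[ℝ] Model n := vecOf.comp a.flip

theorem apply_raise (a : Bil n) (p q : Dual n) : p (raise a q) = a p q := by
  simp [raise, apply_vecOf]

theorem model_ext {v w : Model n} (h : ∀ p : Dual n, p v = p w) : v = w := by
  ext i
  exact h (proj i)

/-- An injective linear map between spaces of equal finite dimension. -/
theorem raise_isInvertible {a : Bil n} (ha : ∀ q, (∀ p, a p q = 0) → q = 0) :
    (raise a).IsInvertible := by
  have hinj : Function.Injective (raise a : Dual n →ₗ[ℝ] Model n) := by
    rw [injective_iff_map_eq_zero]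
    intro q hq
    refine ha q fun p => ?_
    rw [← apply_raise]
    exact (congrArg p hq).trans (map_zero p)
  have hfr : Module.finrank ℝ (Dual n) = Module.finrank ℝ (Model n) := by
    rw [← (LinearMap.toContinuousLinearMap (𝕜 := ℝ) (E := Model n) (F' := ℝ)).finrank_eq]
    exact Subspace.dual_finrank_eq
  refine ⟨(LinearMap.linearEquivOfInjective _ hinj hfr).toContinuousLinearEquiv, ?_⟩
  ext1 q
  rfl

/-- The covariant derivative of a bivector. -/
def nablaA (A : Model n → Bil n) (Γ : Model n → Chris n) (y v : Model n) (p q : Dual n) : ℝ :=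
  fderiv ℝ A y v p q + A y (p.comp (Γ y v)) q + A y p (q.comp (Γ y v))

/-- The curvature. -/
def curv (Γ : Model n → Chris n) (y v w z : Model n) : Model n :=
  fderiv ℝ Γ y v w z - fderiv ℝ Γ y w v z + Γ y v (Γ y w z) - Γ y w (Γ y v z)

end Local

variable (n : ℕ) (M : Type*) [TopologicalSpace M] [ChartedSpace (Model n) M]

/-- A non-degenerate bivector and a flat torsion-free connection which are compatible, in terms of
their expressions in all charts. -/
structure FlatPair where
  /-- the bivector -/
  A : OpenPartialHomeomorph M (Model n) → Model n → Bil n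
  /-- the Christoffel symbols -/
  Γ : OpenPartialHomeomorph M (Model n) → Model n → Chris n
  contDiffOn_A : ∀ e ∈ charts n M, ContDiffOn ℝ ∞ (A e) e.target
  contDiffOn_Γ : ∀ e ∈ charts n M, ContDiffOn ℝ ∞ (Γ e) e.target
  A_coordChange : ∀ e ∈ charts n M, ∀ e' ∈ charts n M, ∀ y ∈ e.target, e.symm y ∈ e'.source →
    ∀ p q, A e' (coordChange e e' y) p q = A e y (p.comp (fderiv ℝ (coordChange e e') y))
      (q.comp (fderiv ℝ (coordChange e e') y))
  Γ_coordChange : ∀ e ∈ charts n M, ∀ e' ∈ charts n M, ∀ y ∈ e.target, e.symm y ∈ e'.source →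
    ∀ v w, Γ e' (coordChange e e' y) (fderiv ℝ (coordChange e e') y v)
        (fderiv ℝ (coordChange e e') y w)
      = fderiv ℝ (coordChange e e') y (Γ e y v w) - fderiv ℝ (fderiv ℝ (coordChange e e')) y v w
  skew : ∀ e ∈ charts n M, ∀ y ∈ e.target, ∀ p q, A e y p q = - A e y q p
  nondeg : ∀ e ∈ charts n M, ∀ y ∈ e.target, ∀ q, (∀ p, A e y p q = 0) → q = 0
  symm : ∀ e ∈ charts n M, ∀ y ∈ e.target, ∀ v w, Γ e y v w = Γ e y w v
  flat : ∀ e ∈ charts n M, ∀ y ∈ e.target, ∀ v w z, curv (Γ e) y v w z = 0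
  compat : ∀ e ∈ charts n M, ∀ y ∈ e.target, ∀ p q r,
    nablaA (A e) (Γ e) y (raise (A e y) r) p q = nablaA (A e) (Γ e) y (raise (A e y) p) q r

variable {n M}

/-! ### The pair of a Hamiltonian operator -/

namespace OpCoeff

variable {c : OpCoeff n} {y : Model n} {T : Set (Model n)}

/-- The Christoffel symbols which are encoded in the coefficient of `uₓₓ`. -/
def Γ (c : OpCoeff n) (y : Model n) : Chris n :=
  ((ContinuousLinearMap.compL ℝ (Model n) (Dual n →L[ℝ] ℝ) (Model n) vecOf).comp
    (c.C₁ y).flip).comp (raise (c.A y)).inverse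

theorem apply_Γ (hy : (raise (c.A y)).IsInvertible) (p s : Dual n) (w : Model n) :
    p (c.Γ y (raise (c.A y) s) w) = c.C₁ y w s p := by
  simp [Γ, hy.inverse_apply_self, apply_vecOf]

theorem contDiffOn_Γ (hA : ContDiffOn ℝ ∞ c.A T) (hC : ContDiffOn ℝ ∞ c.C₁ T)
    (hT : ∀ y ∈ T, (raise (c.A y)).IsInvertible) : ContDiffOn ℝ ∞ c.Γ T := by
  have h1 : ContDiffOn ℝ ∞ (fun y => raise (c.A y)) T :=
    contDiffOn_const.clm_comp (contDiffOn_flip hA)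
  have h2 : ContDiffOn ℝ ∞ (fun y => (raise (c.A y)).inverse) T := fun y hy =>
    ContDiffAt.comp_contDiffWithinAt (g := ContinuousLinearMap.inverse) y
      (hT y hy).contDiffAt_map_inverse (h1 y hy)
  exact (contDiffOn_const.clm_comp (contDiffOn_flip hC)).clm_comp h2

/-- Every vector has the form `♯s`, and on such vectors the claim is the symmetry relation for `C₁`.
-/
theorem IsHamiltonianOn.symm_Γ (h : c.IsHamiltonianOn T) (hT : y ∈ T)
    (hy : (raise (c.A y)).IsInvertible) (v w : Model n) : c.Γ y v w = c.Γ y w v := by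
  obtain ⟨s, rfl⟩ := hy.surjective v
  obtain ⟨t, rfl⟩ := hy.surjective w
  refine model_ext fun p => ?_
  rw [apply_Γ hy, apply_Γ hy]
  exact h.symm y hT p s t

theorem IsHamiltonianOn.C₁_eq (h : c.IsHamiltonianOn T) (hT : y ∈ T)
    (hy : (raise (c.A y)).IsInvertible) (w : Model n) (p q : Dual n) :
    c.C₁ y w p q = - c.A y p (q.comp (c.Γ y w)) := by
  rw [← apply_Γ hy, h.skew y hT, neg_neg, ← apply_raise, h.symm_Γ hT hy]
  rfl

/-- This rewrites the compatibility relation between coefficients as the one for the covariant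
derivative of the bivector. -/
theorem IsHamiltonianOn.nablaA_eq (h : c.IsHamiltonianOn T) (hT : y ∈ T)
    (hy : (raise (c.A y)).IsInvertible) (v : Model n) (p q : Dual n) :
    nablaA c.A c.Γ y v p q = fderiv ℝ c.A y v p q + c.C₁ y v q p - c.C₁ y v p q := by
  rw [nablaA, h.C₁_eq hT hy, h.C₁_eq hT hy, h.skew y hT q]
  ring

end OpCoeff

end

/-! ### The flat torsion-free connection of a Hamiltonian operator -/

section

variable {n : ℕ} {M : Type*} [TopologicalSpace M] [T2Space M] [ChartedSpace (Model n) M]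
  [IsManifold (𝓡 n) ∞ M] {e e' : OpenPartialHomeomorph M (Model n)}
  {P : LoopOperator n M} {K K' : Coefficients n}

theorem Coefficients.eq_zero_of_toOp_A {y : Model n} (hK : (K.leading y).det ≠ 0) (q : Dual n)
    (hq : ∀ p, K.toOp.A y p q = 0) : q = 0 := by
  have h : (K.leading y).mulVec (fun j => q (single j (1 : ℝ))) = 0 := by
    funext i
    have := hq (proj i)
    rw [K.toOp_A, sum_sum_proj] at this
    exact this
  have h0 := Matrix.eq_zero_of_mulVec_eq_zero hK h
  ext v
  rw [clm_eq_sum_single q v]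
  simp [fun j => congrFun h0 j]

/-- The local form of an operator in a chart, with non-degenerate leading coefficient. -/
def IsLocalCoeff (P : LoopOperator n M) (e : OpenPartialHomeomorph M (Model n))
    (K : Coefficients n) : Prop :=
  HasLocalForm P e K ∧ ∀ y ∈ e.target, (K.leading y).det ≠ 0

theorem IsLocalCoeff.isInvertible (h : IsLocalCoeff P e K) {y : Model n} (hy : y ∈ e.target) :
    (raise (K.toOp.A y)).IsInvertible :=
  raise_isInvertible (K.eq_zero_of_toOp_A (h.2 y hy))

/-- Vectors are written as raised covectors pulled back from the second chart. The inhomogeneous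
term of the law for `C₁` is `A` applied to a second derivative; skewness of `A` turns it into minus
the second derivative at the raised covector. -/
theorem IsLocalCoeff.Γ_coordChange (h : IsLocalCoeff P e K) (h' : IsLocalCoeff P e' K')
    (hP : IsPoisson P) (he : e ∈ charts n M) (he' : e' ∈ charts n M) {y : Model n}
    (hy : y ∈ e.target) (hy' : e.symm y ∈ e'.source) (v w : Model n) :
    K'.toOp.Γ (coordChange e e' y) (fderiv ℝ (coordChange e e') y v)
        (fderiv ℝ (coordChange e e') y w)
      = fderiv ℝ (coordChange e e') y (K.toOp.Γ y v w)
        - fderiv ℝ (fderiv ℝ (coordChange e e')) y v w := by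
  have hinv := h.isInvertible hy
  have hinv' : (raise (K'.toOp.A (coordChange e e' y))).IsInvertible :=
    h'.isInvertible (e'.map_source hy')
  have hL : Function.Surjective fun p : Dual n => p.comp (fderiv ℝ (coordChange e e') y) := by
    intro p
    have := fderiv_coordChange_inv he he' (e.map_target hy) hy'
    rw [e.right_inv hy] at this
    refine ⟨p.comp (fderiv ℝ (coordChange e' e) (e' (e.symm y))), ?_⟩
    beta_reduce
    rw [ContinuousLinearMap.comp_assoc, this, ContinuousLinearMap.comp_id]
  obtain ⟨s, rfl⟩ := hinv.surjective v
  obtain ⟨s, rfl⟩ := hL s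
  have hr : fderiv ℝ (coordChange e e') y (raise (K.toOp.A y)
      (s.comp (fderiv ℝ (coordChange e e') y))) = raise (K'.toOp.A (coordChange e e' y)) s := by
    refine model_ext fun p => ?_
    rw [apply_raise, h.1.A_coordChange h'.1 he he' hy hy', ← apply_raise]
    rfl
  refine model_ext fun p => ?_
  beta_reduce
  rw [hr, OpCoeff.apply_Γ hinv', h.1.C₁_coordChange h'.1 he he' hy hy', map_sub]
  have h1 := OpCoeff.apply_Γ hinv (p.comp (fderiv ℝ (coordChange e e') y))
    (s.comp (fderiv ℝ (coordChange e e') y)) w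
  rw [← h1, (hP.isHamiltonianOn h.1 he).skew y hy, ← apply_raise,
    ((contDiffAt_coordChange he he' hy hy').isSymmSndFDerivAt (by simp; norm_cast)).eq _ w]
  simp only [ContinuousLinearMap.comp_apply]
  ring

theorem IsLocalCoeff.contDiffOn_Γ (h : IsLocalCoeff P e K) :
    ContDiffOn ℝ ∞ K.toOp.Γ e.target :=
  OpCoeff.contDiffOn_Γ h.1.1.contDiffOn_A h.1.1.contDiffOn_C₁ fun _ hy => h.isInvertible hy

/-- Where the Christoffel symbols vanish, their derivative is symmetric. -/
theorem IsLocalCoeff.fderiv_Γ_symm (h : IsLocalCoeff P e K) (hP : IsPoisson P)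
    (he : e ∈ charts n M) {y : Model n} (hy : y ∈ e.target) (h0 : K.toOp.Γ y = 0)
    (v w z : Model n) : fderiv ℝ K.toOp.Γ y v w z = fderiv ℝ K.toOp.Γ y w v z := by
  have hH := hP.isHamiltonianOn h.1 he
  have hT := e.open_target.mem_nhds hy
  have hinv := h.isInvertible hy
  have hC0 : K.toOp.C₁ y = 0 := by
    ext1 v; ext1 p; ext1 q
    rw [hH.C₁_eq hy hinv, h0]
    simp
  have hdΓ : HasFDerivAt K.toOp.Γ (fderiv ℝ K.toOp.Γ y) y :=
    ((h.contDiffOn_Γ.contDiffAt hT).differentiableAt (by simp)).hasFDerivAt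
  have hdC : HasFDerivAt K.toOp.C₁ (fderiv ℝ K.toOp.C₁ y) y :=
    ((h.1.1.contDiffOn_C₁.contDiffAt hT).differentiableAt (by simp)).hasFDerivAt
  have hdA : HasFDerivAt K.toOp.A (fderiv ℝ K.toOp.A y) y :=
    ((h.1.1.contDiffOn_A.contDiffAt hT).differentiableAt (by simp)).hasFDerivAt
  -- `C₁` is Γ evaluated on a raised covector; because Γ vanishes at y, the derivative of the
  -- raising map does not enter.
  have key : ∀ d b (s p : Dual n), fderiv ℝ K.toOp.C₁ y d b s p
      = p (fderiv ℝ K.toOp.Γ y d b (raise (K.toOp.A y) s)) := by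
    intro d b s p
    have h1 : (fun z => K.toOp.C₁ z b s p)
        =ᶠ[nhds y] fun z => p (K.toOp.Γ z b (raise (K.toOp.A z) s)) := by
      filter_upwards [hT] with z hz
      rw [hH.symm_Γ hz (h.isInvertible hz), OpCoeff.apply_Γ (h.isInvertible hz)]
    have h2 : HasFDerivAt (fun z => raise (K.toOp.A z) s) _ y :=
      ((hasFDerivAt_const (vecOf (n := n)) y).clm_apply
        (((ContinuousLinearMap.flipₗᵢ ℝ (Dual n) (Dual n) ℝ).toContinuousLinearEquiv
          |>.toContinuousLinearMap.hasFDerivAt.comp y hdA).clm_apply (hasFDerivAt_const s y)))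
    have h3 := (hasFDerivAt_const p y).clm_apply
      ((hdΓ.clm_apply (hasFDerivAt_const b y)).clm_apply h2)
    have h4 := (((hdC.clm_apply (hasFDerivAt_const b y)).clm_apply
      (hasFDerivAt_const s y)).clm_apply (hasFDerivAt_const p y))
    have h5 := congrArg (fun L : Model n →L[ℝ] ℝ => L d) ((h4.unique (h3.congr_of_eventuallyEq h1)))
    simpa [h0] using h5
  obtain ⟨s, rfl⟩ := hinv.surjective v
  obtain ⟨t, rfl⟩ := hinv.surjective z
  refine model_ext fun p => ?_
  rw [← key, ← key]
  have := hH.symm_fderiv y hy hC0 s p t w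
  exact this

/-- In a chart where the symbols vanish at the point, their derivative is symmetric in its first two
arguments. Expressed in the original chart this derivative is `∂Γ + ΓΓ`, so the symmetry is exactly
the vanishing of the curvature; that curvature is a tensor is not used. -/
theorem IsLocalCoeff.curv_eq_zero (h : IsLocalCoeff P e K) (hP : IsPoisson P)
    (hnd : IsNondegenerateDegreeTwo P) (he : e ∈ charts n M) {y : Model n} (hy : y ∈ e.target)
    (v w z : Model n) : curv K.toOp.Γ y v w z = 0 := by
  have hT := e.open_target.mem_nhds hy
  have hsymm := (hP.isHamiltonianOn h.1 he).symm_Γ hy (h.isInvertible hy)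
  obtain ⟨e', he', hy', hφ⟩ := exists_chart_quadMap he hy hsymm
  obtain ⟨K', h'⟩ := hnd e' he'
  have h' : IsLocalCoeff P e' K' := h'
  obtain ⟨d1, d2⟩ := fderiv_of_eventuallyEq_quadMap hsymm hφ
  -- The transformation law for the quadratic coordinate change, valid near y, so that it can be
  -- differentiated there.
  have hlaw : ∀ v w, (fun z => K'.toOp.Γ (coordChange e e' z) (v + K.toOp.Γ y (z - y) v)
        (w + K.toOp.Γ y (z - y) w)) =ᶠ[nhds y]
      fun z => K.toOp.Γ z v w + K.toOp.Γ y (z - y) (K.toOp.Γ z v w) - K.toOp.Γ y v w := by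
    intro v w
    filter_upwards [d1, d2, (isOpen_overlap e e').mem_nhds ⟨hy, hy'⟩] with z h1 h2 hz
    have := h.Γ_coordChange h' hP he he' hz.1 hz.2 v w
    rw [h1, h2] at this
    exact this
  have hy0 : coordChange e e' y ∈ e'.target := e'.map_source hy'
  have h0 : K'.toOp.Γ (coordChange e e' y) = 0 := by
    ext1 v; ext1 w
    have := (hlaw v w).self_of_nhds
    simpa using this
  -- Both sides of the law are differentiated at y. On the left only the derivative of the new
  -- symbols counts, because the symbols themselves are zero at the point.
  have hd : ∀ d v w, fderiv ℝ K'.toOp.Γ (coordChange e e' y) d v w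
      = fderiv ℝ K.toOp.Γ y d v w + K.toOp.Γ y d (K.toOp.Γ y v w) := by
    intro d v w
    have hs : HasFDerivAt (fun z : Model n => z - y) (ContinuousLinearMap.id ℝ _) y :=
      (hasFDerivAt_id y).sub_const y
    have hG : HasFDerivAt (fun z => K.toOp.Γ y (z - y)) _ y :=
      (K.toOp.Γ y).hasFDerivAt.comp y hs
    have hv : ∀ v, HasFDerivAt (fun z => v + K.toOp.Γ y (z - y) v) _ y := fun v =>
      (hG.clm_apply (hasFDerivAt_const v y)).const_add v
    have hΓ : HasFDerivAt K.toOp.Γ (fderiv ℝ K.toOp.Γ y) y :=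
      ((h.contDiffOn_Γ.contDiffAt hT).differentiableAt (by simp)).hasFDerivAt
    have hφd : HasFDerivAt (coordChange e e') (ContinuousLinearMap.id ℝ _) y := by
      have := ((contDiffAt_coordChange he he' hy hy').differentiableAt (by simp)).hasFDerivAt
      rw [d1.self_of_nhds] at this
      simpa using this
    have hΓ' : HasFDerivAt K'.toOp.Γ (fderiv ℝ K'.toOp.Γ (coordChange e e' y))
        (coordChange e e' y) :=
      ((h'.contDiffOn_Γ.contDiffAt (e'.open_target.mem_nhds hy0)).differentiableAt
        (by simp)).hasFDerivAt
    have hΓ'' : HasFDerivAt (fun z => K'.toOp.Γ (coordChange e e' z)) _ y := hΓ'.comp y hφd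
    have hl := (hΓ''.clm_apply (hv v)).clm_apply (hv w)
    have hvw : HasFDerivAt (fun z => K.toOp.Γ z v w) _ y :=
      (hΓ.clm_apply (hasFDerivAt_const v y)).clm_apply (hasFDerivAt_const w y)
    have hr := (hvw.add (hG.clm_apply hvw)).sub_const (K.toOp.Γ y v w)
    have := congrArg (fun L : Model n →L[ℝ] Model n => L d)
      (hl.unique (hr.congr_of_eventuallyEq (hlaw v w)))
    simpa [h0] using this
  have h1 := h'.fderiv_Γ_symm hP he' hy0 h0 v w z
  rw [hd, hd] at h1
  rw [curv, ← sub_eq_zero.2 h1]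
  abel

/-- The local form of an operator in a chart. -/
def localCoeff (P : LoopOperator n M) (e : OpenPartialHomeomorph M (Model n)) : OpCoeff n :=
  (@Classical.epsilon (Coefficients n) ⟨⟨0, 0, 0, 0⟩⟩ (IsLocalCoeff P e)).toOp

theorem exists_localCoeff (hnd : IsNondegenerateDegreeTwo P) (he : e ∈ charts n M) :
    ∃ K, IsLocalCoeff P e K ∧ localCoeff P e = K.toOp :=
  ⟨_, Classical.epsilon_spec (hnd e he), rfl⟩

/-- The bivector and the connection of a Hamiltonian operator. -/
def FlatPair.ofOperator (P : LoopOperator n M) (hnd : IsNondegenerateDegreeTwo P)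
    (hP : IsPoisson P) : FlatPair n M where
  A e := (localCoeff P e).A
  Γ e := (localCoeff P e).Γ
  contDiffOn_A e he := by
    obtain ⟨K, hK, h⟩ := exists_localCoeff hnd he
    rw [h]; exact hK.1.1.contDiffOn_A
  contDiffOn_Γ e he := by
    obtain ⟨K, hK, h⟩ := exists_localCoeff hnd he
    rw [h]; exact hK.contDiffOn_Γ
  A_coordChange e he e' he' y hy hy' p q := by
    obtain ⟨K, hK, h⟩ := exists_localCoeff hnd he
    obtain ⟨K', hK', h'⟩ := exists_localCoeff hnd he'
    rw [h, h']; exact hK.1.A_coordChange hK'.1 he he' hy hy' p q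
  Γ_coordChange e he e' he' y hy hy' v w := by
    obtain ⟨K, hK, h⟩ := exists_localCoeff hnd he
    obtain ⟨K', hK', h'⟩ := exists_localCoeff hnd he'
    rw [h, h']; exact hK.Γ_coordChange hK' hP he he' hy hy' v w
  skew e he y hy := by
    obtain ⟨K, hK, h⟩ := exists_localCoeff hnd he
    rw [h]; exact (hP.isHamiltonianOn hK.1 he).skew y hy
  nondeg e he y hy := by
    obtain ⟨K, hK, h⟩ := exists_localCoeff hnd he
    rw [h]; exact K.eq_zero_of_toOp_A (hK.2 y hy)
  symm e he y hy := by
    obtain ⟨K, hK, h⟩ := exists_localCoeff hnd he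
    rw [h]; exact (hP.isHamiltonianOn hK.1 he).symm_Γ hy (hK.isInvertible hy)
  flat e he y hy v w z := by
    obtain ⟨K, hK, h⟩ := exists_localCoeff hnd he
    rw [h]; exact hK.curv_eq_zero hP hnd he hy v w z
  compat e he y hy p q r := by
    obtain ⟨K, hK, h⟩ := exists_localCoeff hnd he
    have hH := hP.isHamiltonianOn hK.1 he
    rw [h, hH.nablaA_eq hy (hK.isInvertible hy), hH.nablaA_eq hy (hK.isInvertible hy)]
    exact hH.compat y hy p q r

end

section

open VectorField

/-! ### Vector fields in charts -/

variable {n : ℕ} {M : Type*} [TopologicalSpace M] [T2Space M] [ChartedSpace (Model n) M]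
  [IsManifold (𝓡 n) ∞ M] {e e' : OpenPartialHomeomorph M (Model n)} {p : M}

/-- The expression of a vector field in a chart. -/
def fieldRep (e : OpenPartialHomeomorph M (Model n)) (Y : ∀ p : M, TangentSpace (𝓡 n) p)
    (y : Model n) : Model n :=
  toModel e (e.symm y) (Y (e.symm y))

/-- The vector field with a given expression in a chart. -/
def fieldOf (e : OpenPartialHomeomorph M (Model n)) (V : Model n → Model n) (p : M) :
    TangentSpace (𝓡 n) p :=
  ofModel e p (V (e p))

theorem mfderiv_symm_isInvertible (he : e ∈ charts n M) {y : Model n} (hy : y ∈ e.target) :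
    (mfderiv (𝓡 n) (𝓡 n) e.symm y).IsInvertible :=
  ⟨(mdifferentiable_of_mem_charts he).symm.mfderiv hy, rfl⟩

/-- The expression in a chart is the pullback by the inverse chart. This transfers differentiability
and smoothness between sections of the tangent bundle and functions on the model space. -/
theorem mpullback_symm_eventuallyEq (he : e ∈ charts n M) (hp : p ∈ e.source)
    (Y : ∀ p : M, TangentSpace (𝓡 n) p) :
    (fun y => (mpullback (𝓡 n) (𝓡 n) e.symm Y y : Model n)) =ᶠ[nhds (e p)] fieldRep e Y := by
  filter_upwards [e.open_target.mem_nhds (e.map_source hp)] with y hy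
  have hinv := mfderiv_symm_isInvertible he hy
  obtain ⟨v, hv⟩ := hinv.surjective (Y (e.symm y))
  have h1 : mpullback (𝓡 n) (𝓡 n) e.symm Y y = v := by
    rw [mpullback_apply, ← hv]
    exact hinv.inverse_apply_self v
  refine h1.trans ?_
  rw [fieldRep, ← hv]
  exact (congrArg (fun L : Model n →L[ℝ] Model n => L v)
    ((mdifferentiable_of_mem_charts he).comp_symm_deriv hy)).symm

theorem differentiableAt_fieldRep (he : e ∈ charts n M) (hp : p ∈ e.source)
    {Y : ∀ p : M, TangentSpace (𝓡 n) p}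
    (hY : MDifferentiableAt (𝓡 n) ((𝓡 n).prod 𝓘(ℝ, Model n))
        (fun q : M => (⟨q, Y q⟩ : TangentBundle (𝓡 n) M)) p) :
    DifferentiableAt ℝ (fieldRep e Y) (e p) := by
  have hsymm : ContMDiffAt (𝓡 n) (𝓡 n) ∞ e.symm (e p) :=
    (contMDiffOn_symm_of_mem_maximalAtlas he).contMDiffAt
      (e.open_target.mem_nhds (e.map_source hp))
  have h1 : MDifferentiableAt (𝓡 n) ((𝓡 n).prod 𝓘(ℝ, Model n))
      (fun q : M => (⟨q, Y q⟩ : TangentBundle (𝓡 n) M)) (e.symm (e p)) := by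
    rwa [e.left_inv hp]
  have h2 := MDifferentiableAt.mpullback_vectorField h1 hsymm
    (mfderiv_symm_isInvertible he (e.map_source hp)) (by norm_cast)
  have h3 := ((contMDiff_snd_tangentBundle_modelSpace (Model n) 𝓘(ℝ, Model n)
    (n := 1)).contMDiffAt.mdifferentiableAt one_ne_zero).comp (e p) h2
  exact h3.differentiableAt.congr_of_eventuallyEq (mpullback_symm_eventuallyEq he hp Y).symm

theorem contDiffAt_fieldRep (he : e ∈ charts n M) (hp : p ∈ e.source)
    {Y : ∀ p : M, TangentSpace (𝓡 n) p}
    (hY : ContMDiffAt (𝓡 n) ((𝓡 n).prod 𝓘(ℝ, Model n)) ∞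
        (fun q : M => (⟨q, Y q⟩ : TangentBundle (𝓡 n) M)) p) :
    ContDiffAt ℝ ∞ (fieldRep e Y) (e p) := by
  have hsymm : ContMDiffAt (𝓡 n) (𝓡 n) ∞ e.symm (e p) :=
    (contMDiffOn_symm_of_mem_maximalAtlas he).contMDiffAt
      (e.open_target.mem_nhds (e.map_source hp))
  have h1 : ContMDiffAt (𝓡 n) ((𝓡 n).prod 𝓘(ℝ, Model n)) ∞
      (fun q : M => (⟨q, Y q⟩ : TangentBundle (𝓡 n) M)) (e.symm (e p)) := by
    rwa [e.left_inv hp]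
  have := ContMDiffAt.mpullback_vectorField_preimage h1 hsymm
    (mfderiv_symm_isInvertible he (e.map_source hp)) (by simp)
  exact (contMDiffAt_vectorSpace_iff_contDiffAt.1 this).congr_of_eventuallyEq
    (mpullback_symm_eventuallyEq he hp Y).symm

theorem contMDiffAt_fieldOf (he : e ∈ charts n M) (hp : p ∈ e.source) {V : Model n → Model n}
    (hV : ContDiffAt ℝ ∞ V (e p)) :
    ContMDiffAt (𝓡 n) ((𝓡 n).prod 𝓘(ℝ, Model n)) ∞
        (fun q : M => (⟨q, fieldOf e V q⟩ : TangentBundle (𝓡 n) M)) p := by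
  have h : ContMDiffAt (𝓡 n) (𝓡 n) ∞ e p :=
    (contMDiffOn_of_mem_maximalAtlas he).contMDiffAt (e.open_source.mem_nhds hp)
  exact ContMDiffAt.mpullback_vectorField_preimage
    (contMDiffAt_vectorSpace_iff_contDiffAt.2 hV) h (toModel_isInvertible he hp) (by simp)

theorem fieldRep_fieldOf (he : e ∈ charts n M) (V : Model n → Model n) {y : Model n}
    (hy : y ∈ e.target) : fieldRep e (fieldOf e V) y = V y := by
  rw [fieldRep, fieldOf, toModel_ofModel he (e.map_target hy), e.right_inv hy]

theorem fieldRep_coordChange (he : e ∈ charts n M) (he' : e' ∈ charts n M)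
    (Y : ∀ p : M, TangentSpace (𝓡 n) p) {y : Model n} (hy : y ∈ e.target)
    (hy' : e.symm y ∈ e'.source) :
    fieldRep e' Y (coordChange e e' y)
      = fderiv ℝ (coordChange e e') y (fieldRep e Y y) := by
  have h := toModel_apply he he' (e.map_target hy) hy' (Y (e.symm y))
  rw [e.right_inv hy] at h
  rw [fieldRep, coordChange, e'.left_inv hy']
  exact h

/-- The derivative of the expressions of a vector field, under a change of coordinates. -/
theorem fderiv_fieldRep_coordChange (he : e ∈ charts n M) (he' : e' ∈ charts n M)
    {Y : ∀ p : M, TangentSpace (𝓡 n) p} {y : Model n} (hy : y ∈ e.target)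
    (hy' : e.symm y ∈ e'.source) (hY : DifferentiableAt ℝ (fieldRep e Y) y)
    (hY' : DifferentiableAt ℝ (fieldRep e' Y) (coordChange e e' y)) (v : Model n) :
    fderiv ℝ (fieldRep e' Y) (coordChange e e' y) (fderiv ℝ (coordChange e e') y v)
      = fderiv ℝ (fderiv ℝ (coordChange e e')) y v (fieldRep e Y y)
        + fderiv ℝ (coordChange e e') y (fderiv ℝ (fieldRep e Y) y v) := by
  have h1 : (fun z => fieldRep e' Y (coordChange e e' z)) =ᶠ[nhds y]
      fun z => fderiv ℝ (coordChange e e') z (fieldRep e Y z) := by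
    filter_upwards [(isOpen_overlap e e').mem_nhds ⟨hy, hy'⟩] with z hz
    exact fieldRep_coordChange he he' Y hz.1 hz.2
  have h2 : HasFDerivAt (fun z => fieldRep e' Y (coordChange e e' z)) _ y :=
    hY'.hasFDerivAt.comp y
      ((contDiffAt_coordChange he he' hy hy').differentiableAt (by simp)).hasFDerivAt
  have h3 := ((contDiffAt_fderiv_coordChange he he' hy hy').differentiableAt
    (by simp)).hasFDerivAt.clm_apply hY.hasFDerivAt
  have := congrArg (fun L : Model n →L[ℝ] Model n => L v)
    (h2.unique (h3.congr_of_eventuallyEq h1))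
  simp only [ContinuousLinearMap.comp_apply, add_apply, ContinuousLinearMap.flip_apply] at this
  rw [this, add_comm]

/-- Such fields are pullbacks of constant fields, which commute. They allow the torsion to be read
off from the Christoffel symbols. -/
theorem mlieBracket_fieldOf_const (he : e ∈ charts n M) (hp : p ∈ e.source) (v w : Model n) :
    mlieBracket (𝓡 n) (fieldOf e fun _ => v) (fieldOf e fun _ => w) p = 0 := by
  have h : ContMDiffAt (𝓡 n) (𝓡 n) ∞ e p :=
    (contMDiffOn_of_mem_maximalAtlas he).contMDiffAt (e.open_source.mem_nhds hp)
  have hc : ∀ v : Model n, MDifferentiableAt (𝓡 n) ((𝓡 n).prod 𝓘(ℝ, Model n))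
      (fun y : Model n => (⟨y, v⟩ : TangentBundle (𝓡 n) (Model n))) (e p) := fun v =>
    (contMDiffAt_vectorSpace_iff_contDiffAt (n := 1) (V := fun _ => v).2
      contDiffAt_const).mdifferentiableAt one_ne_zero
  have : IsManifold (𝓡 n) (minSmoothness ℝ 2) M := by
    rw [minSmoothness_of_isRCLikeNormedField]
    exact IsManifold.of_le (n := ∞) (by norm_cast)
  have : IsManifold (𝓡 n) (minSmoothness ℝ 2) (Model n) := by
    rw [minSmoothness_of_isRCLikeNormedField]
    infer_instance
  have h0 : mlieBracket (𝓡 n) (fun y : Model n => (v : TangentSpace (𝓡 n) y))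
      (fun y : Model n => (w : TangentSpace (𝓡 n) y)) (e p) = 0 := by
    have hl : ∀ V W : (∀ y : Model n, TangentSpace 𝓘(ℝ, Model n) y),
        mlieBracket 𝓘(ℝ, Model n) V W (e p) = lieBracket ℝ V W (e p) := fun V W => by
      rw [← mlieBracketWithin_univ, mlieBracketWithin_eq_lieBracketWithin]
      exact congrFun (lieBracketWithin_univ (𝕜 := ℝ) (V := V) (W := W)) (e p)
    refine (hl _ _).trans (?_ : (lieBracket ℝ (fun _ => v) (fun _ => w) (e p) : Model n) = 0)
    simp [lieBracket]
  have h2 : minSmoothness ℝ 2 ≤ (∞ : WithTop ℕ∞) := by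
    rw [minSmoothness_of_isRCLikeNormedField]
    norm_cast
  exact (mpullback_mlieBracket (hc v) (hc w) h h2).symm.trans
    ((congrArg (mfderiv (𝓡 n) (𝓡 n) e p).inverse h0).trans (map_zero _))

end

section

open VectorField

/-! ### The connection with given Christoffel symbols -/

variable {n : ℕ} {M : Type*} [TopologicalSpace M] [T2Space M] [ChartedSpace (Model n) M]
  [IsManifold (𝓡 n) ∞ M] {e e' : OpenPartialHomeomorph M (Model n)} {p : M}

/-- The vector field `Y` is differentiable at `p`. -/
abbrev FieldDiffAt (Y : ∀ p : M, TangentSpace (𝓡 n) p) (p : M) : Prop :=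
  MDifferentiableAt (𝓡 n) ((𝓡 n).prod 𝓘(ℝ, Model n))
    (fun q : M => (⟨q, Y q⟩ : TangentBundle (𝓡 n) M)) p

/-- The covariant derivative of a vector field in a chart. -/
def covRep (G : Model n → Chris n) (V : Model n → Model n) (y : Model n) : Model n →L[ℝ] Model n :=
  fderiv ℝ V y + (G y).flip (V y)

/-- The covariant derivative of a vector field, computed in a chart. -/
def covForm (e : OpenPartialHomeomorph M (Model n)) (G : Model n → Chris n)
    (Y : ∀ p : M, TangentSpace (𝓡 n) p) (p : M) :
    TangentSpace (𝓡 n) p →L[ℝ] TangentSpace (𝓡 n) p :=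
  ((ofModel e p).comp ((covRep G (fieldRep e Y) (e p)).comp (toModel e p)) : Model n →L[ℝ] Model n)

theorem toModel_covForm (he : e ∈ charts n M) (hp : p ∈ e.source) (G : Model n → Chris n)
    (Y : ∀ p : M, TangentSpace (𝓡 n) p) (X : Model n) :
    toModel e p (covForm e G Y p X) = covRep G (fieldRep e Y) (e p) (toModel e p X) :=
  toModel_ofModel he hp _

theorem toModel_injective (he : e ∈ charts n M) (hp : p ∈ e.source) :
    Function.Injective (toModel e p) := fun v w h => by
  rw [← ofModel_toModel he hp v, h, ofModel_toModel he hp]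

theorem covForm_add (he : e ∈ charts n M) (hp : p ∈ e.source) (G : Model n → Chris n)
    {Y Z : ∀ p : M, TangentSpace (𝓡 n) p} (hY : FieldDiffAt Y p) (hZ : FieldDiffAt Z p) :
    covForm e G (Y + Z) p = covForm e G Y p + covForm e G Z p := by
  ext X
  refine toModel_injective he hp ?_
  have h : fieldRep e (Y + Z) = fun y => fieldRep e Y y + fieldRep e Z y :=
    funext fun y => map_add (toModel e (e.symm y)) (Y _) (Z _)
  have h1 : covRep G (fieldRep e (Y + Z)) (e p)
      = covRep G (fieldRep e Y) (e p) + covRep G (fieldRep e Z) (e p) := by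
    rw [h]
    simp only [covRep, fderiv_fun_add (differentiableAt_fieldRep he hp hY)
      (differentiableAt_fieldRep he hp hZ), map_add]
    abel
  refine (toModel_covForm he hp G _ X).trans ?_
  rw [h1]
  exact (congrArg₂ (· + ·) (toModel_covForm he hp G Y X) (toModel_covForm he hp G Z X)).symm.trans
    (map_add (toModel e p) _ _).symm

theorem fderiv_comp_symm (he : e ∈ charts n M) (hp : p ∈ e.source) {g : M → ℝ}
    (hg : MDifferentiableAt (𝓡 n) 𝓘(ℝ, ℝ) g p) :
    ∃ L : Dual n, HasFDerivAt (fun y => g (e.symm y)) L (e p) ∧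
      ∀ X : Model n, L (toModel e p X) = mvfderiv (𝓡 n) g p X := by
  have h1 : MDifferentiableAt (𝓡 n) 𝓘(ℝ, ℝ) (fun y => g (e.symm y)) (e p) :=
    MDifferentiableAt.comp (e p) (by rwa [e.left_inv hp])
      ((mdifferentiable_of_mem_charts he).symm.mdifferentiableAt (e.map_source hp))
  have h2 : g =ᶠ[nhds p] (fun y => g (e.symm y)) ∘ e := by
    filter_upwards [e.open_source.mem_nhds hp] with q hq
    simp [e.left_inv hq]
  have h3 := h2.mfderiv_eq (I := 𝓡 n) (I' := 𝓘(ℝ, ℝ))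
  rw [mfderiv_comp p h1 ((mdifferentiable_of_mem_charts he).mdifferentiableAt hp),
    mfderiv_eq_fderiv] at h3
  have h4 : (mvfderiv (𝓡 n) g p : Model n →L[ℝ] ℝ)
      = (fderiv ℝ (fun y => g (e.symm y)) (e p)).comp (toModel e p) := h3
  exact ⟨_, h1.differentiableAt.hasFDerivAt,
    fun X => (congrArg (fun L : Model n →L[ℝ] ℝ => L X) h4).symm⟩

theorem covForm_smul (he : e ∈ charts n M) (hp : p ∈ e.source) (G : Model n → Chris n)
    {Y : ∀ p : M, TangentSpace (𝓡 n) p} {g : M → ℝ} (hY : FieldDiffAt Y p)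
    (hg : MDifferentiableAt (𝓡 n) 𝓘(ℝ, ℝ) g p) :
    covForm e G (g • Y) p = g p • covForm e G Y p + (mvfderiv (𝓡 n) g p).smulRight (Y p) := by
  ext X
  refine toModel_injective he hp ?_
  have h : fieldRep e (g • Y) = fun y => g (e.symm y) • fieldRep e Y y :=
    funext fun y => map_smul (toModel e (e.symm y)) (g _) (Y _)
  obtain ⟨L, hL, hLX⟩ := fderiv_comp_symm he hp hg
  have h1 := hL.fun_smul (differentiableAt_fieldRep he hp hY).hasFDerivAt
  refine (toModel_covForm he hp G _ X).trans ?_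
  have h2 : covRep G (fieldRep e (g • Y)) (e p) (toModel e p X)
      = g p • covRep G (fieldRep e Y) (e p) (toModel e p X)
        + (mvfderiv (𝓡 n) g p : Model n →L[ℝ] ℝ) X • fieldRep e Y (e p) := by
    rw [h]
    simp only [covRep, add_apply, h1.fderiv, ContinuousLinearMap.flip_apply, smul_apply,
      ContinuousLinearMap.smulRight_apply, map_smul, e.left_inv hp, smul_add]
    refine Eq.trans ?_ (congrArg (fun t : ℝ => _ + t • fieldRep e Y (e p)) (hLX X))
    beta_reduce
    abel
  have h3 : fieldRep e Y (e p) = toModel e p (Y p) := by rw [fieldRep, e.left_inv hp]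
  rw [h2, h3]
  refine Eq.symm ((map_add (toModel e p) _ _).trans ?_)
  exact congrArg₂ (· + ·) ((map_smul (toModel e p) _ _).trans
    (congrArg (g p • ·) (toModel_covForm he hp G Y X))) (map_smul (toModel e p) _ _)

/-- Christoffel symbols in all charts, with the transformation law of a connection. -/
structure IsChris (Γ : OpenPartialHomeomorph M (Model n) → Model n → Chris n) : Prop where
  smooth : ∀ e ∈ charts n M, ContDiffOn ℝ ∞ (Γ e) e.target
  law : ∀ e ∈ charts n M, ∀ e' ∈ charts n M, ∀ y ∈ e.target, e.symm y ∈ e'.source →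
    ∀ v w, Γ e' (coordChange e e' y) (fderiv ℝ (coordChange e e') y v)
        (fderiv ℝ (coordChange e e') y w)
      = fderiv ℝ (coordChange e e') y (Γ e y v w) - fderiv ℝ (fderiv ℝ (coordChange e e')) y v w

variable {Γ : OpenPartialHomeomorph M (Model n) → Model n → Chris n}

/-- The second derivative of the coordinate change that appears when the components of the field are
differentiated cancels against the inhomogeneous term of the law for the symbols. -/
theorem IsChris.covForm_eq (hΓ : IsChris Γ) (he : e ∈ charts n M) (he' : e' ∈ charts n M)
    (hp : p ∈ e.source) (hp' : p ∈ e'.source) {Y : ∀ p : M, TangentSpace (𝓡 n) p}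
    (hY : FieldDiffAt Y p) : covForm e (Γ e) Y p = covForm e' (Γ e') Y p := by
  ext X
  refine toModel_injective he' hp' ?_
  refine Eq.trans ?_ (toModel_covForm he' hp' _ Y X).symm
  refine (toModel_apply he he' hp hp' (covForm e (Γ e) Y p X)).trans ?_
  have hy' : e.symm (e p) ∈ e'.source := by rwa [e.left_inv hp]
  have hc : coordChange e e' (e p) = e' p := by rw [coordChange, e.left_inv hp]
  have h1 := fderiv_fieldRep_coordChange he he' (e.map_source hp) hy'
    (differentiableAt_fieldRep he hp hY) (by
      rw [hc]; exact differentiableAt_fieldRep he' hp' hY) (toModel e p X)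
  have h2 := hΓ.law e he e' he' _ (e.map_source hp) hy' (toModel e p X)
    (fieldRep e Y (e p))
  rw [← fieldRep_coordChange he he' Y (e.map_source hp) hy'] at h2
  rw [hc] at h1 h2
  rw [← toModel_apply he he' hp hp' X] at h1 h2
  refine (congrArg _ (toModel_covForm he hp _ Y X)).trans ?_
  simp only [covRep, add_apply, ContinuousLinearMap.flip_apply, map_add]
  rw [h1, h2]
  abel

open Classical in
/-- The covariant derivative with given Christoffel symbols. -/
def covOf (Γ : OpenPartialHomeomorph M (Model n) → Model n → Chris n)
    (Y : ∀ p : M, TangentSpace (𝓡 n) p) (p : M) :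
    TangentSpace (𝓡 n) p →L[ℝ] TangentSpace (𝓡 n) p :=
  -- The default value 0 is the normalization demanded of a `Connection`.
  if FieldDiffAt Y p then covForm (chartAt (Model n) p) (Γ (chartAt (Model n) p)) Y p else 0

theorem IsChris.covOf_eq (hΓ : IsChris Γ) (he : e ∈ charts n M) (hp : p ∈ e.source)
    {Y : ∀ p : M, TangentSpace (𝓡 n) p} (hY : FieldDiffAt Y p) :
    covOf Γ Y p = covForm e (Γ e) Y p := by
  rw [covOf, if_pos hY]
  exact hΓ.covForm_eq (chartAt_mem_charts p) he (mem_chart_source _ p) hp hY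

/-- In the trivialization at p the endomorphism becomes `covRep` in the chart at p, which is smooth
because the symbols and the components of the field are. -/
theorem IsChris.contMDiffAt_covOf (hΓ : IsChris Γ) {Y : ∀ p : M, TangentSpace (𝓡 n) p}
    (hY : ContMDiff (𝓡 n) ((𝓡 n).prod 𝓘(ℝ, Model n)) ∞
      (fun q : M => (⟨q, Y q⟩ : TangentBundle (𝓡 n) M))) (p : M) :
    ContMDiffAt (𝓡 n) ((𝓡 n).prod 𝓘(ℝ, Model n →L[ℝ] Model n)) ∞
      (fun q : M => (⟨q, covOf Γ Y q⟩ : Bundle.TotalSpace (Model n →L[ℝ] Model n)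
        fun q : M => TangentSpace (𝓡 n) q →L[ℝ] TangentSpace (𝓡 n) q)) p := by
  have he := chartAt_mem_charts (n := n) p
  have hp := mem_chart_source (Model n) p
  rw [contMDiffAt_hom_bundle]
  refine ⟨contMDiffAt_id, ?_⟩
  have hV := contDiffAt_fieldRep he hp (hY p)
  have hcov : ContDiffAt ℝ ∞ (covRep (Γ (chartAt (Model n) p)) (fieldRep (chartAt (Model n) p) Y))
      (chartAt (Model n) p p) := by
    have hG := (hΓ.smooth _ he).contDiffAt
      ((chartAt (Model n) p).open_target.mem_nhds (mem_chart_target (Model n) p))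
    have hf := (ContinuousLinearMap.flipₗᵢ ℝ (Model n) (Model n) (Model n)).contDiff.contDiffAt.comp
      (chartAt (Model n) p p) hG
    exact (hV.fderiv_right (m := ∞) (by simp)).add (hf.clm_apply hV)
  have h1 : ContMDiffAt (𝓡 n) 𝓘(ℝ, Model n →L[ℝ] Model n) ∞ (fun q =>
      covRep (Γ (chartAt (Model n) p)) (fieldRep (chartAt (Model n) p) Y)
        (chartAt (Model n) p q)) p :=
    hcov.contMDiffAt.comp p (contMDiffAt_of_mem_maximalAtlas he hp)
  refine h1.congr_of_eventuallyEq ?_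
  filter_upwards [(chartAt (Model n) p).open_source.mem_nhds hp] with q hq
  have hb : q ∈ (trivializationAt (Model n) (TangentSpace (𝓡 n) : M → Type) p).baseSet := hq
  have hT : (trivializationAt (Model n) (TangentSpace (𝓡 n)) p).continuousLinearMapAt ℝ q
      = toModel (chartAt (Model n) p) q :=
    TangentBundle.continuousLinearMapAt_trivializationAt hq
  ext1 v
  rw [hΓ.covOf_eq he hq ((hY q).mdifferentiableAt (by simp))]
  set w := (trivializationAt (Model n) (TangentSpace (𝓡 n) : M → Type) p).symmL ℝ q v with hw
  have h2 : toModel (chartAt (Model n) p) q w = v :=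
    (congrArg (fun L : Model n →L[ℝ] Model n => L w) hT).symm.trans
      ((trivializationAt (Model n) (TangentSpace (𝓡 n) : M → Type) p).continuousLinearMapAt_symmL
        hb v)
  have h3 := toModel_covForm he hq (Γ (chartAt (Model n) p)) Y w
  rw [h2] at h3
  refine Eq.trans ?_ h3
  exact congrArg (fun L : Model n →L[ℝ] Model n => L (covForm _ _ Y q w)) hT

/-- The connection with given Christoffel symbols. -/
def IsChris.connection (hΓ : IsChris Γ) : Connection n M where
  cov :=
    { toFun := covOf Γ
      isCovariantDerivativeOnUniv :=
        { add := fun {Y Z p} hY hZ _ => by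
            have hp := mem_chart_source (Model n) p
            have he := chartAt_mem_charts (n := n) p
            rw [hΓ.covOf_eq he hp hY, hΓ.covOf_eq he hp hZ,
              hΓ.covOf_eq he hp (mdifferentiableAt_add_section hY hZ)]
            exact covForm_add he hp _ hY hZ
          leibniz := fun {Y g p} hY hg _ => by
            have hp := mem_chart_source (Model n) p
            have he := chartAt_mem_charts (n := n) p
            rw [hΓ.covOf_eq he hp hY, hΓ.covOf_eq he hp (hg.smul_section hY)]
            exact covForm_smul he hp _ hY hg } }
  smooth := ⟨⟨fun {Y} hY p _ => (hΓ.contMDiffAt_covOf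
    (contMDiffOn_univ.1 (hY.of_le (by simp))) p).contMDiffWithinAt⟩⟩
  eq_zero_of_not_differentiable Y p h := if_neg h

end

section

open VectorField

/-! ### The Christoffel symbols of a connection -/

variable {n : ℕ} {M : Type*} [TopologicalSpace M] [T2Space M] [ChartedSpace (Model n) M]
  [IsManifold (𝓡 n) ∞ M] {e e' : OpenPartialHomeomorph M (Model n)} {p : M}

/-- The Christoffel symbols as a bilinear map. -/
def Connection.chris (D : Connection n M) (e : OpenPartialHomeomorph M (Model n)) (y : Model n) :
    Chris n :=
  ∑ i, ∑ j, ∑ k, D.christoffel e i j k y • (proj i : Dual n).smulRight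
    ((proj j : Dual n).smulRight (single k (1 : ℝ)))

theorem Connection.chris_apply (D : Connection n M) (y v w : Model n) :
    D.chris e y v w = ∑ i, ∑ j, ∑ k, (D.christoffel e i j k y * v i * w j) •
      single k (1 : ℝ) := by
  simp only [Connection.chris, sum_apply, smul_apply, ContinuousLinearMap.smulRight_apply,
    PiLp.proj_apply, smul_smul, mul_assoc]

theorem Connection.chris_single (D : Connection n M) (y : Model n) (i j k : Fin n) :
    D.chris e y (single i 1) (single j 1) k
      = D.christoffel e i j k y := by
  rw [D.chris_apply]
  simp [Pi.single_apply]

theorem fieldRep_eventuallyEq (he : e ∈ charts n M) (V : Model n → Model n) {y : Model n}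
    (hy : y ∈ e.target) : fieldRep e (fieldOf e V) =ᶠ[nhds y] V := by
  filter_upwards [e.open_target.mem_nhds hy] with z hz
  exact fieldRep_fieldOf he V hz

theorem covRep_fieldOf_const (he : e ∈ charts n M) (G : Model n → Chris n) {y : Model n}
    (hy : y ∈ e.target) (v w : Model n) :
    covRep G (fieldRep e (fieldOf e fun _ => w)) y v = G y v w := by
  rw [covRep, (fieldRep_eventuallyEq he _ hy).fderiv_eq, fieldRep_fieldOf he _ hy]
  simp

theorem fieldDiffAt_fieldOf_const (he : e ∈ charts n M) (hp : p ∈ e.source) (w : Model n) :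
    FieldDiffAt (fieldOf e fun _ => w) p :=
  (contMDiffAt_fieldOf he hp contDiffAt_const).mdifferentiableAt (by simp)

/-- In a chart, a connection is given by its Christoffel symbols. -/
theorem Connection.toModel_cov (D : Connection n M) (he : e ∈ charts n M) {y : Model n}
    (hy : y ∈ e.target) {Y : ∀ p : M, TangentSpace (𝓡 n) p} (hY : FieldDiffAt Y (e.symm y))
    (X : Model n) : toModel e (e.symm y) (D.cov Y (e.symm y) X)
      = covRep (D.chris e) (fieldRep e Y) y (toModel e (e.symm y) X) := by
  have hp := e.map_target hy
  -- The connection with zero symbols in this chart serves for comparison.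
  have h0 : IsCovariantDerivativeOn (Model n) (covForm (n := n) (M := M) e fun _ => 0) e.source :=
    { add := fun hY hZ hp => covForm_add he hp _ hY hZ
      leibniz := fun hY hg hp => covForm_smul he hp _ hY hg }
  -- The difference of two covariant derivatives is tensorial; it depends only on the value of the
  -- field at the point and can be computed on coordinate fields.
  let d : Model n →L[ℝ] Model n →L[ℝ] Model n :=
    IsCovariantDerivativeOn.difference (D.cov.isCovariantDerivativeOn (s := e.source)) h0 (e.symm y)
  have hd : ∀ {Y : ∀ p : M, TangentSpace (𝓡 n) p}, FieldDiffAt Y (e.symm y) → ∀ X : Model n,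
      toModel e (e.symm y) (d (Y (e.symm y)) X) + fderiv ℝ (fieldRep e Y) y
        (toModel e (e.symm y) X) = toModel e (e.symm y) (D.cov Y (e.symm y) X) := by
    intro Y hY X
    have h1 := IsCovariantDerivativeOn.difference_apply
      (D.cov.isCovariantDerivativeOn (s := e.source)) h0 hp hY
    have h2 := toModel_covForm he hp (fun _ => 0) Y X
    rw [e.right_inv hy] at h2
    have h3 : covRep (fun _ => 0) (fieldRep e Y) y (toModel e (e.symm y) X)
        = fderiv ℝ (fieldRep e Y) y (toModel e (e.symm y) X) := by
      simp [covRep]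
    rw [← h3, ← h2]
    refine (map_add (toModel e (e.symm y)) _ _).symm.trans (congrArg _ ?_)
    have h4 : (d (Y (e.symm y)) X : Model n) = (D.cov Y (e.symm y) X : Model n)
        - (covForm e (fun _ => 0) Y (e.symm y) X : Model n) :=
      congrArg (fun L : Model n →L[ℝ] Model n => L X) h1
    exact eq_sub_iff_add_eq.1 h4
  -- On coordinate fields the comparison derivative is zero, so the difference tensor has the
  -- Christoffel symbols as components.
  have hb : ∀ i j, toModel e (e.symm y) (d (ofModel e (e.symm y) (single j 1))
      (ofModel e (e.symm y) (single i 1)))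
      = ∑ k, D.christoffel e i j k y • single k (1 : ℝ) := by
    intro i j
    have h1 := hd (fieldDiffAt_fieldOf_const he hp (single j 1))
      (ofModel e (e.symm y) (single i 1))
    rw [(fieldRep_eventuallyEq he _ hy).fderiv_eq] at h1
    simp only [fderiv_fun_const, Pi.zero_apply, zero_apply, add_zero] at h1
    refine h1.trans ((eq_sum_single _).trans (Finset.sum_congr rfl fun k _ => ?_))
    rfl
  rw [← hd hY X]
  have h4 : fieldRep e Y y = toModel e (e.symm y) (Y (e.symm y)) := rfl
  rw [covRep, add_apply, ContinuousLinearMap.flip_apply, add_comm, D.chris_apply, h4]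
  congr 1
  set v := toModel e (e.symm y) X with hv
  set w := toModel e (e.symm y) (Y (e.symm y)) with hw
  have hX : X = ofModel e (e.symm y) v := (ofModel_toModel he hp X).symm
  have hYp : Y (e.symm y) = ofModel e (e.symm y) w := (ofModel_toModel he hp _).symm
  rw [hX, hYp]
  have e1 : d (ofModel e (e.symm y) w) = ∑ j, w j • d (ofModel e (e.symm y)
      (single j 1)) := clm_eq_sum_single (d.comp (ofModel e (e.symm y))) w
  have e2 : ∀ j, toModel e (e.symm y) (d (ofModel e (e.symm y) (single j 1))
      (ofModel e (e.symm y) v)) = ∑ i, v i • toModel e (e.symm y) (d (ofModel e (e.symm y)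
        (single j 1)) (ofModel e (e.symm y) (single i 1))) :=
    fun j => clm_eq_sum_single ((toModel e (e.symm y)).comp ((d (ofModel e (e.symm y)
      (single j 1))).comp (ofModel e (e.symm y)))) v
  rw [e1, sum_apply, map_sum]
  simp only [smul_apply, map_smul, e2, hb, Finset.smul_sum, smul_smul]
  rw [Finset.sum_comm]
  refine Finset.sum_congr rfl fun i _ => Finset.sum_congr rfl fun j _ =>
    Finset.sum_congr rfl fun k _ => ?_
  congr 1
  ring

/-- Smoothness of a connection is available for globally smooth fields only. The coordinate field is
multiplied by a bump function equal to 1 near the point; locality of the covariant derivative shows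
that the symbols do not notice. -/
theorem Connection.contDiffOn_christoffel (D : Connection n M) (he : e ∈ charts n M)
    (i j k : Fin n) : ContDiffOn ℝ ∞ (D.christoffel e i j k) e.target := by
  intro y hy
  have hp := e.map_target hy
  obtain ⟨χ, -, hχ⟩ := (SmoothBumpFunction.nhds_basis_tsupport (I := 𝓡 n) (e.symm y)).mem_iff.1
    (e.open_source.mem_nhds hp)
  set Y : ∀ p : M, TangentSpace (𝓡 n) p := fieldOf e fun _ => single j 1 with hYdef
  have hY : ContMDiff (𝓡 n) ((𝓡 n).prod 𝓘(ℝ, Model n)) ∞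
      (fun q : M => (⟨q, ((χ : M → ℝ) • Y) q⟩ : TangentBundle (𝓡 n) M)) :=
    ContMDiffOn.smul_section_of_tsupport χ.contMDiff.contMDiffOn e.open_source hχ
      fun q hq => (contMDiffAt_fieldOf he hq contDiffAt_const).contMDiffWithinAt
  have h1 := (contMDiffOn_univ.1 (D.smooth.contMDiff.contMDiff (σ := (χ : M → ℝ) • Y)
    (contMDiffOn_univ.2 (hY.of_le (by simp))))) (e.symm y)
  have h2 := ContMDiffAt.clm_bundle_apply h1
    (contMDiffAt_fieldOf he hp (contDiffAt_const (c := single i 1)))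
  have h3 := contDiffAt_fieldRep he hp h2
  rw [e.right_inv hy] at h3
  have h4 : ContDiffAt ℝ ∞ (fun z => fieldRep e (fun q => D.cov ((χ : M → ℝ) • Y) q
      (fieldOf e (fun _ => single i 1) q)) z k) y :=
    (proj (𝕜 := ℝ) k : Dual n).contDiff.contDiffAt.comp y h3
  refine (h4.congr_of_eventuallyEq ?_).contDiffWithinAt
  have h5 : ∀ᶠ z in nhds y, ∀ᶠ q in nhds (e.symm z), χ q = 1 :=
    (e.symm.continuousAt hy).eventually χ.eventuallyEq_one.eventually_nhds
  filter_upwards [h5, e.open_target.mem_nhds hy] with z hz hzt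
  have h6 : D.cov ((χ : M → ℝ) • Y) (e.symm z) = D.cov Y (e.symm z) :=
    D.cov.isCovariantDerivativeOnUniv.congr_of_eventuallyEq
      ((hY _).mdifferentiableAt (by simp))
      (fieldDiffAt_fieldOf_const he (e.map_target hzt) _) Filter.univ_mem (by
        filter_upwards [hz] with q hq
        simp [hq])
  rw [fieldRep, h6]
  rfl

/-- The covariant derivative of a field with constant components in the first chart is computed in
both charts and compared. -/
theorem Connection.isChris (D : Connection n M) : IsChris D.chris where
  smooth e he := by
    change ContDiffOn ℝ ∞ (fun y => ∑ i, ∑ j, ∑ k, D.christoffel e i j k y •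
      (proj i : Dual n).smulRight
      ((proj j : Dual n).smulRight (single k (1 : ℝ)))) e.target
    refine ContDiffOn.sum fun i _ => .sum fun j _ => .sum fun k _ => ?_
    exact (D.contDiffOn_christoffel he i j k).smul_const' _
  law e he e' he' y hy hy' v w := by
    have hp := e.map_target hy
    have hY := fieldDiffAt_fieldOf_const he hp w
    have h1 := D.toModel_cov he hy hY (ofModel e (e.symm y) v)
    have hyt' : coordChange e e' y ∈ e'.target := e'.map_source hy'
    have hs : e'.symm (coordChange e e' y) = e.symm y := e'.left_inv hy'
    have h2 := D.toModel_cov he' hyt' (Y := fieldOf e fun _ => w) (by rw [hs]; exact hY)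
      (ofModel e (e.symm y) v)
    rw [hs] at h2
    have hT : ∀ X : Model n, toModel e' (e.symm y) X
        = fderiv ℝ (coordChange e e') y (toModel e (e.symm y) X) := fun X => by
      rw [toModel_apply he he' hp hy', e.right_inv hy]
    have hd' := differentiableAt_fieldRep he' hy' hY
    have h3 := fderiv_fieldRep_coordChange he he' (Y := fieldOf e fun _ => w) hy hy'
      (by have := differentiableAt_fieldRep he hp hY; rwa [e.right_inv hy] at this) hd' v
    rw [hT, toModel_ofModel he hp, covRep, add_apply, h3, ContinuousLinearMap.flip_apply,
      fieldRep_coordChange he he' _ hy hy', fieldRep_fieldOf he _ hy,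
      (fieldRep_eventuallyEq he _ hy).fderiv_eq] at h2
    rw [toModel_ofModel he hp, covRep_fieldOf_const he _ hy] at h1
    have h4 := (congrArg (fderiv ℝ (coordChange e e') y) h1).symm.trans ((hT _).symm.trans h2)
    rw [h4]
    simp

theorem IsChris.chris_connection {Γ : OpenPartialHomeomorph M (Model n) → Model n → Chris n}
    (hΓ : IsChris Γ) (he : e ∈ charts n M) {y : Model n} (hy : y ∈ e.target) :
    hΓ.connection.chris e y = Γ e y := by
  have hp := e.map_target hy
  ext1 v; ext1 w
  have hY := fieldDiffAt_fieldOf_const he hp w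
  have h1 := hΓ.connection.toModel_cov he hy hY (ofModel e (e.symm y) v)
  have h2 := toModel_covForm he hp (Γ e) (fieldOf e fun _ => w) (ofModel e (e.symm y) v)
  rw [← hΓ.covOf_eq he hp hY] at h2
  have h3 := h1.symm.trans h2
  rwa [e.right_inv hy, toModel_ofModel he hp, covRep_fieldOf_const he _ hy,
    covRep_fieldOf_const he _ hy] at h3

/-- Differentiable fields are covered by the formula in a chart; on the others both connections have
the normalized value 0. -/
theorem Connection.ext_chris {D D' : Connection n M}
    (h : ∀ e ∈ charts n M, ∀ y ∈ e.target, D.chris e y = D'.chris e y) : D = D' := by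
  have hcov : D.cov = D'.cov := by
    refine CovariantDerivative.ext (funext fun Y => funext fun p => ?_)
    by_cases hY : FieldDiffAt Y p
    · have key : ∀ e ∈ charts n M, ∀ y ∈ e.target, ∀ q, e.symm y = q → FieldDiffAt Y q →
          D.cov Y q = D'.cov Y q := by
        rintro e he y hy _ rfl hq
        refine ContinuousLinearMap.ext fun X => ?_
        refine toModel_injective he (e.map_target hy) ((D.toModel_cov he hy hq X).trans
          (Eq.trans ?_ (D'.toModel_cov he hy hq X).symm))
        rw [covRep, covRep, h e he y hy]
      exact key _ (chartAt_mem_charts p) _ (mem_chart_target _ p) p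
        ((chartAt (Model n) p).left_inv (mem_chart_source (Model n) p)) hY
    · rw [D.eq_zero_of_not_differentiable Y p hY, D'.eq_zero_of_not_differentiable Y p hY]
  cases D; cases D'
  congr

/-- On fields with constant components in a chart the Lie bracket vanishes, so the torsion is the
skew part of the symbols; such fields realize all tangent vectors. -/
theorem Connection.isTorsionFree_iff (D : Connection n M) : D.IsTorsionFree ↔
    ∀ e ∈ charts n M, ∀ y ∈ e.target, ∀ v w, D.chris e y v w = D.chris e y w v := by
  have key : ∀ e ∈ charts n M, ∀ y ∈ e.target, ∀ v w : Model n, toModel e (e.symm y)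
      (D.cov.torsion (e.symm y) (ofModel e (e.symm y) v) (ofModel e (e.symm y) w))
      = D.chris e y v w - D.chris e y w v := by
    intro e he y hy v w
    have hp := e.map_target hy
    have hv := fieldDiffAt_fieldOf_const he hp v
    have hw := fieldDiffAt_fieldOf_const he hp w
    have h1 := D.cov.torsion_apply hv hw
    rw [mlieBracket_fieldOf_const he hp, sub_zero] at h1
    have h2 := D.toModel_cov he hy hw (ofModel e (e.symm y) v)
    have h3 := D.toModel_cov he hy hv (ofModel e (e.symm y) w)
    rw [toModel_ofModel he hp, covRep_fieldOf_const he _ hy] at h2 h3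
    rw [← h2, ← h3]
    exact (congrArg (toModel e (e.symm y)) h1).trans (map_sub (toModel e (e.symm y)) _ _)
  constructor
  · intro h e he y hy v w
    have h1 := key e he y hy v w
    rw [show D.cov.torsion = 0 from h] at h1
    exact (sub_eq_zero.1 (h1.symm.trans (map_zero _)))
  · intro h
    funext p
    have hq : ∀ e ∈ charts n M, ∀ y ∈ e.target, ∀ q, e.symm y = q → D.cov.torsion q = 0 := by
      rintro e he y hy _ rfl
      have hp := e.map_target hy
      refine ContinuousLinearMap.ext fun X => ContinuousLinearMap.ext fun Z => ?_
      refine toModel_injective he hp ?_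
      obtain ⟨v, rfl⟩ : ∃ v, ofModel e (e.symm y) v = X := ⟨_, ofModel_toModel he hp X⟩
      obtain ⟨w, rfl⟩ : ∃ w, ofModel e (e.symm y) w = Z := ⟨_, ofModel_toModel he hp Z⟩
      have h1 := key e he y hy v w
      rw [h e he y hy, sub_self] at h1
      exact h1.trans (map_zero (toModel e (e.symm y))).symm
    exact hq _ (chartAt_mem_charts p) _ (mem_chart_target _ p) p
      ((chartAt (Model n) p).left_inv (mem_chart_source (Model n) p))

end

section

/-! ### Pairs of a bivector and a connection in the charts -/

section Local

variable {n : ℕ}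

theorem dual_eq_sum_proj (q : Dual n) :
    q = ∑ j, q (single j (1 : ℝ)) • (proj j : Dual n) := by
  ext v
  rw [clm_eq_sum_single q v]
  simp [mul_comm]

theorem clm_eq_sum_proj {F : Type*} [NormedAddCommGroup F] [NormedSpace ℝ F]
    (L : Dual n →L[ℝ] F) (q : Dual n) : L q = ∑ j, q (single j (1 : ℝ)) •
      L (proj j : Dual n) := by
  conv_lhs => rw [dual_eq_sum_proj q]
  rw [map_sum]
  simp only [map_smul]

theorem bil_left (a : Bil n) (p q : Dual n) : a p q = ∑ j, p (single j (1 : ℝ)) *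
    a (proj j : Dual n) q :=
  clm_eq_sum_proj (a.flip q) p

theorem bil_right (a : Bil n) (p q : Dual n) : a p q = ∑ j, q (single j (1 : ℝ)) *
    a p (proj j : Dual n) :=
  clm_eq_sum_proj (a p) q

/-- Precomposition of the first argument of a bilinear form on covectors. -/
def precompL (a : Bil n) (G : Chris n) : Model n →L[ℝ] Bil n :=
  (ContinuousLinearMap.compL ℝ (Dual n) (Dual n) (Dual n →L[ℝ] ℝ) a).comp
    ((ContinuousLinearMap.compL ℝ (Model n) (Model n) ℝ).flip.comp G)

/-- The covariant derivative of a bivector as a multilinear map. -/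
def nablaL (A : Model n → Bil n) (Γ : Model n → Chris n) (y : Model n) : Model n →L[ℝ] Bil n :=
  fderiv ℝ A y + precompL (A y) (Γ y) +
    ((ContinuousLinearMap.flipₗᵢ ℝ (Dual n) (Dual n) ℝ : Bil n →L[ℝ] Bil n).comp
      (precompL (A y).flip (Γ y)))

theorem nablaA_eq_nablaL (A : Model n → Bil n) (Γ : Model n → Chris n) (y v : Model n)
    (p q : Dual n) : nablaA A Γ y v p q = nablaL A Γ y v p q := rfl

/-- The curvature as a multilinear map. -/
def curvL (Γ : Model n → Chris n) (y : Model n) :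
    Model n →L[ℝ] Model n →L[ℝ] Model n →L[ℝ] Model n :=
  fderiv ℝ Γ y - (fderiv ℝ Γ y).flip
    + (ContinuousLinearMap.compL ℝ (Model n) (Model n) (Model n)).bilinearComp (Γ y) (Γ y)
    - ((ContinuousLinearMap.compL ℝ (Model n) (Model n) (Model n)).bilinearComp (Γ y) (Γ y)).flip

theorem curv_eq_curvL (Γ : Model n → Chris n) (y v w z : Model n) :
    curv Γ y v w z = curvL Γ y v w z := rfl

theorem nablaA_congr {A A' : Model n → Bil n} {Γ Γ' : Model n → Chris n} {y : Model n}
    (hA : A =ᶠ[nhds y] A') (hΓ : Γ =ᶠ[nhds y] Γ') (v : Model n) (p q : Dual n) :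
    nablaA A Γ y v p q = nablaA A' Γ' y v p q := by
  rw [nablaA, nablaA, hA.fderiv_eq (𝕜 := ℝ), hA.eq_of_nhds, hΓ.eq_of_nhds]

theorem curv_congr {Γ Γ' : Model n → Chris n} {y : Model n}
    (hΓ : Γ =ᶠ[nhds y] Γ') (v w z : Model n) : curv Γ y v w z = curv Γ' y v w z := by
  rw [curv, curv, hΓ.fderiv_eq (𝕜 := ℝ), hΓ.eq_of_nhds]

theorem fderiv_clm_apply_apply {F G H : Type*} [NormedAddCommGroup F] [NormedSpace ℝ F]
    [NormedAddCommGroup G] [NormedSpace ℝ G] [NormedAddCommGroup H] [NormedSpace ℝ H]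
    {A : Model n → F →L[ℝ] G →L[ℝ] H} {y : Model n}
    (hA : DifferentiableAt ℝ A y) (v : Model n) (p : F) (q : G) :
    fderiv ℝ (fun y => A y p q) y v = fderiv ℝ A y v p q := by
  rw [((hA.hasFDerivAt.clm_apply (hasFDerivAt_const p y)).clm_apply
    (hasFDerivAt_const q y)).fderiv]
  simp

/-- Both sides are trilinear, so the identity may be tested on coordinate covectors. -/
theorem cyclic_of_proj (K : Dual n →L[ℝ] Bil n)
    (h : ∀ i j k : Fin n, K (proj i : Dual n) (proj j : Dual n)
      (proj k : Dual n) = K (proj j : Dual n)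
        (proj k : Dual n) (proj i : Dual n)) (p q r : Dual n) :
    K r p q = K p q r := by
  rw [bil_right (K p) q r]
  refine (bil_left (K.flip p) r q).trans ?_
  refine Finset.sum_congr rfl fun i _ => congrArg _ ?_
  change K _ p q = K p q _
  rw [bil_left (K _) p q]
  refine Eq.trans ?_ (clm_eq_sum_proj ((K.flip q).flip _) p).symm
  refine Finset.sum_congr rfl fun j _ => congrArg _ ?_
  rw [ContinuousLinearMap.flip_apply, ContinuousLinearMap.flip_apply]
  rw [bil_right (K _) _ q, bil_left (K _) q _]
  exact Finset.sum_congr rfl fun k _ => congrArg _ (h i j k)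

theorem curv_eq_zero_of_single {Γ : Model n → Chris n} {y : Model n}
    (h : ∀ i j k : Fin n, curv Γ y (single i 1) (single j 1)
      (single k 1) = 0) (v w z : Model n) : curv Γ y v w z = 0 := by
  rw [curv_eq_curvL, clm_eq_sum_single (curvL Γ y) v]
  simp only [sum_apply, smul_apply]
  refine Finset.sum_eq_zero fun i _ => ?_
  rw [clm_eq_sum_single (curvL Γ y _) w]
  simp only [sum_apply, smul_apply]
  rw [Finset.sum_eq_zero, smul_zero]
  intro j _
  rw [clm_eq_sum_single (curvL Γ y _ _) z, Finset.sum_eq_zero, smul_zero]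
  intro k _
  rw [← curv_eq_curvL, h, smul_zero]

end Local

variable {n : ℕ} {M : Type*} [TopologicalSpace M] [T2Space M] [ChartedSpace (Model n) M]
  [IsManifold (𝓡 n) ∞ M] {e e' : OpenPartialHomeomorph M (Model n)}

/-- A bivector in a chart. -/
def Bivector.bil (a : Bivector n M) (e : OpenPartialHomeomorph M (Model n)) (y : Model n) : Bil n :=
  ∑ i, ∑ j, a.comp e i j y • unitBil i j

theorem Bivector.bil_apply (a : Bivector n M) (y : Model n) (p q : Dual n) :
    a.bil e y p q = ∑ i, ∑ j, a.comp e i j y *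
      (p (single i (1 : ℝ)) * q (single j (1 : ℝ))) := by
  simp only [Bivector.bil, sum_apply, smul_apply, unitBil_apply, smul_eq_mul]

theorem Bivector.bil_proj (a : Bivector n M) (y : Model n) (i j : Fin n) :
    a.bil e y (proj i : Dual n) (proj j : Dual n)
      = a.comp e i j y := by
  rw [a.bil_apply, sum_sum_proj]
  simp

theorem Bivector.contDiffOn_bil (a : Bivector n M) (he : e ∈ charts n M) :
    ContDiffOn ℝ ∞ (a.bil e) e.target := by
  change ContDiffOn ℝ ∞ (fun y => ∑ i, ∑ j, a.comp e i j y • unitBil i j) e.target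
  exact ContDiffOn.sum fun i _ => .sum fun j _ => (a.smooth e he i j).smul_const' _

theorem Bivector.bil_eq (a : Bivector n M) {y : Model n} {x : M} (h : e.symm y = x)
    (p q : Dual n) : a.bil e y p q = a.toFun x (p.comp (toModel e x)) (q.comp (toModel e x)) := by
  subst h
  have h1 : ∀ p : Dual n, (p.comp (toModel e (e.symm y)) : Cotangent n (e.symm y))
      = ∑ i, p (single i (1 : ℝ)) • coordCovec e i (e.symm y) := by
    exact fun p => clm_eq_sum_proj ((ContinuousLinearMap.compL ℝ (Model n) (Model n) ℝ).flip
      (toModel e (e.symm y))) p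
  rw [h1 p, h1 q, a.bil_apply]
  simp only [map_sum, map_smul, LinearMap.sum_apply, LinearMap.smul_apply, smul_eq_mul,
    Finset.mul_sum]
  rw [Finset.sum_comm]
  refine Finset.sum_congr rfl fun i _ => Finset.sum_congr rfl fun j _ => ?_
  rw [Bivector.comp]
  ring

theorem Connection.covBivector_eq (D : Connection n M) (a : Bivector n M) (he : e ∈ charts n M)
    {y : Model n} (hy : y ∈ e.target) (k i j : Fin n) : D.covBivector a e k i j y
      = nablaA (a.bil e) (D.chris e) y (single k 1) (proj i : Dual n)
        (proj j : Dual n) := by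
  rw [Connection.covBivector, nablaA]
  congr 1
  · congr 1
    · rw [pderiv, ← fderiv_clm_apply_apply ((a.contDiffOn_bil he).contDiffAt
        (e.open_target.mem_nhds hy) |>.differentiableAt (by simp))]
      simp only [Bivector.bil_proj]
    · rw [bil_left]
      refine Finset.sum_congr rfl fun r _ => ?_
      rw [Bivector.bil_proj, ← D.chris_single]
      rfl
  · rw [bil_right]
    refine Finset.sum_congr rfl fun r _ => ?_
    rw [Bivector.bil_proj, ← D.chris_single]
    rfl

theorem isCompatible_iff (a : Bivector n M) (D : Connection n M) : IsCompatible a D ↔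
    ∀ e ∈ charts n M, ∀ y ∈ e.target, ∀ p q r, nablaA (a.bil e) (D.chris e) y
      (raise (a.bil e y) r) p q = nablaA (a.bil e) (D.chris e) y (raise (a.bil e y) p) q r := by
  -- The coordinate condition contracts the second index of the bivector, while `raise` contracts
  -- its argument with the second slot and yields a vector in the first. The resulting sign is the
  -- same on both sides of the condition.
  have key : ∀ e ∈ charts n M, ∀ y ∈ e.target, ∀ i j k : Fin n,
      ∑ r, a.comp e i r y * D.covBivector a e r j k y
        = - nablaA (a.bil e) (D.chris e) y (raise (a.bil e y) (proj i : Dual n))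
          (proj j : Dual n) (proj k : Dual n) := by
    intro e he y hy i j k
    rw [nablaA_eq_nablaL, clm_eq_sum_single (nablaL _ _ y)]
    simp only [sum_apply, smul_apply, smul_eq_mul, ← Finset.sum_neg_distrib]
    refine Finset.sum_congr rfl fun r _ => ?_
    rw [D.covBivector_eq a he hy, nablaA_eq_nablaL, ← neg_mul]
    congr 1
    have h1 := apply_raise (a.bil e y) (proj r) (proj i)
    rw [Bivector.bil_proj] at h1
    rw [show (raise (a.bil e y) (proj i : Dual n)) r = a.comp e r i y from h1]
    exact a.skew _ _ _
  constructor
  · intro h e he y hy p q r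
    refine cyclic_of_proj ((nablaL (a.bil e) (D.chris e) y).comp (raise (a.bil e y)))
      (fun i j k => ?_) p q r
    have h1 := h e he y hy i j k
    rw [key e he y hy, key e he y hy] at h1
    exact neg_injective h1
  · intro h e he y hy i j k
    rw [key e he y hy, key e he y hy, h e he y hy]

theorem Connection.differentiableAt_chris (D : Connection n M) (he : e ∈ charts n M) {y : Model n}
    (hy : y ∈ e.target) : DifferentiableAt ℝ (D.chris e) y :=
  ((D.isChris.smooth e he).contDiffAt (e.open_target.mem_nhds hy)).differentiableAt (by simp)

theorem Connection.isFlat_iff (D : Connection n M) : D.IsFlat ↔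
    ∀ e ∈ charts n M, ∀ y ∈ e.target, ∀ v w z, curv (D.chris e) y v w z = 0 := by
  have key : ∀ e ∈ charts n M, ∀ y ∈ e.target, ∀ k s l t : Fin n,
      pderiv s (D.christoffel e l t k) y - pderiv l (D.christoffel e s t k) y
      + ∑ r, D.christoffel e s r k y * D.christoffel e l t r y
      - ∑ r, D.christoffel e l r k y * D.christoffel e s t r y
      = curv (D.chris e) y (single s 1) (single l 1)
        (single t 1) k := by
    intro e he y hy k s l t
    have h1 : ∀ s l t k, pderiv s (D.christoffel e l t k) y = fderiv ℝ (D.chris e) y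
        (single s 1) (single l 1) (single t 1) k := by
      intro s l t k
      rw [pderiv, ← fderiv_clm_apply_apply (D.differentiableAt_chris he hy)]
      have h2 := (((D.differentiableAt_chris he hy).clm_apply (differentiableAt_const
        (single l 1))).clm_apply (differentiableAt_const
        (single t 1))).hasFDerivAt
      have h3 := ((proj k : Dual n).hasFDerivAt.comp y h2).fderiv
      have h4 : D.christoffel e l t k = (proj k : Dual n) ∘ (fun y => D.chris e y
        (single l 1) (single t 1)) :=
        funext fun y => (D.chris_single y l t k).symm
      rw [h4, h3]
      rfl
    have h2 : ∀ s l, ∑ r, D.christoffel e s r k y * D.christoffel e l t r y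
        = D.chris e y (single s 1) (D.chris e y (single l 1)
          (single t 1)) k := by
      intro s l
      rw [clm_eq_sum_single (D.chris e y (single s 1))]
      simp only [WithLp.ofLp_sum, Finset.sum_apply, WithLp.ofLp_smul,
        Pi.smul_apply, smul_eq_mul, D.chris_single]
      exact Finset.sum_congr rfl fun r _ => mul_comm _ _
    rw [h1, h1, h2, h2]
    rfl
  constructor
  · intro h e he y hy v w z
    refine curv_eq_zero_of_single (fun s l t => ?_) v w z
    ext k
    rw [← key e he y hy, h e he y hy]
    rfl
  · intro h e he y hy k s l t
    rw [key e he y hy, h e he y hy]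
    rfl

end

/-! ### Passage between pairs on the manifold and their chart expressions -/

section

variable {n : ℕ} {M : Type*} [TopologicalSpace M] [T2Space M] [ChartedSpace (Model n) M]
  [IsManifold (𝓡 n) ∞ M] {e e' : OpenPartialHomeomorph M (Model n)}

/-- The chart expressions of a compatible pair. -/
def FlatPair.ofPair (q : CompatiblePair n M) : FlatPair n M where
  A := q.1.1.bil
  Γ := q.1.2.chris
  contDiffOn_A _ he := q.1.1.contDiffOn_bil he
  contDiffOn_Γ e he := q.1.2.isChris.smooth e he
  A_coordChange e he e' he' y hy hy' r s := by
    rw [q.1.1.bil_eq (show e'.symm (coordChange e e' y) = e.symm y from e'.left_inv hy'),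
      q.1.1.bil_eq rfl]
    have h1 : toModel e' (e.symm y)
        = (fderiv ℝ (coordChange e e') y).comp (toModel e (e.symm y)) := by
      refine ContinuousLinearMap.ext fun v => ?_
      rw [toModel_apply he he' (e.map_target hy) hy', e.right_inv hy]
      rfl
    rw [h1]
    rfl
  Γ_coordChange := q.1.2.isChris.law
  skew e _ y _ r s := by
    rw [q.1.1.bil_eq rfl, q.1.1.bil_eq rfl]
    exact q.1.1.skew _ _ _
  nondeg e he y hy r h := by
    have hp := e.map_target hy
    have h0 : (r.comp (toModel e (e.symm y)) : Cotangent n (e.symm y)) = 0 := by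
      refine (q.2.1 (e.symm y)).2 _ fun s => ?_
      have h1 := h (s.comp (ofModel e (e.symm y)))
      rw [q.1.1.bil_eq rfl] at h1
      refine Eq.trans ?_ h1
      congr 2
      refine ContinuousLinearMap.ext fun v => ?_
      exact (congrArg s (ofModel_toModel he hp v)).symm
    ext v
    rw [← toModel_ofModel he hp v]
    exact congrArg (fun L : Dual n => L (ofModel e (e.symm y) v)) h0
  symm := q.1.2.isTorsionFree_iff.1 q.2.2.1
  flat := q.1.2.isFlat_iff.1 q.2.2.2.1
  compat := (isCompatible_iff _ _).1 q.2.2.2.2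

namespace FlatPair

variable (F : FlatPair n M)

theorem isChris : IsChris F.Γ := ⟨F.contDiffOn_Γ, F.Γ_coordChange⟩

/-- The bilinear form at a point. -/
def form (x : M) : Bil n :=
  (F.A (chartAt (Model n) x) (chartAt (Model n) x x)).bilinearComp
    ((ContinuousLinearMap.compL ℝ (Model n) (Model n) ℝ).flip (ofModel (chartAt (Model n) x) x))
    ((ContinuousLinearMap.compL ℝ (Model n) (Model n) ℝ).flip (ofModel (chartAt (Model n) x) x))

/-- The form is defined through the preferred chart at each point; the transformation law makes it
independent of that chart. -/
theorem form_comp_toModel (he : e ∈ charts n M) {y : Model n} (hy : y ∈ e.target) (r s : Dual n) :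
    F.form (e.symm y) (r.comp (toModel e (e.symm y))) (s.comp (toModel e (e.symm y)))
      = F.A e y r s := by
  have hp := e.map_target hy
  set x := e.symm y with hx
  set c := chartAt (Model n) x with hc
  have hcs : x ∈ c.source := mem_chart_source _ x
  have hcm : c ∈ charts n M := chartAt_mem_charts x
  have h1 := F.A_coordChange c hcm e he (c x) (c.map_source hcs)
    (by rw [c.left_inv hcs]; exact hp) r s
  have h2 : coordChange c e (c x) = y := by
    rw [coordChange, c.left_inv hcs, hx, e.right_inv hy]
  have h3 : (toModel e x).comp (ofModel c x) = fderiv ℝ (coordChange c e) (c x) := by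
    refine ContinuousLinearMap.ext fun v => ?_
    rw [ContinuousLinearMap.comp_apply, toModel_apply hcm he hcs hp, toModel_ofModel hcm hcs]
  rw [h2, ← h3] at h1
  exact h1.symm

/-- The bivector of a pair given by its chart expressions. -/
def bivector : Bivector n M where
  toFun x := LinearMap.mk₂ ℝ (fun r s : Dual n => F.form x r s)
    (fun r r' s => (F.form x).map_add₂ r r' s) (fun c r s => (F.form x).map_smul₂ c r s)
    (fun r s s' => (F.form x r).map_add s s') (fun c r s => (F.form x r).map_smul c s)
  skew x r s := F.skew _ (chartAt_mem_charts x) _ (mem_chart_target _ x) _ _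
  smooth e he i j := by
    have h1 := ((F.contDiffOn_A e he).clm_apply (contDiffOn_const
      (c := (proj i : Dual n)))).clm_apply (contDiffOn_const
      (c := (proj j : Dual n)))
    exact h1.congr fun y hy => F.form_comp_toModel he hy _ _

theorem bil_bivector (he : e ∈ charts n M) {y : Model n} (hy : y ∈ e.target) :
    F.bivector.bil e y = F.A e y := by
  ext r s
  rw [F.bivector.bil_eq rfl]
  exact F.form_comp_toModel he hy r s

/-- The compatible pair which is given by its chart expressions. -/
def toPair : CompatiblePair n M :=
  ⟨(F.bivector, F.isChris.connection), by
    have hA : ∀ e ∈ charts n M, ∀ y ∈ e.target, F.bivector.bil e =ᶠ[nhds y] F.A e :=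
      fun e he y hy => by
        filter_upwards [e.open_target.mem_nhds hy] with z hz using F.bil_bivector he hz
    have hΓ : ∀ e ∈ charts n M, ∀ y ∈ e.target, F.isChris.connection.chris e =ᶠ[nhds y] F.Γ e :=
      fun e he y hy => by
        filter_upwards [e.open_target.mem_nhds hy] with z hz using F.isChris.chris_connection he hz
    refine ⟨fun x => ?_, ?_, ?_, ?_⟩
    · have hcs := mem_chart_source (Model n) x
      have hcm := chartAt_mem_charts (n := n) x
      have key : ∀ r : Dual n, (∀ s, F.form x s r = 0) → r = 0 := by
        intro r hr
        have h0 : r.comp (ofModel (chartAt (Model n) x) x) = 0 := by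
          refine F.nondeg _ hcm _ (mem_chart_target _ x) _ fun s => ?_
          have h1 := hr (s.comp (toModel (chartAt (Model n) x) x))
          refine Eq.trans ?_ h1
          change _ = F.A (chartAt (Model n) x) _ ((s.comp _).comp _) _
          congr 2
          refine ContinuousLinearMap.ext fun v => ?_
          exact (congrArg s (toModel_ofModel hcm hcs v)).symm
        ext v
        rw [← ofModel_toModel hcm hcs v]
        exact congrArg (fun L : Dual n => L (toModel (chartAt (Model n) x) x v)) h0
      refine ⟨fun r hr => key r fun s => ?_, key⟩
      rw [show F.form x s r = - F.form x r s from F.bivector.skew x s r,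
        show F.form x r s = 0 from hr s, neg_zero]
    · refine (Connection.isTorsionFree_iff _).2 fun e he y hy v w => ?_
      rw [(hΓ e he y hy).eq_of_nhds]
      exact F.symm e he y hy v w
    · refine (Connection.isFlat_iff _).2 fun e he y hy v w z => ?_
      rw [curv_congr (hΓ e he y hy)]
      exact F.flat e he y hy v w z
    · refine (isCompatible_iff _ _).2 fun e he y hy r s t => ?_
      dsimp only
      rw [nablaA_congr (hA e he y hy) (hΓ e he y hy), nablaA_congr (hA e he y hy) (hΓ e he y hy),
        (hA e he y hy).eq_of_nhds]
      exact F.compat e he y hy r s t⟩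

end FlatPair

theorem Bivector.ext_bil {a b : Bivector n M}
    (h : ∀ e ∈ charts n M, ∀ y ∈ e.target, a.bil e y = b.bil e y) : a = b := by
  have h1 : a.toFun = b.toFun := by
    funext x
    have hcs := mem_chart_source (Model n) x
    have hcm := chartAt_mem_charts (n := n) x
    refine LinearMap.ext fun r => LinearMap.ext fun s => ?_
    have key : ∀ r : Cotangent n x, ∃ r' : Dual n,
        (r'.comp (toModel (chartAt (Model n) x) x) : Cotangent n x) = r := fun r =>
      ⟨(r : Dual n).comp (ofModel (chartAt (Model n) x) x),
        ContinuousLinearMap.ext fun v => congrArg r (ofModel_toModel hcm hcs v)⟩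
    obtain ⟨r, rfl⟩ := key r
    obtain ⟨s, rfl⟩ := key s
    have h2 := congrArg (fun a : Bil n => a r s) (h _ hcm _ (mem_chart_target _ x))
    have hx := (chartAt (Model n) x).left_inv hcs
    exact (a.bil_eq hx r s).symm.trans (h2.trans (b.bil_eq hx r s))
  cases a; cases b
  congr

theorem CompatiblePair.ext_bil {q q' : CompatiblePair n M}
    (hA : ∀ e ∈ charts n M, ∀ y ∈ e.target, q.1.1.bil e y = q'.1.1.bil e y)
    (hΓ : ∀ e ∈ charts n M, ∀ y ∈ e.target, q.1.2.chris e y = q'.1.2.chris e y) : q = q' :=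
  Subtype.ext (Prod.ext (Bivector.ext_bil hA) (Connection.ext_chris hΓ))

end

/-! ### Covariant derivatives along families of points -/

section Along

variable {n : ℕ} {Q : Type*} [NormedAddCommGroup Q] [NormedSpace ℝ Q] {A : Model n → Bil n}
  {Γ : Model n → Chris n} {γ : Q → Model n} {X Y : Q → Dual n} {V : Q → Model n} {q : Q}
  {O : Set Q} {T : Set (Model n)}

theorem hasFDerivAt_comp {G H : Type*} [NormedAddCommGroup G] [NormedSpace ℝ G]
    [NormedAddCommGroup H] [NormedSpace ℝ H] {f : G → H} {g : Q → G}
    (hf : DifferentiableAt ℝ f (g q)) (hg : DifferentiableAt ℝ g q) :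
    HasFDerivAt (fun q => f (g q)) ((fderiv ℝ f (g q)).comp (fderiv ℝ g q)) q :=
  hf.hasFDerivAt.comp q hg.hasFDerivAt

/-- The covariant derivative of a covector field along `γ`, in a chart. -/
def covDir (Γ : Model n → Chris n) (γ : Q → Model n) (X : Q → Dual n) (h q : Q) : Dual n :=
  fderiv ℝ X q h - (X q).comp (Γ (γ q) (fderiv ℝ γ q h))

/-- The covariant derivative of a vector field along `γ`, in a chart. -/
def vecDir (Γ : Model n → Chris n) (γ : Q → Model n) (V : Q → Model n) (h q : Q) : Model n :=
  fderiv ℝ V q h + Γ (γ q) (fderiv ℝ γ q h) (V q)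

theorem contDiffOn_covDir (hO : IsOpen O) (hΓ : ContDiffOn ℝ ∞ Γ T) (hγ : ContDiffOn ℝ ∞ γ O)
    (hX : ContDiffOn ℝ ∞ X O) (hT : ∀ q ∈ O, γ q ∈ T) (h : Q) :
    ContDiffOn ℝ ∞ (covDir Γ γ X h) O := by
  have h1 := (hX.fderiv_of_isOpen (m := ∞) hO (by simp)).clm_apply (contDiffOn_const (c := h))
  have h2 := (hγ.fderiv_of_isOpen (m := ∞) hO (by simp)).clm_apply (contDiffOn_const (c := h))
  exact h1.sub (hX.clm_comp ((hΓ.comp hγ hT).clm_apply h2))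

theorem contDiffOn_vecDir (hO : IsOpen O) (hΓ : ContDiffOn ℝ ∞ Γ T) (hγ : ContDiffOn ℝ ∞ γ O)
    (hV : ContDiffOn ℝ ∞ V O) (hT : ∀ q ∈ O, γ q ∈ T) (h : Q) :
    ContDiffOn ℝ ∞ (vecDir Γ γ V h) O := by
  have h1 := (hV.fderiv_of_isOpen (m := ∞) hO (by simp)).clm_apply (contDiffOn_const (c := h))
  have h2 := (hγ.fderiv_of_isOpen (m := ∞) hO (by simp)).clm_apply (contDiffOn_const (c := h))
  exact h1.add (((hΓ.comp hγ hT).clm_apply h2).clm_apply hV)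

theorem contDiff_raise : ContDiff ℝ ∞ (raise : Bil n → Dual n →L[ℝ] Model n) :=
  contDiff_const.clm_comp (ContinuousLinearMap.flipₗᵢ ℝ (Dual n) (Dual n) ℝ).contDiff

/-- Leibniz rule: the two connection terms cancel. It and its analogue for the bivector allow
ordinary derivatives of scalars to be expressed by tensors. -/
theorem fderiv_pairing (hX : DifferentiableAt ℝ X q) (hV : DifferentiableAt ℝ V q) (h : Q) :
    fderiv ℝ (fun q => X q (V q)) q h = covDir Γ γ X h q (V q) + X q (vecDir Γ γ V h q) := by
  rw [fderiv_clm_apply hX hV]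
  simp [covDir, vecDir]
  ring

theorem fderiv_bil (hA : DifferentiableAt ℝ A (γ q)) (hγ : DifferentiableAt ℝ γ q)
    (hX : DifferentiableAt ℝ X q) (hY : DifferentiableAt ℝ Y q) (h : Q) :
    fderiv ℝ (fun q => A (γ q) (X q) (Y q)) q h
      = nablaA A Γ (γ q) (fderiv ℝ γ q h) (X q) (Y q)
        + A (γ q) (covDir Γ γ X h q) (Y q) + A (γ q) (X q) (covDir Γ γ Y h q) := by
  rw [(((hasFDerivAt_comp hA hγ).clm_apply hX.hasFDerivAt).clm_apply
    hY.hasFDerivAt).fderiv]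
  simp [covDir, nablaA]
  ring

/-- Covariant derivatives in different directions commute. -/
theorem covDir_comm (hO : IsOpen O) (hq : q ∈ O) (hTo : IsOpen T) (hΓ : ContDiffOn ℝ ∞ Γ T)
    (hγ : ContDiffOn ℝ ∞ γ O) (hX : ContDiffOn ℝ ∞ X O) (hT : ∀ q ∈ O, γ q ∈ T)
    (hflat : ∀ v w z, curv Γ (γ q) v w z = 0) (h k : Q) :
    covDir Γ γ (covDir Γ γ X h) k q = covDir Γ γ (covDir Γ γ X k) h q := by
  have hs : ∀ {F : Type _} [NormedAddCommGroup F] [NormedSpace ℝ F] {f : Q → F},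
      ContDiffOn ℝ ∞ f O → (∀ v, HasFDerivAt (fun q => fderiv ℝ f q v)
        ((fderiv ℝ (fderiv ℝ f) q).flip v) q) ∧
        ∀ v w, fderiv ℝ (fderiv ℝ f) q v w = fderiv ℝ (fderiv ℝ f) q w v := by
    intro F _ _ f hf
    have h1 := differentiableAt_of_contDiffOn hO (hf.fderiv_of_isOpen (m := ∞) hO (by simp)) hq
    refine ⟨fun v => ?_, (hf.contDiffAt (hO.mem_nhds hq)).isSymmSndFDerivAt
      (by simpa using WithTop.coe_le_coe.2 (le_top (a := (2 : ℕ∞))))⟩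
    have h2 := h1.hasFDerivAt.clm_apply (hasFDerivAt_const v q)
    simpa using h2
  have hd := fun h : Q => (((hs hX).1 h).sub
    ((differentiableAt_of_contDiffOn hO hX hq).hasFDerivAt.clm_comp
      ((hasFDerivAt_comp (differentiableAt_of_contDiffOn hTo hΓ (hT q hq))
        (differentiableAt_of_contDiffOn hO hγ hq)).clm_apply ((hs hγ).1 h)))).fderiv
  have key : ∀ h k : Q, ∀ z, covDir Γ γ (covDir Γ γ X h) k q z
      = fderiv ℝ (fderiv ℝ X) q k h z - fderiv ℝ X q k (Γ (γ q) (fderiv ℝ γ q h) z)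
        - X q (fderiv ℝ Γ (γ q) (fderiv ℝ γ q k) (fderiv ℝ γ q h) z)
        - X q (Γ (γ q) (fderiv ℝ (fderiv ℝ γ) q k h) z)
        - fderiv ℝ X q h (Γ (γ q) (fderiv ℝ γ q k) z)
        + X q (Γ (γ q) (fderiv ℝ γ q h) (Γ (γ q) (fderiv ℝ γ q k) z)) := by
    intro h k z
    rw [covDir]
    have h1 : fderiv ℝ (covDir Γ γ X h) q = _ := hd h
    rw [h1]
    simp [covDir]
    ring
  ext z
  -- After expansion the two iterated derivatives differ by X paired with the curvature; second
  -- derivatives of X and of γ are symmetric. Torsion plays no role here.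
  have h3 := congrArg (X q) (hflat (fderiv ℝ γ q k) (fderiv ℝ γ q h) z)
  simp only [curv, map_add, map_sub, map_zero] at h3
  rw [key, key, (hs hX).2 h k, (hs hγ).2 h k]
  linarith

variable {M : Type*} [TopologicalSpace M] [T2Space M] [ChartedSpace (Model n) M]
  [IsManifold (𝓡 n) ∞ M] {e e' : OpenPartialHomeomorph M (Model n)} (F : FlatPair n M)

theorem FlatPair.covDir_coordChange (he : e ∈ charts n M) (he' : e' ∈ charts n M) {γ' : Q → Model n}
    {X' : Q → Dual n} (hy : γ q ∈ e.target) (hy' : e.symm (γ q) ∈ e'.source)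
    (hγ : DifferentiableAt ℝ γ q) (hX' : DifferentiableAt ℝ X' q)
    (hγγ : γ' =ᶠ[nhds q] fun q => coordChange e e' (γ q))
    (hXX : X =ᶠ[nhds q] fun q => (X' q).comp (fderiv ℝ (coordChange e e') (γ q))) (h : Q) :
    covDir (F.Γ e) γ X h q
      = (covDir (F.Γ e') γ' X' h q).comp (fderiv ℝ (coordChange e e') (γ q)) := by
  have h1 := (contDiffAt_coordChange he he' hy hy').differentiableAt (by simp)
  have h2 := (contDiffAt_fderiv_coordChange he he' hy hy').differentiableAt (by simp)
  have h3 : fderiv ℝ γ' q h = fderiv ℝ (coordChange e e') (γ q) (fderiv ℝ γ q h) := by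
    rw [hγγ.fderiv_eq, (hasFDerivAt_comp h1 hγ).fderiv]
    rfl
  have h4 : fderiv ℝ X q h = (X' q).comp (fderiv ℝ (fderiv ℝ (coordChange e e')) (γ q)
      (fderiv ℝ γ q h)) + (fderiv ℝ X' q h).comp (fderiv ℝ (coordChange e e') (γ q)) := by
    rw [hXX.fderiv_eq (𝕜 := ℝ), (hX'.hasFDerivAt.clm_comp
      (hasFDerivAt_comp h2 hγ)).fderiv]
    ext z
    simp
  ext z
  have h5 := congrArg (X' q) (F.Γ_coordChange e he e' he' _ hy hy' (fderiv ℝ γ q h) z)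
  rw [covDir, covDir, h4, hXX.eq_of_nhds, h3, hγγ.eq_of_nhds]
  simp only [sub_apply, add_apply, ContinuousLinearMap.comp_apply, map_sub] at h5 ⊢
  rw [h5]
  ring

theorem FlatPair.vecDir_coordChange (he : e ∈ charts n M) (he' : e' ∈ charts n M)
    {γ' V' : Q → Model n}
    (hy : γ q ∈ e.target) (hy' : e.symm (γ q) ∈ e'.source)
    (hγ : DifferentiableAt ℝ γ q) (hV : DifferentiableAt ℝ V q)
    (hγγ : γ' =ᶠ[nhds q] fun q => coordChange e e' (γ q))
    (hVV : V' =ᶠ[nhds q] fun q => fderiv ℝ (coordChange e e') (γ q) (V q)) (h : Q) :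
    vecDir (F.Γ e') γ' V' h q = fderiv ℝ (coordChange e e') (γ q) (vecDir (F.Γ e) γ V h q) := by
  have h1 := (contDiffAt_coordChange he he' hy hy').differentiableAt (by simp)
  have h2 := (contDiffAt_fderiv_coordChange he he' hy hy').differentiableAt (by simp)
  have h3 : fderiv ℝ γ' q h = fderiv ℝ (coordChange e e') (γ q) (fderiv ℝ γ q h) := by
    rw [hγγ.fderiv_eq, (hasFDerivAt_comp h1 hγ).fderiv]
    rfl
  have h4 : fderiv ℝ V' q h = fderiv ℝ (coordChange e e') (γ q) (fderiv ℝ V q h)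
      + fderiv ℝ (fderiv ℝ (coordChange e e')) (γ q) (fderiv ℝ γ q h) (V q) := by
    rw [hVV.fderiv_eq, ((hasFDerivAt_comp h2 hγ).clm_apply hV.hasFDerivAt).fderiv]
    simp
  rw [vecDir, vecDir, h4, hVV.eq_of_nhds, h3, hγγ.eq_of_nhds,
    F.Γ_coordChange e he e' he' _ hy hy', map_add]
  abel

theorem FlatPair.raise_coordChange (he : e ∈ charts n M) (he' : e' ∈ charts n M) {y : Model n}
    (hy : y ∈ e.target) (hy' : e.symm y ∈ e'.source) (r : Dual n) :
    raise (F.A e' (coordChange e e' y)) r = fderiv ℝ (coordChange e e') y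
      (raise (F.A e y) (r.comp (fderiv ℝ (coordChange e e') y))) := by
  refine model_ext fun p => ?_
  rw [apply_raise, F.A_coordChange e he e' he' y hy hy', ← apply_raise]
  rfl

end Along

/-! ### The operator of a compatible pair -/

theorem fderiv_add_one {G : Type*} [NormedAddCommGroup G] [NormedSpace ℝ G] {f : ℝ → G}
    (hf : Function.Periodic f 1) (x : ℝ) : fderiv ℝ f (x + 1) = fderiv ℝ f x := by
  rw [← fderiv_comp_add_right (𝕜 := ℝ) (f := f) (x := x) (1 : ℝ)]
  simp only [hf _]

section

variable {n : ℕ} {M : Type*} [TopologicalSpace M] [T2Space M] [ChartedSpace (Model n) M]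
  [IsManifold (𝓡 n) ∞ M] {e e' : OpenPartialHomeomorph M (Model n)}

namespace FlatPair

variable (F : FlatPair n M) {u : Loop n M} (α β : CovectorAlong u) (V : VectorAlong u) {x : ℝ}

theorem exists_chart (u : Loop n M) (x : ℝ) : ∃ e ∈ charts n M, x ∈ u.dom e :=
  ⟨_, chartAt_mem_charts _, mem_dom_chartAt u x⟩

theorem rep_mem (hx : x ∈ u.dom e) : u.rep e x ∈ e.target := e.map_source hx

theorem symm_rep (hx : x ∈ u.dom e) : e.symm (u.rep e x) = u (x : UnitAddCircle) := e.left_inv hx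

/-- The covariant derivative of a covector field along a loop. -/
def covD : CovectorAlong u :=
  CovectorAlong.ofReps u (fun e => covDir (F.Γ e) (u.rep e) (α.rep e) 1)
    (fun e x => by
      rw [covDir, covDir, fderiv_add_one fun x => α.rep_add_one x, α.rep_add_one, u.rep_add_one,
        fderiv_add_one fun x => u.rep_add_one x])
    (fun e he => contDiffOn_covDir (u.isOpen_dom e) (F.contDiffOn_Γ e he) (u.contDiffOn_rep he)
      (α.contDiffOn_rep he) (fun x hx => rep_mem hx) 1)
    (fun e he e' he' x hx hx' => by
      refine F.covDir_coordChange he he' (rep_mem hx) (by rwa [symm_rep hx])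
        (differentiableAt_of_contDiffOn (u.isOpen_dom e) (u.contDiffOn_rep he) hx)
        (differentiableAt_of_contDiffOn (u.isOpen_dom e') (α.contDiffOn_rep he') hx') ?_ ?_ 1
      · filter_upwards [(u.isOpen_dom e).mem_nhds hx] with y hy using u.rep_coordChange hy
      · filter_upwards [(u.isOpen_dom e).mem_nhds hx, (u.isOpen_dom e').mem_nhds hx'] with y hy hy'
          using α.rep_coordChange he he' hy hy')

theorem rep_covD (he : e ∈ charts n M) (hx : x ∈ u.dom e) :
    (F.covD α).rep e x = covDir (F.Γ e) (u.rep e) (α.rep e) 1 x :=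
  CovectorAlong.rep_ofReps _ _ _ he hx

/-- The covariant derivative of a vector field along a loop. -/
def vecD : VectorAlong u :=
  VectorAlong.ofReps u (fun e => vecDir (F.Γ e) (u.rep e) (V.rep e) 1)
    (fun e x => by
      rw [vecDir, vecDir, fderiv_add_one fun x => V.rep_add_one x, V.rep_add_one, u.rep_add_one,
        fderiv_add_one fun x => u.rep_add_one x])
    (fun e he => contDiffOn_vecDir (u.isOpen_dom e) (F.contDiffOn_Γ e he) (u.contDiffOn_rep he)
      (V.contDiffOn_rep he) (fun x hx => rep_mem hx) 1)
    (fun e he e' he' x hx hx' => by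
      refine F.vecDir_coordChange he he' (rep_mem hx) (by rwa [symm_rep hx])
        (differentiableAt_of_contDiffOn (u.isOpen_dom e) (u.contDiffOn_rep he) hx)
        (differentiableAt_of_contDiffOn (u.isOpen_dom e) (V.contDiffOn_rep he) hx) ?_ ?_ 1
      · filter_upwards [(u.isOpen_dom e).mem_nhds hx] with y hy using u.rep_coordChange hy
      · filter_upwards [(u.isOpen_dom e).mem_nhds hx, (u.isOpen_dom e').mem_nhds hx'] with y hy hy'
          using V.rep_coordChange he he' hy hy')

theorem rep_vecD (he : e ∈ charts n M) (hx : x ∈ u.dom e) :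
    (F.vecD V).rep e x = vecDir (F.Γ e) (u.rep e) (V.rep e) 1 x :=
  VectorAlong.rep_ofReps _ _ _ he hx

/-- The vector field obtained by raising the index of a covector field. -/
def sharp : VectorAlong u :=
  VectorAlong.ofReps u (fun e x => raise (F.A e (u.rep e x)) (α.rep e x))
    (fun e x => by rw [α.rep_add_one, u.rep_add_one])
    (fun e he => (contDiff_raise.comp_contDiffOn ((F.contDiffOn_A e he).comp (u.contDiffOn_rep he)
      fun x hx => rep_mem hx)).clm_apply (α.contDiffOn_rep he))
    (fun e he e' he' x hx hx' => by
      rw [u.rep_coordChange hx, F.raise_coordChange he he' (rep_mem hx) (by rwa [symm_rep hx]),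
        α.rep_coordChange he he' hx hx'])

theorem rep_sharp (he : e ∈ charts n M) (hx : x ∈ u.dom e) :
    (F.sharp α).rep e x = raise (F.A e (u.rep e x)) (α.rep e x) :=
  VectorAlong.rep_ofReps _ _ _ he hx

/-- The operator of degree two of a compatible pair. -/
def operator : LoopOperator n M := fun _ α => F.vecD (F.sharp (F.covD α))

theorem smoothPeriodic_pairing : SmoothPeriodic fun x : ℝ =>
    α (x : UnitAddCircle) (V (x : UnitAddCircle)) := by
  refine ⟨contDiff_iff_contDiffAt.2 fun x => ?_, fun x => by rw [AddCircle.coe_add_period]⟩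
  obtain ⟨e, he, hx⟩ := exists_chart u x
  have hN := (u.isOpen_dom e).mem_nhds hx
  refine (((α.contDiffOn_rep he).clm_apply (V.contDiffOn_rep he)).contDiffAt
    hN).congr_of_eventuallyEq ?_
  filter_upwards [hN] with y hy using pairing_eq α V he hy

/-- The integral of the derivative of the scalar `α(V)` over a period is zero, and the Leibniz rule
splits that derivative covariantly. -/
theorem integral_vecD : ∫ x in (0 : ℝ)..1, α (x : UnitAddCircle) (F.vecD V (x : UnitAddCircle))
    = - ∫ x in (0 : ℝ)..1, F.covD α (x : UnitAddCircle) (V (x : UnitAddCircle)) := by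
  have h := smoothPeriodic_pairing α V
  have h1 := smoothPeriodic_pairing α (F.vecD V)
  have h2 := smoothPeriodic_pairing (F.covD α) V
  rw [← add_eq_zero_iff_eq_neg, add_comm, ← intervalIntegral.integral_add
    (h2.continuous.intervalIntegrable _ _) (h1.continuous.intervalIntegrable _ _)]
  refine Eq.trans ?_ h.integral_deriv
  refine intervalIntegral.integral_congr fun x _ => ?_
  obtain ⟨e, he, hx⟩ := exists_chart u x
  have hN := (u.isOpen_dom e).mem_nhds hx
  have h3 : (fun x : ℝ => α (x : UnitAddCircle) (V (x : UnitAddCircle)))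
      =ᶠ[nhds x] fun x => α.rep e x (V.rep e x) := by
    filter_upwards [hN] with y hy using pairing_eq α V he hy
  have h4 := fderiv_pairing (Γ := F.Γ e) (γ := u.rep e)
    (differentiableAt_of_contDiffOn (u.isOpen_dom e) (α.contDiffOn_rep he) hx)
    (differentiableAt_of_contDiffOn (u.isOpen_dom e) (V.contDiffOn_rep he) hx) 1
  rw [fderiv_apply_one_eq_deriv, ← h3.deriv_eq] at h4
  rw [pairing_eq _ _ he hx, pairing_eq _ _ he hx, F.rep_covD α he hx, F.rep_vecD V he hx]
  exact h4.symm

theorem pairing_sharp_skew : α (x : UnitAddCircle) (F.sharp β (x : UnitAddCircle))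
    = - β (x : UnitAddCircle) (F.sharp α (x : UnitAddCircle)) := by
  obtain ⟨e, he, hx⟩ := exists_chart u x
  rw [pairing_eq _ _ he hx, pairing_eq _ _ he hx, F.rep_sharp _ he hx, F.rep_sharp _ he hx,
    apply_raise, apply_raise, F.skew _ he _ (rep_mem hx)]

/-- One integration by parts brings the bracket to a form that is visibly skew and contains first
covariant derivatives only. -/
theorem bracket_operator (δF δG : ∀ u : Loop n M, CovectorAlong u) (u : Loop n M) :
    bracket F.operator δF δG u = - ∫ x in (0 : ℝ)..1, F.covD (δF u) (x : UnitAddCircle)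
      (F.sharp (F.covD (δG u)) (x : UnitAddCircle)) :=
  F.integral_vecD _ _

theorem bracket_skew (δF δG : ∀ u : Loop n M, CovectorAlong u) (u : Loop n M) :
    bracket F.operator δF δG u = - bracket F.operator δG δF u := by
  rw [F.bracket_operator, F.bracket_operator, neg_neg, ← intervalIntegral.integral_neg]
  refine intervalIntegral.integral_congr fun x _ => ?_
  rw [F.pairing_sharp_skew (F.covD (δF u)), neg_neg]

end FlatPair

end

/-! ### The coefficients of the operator of a compatible pair -/

section

variable {n : ℕ}

/-- The components of the coefficients of an operator. -/
def OpCoeff.toCoeff (c : OpCoeff n) : Coefficients n where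
  a i j y := c.A y (proj i : Dual n) (proj j : Dual n)
  b i j k y := c.B y (single k 1) (proj i : Dual n)
    (proj j : Dual n)
  c₂ i j k l y := c.C₂ y (single k 1) (single l 1)
    (proj i : Dual n) (proj j : Dual n)
  c₁ i j k y := c.C₁ y (single k 1) (proj i : Dual n)
    (proj j : Dual n)

theorem bil_eq_sum (a : Bil n) (p q : Dual n) : a p q = ∑ i, ∑ j,
    a (proj i : Dual n) (proj j : Dual n) *
      (p (single i (1 : ℝ)) * q (single j (1 : ℝ))) := by
  rw [bil_left]
  refine Finset.sum_congr rfl fun i _ => ?_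
  rw [bil_right, Finset.mul_sum]
  exact Finset.sum_congr rfl fun j _ => by ring

theorem OpCoeff.toOp_toCoeff (c : OpCoeff n) : c.toCoeff.toOp = c := by
  have hA : c.toCoeff.toOp.A = c.A := by
    funext y; ext p q
    rw [Coefficients.toOp_A, bil_eq_sum]
    rfl
  have h1 : ∀ (L : Model n →L[ℝ] Bil n) (v : Model n) (p q : Dual n), ∑ k, L
      (single k 1) p q * v k = L v p q := by
    intro L v p q
    rw [clm_eq_sum_single L v]
    simp [mul_comm]
  have hB : c.toCoeff.toOp.B = c.B := by
    funext y; ext v p q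
    rw [Coefficients.toOp_B, bil_eq_sum]
    simp only [← h1 _ v]
    rfl
  have hC₁ : c.toCoeff.toOp.C₁ = c.C₁ := by
    funext y; ext v p q
    rw [Coefficients.toOp_C₁, bil_eq_sum]
    simp only [← h1 _ v]
    rfl
  have hC₂ : c.toCoeff.toOp.C₂ = c.C₂ := by
    funext y; ext v w p q
    rw [Coefficients.toOp_C₂, bil_eq_sum]
    refine Finset.sum_congr rfl fun i _ => Finset.sum_congr rfl fun j _ => congrArg (· * _) ?_
    rw [clm_eq_sum_single (c.C₂ y) v]
    simp only [sum_apply, smul_apply, smul_eq_mul]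
    refine Finset.sum_congr rfl fun k _ => ?_
    rw [← h1 _ w, Finset.mul_sum]
    exact Finset.sum_congr rfl fun l _ => by simp only [OpCoeff.toCoeff]; ring
  cases h : c.toCoeff.toOp
  cases c
  simp_all only

/-- Exchanging the arguments of a bilinear form. -/
def flipBil : Bil n →L[ℝ] Bil n := (ContinuousLinearMap.flipₗᵢ ℝ (Dual n) (Dual n) ℝ : _)

/-- Precomposition of the first argument with the adjoint of an endomorphism. -/
def preE : Bil n →L[ℝ] (Model n →L[ℝ] Model n) →L[ℝ] Bil n :=
  (ContinuousLinearMap.compL ℝ (Dual n) (Dual n) (Dual n →L[ℝ] ℝ)).bilinearComp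
    (ContinuousLinearMap.id ℝ (Bil n)) (ContinuousLinearMap.compL ℝ (Model n) (Model n) ℝ).flip

/-- Precomposition of the second argument with the adjoint of an endomorphism. -/
def postE : Bil n →L[ℝ] (Model n →L[ℝ] Model n) →L[ℝ] Bil n :=
  (ContinuousLinearMap.compL ℝ (Model n →L[ℝ] Model n) (Bil n) (Bil n) flipBil).comp
    (preE.comp flipBil)

theorem preE_apply (a : Bil n) (m : Model n →L[ℝ] Model n) (p q : Dual n) :
    preE a m p q = a (p.comp m) q := rfl

theorem postE_apply (a : Bil n) (m : Model n →L[ℝ] Model n) (p q : Dual n) :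
    postE a m p q = a p (q.comp m) := rfl

/-- The coefficient of `uₓ uₓ` before symmetrization. -/
def quadCoeff (A : Model n → Bil n) (Γ : Model n → Chris n) (y : Model n) :
    Model n →L[ℝ] Model n →L[ℝ] Bil n :=
  postE.bilinearComp (fderiv ℝ A y) (Γ y)
    + (ContinuousLinearMap.compL ℝ (Model n) (Model n →L[ℝ] Model n) (Bil n) (postE (A y))).comp
      (fderiv ℝ Γ y)
    + postE.bilinearComp ((preE (A y)).comp (Γ y)) (Γ y)

theorem quadCoeff_apply (A : Model n → Bil n) (Γ : Model n → Chris n) (y v w : Model n)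
    (p q : Dual n) : quadCoeff A Γ y v w p q = fderiv ℝ A y v p (q.comp (Γ y w))
      + A y p (q.comp (fderiv ℝ Γ y v w)) + A y (p.comp (Γ y v)) (q.comp (Γ y w)) := rfl

/-- The coefficients of the operator `∇ₓ ♯ ∇ₓ`. -/
def pairCoeff (A : Model n → Bil n) (Γ : Model n → Chris n) : OpCoeff n where
  A := A
  B y := fderiv ℝ A y - (postE (A y)).comp (Γ y) + (preE (A y)).comp (Γ y)
  -- Only values on equal arguments enter the operator; symmetrizing meets the symmetry convention
  -- for `cⁱʲₖₗ`.
  C₂ y := -(1 / 2 : ℝ) • (quadCoeff A Γ y + (quadCoeff A Γ y).flip)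
  C₁ y := - (postE (A y)).comp (Γ y)

theorem isRegularOn_pairCoeff {A : Model n → Bil n} {Γ : Model n → Chris n} {T : Set (Model n)}
    (hT : IsOpen T) (hA : ContDiffOn ℝ ∞ A T) (hΓ : ContDiffOn ℝ ∞ Γ T) :
    (pairCoeff A Γ).toCoeff.IsRegularOn T := by
  have hc : ∀ {G : Type} [NormedAddCommGroup G] [NormedSpace ℝ G] {c : G},
      ContDiffOn ℝ ∞ (fun _ : Model n => c) T := contDiffOn_const
  have hA' := hA.fderiv_of_isOpen (m := ∞) hT (by simp)
  have hΓ' := hΓ.fderiv_of_isOpen (m := ∞) hT (by simp)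
  have hpost : ∀ k (i j : Fin n), ContDiffOn ℝ ∞ (fun y => A y (proj i : Dual n)
      ((proj j : Dual n).comp (Γ y (single k 1)))) T := fun k i j =>
    (hA.clm_apply hc).clm_apply (hc.clm_comp (hΓ.clm_apply hc))
  have hpre : ∀ k (i j : Fin n), ContDiffOn ℝ ∞ (fun y => A y ((proj i :
      Dual n).comp (Γ y (single k 1))) (proj j : Dual n)) T :=
    fun k i j => (hA.clm_apply (hc.clm_comp (hΓ.clm_apply hc))).clm_apply hc
  have hquad : ∀ k l (i j : Fin n), ContDiffOn ℝ ∞ (fun y => quadCoeff A Γ y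
      (single k 1) (single l 1) (proj i : Dual n)
      (proj j : Dual n)) T := fun k l i j => by
    simp only [quadCoeff_apply]
    exact ((((hA'.clm_apply hc).clm_apply hc).clm_apply (hc.clm_comp (hΓ.clm_apply hc))).add
      ((hA.clm_apply hc).clm_apply (hc.clm_comp ((hΓ'.clm_apply hc).clm_apply hc)))).add
      ((hA.clm_apply (hc.clm_comp (hΓ.clm_apply hc))).clm_apply (hc.clm_comp (hΓ.clm_apply hc)))
  refine ⟨fun i j => (hA.clm_apply hc).clm_apply hc, fun i j k => ?_, fun i j k l => ?_,
    fun i j k => (hpost k i j).neg, fun i j k l y _ => ?_⟩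
  · exact ((((hA'.clm_apply hc).clm_apply hc).clm_apply hc).sub (hpost k i j)).add (hpre k i j)
  · exact ((hquad k l i j).add (hquad l k i j)).const_smul (-(1 / 2 : ℝ))
  · exact congrArg (fun r : ℝ => -(1 / 2 : ℝ) * r) (add_comm _ _)

end

/-! ### The local form of the operator of a pair -/

section

variable {n : ℕ} {M : Type*} [TopologicalSpace M] [T2Space M] [ChartedSpace (Model n) M]
  [IsManifold (𝓡 n) ∞ M] {e : OpenPartialHomeomorph M (Model n)} (F : FlatPair n M)

/-- The outer covariant derivative is carried out by the product rule after pairing with a fixed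
covector ξ. The acceleration of the loop appears only when the inner symbol `Γ(uₓ)` is
differentiated, which is why the coefficient of `uₓₓ` is minus `a` contracted with Γ. -/
theorem FlatPair.rep_operator (he : e ∈ charts n M) (u : Loop n M) (α : CovectorAlong u) {x : ℝ}
    (hx : x ∈ u.dom e) : (F.operator u α).rep e x
      = (pairCoeff (F.A e) (F.Γ e)).along (u.rep e) (α.rep e) x := by
  have ho := u.isOpen_dom e
  have hu := u.contDiffOn_rep he
  have hα := α.contDiffOn_rep he
  have hy := FlatPair.rep_mem hx
  have dA := differentiableAt_of_contDiffOn e.open_target (F.contDiffOn_A e he) hy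
  have dΓ := differentiableAt_of_contDiffOn e.open_target (F.contDiffOn_Γ e he) hy
  have du := differentiableAt_of_contDiffOn ho hu hx
  have dα := (differentiableAt_of_contDiffOn ho hα hx).hasDerivAt
  have du' := (differentiableAt_of_contDiffOn ho (contDiffOn_deriv ho hu) hx).hasDerivAt
  have dα' := (differentiableAt_of_contDiffOn ho (contDiffOn_deriv ho hα) hx).hasDerivAt
  have hAu := dA.hasFDerivAt.comp_hasDerivAt x du.hasDerivAt
  have hΓu := dΓ.hasFDerivAt.comp_hasDerivAt x du.hasDerivAt
  have hp := dα'.fun_sub (dα.clm_comp (hΓu.clm_apply du'))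
  refine model_ext fun ξ => ?_
  have h1 : (F.sharp (F.covD α)).rep e =ᶠ[nhds x] fun x => raise (F.A e (u.rep e x))
      (deriv (α.rep e) x - (α.rep e x).comp (F.Γ e (u.rep e x) (deriv (u.rep e) x))) := by
    filter_upwards [ho.mem_nhds hx] with y hy
    rw [F.rep_sharp _ he hy, F.rep_covD _ he hy, covDir, fderiv_apply_one_eq_deriv,
      fderiv_apply_one_eq_deriv]
  have h2 : DifferentiableAt ℝ ((F.sharp (F.covD α)).rep e) x :=
    differentiableAt_of_contDiffOn ho ((F.sharp (F.covD α)).contDiffOn_rep he) hx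
  have h3 : ξ (deriv ((F.sharp (F.covD α)).rep e) x) = deriv (fun x => F.A e (u.rep e x) ξ
      (deriv (α.rep e) x - (α.rep e x).comp (F.Γ e (u.rep e x) (deriv (u.rep e) x)))) x := by
    rw [← (ξ.hasFDerivAt.comp_hasDerivAt x h2.hasDerivAt).deriv]
    refine Filter.EventuallyEq.deriv_eq ?_
    filter_upwards [h1] with y hy
    rw [Function.comp_apply, hy, apply_raise]
  have h4 := ((hAu.clm_apply (hasDerivAt_const x ξ)).clm_apply hp).deriv
  change (deriv fun x => F.A e (u.rep e x) ξ (deriv (α.rep e) x - (α.rep e x).comp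
    (F.Γ e (u.rep e x) (deriv (u.rep e) x)))) x = _ at h4
  rw [FlatPair.operator, F.rep_vecD _ he hx, vecDir, map_add, fderiv_apply_one_eq_deriv,
    fderiv_apply_one_eq_deriv, h3, h4, OpCoeff.along, OpCoeff.apply_op, h1.eq_of_nhds]
  have h5 : ∀ s, ξ (F.Γ e (u.rep e x) (deriv (u.rep e) x) (raise (F.A e (u.rep e x)) s))
      = F.A e (u.rep e x) (ξ.comp (F.Γ e (u.rep e x) (deriv (u.rep e) x))) s := fun s =>
    apply_raise _ (ξ.comp _) s
  rw [h5]
  simp [pairCoeff, quadCoeff_apply, preE_apply, postE_apply]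
  ring

theorem FlatPair.hasLocalForm (he : e ∈ charts n M) :
    HasLocalForm F.operator e (pairCoeff (F.A e) (F.Γ e)).toCoeff :=
  HasLocalForm.of_rep_eq he
    (isRegularOn_pairCoeff e.open_target (F.contDiffOn_A e he) (F.contDiffOn_Γ e he))
    fun u α x hx => by rw [OpCoeff.toOp_toCoeff, F.rep_operator he u α hx]

theorem FlatPair.isNondegenerateDegreeTwo : IsNondegenerateDegreeTwo F.operator := by
  refine fun e he => ⟨_, F.hasLocalForm he, fun y hy => ?_⟩
  intro hdet
  obtain ⟨v, hv, hv0⟩ := Matrix.exists_mulVec_eq_zero_iff.2 hdet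
  have h1 : (∑ j, v j • (proj j : Dual n)) = 0 := by
    refine F.nondeg e he y hy _ fun p => ?_
    rw [bil_left]
    refine Finset.sum_eq_zero fun i _ => ?_
    have h2 := congrFun hv0 i
    simp only [Matrix.mulVec, dotProduct, Coefficients.leading, Matrix.of_apply,
      OpCoeff.toCoeff, Pi.zero_apply, pairCoeff] at h2
    rw [map_sum]
    simp only [map_smul, smul_eq_mul]
    rw [Finset.sum_congr rfl fun j _ => mul_comm (v j) _, h2, mul_zero]
  refine hv (funext fun j => ?_)
  have h3 := congrArg (fun L : Dual n => L (single j 1)) h1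
  simpa [sum_apply, Pi.single_apply] using h3

end

/-! ### The Euler–Lagrange expression of a local functional -/

section

variable {n m : ℕ} {M : Type*} [TopologicalSpace M] [T2Space M] [ChartedSpace (Model n) M]
  [IsManifold (𝓡 n) ∞ M] {e : OpenPartialHomeomorph M (Model n)}
  {E : Type*} [NormedAddCommGroup E] [NormedSpace ℝ E]

theorem eventually_fract_eq {c x : ℝ} (h : Int.fract (x - c) ≠ 0) :
    ∀ᶠ y in nhds x, Int.fract (y - c) = y - c - ⌊x - c⌋ := by
  have h1 : (⌊x - c⌋ : ℝ) + c < x := by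
    have := (Int.fract_nonneg (x - c)).lt_of_ne h.symm
    rw [Int.fract] at this
    linarith
  have h2 : x < (⌊x - c⌋ : ℝ) + 1 + c := by linarith [Int.lt_floor_add_one (x - c)]
  filter_upwards [Ioo_mem_nhds h1 h2] with y hy
  rw [Int.fract, Int.floor_eq_iff.2 ⟨by linarith [hy.1], by linarith [hy.2]⟩]

theorem coe_eq_of_fract_eq_zero {c x : ℝ} (h : Int.fract (x - c) = 0) :
    (x : UnitAddCircle) = c := by
  rw [← sub_eq_zero, ← AddCircle.coe_sub, AddCircle.coe_eq_zero_iff]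
  refine ⟨⌊x - c⌋, ?_⟩
  rw [Int.fract] at h
  rw [zsmul_eq_mul, mul_one]
  linarith

/-- Any density agrees locally with a compactly supported one. -/
theorem exists_compactDensity {T : Set (Model n)} (hT : IsOpen T)
    {f : ℝ × (Fin (m + 1) → Model n) → ℝ} (hf : ContDiffOn ℝ ∞ f {q | q.2 0 ∈ T}) {y₀ : Model n}
    (hy₀ : y₀ ∈ T) (x₀ : ℝ) : ∃ (g : CompactDensity n m T) (W : Set (Model n))
      (N : Set UnitAddCircle), IsOpen W ∧ y₀ ∈ W ∧ IsOpen N ∧ (x₀ : UnitAddCircle) ∈ N ∧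
      ∀ x : ℝ, (x : UnitAddCircle) ∈ N → ∃ k : ℤ, ∀ q : Fin (m + 1) → Model n, q 0 ∈ W →
        g.toFun (x, q) = f (x - k, q) := by
  obtain ⟨χ, W, hχ, hχc, hχT, hW, hyW, -, hχ1⟩ := exists_cutoff hT hy₀
  -- A density in a chart is not required to be periodic in x. The circle is cut at the point
  -- opposite to `x₀`; away from the cut, `c + Int.fract (x - c)` is a smooth choice of
  -- representative, and the bump θ vanishes near the cut.
  set c : ℝ := x₀ - 1 / 2 with hc
  have hne : (x₀ : UnitAddCircle) ∈ ({(c : UnitAddCircle)}ᶜ : Set UnitAddCircle) := by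
    intro h
    have h1 : ((1 / 2 : ℝ) : UnitAddCircle) = 0 := by
      rw [show (1 / 2 : ℝ) = x₀ - c by rw [hc]; ring, AddCircle.coe_sub, sub_eq_zero]
      exact h
    obtain ⟨k, hk⟩ := (AddCircle.coe_eq_zero_iff _).1 h1
    rw [zsmul_eq_mul, mul_one] at hk
    have h2 : ((2 * k : ℤ) : ℝ) = 1 := by push_cast; linarith
    have h3 : 2 * k = 1 := by exact_mod_cast h2
    omega
  obtain ⟨θ, S, hθ, hS, hSN, -, hθ0, N, hN, hxN, hθ1⟩ :=
    exists_circle_bump isClosed_singleton.isOpen_compl hne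
  have hfr : ∀ x : ℝ, (x : UnitAddCircle) ∈ S → Int.fract (x - c) ≠ 0 :=
    fun x hx h => hSN hx (coe_eq_of_fract_eq_zero h)
  refine ⟨{ toFun := fun p => θ p.1 * (χ (p.2 0) * f (c + Int.fract (p.1 - c), p.2))
            smooth := ?_
            periodic := fun x q => ?_
            supp := tsupport χ
            isCompact_supp := hχc
            supp_subset := hχT
            eq_zero := fun q hq => by simp [image_eq_zero_of_notMem_tsupport hq] },
    W, N, hW, hyW, hN, hxN, fun x hx => ⟨⌊x - c⌋, fun q hq => ?_⟩⟩
  · rintro ⟨x, q⟩ hq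
    refine ContDiffAt.contDiffWithinAt ?_
    by_cases hx : (x : UnitAddCircle) ∈ S
    · have h1 : ContDiffAt ℝ ∞ (fun p : ℝ × (Fin (m + 1) → Model n) =>
          θ p.1 * (χ (p.2 0) * f (p.1 - ⌊x - c⌋, p.2))) (x, q) := by
        refine ((hθ.smooth.comp contDiff_fst).contDiffAt).mul
          ((hχ.comp (by fun_prop : ContDiff ℝ ∞ fun p : ℝ × (Fin (m + 1) → Model n) =>
            p.2 0)).contDiffAt.mul ?_)
        exact ContDiffAt.comp (g := f) (x, q) (hf.contDiffAt ((isOpen_jets hT).mem_nhds hq))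
          (by fun_prop : ContDiff ℝ ∞ fun p : ℝ × (Fin (m + 1) → Model n) =>
            (p.1 - (⌊x - c⌋ : ℝ), p.2)).contDiffAt
      refine h1.congr_of_eventuallyEq ?_
      filter_upwards [continuous_fst.continuousAt.eventually (eventually_fract_eq (hfr x hx))]
        with p hp
      rw [hp, show c + (p.1 - c - (⌊x - c⌋ : ℝ)) = p.1 - ⌊x - c⌋ by ring]
    · refine (contDiffAt_const (c := (0 : ℝ))).congr_of_eventuallyEq ?_
      filter_upwards [continuous_fst.continuousAt.eventually
        ((isClosed_preimage_coe hS).isOpen_compl.mem_nhds hx)] with p hp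
      rw [hθ0 p.1 hp, zero_mul]
  · simp only [hθ.periodic x, add_sub_right_comm, Int.fract_add_one]
  · dsimp only
    rw [hθ1 x hx, hχ1 _ hq, one_mul, one_mul, Int.fract, show c + (x - c - (⌊x - c⌋ : ℝ))
      = x - ⌊x - c⌋ by ring]

theorem jet_congr {γ γ' : ℝ → Model n} {x : ℝ} (h : γ =ᶠ[nhds x] γ') : jet m γ x = jet m γ' x :=
  funext fun k => h.iteratedDeriv_eq k

/-- The density of a local functional depends smoothly on parameters. -/
theorem contDiff_local_family {ρ : Loop n M → UnitAddCircle → ℝ}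
    (hρ : ∀ e ∈ charts n M, ∃ f : ℝ × (Fin (m + 1) → Model n) → ℝ,
      ContDiffOn ℝ ∞ f {q | q.2 0 ∈ e.target} ∧ ∀ (u : Loop n M) (x : ℝ), x ∈ u.dom e →
        ρ u (x : UnitAddCircle) = f (x, jet m (u.rep e) x)) {U : E → Loop n M}
    (hU : ContMDiff 𝓘(ℝ, E × ℝ) (𝓡 n) ∞ (fun q : E × ℝ => U q.1 (q.2 : UnitAddCircle))) :
    ContDiff ℝ ∞ fun q : E × ℝ => ρ (U q.1) (q.2 : UnitAddCircle) := by
  refine contDiff_iff_contDiffAt.2 fun q => ?_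
  obtain ⟨e, he, hx⟩ := FlatPair.exists_chart (U q.1) q.2
  obtain ⟨f, hf, hρf⟩ := hρ e he
  have hN := (isOpen_family_dom hU e).mem_nhds hx
  refine ((contDiffOn_density_family (isOpen_family_dom hU e) (contDiffOn_family_rep he hU) hf
    fun q hq => e.map_source hq).contDiffAt hN).congr_of_eventuallyEq ?_
  filter_upwards [hN] with p hp using hρf _ _ hp

/-- Near a given point the density of F agrees with a compactly supported one. Along variations
confined to that region the two functionals differ by a constant, so their variational derivatives
have the same pairing with every such variation and must coincide there. No uniqueness of
variational derivatives is assumed beforehand. -/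
theorem exists_eulerLagrange {F : Loop n M → ℝ} {δF : ∀ u : Loop n M, CovectorAlong u}
    (hF : IsLocalFunctional F) (hδ : HasVariationalDerivative F δF) (he : e ∈ charts n M) {p₀ : M}
    (hp₀ : p₀ ∈ e.source) (x₀ : ℝ) : ∃ (m : ℕ) (g : CompactDensity n m e.target)
      (N : Set UnitAddCircle) (O : Set M), IsOpen N ∧ (x₀ : UnitAddCircle) ∈ N ∧ IsOpen O ∧
      p₀ ∈ O ∧ O ⊆ e.source ∧ ∀ (v : Loop n M) (x : ℝ), (x : UnitAddCircle) ∈ N →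
        v (x : UnitAddCircle) ∈ O → (δF v).rep e x = g.eulerLagrange v x := by
  obtain ⟨m, ρ, hρ, hFρ⟩ := hF
  obtain ⟨f, hf, hρf⟩ := hρ e he
  obtain ⟨g, W, N, hW, hyW, hN, hxN, hg⟩ :=
    exists_compactDensity e.open_target hf (e.map_source hp₀) x₀
  have hO : IsOpen (e.source ∩ e ⁻¹' W) := e.isOpen_inter_preimage hW
  refine ⟨m, g, N, _, hN, hxN, hO, ⟨hp₀, hyW⟩, Set.inter_subset_left, fun v x hx hvx => ?_⟩
  set O := e.source ∩ e ⁻¹' W with hOdef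
  have he₁ : e.restr O ∈ charts n M :=
    restr_mem_maximalAtlas (contDiffGroupoid ∞ (𝓡 n)) he hO
  have hsrc : (e.restr O).source = O := by
    rw [e.restr_source' O hO]
    exact Set.inter_eq_right.2 Set.inter_subset_left
  obtain ⟨φ, S, hφ, hS, hSN, -, hφ0, O', -, hxO', hφ1⟩ := exists_circle_bump
    (N := N ∩ {z | v z ∈ O}) (hN.inter (hO.preimage v.continuous)) (x₀ := x) ⟨hx, hvx⟩
  refine sub_eq_zero.1 (ContinuousLinearMap.ext fun w => ?_)
  -- The localized difference of the two covectors in the direction w. The variation is chosen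
  -- proportional to k itself, so that equality of the derivatives becomes `∫ k² = 0`.
  let k : ℝ → ℝ := fun y => φ y • ((δF v).rep e y - g.eulerLagrange v y) w
  have hk : SmoothPeriodic k := by
    refine smoothPeriodic_smul (e := e) (u := v) hS (fun z hz => (hSN hz).2.1) hφ hφ0
      ((((δF v).contDiffOn_rep he).sub
        (g.smoothPeriodic_eulerLagrange he v).smooth.contDiffOn).clm_apply contDiffOn_const)
      fun y => ?_
    rw [(δF v).rep_add_one, (g.smoothPeriodic_eulerLagrange he v).periodic y]
  have hV : SmoothPeriodic fun y => (φ y * k y) • w := (hφ.mul hk).smul (.const w)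
  obtain ⟨δ, hδ0, U, hU, hU0, hUS, hUe⟩ := exists_chartVariation v he₁ hV hS
    (fun z hz => by rw [hsrc]; exact (hSN hz).2) fun y hy => by simp only [hφ0 y hy, zero_mul, zero_smul]
  have hder : ∀ y ∈ v.dom (e.restr O), HasDerivAt (fun s => (U s).rep e y) ((φ y * k y) • w) 0 := by
    intro y hy
    have h1 := ((hasDerivAt_damp hδ0).smul_const ((φ y * k y) • w)).const_add (v.rep e y)
    rw [one_smul] at h1
    refine h1.congr_of_eventuallyEq (Filter.Eventually.of_forall fun s => ?_)
    exact (hUe s y hy).2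
  have hint : ∀ α : CovectorAlong v, ∀ y, ∃ e' ∈ charts n M, y ∈ v.dom e' ∧ ∃ z,
      HasDerivAt (fun s => (U s).rep e' y) z 0 ∧
        φ y * k y * α.rep e y w = α.rep e' y z := by
    intro α y
    by_cases hy : (y : UnitAddCircle) ∈ S
    · refine ⟨e, he, (hSN hy).2.1, _, hder y ?_, ?_⟩
      · change _ ∈ (e.restr O).source
        rw [hsrc]; exact (hSN hy).2
      · rw [map_smul, smul_eq_mul]
    · obtain ⟨e', he', hy'⟩ := FlatPair.exists_chart v y
      refine ⟨e', he', hy', 0, ?_, by rw [hφ0 y hy, zero_mul, zero_mul, map_zero]⟩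
      refine (hasDerivAt_const (0 : ℝ) (v.rep e' y)).congr_of_eventuallyEq
        (Filter.Eventually.of_forall fun s => ?_)
      exact congrArg e' (hUS s y hy)
  have h1 := hδ.hasDerivAt hU hU0 (hint (δF v))
  have h2 := (g.hasVariationalDerivative he).hasDerivAt hU hU0 (hint (g.variation he v))
  have hcont : ∀ s, Continuous (fun y : ℝ => ρ (U s) (y : UnitAddCircle)) ∧
      Continuous (fun y : ℝ => g.eval (U s) y) := by
    intro s
    have h3 := (contDiff_local_family hρ hU).continuous
    have h4 := (g.contDiff_eval_family he hU).continuous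
    exact ⟨h3.comp (by fun_prop : Continuous fun y : ℝ => (s, y)),
      h4.comp (by fun_prop : Continuous fun y : ℝ => (s, y))⟩
  -- Over S the two densities coincide; off S the loop is unchanged near the point, so each density
  -- keeps its value.
  have hconst : ∀ s, F (U s) - g.functional (U s) = F v - g.functional v := by
    have h5 : ∀ s, F (U s) - g.functional (U s) = ∫ y in (0 : ℝ)..1,
        (ρ (U s) (y : UnitAddCircle) - g.eval (U s) y) := fun s => by
      rw [intervalIntegral.integral_sub ((hcont s).1.intervalIntegrable _ _)
        ((hcont s).2.intervalIntegrable _ _), hFρ]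
      rfl
    intro s
    rw [h5 s, ← hU0, h5 0]
    refine intervalIntegral.integral_congr fun y _ => ?_
    by_cases hy : (y : UnitAddCircle) ∈ S
    · have hz : ∀ s, ρ (U s) (y : UnitAddCircle) - g.eval (U s) y = 0 := by
        intro s
        have hyv : y ∈ v.dom (e.restr O) := by
          change _ ∈ (e.restr O).source
          rw [hsrc]; exact (hSN hy).2
        have hyU : U s (y : UnitAddCircle) ∈ O := by
          rw [← hsrc]; exact (hUe s y hyv).1
        obtain ⟨j, hj⟩ := hg y (hSN hy).1
        have hc : ((y - j : ℝ) : UnitAddCircle) = y := by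
          rw [AddCircle.coe_sub, sub_eq_self, AddCircle.coe_eq_zero_iff]
          exact ⟨j, by simp⟩
        have h6 := hρf (U s) (y - j) (by rw [hc]; exact hyU.1)
        have h7 : jet m ((U s).rep e) (y - j) = jet m ((U s).rep e) y := by
          have : Function.Periodic (jet m ((U s).rep e)) 1 := jet_add_one (periodic_rep (U s))
          simpa using this.sub_zsmul_eq (x := y) j
        rw [hc] at h6
        rw [CompactDensity.eval, if_pos (show y ∈ (U s).dom e from hyU.1), sub_eq_zero,
          hj _ (by rw [jet_zero_apply]; exact hyU.2), ← h7]
        exact h6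
      rw [hz, hz]
    · have hev : ∀ᶠ z : ℝ in nhds y, U s (z : UnitAddCircle) = U 0 (z : UnitAddCircle) := by
        filter_upwards [eventually_notMem_of_isClosed hS hy] with z hz
        rw [hUS s z hz, hUS 0 z hz]
      have hrep : ∀ e', (U s).rep e' =ᶠ[nhds y] (U 0).rep e' := fun e' => by
        filter_upwards [hev] with z hz using congrArg e' hz
      obtain ⟨e', he', hy'⟩ := FlatPair.exists_chart (U 0) y
      obtain ⟨f', -, hf'⟩ := hρ e' he'
      have h6 := hf' (U s) y (by rw [hev.self_of_nhds]; exact hy')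
      have h7 := hf' (U 0) y hy'
      have h8 : ρ (U s) (y : UnitAddCircle) = ρ (U 0) (y : UnitAddCircle) := by
        refine h6.trans (Eq.trans ?_ h7.symm)
        exact congrArg (fun j => f' (y, j)) (jet_congr (hrep e'))
      have h9 : y ∈ (U s).dom e ↔ y ∈ (U 0).dom e := by
        simp only [Loop.dom, Set.mem_ofPred_eq, hev.self_of_nhds]
      rw [h8, CompactDensity.eval, CompactDensity.eval, jet_congr (hrep e)]
      by_cases h10 : y ∈ (U 0).dom e
      · rw [if_pos h10, if_pos (h9.2 h10)]
      · rw [if_neg h10, if_neg fun h => h10 (h9.1 h)]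
  have h3 : HasDerivAt (fun s => F (U s) - g.functional (U s)) 0 0 := by
    simp only [hconst]
    exact hasDerivAt_const _ _
  have h4 := (h1.sub h2).unique h3
  have h5 : ∫ y in (0 : ℝ)..1, k y * k y = 0 := by
    have hsm : ∀ α : CovectorAlong v, IntervalIntegrable (fun y => φ y * k y * α.rep e y w)
        MeasureTheory.volume 0 1 := fun α => by
      have := smoothPeriodic_smul (e := e) (u := v) hS (fun z hz => (hSN hz).2.1) (hφ.mul hk)
        (fun y hy => by rw [hφ0 y hy, zero_mul]) ((α.contDiffOn_rep he).clm_apply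
          (contDiffOn_const (c := w))) fun y => by rw [α.rep_add_one]
      exact this.continuous.intervalIntegrable _ _
    refine Eq.trans ?_ ((intervalIntegral.integral_sub (hsm _) (hsm _)).trans h4)
    refine intervalIntegral.integral_congr fun y _ => ?_
    beta_reduce
    by_cases hy : (y : UnitAddCircle) ∈ S
    · rw [g.rep_variation he v (hSN hy).2.1]
      simp only [k, smul_eq_mul, sub_apply]
      ring
    · simp only [k, hφ0 y hy, zero_smul, zero_mul, mul_zero, sub_zero]
  have h6 := hk.eq_zero_of_integral_sq h5 x
  simp only [k, hφ1 x hxO', one_smul] at h6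
  exact h6

end

/-! ### Variational derivatives along families of loops -/

section

variable {n : ℕ} {M : Type*} [TopologicalSpace M] [T2Space M] [ChartedSpace (Model n) M]
  [IsManifold (𝓡 n) ∞ M] {e : OpenPartialHomeomorph M (Model n)} {E : Type*}
  [NormedAddCommGroup E] [NormedSpace ℝ E] {U : E → Loop n M} {F : Loop n M → ℝ}
  {δF : ∀ u : Loop n M, CovectorAlong u}

theorem CompactDensity.contDiffOn_eulerLagrange_family {m : ℕ} (g : CompactDensity n m e.target)
    (he : e ∈ charts n M)
    (hU : ContMDiff 𝓘(ℝ, E × ℝ) (𝓡 n) ∞ (fun q : E × ℝ => U q.1 (q.2 : UnitAddCircle))) :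
    ContDiffOn ℝ ∞ (fun q : E × ℝ => g.eulerLagrange (U q.1) q.2)
      {q : E × ℝ | q.2 ∈ (U q.1).dom e} := by
  have hO := isOpen_family_dom hU e
  have h1 : ∀ k, ContDiffOn ℝ ∞ (fun q : E × ℝ => g.partials (U q.1) k q.2)
      {q : E × ℝ | q.2 ∈ (U q.1).dom e} := fun k =>
    (contDiffOn_density_family hO (contDiffOn_family_rep he hU)
      (contDiffOn_jetDeriv e.open_target g.smooth k) fun q hq => e.map_source hq).congr
      fun q hq => if_pos hq
  change ContDiffOn ℝ ∞ (fun q : E × ℝ => ∑ k : Fin (m + 1), (-1 : ℝ) ^ (k : ℕ) •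
    iteratedDeriv k (g.partials (U q.1) k) q.2) _
  refine ContDiffOn.sum fun k _ => ContDiffOn.const_smul _ ?_
  exact (contDiffOn_dx_iterate hO (h1 k) k).congr fun q hq =>
    iteratedDeriv_eq_dx_iterate (g := fun q : E × ℝ => g.partials (U q.1) k q.2) hO (h1 k) k hq

/-- Euler–Lagrange expressions depend smoothly on parameters, and locally a variational derivative
is one of them. This regularity is not part of the definition of a variational derivative. -/
theorem HasVariationalDerivative.contDiffOn_family_rep (hδ : HasVariationalDerivative F δF)
    (hF : IsLocalFunctional F) (he : e ∈ charts n M)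
    (hU : ContMDiff 𝓘(ℝ, E × ℝ) (𝓡 n) ∞ (fun q : E × ℝ => U q.1 (q.2 : UnitAddCircle))) :
    ContDiffOn ℝ ∞ (fun q : E × ℝ => (δF (U q.1)).rep e q.2)
      {q : E × ℝ | q.2 ∈ (U q.1).dom e} := by
  intro q hq
  obtain ⟨m, g, N, O, hN, hxN, hO, hpO, -, h⟩ := exists_eulerLagrange hF hδ he hq q.2
  have hO' := isOpen_family_dom hU e
  refine (((g.contDiffOn_eulerLagrange_family he hU).contDiffAt (hO'.mem_nhds hq)
    ).congr_of_eventuallyEq ?_).contDiffWithinAt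
  have h1 : Continuous fun q : E × ℝ => ((q.2 : ℝ) : UnitAddCircle) :=
    (AddCircle.continuous_mk' (1 : ℝ)).comp continuous_snd
  filter_upwards [(hN.preimage h1).mem_nhds hxN, (hO.preimage hU.continuous).mem_nhds hpO]
    with p hp hp' using h _ _ hp hp'

end

/-! ### Families of loops with prescribed velocities -/

section

variable {n N : ℕ} {M : Type*} [TopologicalSpace M] [T2Space M] [ChartedSpace (Model n) M]
  [IsManifold (𝓡 n) ∞ M] {e e' : OpenPartialHomeomorph M (Model n)} {u : Loop n M}

theorem hasDerivAt_rep_coordChange (he : e ∈ charts n M) (he' : e' ∈ charts n M) {U : ℝ → Loop n M}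
    (hU : ContMDiff 𝓘(ℝ, ℝ × ℝ) (𝓡 n) ∞ (fun q : ℝ × ℝ => U q.1 (q.2 : UnitAddCircle)))
    (hU0 : U 0 = u) {x : ℝ} (hx : x ∈ u.dom e) (hx' : x ∈ u.dom e') {v : Model n}
    (hv : HasDerivAt (fun s => (U s).rep e x) v 0) :
    HasDerivAt (fun s => (U s).rep e' x) (fderiv ℝ (coordChange e e') (u.rep e x) v) 0 := by
  subst hU0
  have h1 : DifferentiableAt ℝ (coordChange e e') ((U 0).rep e x) :=
    (contDiffAt_coordChange he he' (FlatPair.rep_mem hx)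
      (by rwa [FlatPair.symm_rep hx])).differentiableAt (by simp)
  refine (h1.hasFDerivAt.comp_hasDerivAt 0 hv).congr_of_eventuallyEq ?_
  have h2 : {s : ℝ | x ∈ (U s).dom e} ∈ nhds 0 :=
    ((isOpen_family_dom hU e).preimage
      (by fun_prop : Continuous fun s : ℝ => (s, x))).mem_nhds hx
  filter_upwards [h2] with s hs using (U s).rep_coordChange hs

/-- Displacements can be added only inside a chart, so a prescribed velocity supported in one chart
is added to an already constructed family. The parameters are damped to keep the result in the
chart. -/
theorem exists_family_step {W : (Fin N → ℝ) → Loop n M}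
    (hW : ContMDiff 𝓘(ℝ, (Fin N → ℝ) × ℝ) (𝓡 n) ∞
      (fun q : (Fin N → ℝ) × ℝ => W q.1 (q.2 : UnitAddCircle)))
    (hW0 : W 0 = u) (he : e ∈ charts n M) {Y : Fin N → ℝ → Model n}
    (hY : ∀ i, SmoothPeriodic (Y i)) {S : Set UnitAddCircle} (hS : IsClosed S)
    (hSu : ∀ z ∈ S, u z ∈ e.source) (h0 : ∀ i, ∀ x : ℝ, (x : UnitAddCircle) ∉ S → Y i x = 0) :
    ∃ δ > 0, ∃ W' : (Fin N → ℝ) → Loop n M,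
      ContMDiff 𝓘(ℝ, (Fin N → ℝ) × ℝ) (𝓡 n) ∞
        (fun q : (Fin N → ℝ) × ℝ => W' q.1 (q.2 : UnitAddCircle)) ∧ W' 0 = u ∧
      (∀ t, ∀ x : ℝ, (x : UnitAddCircle) ∉ S →
        W' t (x : UnitAddCircle) = W (fun i => damp δ (t i)) (x : UnitAddCircle)) ∧
      ∀ t, ∀ x : ℝ, (x : UnitAddCircle) ∈ S →
        (W' t).rep e x = (W fun i => damp δ (t i)).rep e x + ∑ i, damp δ (t i) • Y i x := by
  classical
  let g : (Fin N → ℝ) × ℝ → Model n := fun q => (W q.1).rep e q.2 + ∑ i, q.1 i • Y i q.2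
  have hO := isOpen_family_dom hW e
  have hg : ContDiffOn ℝ ∞ g {q | q.2 ∈ (W q.1).dom e} := by
    refine (contDiffOn_family_rep he hW).add (ContDiff.contDiffOn ?_)
    refine ContDiff.sum fun i _ => (by fun_prop : ContDiff ℝ ∞ fun q : (Fin N → ℝ) × ℝ => q.1 i).smul
      ((hY i).smooth.comp contDiff_snd)
  have hA : IsOpen ({q : (Fin N → ℝ) × ℝ | q.2 ∈ (W q.1).dom e} ∩ g ⁻¹' e.target) :=
    hg.continuousOn.isOpen_inter_preimage hO e.open_target
  have hK : IsCompact (Set.Icc (0 : ℝ) 1 ∩ {x : ℝ | (x : UnitAddCircle) ∈ S}) :=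
    isCompact_Icc.inter_right (isClosed_preimage_coe hS)
  -- At parameter 0 the displaced loop lies in the chart over the compact set K; the tube lemma
  -- extends this to a neighbourhood of 0 in parameter space.
  obtain ⟨O, K', hOo, -, h0O, hKK', hOK⟩ := generalized_tube_lemma
    (isCompact_singleton (x := (0 : Fin N → ℝ))) hK hA (by
      rintro ⟨t, x⟩ ⟨rfl, hx⟩
      have hxe : x ∈ (W 0).dom e := by rw [hW0]; exact hSu _ hx.2
      refine ⟨hxe, ?_⟩
      simp only [g, Set.mem_preimage, Pi.zero_apply, zero_smul, Finset.sum_const_zero, add_zero]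
      exact FlatPair.rep_mem hxe)
  obtain ⟨δ, hδ, hball⟩ := Metric.nhds_basis_closedBall.mem_iff.1
    (hOo.mem_nhds (Set.singleton_subset_iff.1 h0O))
  let T : (Fin N → ℝ) → Fin N → ℝ := fun t i => damp δ (t i)
  have hT : ContDiff ℝ ∞ T := contDiff_pi.2 fun i => (contDiff_damp δ).comp (by fun_prop)
  have hTO : ∀ t, T t ∈ O := fun t => hball <| by
    rw [mem_closedBall_zero_iff, pi_norm_le_iff_of_nonneg hδ.le]
    exact fun i => abs_damp_le hδ _
  have hfr : ∀ x : ℝ, ((Int.fract x : ℝ) : UnitAddCircle) = x := fun x => AddCircle.coe_fract x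
  have hYfr : ∀ i, ∀ x : ℝ, Y i (Int.fract x) = Y i x := fun i x => by
    simpa using (hY i).periodic.sub_zsmul_eq (x := x) ⌊x⌋
  have hmem : ∀ t, ∀ x : ℝ, (x : UnitAddCircle) ∈ S →
      x ∈ (W (T t)).dom e ∧ g (T t, x) ∈ e.target := by
    intro t x hx
    have := hOK (Set.mk_mem_prod (hTO t) (hKK' ⟨⟨Int.fract_nonneg x, (Int.fract_lt_one x).le⟩,
      by rw [Set.mem_ofPred_eq, hfr]; exact hx⟩))
    simpa only [g, Set.mem_inter_iff, Set.mem_ofPred_eq, Set.mem_preimage, Loop.dom, Loop.rep, hfr,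
      hYfr] using this
  let c : (Fin N → ℝ) → ℝ → M := fun t x =>
    if (x : UnitAddCircle) ∈ S then e.symm (g (T t, x)) else W (T t) (x : UnitAddCircle)
  have hc1 : ∀ t x, x ∈ (W (T t)).dom e → c t x = e.symm (g (T t, x)) := by
    intro t x hx
    by_cases hxS : (x : UnitAddCircle) ∈ S
    · exact if_pos hxS
    · simp only [c, g, if_neg hxS, h0 _ x hxS, smul_zero, Finset.sum_const_zero, add_zero]
      exact (FlatPair.symm_rep hx).symm
  have hTid : ContDiff ℝ ∞ fun q : (Fin N → ℝ) × ℝ => (T q.1, q.2) :=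
    (hT.comp contDiff_fst).prodMk contDiff_snd
  have hc : ContMDiff 𝓘(ℝ, (Fin N → ℝ) × ℝ) (𝓡 n) ∞ (fun q : (Fin N → ℝ) × ℝ => c q.1 q.2) := by
    rintro ⟨t, x⟩
    by_cases hxS : (x : UnitAddCircle) ∈ S
    · have h1 : ContDiffAt ℝ ∞ (fun q : (Fin N → ℝ) × ℝ => g (T q.1, q.2)) (t, x) :=
        (hg.contDiffAt (hO.mem_nhds (hmem t x hxS).1)).comp (t, x) hTid.contDiffAt
      refine ((contMDiffAt_symm_of_mem_maximalAtlas he (hmem t x hxS).2).comp (t, x)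
        h1.contMDiffAt).congr_of_eventuallyEq ?_
      filter_upwards [(hO.preimage hTid.continuous).mem_nhds (hmem t x hxS).1] with q hq
        using hc1 _ _ hq
    · refine ((hW.comp hTid.contMDiff) (t, x)).congr_of_eventuallyEq ?_
      have : {q : (Fin N → ℝ) × ℝ | (q.2 : UnitAddCircle) ∉ S} ∈ nhds (t, x) :=
        ((isClosed_preimage_coe hS).isOpen_compl.preimage continuous_snd).mem_nhds hxS
      filter_upwards [this] with q hq using if_neg hq
  refine ⟨δ, hδ, fun t => Loop.mk' (c t) ?_ ?_, hc, ?_, fun t x hx => ?_, fun t x hx => ?_⟩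
  · exact hc.comp (g := fun q : (Fin N → ℝ) × ℝ => c q.1 q.2) (f := fun x : ℝ => (t, x))
      (by fun_prop : ContDiff ℝ ∞ fun x : ℝ => (t, x)).contMDiff
  · intro x
    simp only [c, g, Loop.rep_add_one, (hY _).periodic x, AddCircle.coe_add_period]
  · ext x
    change c 0 x = _
    have hT0 : T 0 = 0 := funext fun i => damp_zero δ
    by_cases hxS : (x : UnitAddCircle) ∈ S
    · simp only [c, g, if_pos hxS, hT0, Pi.zero_apply, zero_smul, Finset.sum_const_zero, add_zero,
        hW0]
      exact FlatPair.symm_rep (hSu _ hxS)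
    · simp only [c, if_neg hxS, hT0, hW0]
  · exact if_neg hx
  · change e (c t x) = _
    rw [hc1 t x (hmem t x hx).1]
    exact e.right_inv (hmem t x hx).2

theorem damp_single (δ : ℝ) (i : Fin N) (s : ℝ) :
    (fun j => damp δ (Pi.single (M := fun _ => ℝ) i s j)) = Pi.single i (damp δ s) := by
  ext j
  rcases eq_or_ne j i with rfl | h
  · simp
  · simp [h]

/-- There are families of loops through a given loop with given velocities. -/
theorem exists_family (Z : Fin N → VectorAlong u) : ∃ W : (Fin N → ℝ) → Loop n M,
    ContMDiff 𝓘(ℝ, (Fin N → ℝ) × ℝ) (𝓡 n) ∞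
      (fun q : (Fin N → ℝ) × ℝ => W q.1 (q.2 : UnitAddCircle)) ∧ W 0 = u ∧
    ∀ i, ∀ e ∈ charts n M, ∀ x ∈ u.dom e,
      HasDerivAt (fun s : ℝ => (W (Pi.single i s)).rep e x) ((Z i).rep e x) 0 := by
  classical
  obtain ⟨s, θ, S, hθ, hS, hSN, hθ0, hsum⟩ := exists_circle_partition
    (N := fun z => u.toFun ⁻¹' (chartAt (Model n) (u z)).source)
    (fun z => (chartAt (Model n) (u z)).open_source.preimage u.continuous)
    fun z => mem_chart_source _ (u z)
  -- Induction over the partition of unity: each step adds the part `θ z` of the prescribed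
  -- velocities in one chart. Damping does not change velocities at 0.
  suffices h : ∀ s : Finset UnitAddCircle, ∃ W : (Fin N → ℝ) → Loop n M,
      ContMDiff 𝓘(ℝ, (Fin N → ℝ) × ℝ) (𝓡 n) ∞
        (fun q : (Fin N → ℝ) × ℝ => W q.1 (q.2 : UnitAddCircle)) ∧ W 0 = u ∧
      ∀ i, ∀ e ∈ charts n M, ∀ x ∈ u.dom e, HasDerivAt (fun s : ℝ => (W (Pi.single i s)).rep e x)
        ((∑ z ∈ s, θ z x) • (Z i).rep e x) 0 by
    obtain ⟨W, hW, hW0, h⟩ := h s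
    refine ⟨W, hW, hW0, fun i e he x hx => ?_⟩
    simpa only [hsum, one_smul] using h i e he x hx
  intro s
  induction s using Finset.induction_on with
  | empty =>
    refine ⟨fun _ => u, u.smooth.comp contDiff_snd.contMDiff, rfl, fun i e he x hx => ?_⟩
    simpa using hasDerivAt_const (0 : ℝ) (u.rep e x)
  | insert a s ha ih =>
    obtain ⟨W, hW, hW0, hWd⟩ := ih
    have hea := chartAt_mem_charts (n := n) (u a)
    obtain ⟨δ, hδ, W', hW', hW'0, hW'S, hW'e⟩ := exists_family_step hW hW0 hea
      (Y := fun i x => θ a x • (Z i).rep (chartAt (Model n) (u a)) x)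
      (fun i => smoothPeriodic_smul (u := u) (e := chartAt (Model n) (u a)) (hS a) (hSN a) (hθ a)
        (hθ0 a) ((Z i).contDiffOn_rep hea) (Z i).rep_add_one) (hS a) (hSN a)
      fun i x hx => by rw [hθ0 a x hx, zero_smul]
    refine ⟨W', hW', hW'0, fun i e he x hx => ?_⟩
    have hcomp : ∀ e ∈ charts n M, x ∈ u.dom e →
        HasDerivAt (fun s : ℝ => (W (Pi.single i (damp δ s))).rep e x)
          ((∑ z ∈ s, θ z x) • (Z i).rep e x) 0 := by
      intro e he hx
      have h1 := hWd i e he x hx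
      rw [← damp_zero δ] at h1
      have h2 := h1.scomp (0 : ℝ) (hasDerivAt_damp hδ)
      rwa [one_smul] at h2
    by_cases hxS : (x : UnitAddCircle) ∈ S a
    · have hxa : x ∈ u.dom (chartAt (Model n) (u a)) := hSN a hxS
      have h1 : HasDerivAt (fun s : ℝ => (W' (Pi.single i s)).rep (chartAt (Model n) (u a)) x)
          ((∑ z ∈ insert a s, θ z x) • (Z i).rep (chartAt (Model n) (u a)) x) 0 := by
        have h2 := (hcomp _ hea hxa).add ((hasDerivAt_damp hδ).smul_const
          (θ a x • (Z i).rep (chartAt (Model n) (u a)) x))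
        rw [one_smul, ← add_smul, add_comm (∑ z ∈ s, θ z x) (θ a x), ← Finset.sum_insert
          (f := fun z => θ z x) ha] at h2
        refine h2.congr_of_eventuallyEq (Filter.Eventually.of_forall fun r => ?_)
        refine (hW'e _ x hxS).trans ?_
        rw [damp_single, Finset.sum_eq_single i]
        · simp
        · intro j _ hj
          simp [hj]
        · simp
      have h2 := hasDerivAt_rep_coordChange (u := u) hea he (U := fun s => W' (Pi.single i s))
        (hW'.comp (f := fun q : ℝ × ℝ => (Pi.single (M := fun _ => ℝ) i q.1, q.2)) ?_)
        (by simp [hW'0]) hxa hx h1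
      · rwa [map_smul, ← (Z i).rep_coordChange hea he hxa hx] at h2
      · exact (((ContinuousLinearMap.single ℝ (fun _ : Fin N => ℝ) i).contDiff.comp
          contDiff_fst).prodMk contDiff_snd).contMDiff
    · rw [Finset.sum_insert ha, hθ0 a x hxS, zero_add]
      refine (hcomp e he hx).congr_of_eventuallyEq (Filter.Eventually.of_forall fun r => ?_)
      refine (congrArg e (hW'S _ x hxS)).trans ?_
      rw [damp_single]
      rfl

end

/-! ### The second covariant derivative of the bivector -/

section Local

variable {n : ℕ} {Q : Type*} [NormedAddCommGroup Q] [NormedSpace ℝ Q] {A : Model n → Bil n}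
  {Γ : Model n → Chris n} {γ : Q → Model n} {X Y Z : Q → Dual n} {V : Q → Model n} {q : Q}
  {y : Model n} {T : Set (Model n)}

theorem contDiffOn_nablaL (hT : IsOpen T) (hA : ContDiffOn ℝ ∞ A T) (hΓ : ContDiffOn ℝ ∞ Γ T) :
    ContDiffOn ℝ ∞ (nablaL A Γ) T := by
  have h : ∀ {B : Model n → Bil n}, ContDiffOn ℝ ∞ B T →
      ContDiffOn ℝ ∞ (fun y => precompL (B y) (Γ y)) T := fun {B} hB =>
    (contDiffOn_const.clm_apply hB).clm_comp (contDiffOn_const.clm_comp hΓ)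
  exact ((hA.fderiv_of_isOpen (m := ∞) hT (by simp)).add (h hA)).add
    (contDiffOn_const.clm_comp (h ((ContinuousLinearMap.flipₗᵢ ℝ (Dual n) (Dual n) ℝ
      ).contDiff.comp_contDiffOn hA)))

/-- The second covariant derivative of a bivector. -/
def hessA (A : Model n → Bil n) (Γ : Model n → Chris n) (y k h : Model n) (p q : Dual n) : ℝ :=
  fderiv ℝ (nablaL A Γ) y k h p q - nablaL A Γ y (Γ y k h) p q
    + nablaL A Γ y h (p.comp (Γ y k)) q + nablaL A Γ y h p (q.comp (Γ y k))

theorem fderiv_nablaL (hN : DifferentiableAt ℝ (nablaL A Γ) (γ q)) (hγ : DifferentiableAt ℝ γ q)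
    (hV : DifferentiableAt ℝ V q) (hX : DifferentiableAt ℝ X q) (hY : DifferentiableAt ℝ Y q)
    (h : Q) :
    fderiv ℝ (fun q => nablaL A Γ (γ q) (V q) (X q) (Y q)) q h
      = hessA A Γ (γ q) (fderiv ℝ γ q h) (V q) (X q) (Y q)
        + nablaL A Γ (γ q) (vecDir Γ γ V h q) (X q) (Y q)
        + nablaL A Γ (γ q) (V q) (covDir Γ γ X h q) (Y q)
        + nablaL A Γ (γ q) (V q) (X q) (covDir Γ γ Y h q) := by
  rw [((((hasFDerivAt_comp hN hγ).clm_apply hV.hasFDerivAt).clm_apply hX.hasFDerivAt).clm_apply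
    hY.hasFDerivAt).fderiv]
  simp [covDir, vecDir, hessA]
  ring

/-- For a flat torsion-free connection the second covariant derivative is symmetric. -/
theorem hessA_symm (hT : IsOpen T) (hA : ContDiffOn ℝ ∞ A T) (hΓ : ContDiffOn ℝ ∞ Γ T)
    (hy : y ∈ T) (hsymm : ∀ v w, Γ y v w = Γ y w v) (hflat : ∀ v w z, curv Γ y v w z = 0)
    (k h : Model n) (p q : Dual n) : hessA A Γ y k h p q = hessA A Γ y h k p q := by
  have hA1 := differentiableAt_of_contDiffOn hT hA hy
  have hΓ1 := differentiableAt_of_contDiffOn hT hΓ hy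
  have hA2 := differentiableAt_of_contDiffOn hT (hA.fderiv_of_isOpen (m := ∞) hT (by simp)) hy
  have hN := differentiableAt_of_contDiffOn hT (contDiffOn_nablaL hT hA hΓ) hy
  have hs : fderiv ℝ (fderiv ℝ A) y k h = fderiv ℝ (fderiv ℝ A) y h k :=
    (hA.contDiffAt (hT.mem_nhds hy)).isSymmSndFDerivAt
      (by simpa using WithTop.coe_le_coe.2 (le_top (a := (2 : ℕ∞)))) k h
  have key : ∀ k h, fderiv ℝ (nablaL A Γ) y k h p q
      = fderiv ℝ (fderiv ℝ A) y k h p q + fderiv ℝ A y k (p.comp (Γ y h)) q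
        + A y (p.comp (fderiv ℝ Γ y k h)) q + fderiv ℝ A y k p (q.comp (Γ y h))
        + A y p (q.comp (fderiv ℝ Γ y k h)) := by
    intro k h
    have h1 := (hN.hasFDerivAt.clm_apply (hasFDerivAt_const h y)).clm_apply (hasFDerivAt_const p y)
    have h2 := h1.clm_apply (hasFDerivAt_const q y)
    have h3 := hΓ1.hasFDerivAt.clm_apply (hasFDerivAt_const h y)
    have h4 := (((hA2.hasFDerivAt.clm_apply (hasFDerivAt_const h y)).clm_apply
      (hasFDerivAt_const p y)).clm_apply (hasFDerivAt_const q y)).add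
      (((hA1.hasFDerivAt.clm_apply ((hasFDerivAt_const p y).clm_comp h3)).clm_apply
      (hasFDerivAt_const q y)))
    have h5 := h4.add ((hA1.hasFDerivAt.clm_apply (hasFDerivAt_const p y)).clm_apply
      ((hasFDerivAt_const q y).clm_comp h3))
    have h6 := congrArg (fun L => L k) (h2.unique h5)
    simp at h6
    rw [h6]
    ring
  -- Flatness lets the two arguments of the derivative of Γ be exchanged at the price of terms
  -- quadratic in Γ, which match those in the definition of `hessA`.
  have hc : ∀ p : Dual n, p.comp (fderiv ℝ Γ y k h) = p.comp (fderiv ℝ Γ y h k)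
      - (p.comp (Γ y k)).comp (Γ y h) + (p.comp (Γ y h)).comp (Γ y k) := by
    intro p
    ext z
    have h3 := congrArg p (hflat k h z)
    simp only [curv, map_add, map_sub, map_zero] at h3
    simp only [sub_apply, add_apply, ContinuousLinearMap.comp_apply]
    linarith
  simp only [hessA, key, ← nablaA_eq_nablaL, nablaA, hs, hsymm k h, hc p, hc q, map_add, map_sub,
    add_apply, sub_apply]
  ring

/-- Leibniz rule for raising an index; the derivative of the bivector contributes the first summand.
-/
theorem vecDir_raise (hA : DifferentiableAt ℝ A (γ q)) (hγ : DifferentiableAt ℝ γ q)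
    (hX : DifferentiableAt ℝ X q) (h : Q) :
    vecDir Γ γ (fun q => raise (A (γ q)) (X q)) h q
      = raise (nablaL A Γ (γ q) (fderiv ℝ γ q h)) (X q) + raise (A (γ q)) (covDir Γ γ X h q) := by
  have hV : DifferentiableAt ℝ (fun q => raise (A (γ q)) (X q)) q :=
    ((contDiff_raise.differentiable (by simp) _).comp q (hA.comp q hγ)).clm_apply hX
  refine model_ext fun p => ?_
  have h1 := fderiv_pairing (Γ := Γ) (γ := γ) (differentiableAt_const p) hV h
  have h2 := fderiv_bil (Γ := Γ) hA hγ (differentiableAt_const p) hX h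
  simp only [apply_raise] at h1
  rw [map_add, apply_raise, apply_raise]
  rw [nablaA_eq_nablaL] at h2
  linarith

theorem fderiv_nablaL_raise (hA : DifferentiableAt ℝ A (γ q))
    (hN : DifferentiableAt ℝ (nablaL A Γ) (γ q)) (hγ : DifferentiableAt ℝ γ q)
    (hX : DifferentiableAt ℝ X q) (hY : DifferentiableAt ℝ Y q) (hZ : DifferentiableAt ℝ Z q)
    (h : Q) :
    fderiv ℝ (fun q => nablaL A Γ (γ q) (raise (A (γ q)) (Z q)) (X q) (Y q)) q h
      = hessA A Γ (γ q) (fderiv ℝ γ q h) (raise (A (γ q)) (Z q)) (X q) (Y q)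
        + nablaL A Γ (γ q) (raise (nablaL A Γ (γ q) (fderiv ℝ γ q h)) (Z q)) (X q) (Y q)
        + nablaL A Γ (γ q) (raise (A (γ q)) (covDir Γ γ Z h q)) (X q) (Y q)
        + nablaL A Γ (γ q) (raise (A (γ q)) (Z q)) (covDir Γ γ X h q) (Y q)
        + nablaL A Γ (γ q) (raise (A (γ q)) (Z q)) (X q) (covDir Γ γ Y h q) := by
  have hV : DifferentiableAt ℝ (fun q => raise (A (γ q)) (Z q)) q :=
    ((contDiff_raise.differentiable (by simp) _).comp q (hA.comp q hγ)).clm_apply hZ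
  rw [fderiv_nablaL hN hγ hV hX hY h, vecDir_raise hA hγ hZ h]
  simp only [map_add, add_apply]
  ring

end Local

namespace FlatPair

variable {n : ℕ} {M : Type*} [TopologicalSpace M] [T2Space M] [ChartedSpace (Model n) M]
  [IsManifold (𝓡 n) ∞ M] {e : OpenPartialHomeomorph M (Model n)} (F : FlatPair n M)
  {y : Model n}

/-- The covariant derivative of the bivector. -/
def N (F : FlatPair n M) (e : OpenPartialHomeomorph M (Model n)) : Model n → Model n →L[ℝ] Bil n :=
  nablaL (F.A e) (F.Γ e)

theorem differentiableAt_A (he : e ∈ charts n M) (hy : y ∈ e.target) :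
    DifferentiableAt ℝ (F.A e) y :=
  differentiableAt_of_contDiffOn e.open_target (F.contDiffOn_A e he) hy

theorem differentiableAt_N (he : e ∈ charts n M) (hy : y ∈ e.target) :
    DifferentiableAt ℝ (nablaL (F.A e) (F.Γ e)) y :=
  differentiableAt_of_contDiffOn e.open_target (contDiffOn_nablaL e.open_target
    (F.contDiffOn_A e he) (F.contDiffOn_Γ e he)) hy

theorem exists_raise (he : e ∈ charts n M) (hy : y ∈ e.target) (v : Model n) :
    ∃ s, raise (F.A e y) s = v :=
  ⟨_, (raise_isInvertible (F.nondeg e he y hy)).self_apply_inverse v⟩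

theorem N_skew (he : e ∈ charts n M) (hy : y ∈ e.target) (v : Model n) (p q : Dual n) :
    F.N e y v p q = - F.N e y v q p := by
  have hA := F.differentiableAt_A he hy
  have h1 : (fun z => F.A e z p q) =ᶠ[nhds y] fun z => - F.A e z q p := by
    filter_upwards [e.open_target.mem_nhds hy] with z hz using F.skew e he z hz p q
  have h2 := congrArg (fun L => L v) (h1.fderiv_eq (𝕜 := ℝ))
  simp only [fderiv_fun_neg, neg_apply] at h2
  rw [fderiv_clm_apply_apply hA, fderiv_clm_apply_apply hA] at h2
  simp only [N, ← nablaA_eq_nablaL, nablaA, h2, F.skew e he y hy (p.comp _) q,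
    F.skew e he y hy p (q.comp _)]
  ring

theorem hess_skew (he : e ∈ charts n M) (hy : y ∈ e.target) (k h : Model n) (p q : Dual n) :
    hessA (F.A e) (F.Γ e) y k h p q = - hessA (F.A e) (F.Γ e) y k h q p := by
  have hN := F.differentiableAt_N he hy
  have h1 : (fun z => F.N e z h p q) =ᶠ[nhds y] fun z => - F.N e z h q p := by
    filter_upwards [e.open_target.mem_nhds hy] with z hz using F.N_skew he hz h p q
  have h2 := congrArg (fun L => L k) (h1.fderiv_eq (𝕜 := ℝ))
  have h3 : ∀ p q, fderiv ℝ (fun z => F.N e z h p q) y k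
      = fderiv ℝ (nablaL (F.A e) (F.Γ e)) y k h p q := by
    intro p q
    rw [N, (((hN.hasFDerivAt.clm_apply (hasFDerivAt_const h y)).clm_apply
      (hasFDerivAt_const p y)).clm_apply (hasFDerivAt_const q y)).fderiv]
    simp
  simp only [fderiv_fun_neg, neg_apply] at h2
  rw [h3, h3] at h2
  have h4 := F.N_skew he hy (F.Γ e y k h) p q
  have h5 := F.N_skew he hy h (p.comp (F.Γ e y k)) q
  have h6 := F.N_skew he hy h p (q.comp (F.Γ e y k))
  simp only [N] at h4 h5 h6
  simp only [hessA, h2, h4, h5, h6]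
  ring

/-- The derivative of the compatibility condition. -/
theorem hess_compat (he : e ∈ charts n M) (hy : y ∈ e.target) (w : Model n) (p q r : Dual n) :
    hessA (F.A e) (F.Γ e) y w (raise (F.A e y) r) p q + F.N e y (raise (F.N e y w) r) p q
      = hessA (F.A e) (F.Γ e) y w (raise (F.A e y) p) q r + F.N e y (raise (F.N e y w) p) q r := by
  have h1 : (fun z => F.N e z (raise (F.A e z) r) p q)
      =ᶠ[nhds y] fun z => F.N e z (raise (F.A e z) p) q r := by
    filter_upwards [e.open_target.mem_nhds hy] with z hz using F.compat e he z hz p q r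
  have h2 := congrArg (fun L => L w) (h1.fderiv_eq (𝕜 := ℝ))
  have h3 := fun p q r : Dual n => fderiv_nablaL_raise (γ := fun z => z) (q := y)
    (F.differentiableAt_A he hy) (F.differentiableAt_N he hy) differentiableAt_id
    (differentiableAt_const p) (differentiableAt_const q) (differentiableAt_const r) w
  have h4 := h3 p q r
  have h5 := h3 q r p
  have hc := F.compat e he y hy
  simp only [nablaA_eq_nablaL] at hc
  simp only [fderiv_fun_id, ContinuousLinearMap.id_apply] at h4 h5
  simp only [N] at h2 ⊢
  -- Constant covectors need not be parallel; the terms with their covariant derivatives cancel by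
  -- the undifferentiated compatibility condition.
  linarith [hc p q (covDir (F.Γ e) (fun z => z) (fun _ => r) w y),
    hc (covDir (F.Γ e) (fun z => z) (fun _ => p) w y) q r,
    hc p (covDir (F.Γ e) (fun z => z) (fun _ => q) w y) r]

/-- By compatibility and skewness the form `(∇_{♯r} a)(p, q)` is totally skew. Writing the vector
obtained from `∇_{♯s} a` and r as `♯σ(s, r)`, the quadratic expressions in the derivative of `a`
become values of `a` on the skew products σ, whose symmetries are evident. -/
theorem exists_eps (he : e ∈ charts n M) (hy : y ∈ e.target) :
    ∃ σ : Dual n → Dual n → Dual n, (∀ s r, σ s r = - σ r s) ∧ ∀ s r p q,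
      F.N e y (raise (F.N e y (raise (F.A e y) s)) r) p q = F.A e y (σ p q) (σ s r) := by
  have hc := F.compat e he y hy
  simp only [nablaA_eq_nablaL] at hc
  change ∀ p q r, F.N e y (raise (F.A e y) r) p q = F.N e y (raise (F.A e y) p) q r at hc
  have hs := F.N_skew he hy
  choose σ hσ using fun s r => F.exists_raise he hy (raise (F.N e y (raise (F.A e y) s)) r)
  have hi := fun s : Dual n => (raise_isInvertible (F.nondeg e he y hy)).inverse_apply_self s
  have hσ' : ∀ s r, σ s r = - σ r s := by
    intro s r
    rw [← hi (σ s r), ← hi (- σ r s), map_neg, hσ, hσ]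
    congr 1
    refine model_ext fun p => ?_
    refine (apply_raise _ _ _).trans (Eq.trans ?_ (map_neg p _).symm)
    rw [apply_raise, hc p r s, hs, hc p s r, hc s r p]
  refine ⟨σ, hσ', fun s r p q => ?_⟩
  · rw [← hσ s r, hc p q, hc q, ← apply_raise (F.N e y _), ← hσ, apply_raise, hσ' q p, map_neg,
      F.skew e he y hy, neg_neg]

/-- The cyclic identity for the second covariant derivative of the bivector. -/
theorem hess_eq (he : e ∈ charts n M) (hy : y ∈ e.target) (w : Model n) (p q r : Dual n) :
    hessA (F.A e) (F.Γ e) y w (raise (F.A e y) r) p q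
      = F.N e y (raise (F.N e y w) p) q r + F.N e y (raise (F.N e y w) q) r p := by
  obtain ⟨σ, hσ, hε⟩ := F.exists_eps he hy
  obtain ⟨s, rfl⟩ := F.exists_raise he hy w
  have hsym := fun s r => hessA_symm e.open_target (F.contDiffOn_A e he) (F.contDiffOn_Γ e he) hy
    (F.symm e he y hy) (F.flat e he y hy) (raise (F.A e y) s) (raise (F.A e y) r)
  have hsk := fun s r => F.hess_skew he hy (raise (F.A e y) s) (raise (F.A e y) r)
  have hc := fun s => F.hess_compat he hy (raise (F.A e y) s)
  simp only [hε] at hc ⊢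
  have hA := F.skew e he y hy
  have h1 : ∀ a b c d, F.A e y (σ c d) (σ a b) = - F.A e y (σ c d) (σ b a) := fun a b c d => by
    rw [hσ a b, map_neg]
  -- The Hessian is symmetric in its two directions, skew in its two covectors and, by `hc`, cyclic
  -- up to the quadratic terms. A form symmetric in its first two arguments and totally skew in its
  -- last three is zero, so these relations determine the Hessian; the listed instances solve the
  -- linear system.
  linarith [hsym s r p q, hsym s p q r, hsym r p q s, hc s p q r, hc r p q s, hc p q r s,
    hc p r s q, hsk p r s q, h1 s r p q, h1 s p q r, h1 r p q s, hA (σ r p) (σ q s),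
    hA (σ r p) (σ s q), h1 q s r p, h1 s q r p, h1 p r s q, hA (σ s q) (σ p r), h1 p r q s]

end FlatPair

/-! ### The exact term of the Jacobi identity -/

namespace FlatPair

section

variable {n : ℕ} {M : Type*} [TopologicalSpace M] [T2Space M] [ChartedSpace (Model n) M]
  [IsManifold (𝓡 n) ∞ M] {e e' : OpenPartialHomeomorph M (Model n)} (F : FlatPair n M)
  {y : Model n} {Q : Type*} [NormedAddCommGroup Q] [NormedSpace ℝ Q] {γ : Q → Model n}
  {X Y Z : Q → Dual n} {q : Q}

/-- Both sides arise from differentiating the law for the bivector; the covariant derivatives of the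
pulled-back covectors correspond, so the remaining terms do too. -/
theorem N_coordChange (he : e ∈ charts n M) (he' : e' ∈ charts n M) (hy : y ∈ e.target)
    (hy' : e.symm y ∈ e'.source) (v : Model n) (p q : Dual n) :
    F.N e' (coordChange e e' y) (fderiv ℝ (coordChange e e') y v) p q
      = F.N e y v (p.comp (fderiv ℝ (coordChange e e') y))
        (q.comp (fderiv ℝ (coordChange e e') y)) := by
  have h1 := (contDiffAt_coordChange he he' hy hy').differentiableAt (by simp)
  have h2 := (contDiffAt_fderiv_coordChange he he' hy hy').differentiableAt (by simp)
  have hX : ∀ p : Dual n, DifferentiableAt ℝ (fun z => p.comp (fderiv ℝ (coordChange e e') z)) y :=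
    fun p => ((differentiableAt_const p).clm_comp h2)
  have hev : (fun z => F.A e' (coordChange e e' z) p q) =ᶠ[nhds y] fun z => F.A e z
      (p.comp (fderiv ℝ (coordChange e e') z)) (q.comp (fderiv ℝ (coordChange e e') z)) := by
    filter_upwards [(e.isOpen_inter_preimage_symm e'.open_source).mem_nhds ⟨hy, hy'⟩] with z hz
      using F.A_coordChange e he e' he' z hz.1 hz.2 p q
  have h3 := congrArg (fun L => L v) (hev.fderiv_eq (𝕜 := ℝ))
  have hy2 : coordChange e e' y ∈ e'.target := e'.map_source hy'
  have h4 := fderiv_bil (Γ := F.Γ e') (γ := coordChange e e') (F.differentiableAt_A he' hy2) h1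
    (differentiableAt_const p) (differentiableAt_const q) v
  have h5 := fderiv_bil (Γ := F.Γ e) (γ := fun z => z) (F.differentiableAt_A he hy)
    differentiableAt_id (hX p) (hX q) v
  have hc : ∀ p : Dual n, covDir (F.Γ e) (fun z => z)
      (fun z => p.comp (fderiv ℝ (coordChange e e') z)) v y
      = (covDir (F.Γ e') (coordChange e e') (fun _ => p) v y).comp
        (fderiv ℝ (coordChange e e') y) := fun p =>
    F.covDir_coordChange (γ := fun z => z) he he' hy hy' differentiableAt_id
      (differentiableAt_const p) .rfl .rfl v
  have hA := F.A_coordChange e he e' he' y hy hy'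
  simp only [fderiv_fun_id, ContinuousLinearMap.id_apply, hc, nablaA_eq_nablaL, ← hA] at h4 h5
  simp only [N]
  linarith

/-- The Leibniz rule gives a Hessian term and quadratic terms. The cyclic identity `hess_eq`
replaces the Hessian by exactly the quadratic terms needed to complete the derivatives of the three
raised covectors. -/
theorem fderiv_N_raise (he : e ∈ charts n M) (hq : γ q ∈ e.target) (hγ : DifferentiableAt ℝ γ q)
    (hX : DifferentiableAt ℝ X q) (hY : DifferentiableAt ℝ Y q) (hZ : DifferentiableAt ℝ Z q)
    (h : Q) :
    fderiv ℝ (fun q => F.N e (γ q) (raise (F.A e (γ q)) (Z q)) (X q) (Y q)) q h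
      = F.N e (γ q) (vecDir (F.Γ e) γ (fun q => raise (F.A e (γ q)) (Z q)) h q) (X q) (Y q)
        + F.N e (γ q) (vecDir (F.Γ e) γ (fun q => raise (F.A e (γ q)) (X q)) h q) (Y q) (Z q)
        + F.N e (γ q) (vecDir (F.Γ e) γ (fun q => raise (F.A e (γ q)) (Y q)) h q) (Z q) (X q) := by
  have hA := F.differentiableAt_A he hq
  have h1 := fderiv_nablaL_raise hA (F.differentiableAt_N he hq) hγ hX hY hZ h
  have h2 := F.hess_eq he hq (fderiv ℝ γ q h) (X q) (Y q) (Z q)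
  have hc := F.compat e he _ hq
  rw [vecDir_raise hA hγ hX, vecDir_raise hA hγ hY, vecDir_raise hA hγ hZ]
  simp only [nablaA_eq_nablaL] at hc
  simp only [N, map_add, add_apply] at h2 ⊢
  linarith [hc (covDir (F.Γ e) γ X h q) (Y q) (Z q), hc (X q) (covDir (F.Γ e) γ Y h q) (Z q),
    hc (covDir (F.Γ e) γ Y h q) (Z q) (X q)]

variable {u : Loop n M}

/-- The covariant derivative of the bivector, along a loop. -/
def loopN (V : VectorAlong u) (α β : CovectorAlong u) (x : ℝ) : ℝ :=
  F.N (chartAt (Model n) (u (x : UnitAddCircle)))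
    (u.rep (chartAt (Model n) (u (x : UnitAddCircle))) x)
    (V.rep (chartAt (Model n) (u (x : UnitAddCircle))) x)
    (α.rep (chartAt (Model n) (u (x : UnitAddCircle))) x)
    (β.rep (chartAt (Model n) (u (x : UnitAddCircle))) x)

theorem loopN_eq (V : VectorAlong u) (α β : CovectorAlong u) (he : e ∈ charts n M) {x : ℝ}
    (hx : x ∈ u.dom e) :
    F.loopN V α β x = F.N e (u.rep e x) (V.rep e x) (α.rep e x) (β.rep e x) := by
  have he' := chartAt_mem_charts (n := n) (u (x : UnitAddCircle))
  have hx' := mem_dom_chartAt u x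
  rw [loopN, u.rep_coordChange hx, V.rep_coordChange he he' hx hx',
    F.N_coordChange he he' (rep_mem hx) (by rwa [symm_rep hx]), ← α.rep_coordChange he he' hx hx',
    ← β.rep_coordChange he he' hx hx']

theorem smoothPeriodic_loopN (V : VectorAlong u) (α β : CovectorAlong u) :
    SmoothPeriodic (F.loopN V α β) := by
  refine ⟨contDiff_iff_contDiffAt.2 fun x => ?_, fun x => ?_⟩
  · obtain ⟨e, he, hx⟩ := exists_chart u x
    have hN := (u.isOpen_dom e).mem_nhds hx
    have h1 : ContDiffOn ℝ ∞ (fun x => F.N e (u.rep e x)) (u.dom e) :=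
      (contDiffOn_nablaL e.open_target (F.contDiffOn_A e he) (F.contDiffOn_Γ e he)).comp
        (u.contDiffOn_rep he) fun x hx => rep_mem hx
    refine ((((h1.clm_apply (V.contDiffOn_rep he)).clm_apply (α.contDiffOn_rep he)).clm_apply
      (β.contDiffOn_rep he)).contDiffAt hN).congr_of_eventuallyEq ?_
    filter_upwards [hN] with y hy using F.loopN_eq V α β he hy
  · simp only [loopN, u.rep_add_one, V.rep_add_one, α.rep_add_one, β.rep_add_one,
      AddCircle.coe_add_period]

/-- The integrand is the derivative of the periodic function `(∇_{♯κ} a)(α, β)`. -/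
theorem integral_loopN (α β κ : CovectorAlong u) : ∫ x in (0 : ℝ)..1,
    (F.loopN (F.vecD (F.sharp κ)) α β x + F.loopN (F.vecD (F.sharp α)) β κ x
      + F.loopN (F.vecD (F.sharp β)) κ α x) = 0 := by
  refine Eq.trans ?_ (F.smoothPeriodic_loopN (F.sharp κ) α β).integral_deriv
  refine intervalIntegral.integral_congr fun x _ => ?_
  obtain ⟨e, he, hx⟩ := exists_chart u x
  have hO := u.isOpen_dom e
  have hev : F.loopN (F.sharp κ) α β =ᶠ[nhds x] fun x => F.N e (u.rep e x)
      (raise (F.A e (u.rep e x)) (κ.rep e x)) (α.rep e x) (β.rep e x) := by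
    filter_upwards [hO.mem_nhds hx] with y hy
    rw [F.loopN_eq _ _ _ he hy, F.rep_sharp κ he hy]
  have hv : ∀ α : CovectorAlong u, (F.vecD (F.sharp α)).rep e x
      = vecDir (F.Γ e) (u.rep e) (fun x => raise (F.A e (u.rep e x)) (α.rep e x)) 1 x := by
    intro α
    have h1 : (F.sharp α).rep e =ᶠ[nhds x] fun x => raise (F.A e (u.rep e x)) (α.rep e x) := by
      filter_upwards [hO.mem_nhds hx] with y hy using F.rep_sharp α he hy
    rw [F.rep_vecD _ he hx, vecDir, vecDir, h1.fderiv_eq, h1.eq_of_nhds]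
  have hd := fun α : CovectorAlong u => differentiableAt_of_contDiffOn hO (α.contDiffOn_rep he) hx
  have h2 := F.fderiv_N_raise he (rep_mem hx)
    (differentiableAt_of_contDiffOn hO (u.contDiffOn_rep he) hx) (hd α) (hd β) (hd κ) 1
  rw [fderiv_apply_one_eq_deriv] at h2
  rw [hev.deriv_eq, h2]
  simp only [F.loopN_eq _ _ _ he hx, hv]

end

end FlatPair

/-! ### Covector fields along families of loops -/

section

variable {n : ℕ} {M : Type*} [TopologicalSpace M] [T2Space M] [ChartedSpace (Model n) M]
  [IsManifold (𝓡 n) ∞ M] {e e' : OpenPartialHomeomorph M (Model n)} (F : FlatPair n M)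
  {E : Type*} [NormedAddCommGroup E] [NormedSpace ℝ E] {W : E → Loop n M}
  {δ : ∀ u : Loop n M, CovectorAlong u}

/-- The expression of a family of loops in a chart. -/
def famRep (W : E → Loop n M) (e : OpenPartialHomeomorph M (Model n)) (q : E × ℝ) : Model n :=
  (W q.1).rep e q.2

/-- The expression in a chart of covector fields along a family of loops. -/
def famCov (W : E → Loop n M) (δ : ∀ u : Loop n M, CovectorAlong u)
    (e : OpenPartialHomeomorph M (Model n)) (q : E × ℝ) : Dual n :=
  (δ (W q.1)).rep e q.2

/-- The set on which a family of loops runs in a chart. -/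
def famDom (W : E → Loop n M) (e : OpenPartialHomeomorph M (Model n)) : Set (E × ℝ) :=
  {q | q.2 ∈ (W q.1).dom e}

variable (W δ) in
/-- A smooth family of loops, and smooth covector fields along it. -/
structure IsSmoothAlong : Prop where
  family : ContMDiff 𝓘(ℝ, E × ℝ) (𝓡 n) ∞ (fun q : E × ℝ => W q.1 (q.2 : UnitAddCircle))
  cov : ∀ e ∈ charts n M, ContDiffOn ℝ ∞ (famCov W δ e) (famDom W e)

theorem fderiv_add_right_one {G : Type*} [NormedAddCommGroup G] [NormedSpace ℝ G]
    {f : E × ℝ → G} (hf : ∀ t x, f (t, x + 1) = f (t, x)) (t : E) (x : ℝ) :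
    fderiv ℝ f (t, x + 1) = fderiv ℝ f (t, x) := by
  have h1 := fderiv_comp_add_right (𝕜 := ℝ) (f := f) (x := (t, x)) ((0 : E), (1 : ℝ))
  rw [Prod.mk_add_mk, add_zero] at h1
  rw [← h1]
  congr 1
  ext q
  rw [show q + ((0 : E), (1 : ℝ)) = (q.1, q.2 + 1) by ext <;> simp, hf]

namespace IsSmoothAlong

variable {q : E × ℝ} {v : E × ℝ} {x : ℝ}

theorem isOpen_famDom (h : IsSmoothAlong W δ) (e : OpenPartialHomeomorph M (Model n)) : IsOpen
    (famDom W e) :=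
  isOpen_family_dom h.family e

theorem contDiffOn_famRep (h : IsSmoothAlong W δ) (he : e ∈ charts n M) : ContDiffOn ℝ ∞
    (famRep W e) (famDom W e) :=
  contDiffOn_family_rep he h.family

theorem differentiableAt_famRep (h : IsSmoothAlong W δ) (he : e ∈ charts n M)
    (hq : q ∈ famDom W e) :
    DifferentiableAt ℝ (famRep W e) q :=
  differentiableAt_of_contDiffOn (h.isOpen_famDom e) (h.contDiffOn_famRep he) hq

theorem differentiableAt_famCov (h : IsSmoothAlong W δ) (he : e ∈ charts n M)
    (hq : q ∈ famDom W e) :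
    DifferentiableAt ℝ (famCov W δ e) q :=
  differentiableAt_of_contDiffOn (h.isOpen_famDom e) (h.cov e he) hq

theorem famRep_coordChange (h : IsSmoothAlong W δ) (hq : q ∈ famDom W e) :
    famRep W e' =ᶠ[nhds q] fun q => coordChange e e' (famRep W e q) := by
  filter_upwards [(h.isOpen_famDom e).mem_nhds hq] with p hp using (W p.1).rep_coordChange hp

theorem famCov_coordChange (h : IsSmoothAlong W δ) (he : e ∈ charts n M) (he' : e' ∈ charts n M)
    (hq : q ∈ famDom W e)
    (hq' : q ∈ famDom W e') : famCov W δ e =ᶠ[nhds q] fun q =>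
      (famCov W δ e' q).comp (fderiv ℝ (coordChange e e') (famRep W e q)) := by
  filter_upwards [(h.isOpen_famDom e).mem_nhds hq, (h.isOpen_famDom e').mem_nhds hq'] with p hp hp'
    using (δ (W p.1)).rep_coordChange he he' hp hp'

theorem rep_covD (h : IsSmoothAlong W δ) (he : e ∈ charts n M) (hq : q ∈ famDom W e) :
    (F.covD (δ (W q.1))).rep e q.2
      = covDir (F.Γ e) (famRep W e) (famCov W δ e) (0, 1) q := by
  rw [F.rep_covD _ he hq, covDir, covDir, fderiv_apply_one_eq_deriv, fderiv_apply_one_eq_deriv]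
  rw [← (hasDerivAt_right_of_contDiff (ε := q.1) (x := q.2) (h.differentiableAt_famRep he hq)).deriv,
    ← (hasDerivAt_right_of_contDiff (ε := q.1) (x := q.2) (h.differentiableAt_famCov he hq)).deriv]
  rfl

/-- The covariant derivative of the covector fields along a family of loops. -/
def covAlong (h : IsSmoothAlong W δ) (v : E × ℝ) : CovectorAlong (W 0) :=
  CovectorAlong.ofReps (W 0) (fun e x => covDir (F.Γ e) (famRep W e) (famCov W δ e) v (0, x))
    (fun e x => by
      have h1 : ∀ t x, famRep W e (t, x + 1) = famRep W e (t, x) := fun t x => (W t).rep_add_one x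
      have h2 : ∀ t x, famCov W δ e (t, x + 1) = famCov W δ e (t, x) :=
        fun t x => (δ (W t)).rep_add_one x
      simp only [covDir, fderiv_add_right_one h1, fderiv_add_right_one h2, h1, h2])
    (fun e he => (contDiffOn_covDir (h.isOpen_famDom e) (F.contDiffOn_Γ e he)
      (h.contDiffOn_famRep he) (h.cov e he) (fun q hq => FlatPair.rep_mem hq) v).comp
      (by fun_prop : ContDiff ℝ ∞ fun x : ℝ => ((0 : E), x)).contDiffOn fun x hx => hx)
    (fun e he e' he' x hx hx' => F.covDir_coordChange (γ := famRep W e) (q := (0, x)) he he'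
      (FlatPair.rep_mem hx) (by rw [famRep, FlatPair.symm_rep hx]; exact hx')
        (h.differentiableAt_famRep he hx)
      (h.differentiableAt_famCov he' hx') (h.famRep_coordChange hx)
      (h.famCov_coordChange he he' hx hx') v)

theorem rep_covAlong (h : IsSmoothAlong W δ) (he : e ∈ charts n M) (hx : x ∈ (W 0).dom e) :
    (h.covAlong F v).rep e x = covDir (F.Γ e) (famRep W e) (famCov W δ e) v (0, x) :=
  CovectorAlong.rep_ofReps _ _ _ he hx

/-- Covariant derivatives along the loops and in the direction of the family commute. -/
theorem rep_covD_covAlong (h : IsSmoothAlong W δ) (he : e ∈ charts n M) (hx : x ∈ (W 0).dom e) :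
    (F.covD (h.covAlong F v)).rep e x = covDir (F.Γ e) (famRep W e)
      (covDir (F.Γ e) (famRep W e) (famCov W δ e) (0, 1)) v (0, x) := by
  have h1 := contDiffOn_covDir (h.isOpen_famDom e) (F.contDiffOn_Γ e he)
      (h.contDiffOn_famRep he) (h.cov e he) (fun q hq => FlatPair.rep_mem hq) v
  have h2 : (h.covAlong F v).rep e =ᶠ[nhds x] fun x =>
      covDir (F.Γ e) (famRep W e) (famCov W δ e) v (0, x) := by
    filter_upwards [((W 0).isOpen_dom e).mem_nhds hx] with y hy using h.rep_covAlong F he hy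
  rw [← covDir_comm (h.isOpen_famDom e) hx e.open_target (F.contDiffOn_Γ e he)
    (h.contDiffOn_famRep he) (h.cov e he) (fun q hq => FlatPair.rep_mem hq)
    (F.flat e he _ (FlatPair.rep_mem hx)) v (0, 1), F.rep_covD _ he hx, covDir, covDir,
    fderiv_apply_one_eq_deriv, fderiv_apply_one_eq_deriv, h2.deriv_eq, h2.eq_of_nhds,
    ← (hasDerivAt_right_of_contDiff (h.differentiableAt_famRep he hx)).deriv,
    ← (hasDerivAt_right_of_contDiff (differentiableAt_of_contDiffOn (h.isOpen_famDom e) h1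
      hx)).deriv]
  rfl

end IsSmoothAlong

end

/-! ### The Jacobi identity -/

section

variable {E G : Type*} [NormedAddCommGroup E] [NormedSpace ℝ E] [NormedAddCommGroup G]
  [NormedSpace ℝ G]

theorem hasDerivAt_line {g : E × ℝ → G} {t : E} {x : ℝ} (hg : DifferentiableAt ℝ g (t, x)) (v : E) :
    HasDerivAt (fun s : ℝ => g (t + s • v, x)) (fderiv ℝ g (t, x) (v, 0)) 0 := by
  have h1 : HasDerivAt (fun s : ℝ => (t + s • v, x)) (v, (0 : ℝ)) 0 := by
    have h2 := (((hasDerivAt_id (0 : ℝ)).smul_const v).const_add t).prodMk (hasDerivAt_const 0 x)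
    simpa using h2
  have h3 : HasFDerivAt g (fderiv ℝ g (t, x)) (t + (0 : ℝ) • v, x) := by
    rw [zero_smul, add_zero]
    exact hg.hasFDerivAt
  exact h3.comp_hasDerivAt 0 h1

theorem hasDerivAt_integral_line {g : E × ℝ → ℝ} (hg : ContDiff ℝ ∞ g) (t v : E) :
    HasDerivAt (fun s : ℝ => ∫ x in (0 : ℝ)..1, g (t + s • v, x))
      (∫ x in (0 : ℝ)..1, fderiv ℝ g (t, x) (v, 0)) 0 :=
  hasDerivAt_integral_of_hasDerivAt (G := fun q : ℝ × ℝ => g (t + q.1 • v, q.2))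
    (hg.comp (by fun_prop)) fun _ => hasDerivAt_line (hg.differentiable (by simp) _) v

end

section

variable {n : ℕ} {M : Type*} [TopologicalSpace M] [T2Space M] [ChartedSpace (Model n) M]
  [IsManifold (𝓡 n) ∞ M] {e e' : OpenPartialHomeomorph M (Model n)} (F : FlatPair n M)
  {E : Type*} [NormedAddCommGroup E] [NormedSpace ℝ E] {W : E → Loop n M}
  {δ δ₁ δ₂ : ∀ u : Loop n M, CovectorAlong u} {f : Loop n M → ℝ}

theorem HasVariationalDerivative.hasDerivAt_line (hδ : HasVariationalDerivative f δ)
    (hW : ContMDiff 𝓘(ℝ, E × ℝ) (𝓡 n) ∞ (fun q : E × ℝ => W q.1 (q.2 : UnitAddCircle)))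
    (t v : E) {g : ℝ → ℝ} (hg : ∀ x : ℝ, ∃ e ∈ charts n M, x ∈ (W t).dom e ∧
      g x = (δ (W t)).rep e x (fderiv ℝ (famRep W e) (t, x) (v, 0))) :
    HasDerivAt (fun s : ℝ => f (W (t + s • v))) (∫ x in (0 : ℝ)..1, g x) 0 := by
  refine hδ.hasDerivAt (u := W t) (U := fun s => W (t + s • v))
    (hW.comp (f := fun q : ℝ × ℝ => (t + q.1 • v, q.2)) (by fun_prop : ContDiff ℝ ∞
      fun q : ℝ × ℝ => (t + q.1 • v, q.2)).contMDiff) (by simp) fun x => ?_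
  obtain ⟨e, he, hx, hgx⟩ := hg x
  exact ⟨e, he, hx, _, DegTwo.hasDerivAt_line (differentiableAt_of_contDiffOn
    (isOpen_family_dom hW e) (DegTwo.contDiffOn_family_rep he hW) hx) v, hgx⟩

/-- The derivative of a family of loops, paired with covector fields along the family. -/
def famPair (W : E → Loop n M) (δ : ∀ u : Loop n M, CovectorAlong u) (v q : E × ℝ) : ℝ :=
  famCov W δ (chartAt (Model n) (W q.1 (q.2 : UnitAddCircle))) q
    (fderiv ℝ (famRep W (chartAt (Model n) (W q.1 (q.2 : UnitAddCircle)))) q v)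

namespace IsSmoothAlong

variable {q : E × ℝ} {x : ℝ}

theorem famPair_eq (h : IsSmoothAlong W δ) (he : e ∈ charts n M) (hq : q ∈ famDom W e) (v : E × ℝ) :
    famPair W δ v q = famCov W δ e q (fderiv ℝ (famRep W e) q v) := by
  have he' := chartAt_mem_charts (n := n) (W q.1 (q.2 : UnitAddCircle))
  have hq' : q ∈ famDom W (chartAt (Model n) (W q.1 (q.2 : UnitAddCircle))) :=
    mem_dom_chartAt (W q.1) q.2
  have h1 := (contDiffAt_coordChange he he' (FlatPair.rep_mem hq)
    (by rw [FlatPair.symm_rep hq]; exact hq')).differentiableAt (by simp)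
  rw [famPair, (h.famRep_coordChange hq).fderiv_eq,
    (hasFDerivAt_comp (f := coordChange e _) (g := famRep W e) h1
      (h.differentiableAt_famRep he hq)).fderiv, (h.famCov_coordChange he he' hq hq').eq_of_nhds]
  rfl

theorem exists_chart (q : E × ℝ) : ∃ e ∈ charts n M, q ∈ famDom W e :=
  FlatPair.exists_chart (W q.1) q.2

theorem contDiff_of_charts (h : IsSmoothAlong W δ) {g : E × ℝ → ℝ}
    {g' : OpenPartialHomeomorph M (Model n) → E × ℝ → ℝ}
    (hg : ∀ e ∈ charts n M, ∀ q ∈ famDom W e, g q = g' e q)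
    (hg' : ∀ e ∈ charts n M, ContDiffOn ℝ ∞ (g' e) (famDom W e)) : ContDiff ℝ ∞ g := by
  refine contDiff_iff_contDiffAt.2 fun q => ?_
  obtain ⟨e, he, hq⟩ := exists_chart (W := W) q
  have hN := (h.isOpen_famDom e).mem_nhds hq
  refine ((hg' e he).contDiffAt hN).congr_of_eventuallyEq ?_
  filter_upwards [hN] with p hp using hg e he p hp

theorem contDiff_famPair (h : IsSmoothAlong W δ) (v : E × ℝ) : ContDiff ℝ ∞ (famPair W δ v) :=
  h.contDiff_of_charts (fun e he q hq => h.famPair_eq he hq v) fun e he =>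
    (h.cov e he).clm_apply (((h.contDiffOn_famRep he).fderiv_of_isOpen (m := ∞)
      (h.isOpen_famDom e) (by simp)).clm_apply contDiffOn_const)

theorem fderiv_famPair (h : IsSmoothAlong W δ) (he : e ∈ charts n M) (hq : q ∈ famDom W e)
    (v w : E × ℝ) : fderiv ℝ (famPair W δ v) q w
      = covDir (F.Γ e) (famRep W e) (famCov W δ e) w q (fderiv ℝ (famRep W e) q v)
        + famCov W δ e q (fderiv ℝ (fderiv ℝ (famRep W e)) q w v
          + F.Γ e (famRep W e q) (fderiv ℝ (famRep W e) q w) (fderiv ℝ (famRep W e) q v)) := by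
  have h1 : famPair W δ v =ᶠ[nhds q] fun q => famCov W δ e q (fderiv ℝ (famRep W e) q v) := by
    filter_upwards [(h.isOpen_famDom e).mem_nhds hq] with p hp using h.famPair_eq he hp v
  have h2 := differentiableAt_of_contDiffOn (h.isOpen_famDom e)
    ((h.contDiffOn_famRep he).fderiv_of_isOpen (m := ∞) (h.isOpen_famDom e) (by simp)) hq
  have h3 := h2.hasFDerivAt.clm_apply (hasFDerivAt_const v q)
  rw [h1.fderiv_eq, fderiv_pairing (Γ := F.Γ e) (γ := famRep W e)
    (h.differentiableAt_famCov he hq) h3.differentiableAt, vecDir, h3.fderiv]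
  simp

/-- Each side is a second derivative at parameter 0 of the functional along the family, whose
density is a smooth function of the parameters and x; the second derivatives of this density are
symmetric. -/
theorem integral_fderiv_famPair_symm (h : IsSmoothAlong W δ) (hf : IsLocalFunctional f)
    (hδ : HasVariationalDerivative f δ) (v w : E) :
    ∫ x in (0 : ℝ)..1, fderiv ℝ (famPair W δ (v, 0)) (0, x) (w, 0)
      = ∫ x in (0 : ℝ)..1, fderiv ℝ (famPair W δ (w, 0)) (0, x) (v, 0) := by
  obtain ⟨m, ρ, hρ, hfρ⟩ := hf
  let g : E × ℝ → ℝ := fun q => ρ (W q.1) (q.2 : UnitAddCircle)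
  have hg : ContDiff ℝ ∞ g := contDiff_local_family hρ h.family
  have hg' : ContDiff ℝ ∞ (fderiv ℝ g) := hg.fderiv_right (m := ∞) (by simp)
  have h1 : ∀ v t, ∫ x in (0 : ℝ)..1, famPair W δ (v, 0) (t, x)
      = ∫ x in (0 : ℝ)..1, fderiv ℝ g (t, x) (v, 0) := by
    intro v t
    refine (hδ.hasDerivAt_line h.family t v fun x => ?_).unique
      ((hasDerivAt_integral_line hg t v).congr_of_eventuallyEq
        (Filter.Eventually.of_forall fun s => hfρ _))
    obtain ⟨e, he, hq⟩ := exists_chart (W := W) (t, x)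
    exact ⟨e, he, hq, h.famPair_eq he hq _⟩
  have h2 : ∀ v w, ∫ x in (0 : ℝ)..1, fderiv ℝ (famPair W δ (v, 0)) (0, x) (w, 0)
      = ∫ x in (0 : ℝ)..1, fderiv ℝ (fderiv ℝ g) (0, x) (w, 0) (v, 0) := by
    intro v w
    have h3 := hasDerivAt_integral_line (hg'.clm_apply (contDiff_const (c := (v, (0 : ℝ))))) 0 w
    refine ((hasDerivAt_integral_line (h.contDiff_famPair (v, 0)) 0 w).unique
      (h3.congr_of_eventuallyEq (Filter.Eventually.of_forall fun s => h1 _ _))).trans ?_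
    refine intervalIntegral.integral_congr fun x _ => ?_
    rw [((hg'.differentiable (by simp) (0, x)).hasFDerivAt.clm_apply
      (hasFDerivAt_const _ _)).fderiv]
    simp
  rw [h2, h2]
  refine intervalIntegral.integral_congr fun x _ => ?_
  exact (hg.contDiffAt (x := (0, x))).isSymmSndFDerivAt
    (by simpa using WithTop.coe_le_coe.2 (le_top (a := (2 : ℕ∞)))) _ _

/-- The covariant Hessian of a functional is symmetric. -/
theorem integral_covAlong_symm (h : IsSmoothAlong W δ) (hf : IsLocalFunctional f)
    (hδ : HasVariationalDerivative f δ) {v w : E} {Zv Zw : VectorAlong (W 0)}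
    (hv : ∀ e ∈ charts n M, ∀ x ∈ (W 0).dom e, fderiv ℝ (famRep W e) (0, x) (v, 0) = Zv.rep e x)
    (hw : ∀ e ∈ charts n M, ∀ x ∈ (W 0).dom e, fderiv ℝ (famRep W e) (0, x) (w, 0) = Zw.rep e x) :
    ∫ x in (0 : ℝ)..1, h.covAlong F (w, 0) (x : UnitAddCircle) (Zv (x : UnitAddCircle))
      = ∫ x in (0 : ℝ)..1, h.covAlong F (v, 0) (x : UnitAddCircle) (Zw (x : UnitAddCircle)) := by
  have hi : ∀ v w : E, IntervalIntegrable
      (fun x => fderiv ℝ (famPair W δ (v, 0)) (0, x) (w, 0)) MeasureTheory.volume 0 1 := fun v w =>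
    ((((h.contDiff_famPair (v, 0)).continuous_fderiv (by simp)).clm_apply
      continuous_const).comp (by fun_prop : Continuous fun x : ℝ => ((0 : E), x))
      ).intervalIntegrable _ _
  have hj := fun (α : CovectorAlong (W 0)) Z =>
    (FlatPair.smoothPeriodic_pairing α Z).continuous.intervalIntegrable (μ := MeasureTheory.volume)
      0 1
  rw [← sub_eq_zero, ← intervalIntegral.integral_sub (hj _ _) (hj _ _)]
  have h1 := h.integral_fderiv_famPair_symm hf hδ v w
  rw [← sub_eq_zero, ← intervalIntegral.integral_sub (hi _ _) (hi _ _)] at h1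
  refine Eq.trans (intervalIntegral.integral_congr fun x _ => ?_) h1
  obtain ⟨e, he, hx⟩ := FlatPair.exists_chart (W 0) x
  have hs := (h.contDiffOn_famRep he).contDiffAt ((h.isOpen_famDom e).mem_nhds (x := (0, x)) hx)
  -- The covariant Hessian differs from the ordinary second variation by the covariant acceleration
  -- of the family. This is symmetric because mixed partial derivatives commute and the torsion
  -- vanishes.
  rw [pairing_eq _ _ he hx, pairing_eq _ _ he hx, h.rep_covAlong F he hx, h.rep_covAlong F he hx,
    ← hv e he x hx, ← hw e he x hx, h.fderiv_famPair F he hx, h.fderiv_famPair F he hx,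
    F.symm e he (famRep W e (0, x)) (FlatPair.rep_mem hx), hs.isSymmSndFDerivAt
      (by simpa using WithTop.coe_le_coe.2 (le_top (a := (2 : ℕ∞)))) (w, 0) (v, 0)]
  ring

/-- The derivative of the bracket along a family of loops. -/
theorem hasDerivAt_bracket (h₁ : IsSmoothAlong W δ₁) (h₂ : IsSmoothAlong W δ₂) {v : E}
    {Z : VectorAlong (W 0)}
    (hv : ∀ e ∈ charts n M, ∀ x ∈ (W 0).dom e, fderiv ℝ (famRep W e) (0, x) (v, 0) = Z.rep e x) :
    HasDerivAt (fun s : ℝ => bracket F.operator δ₁ δ₂ (W (0 + s • v)))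
      (- (∫ x in (0 : ℝ)..1, F.loopN Z (F.covD (δ₁ (W 0))) (F.covD (δ₂ (W 0))) x)
        + (∫ x in (0 : ℝ)..1, h₁.covAlong F (v, 0) (x : UnitAddCircle)
            (F.operator (W 0) (δ₂ (W 0)) (x : UnitAddCircle)))
        - ∫ x in (0 : ℝ)..1, h₂.covAlong F (v, 0) (x : UnitAddCircle)
            (F.operator (W 0) (δ₁ (W 0)) (x : UnitAddCircle))) 0 := by
  let B : E × ℝ → ℝ := fun q => F.covD (δ₁ (W q.1)) (q.2 : UnitAddCircle)
    (F.sharp (F.covD (δ₂ (W q.1))) (q.2 : UnitAddCircle))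
  let p := fun (δ : ∀ u : Loop n M, CovectorAlong u) e =>
    covDir (F.Γ e) (famRep W e) (famCov W δ e) (0, 1)
  have hp : ∀ {δ}, IsSmoothAlong W δ → ∀ e ∈ charts n M, ContDiffOn ℝ ∞ (p δ e) (famDom W e) :=
    fun h e he => contDiffOn_covDir (h.isOpen_famDom e) (F.contDiffOn_Γ e he)
      (h.contDiffOn_famRep he) (h.cov e he) (fun q hq => FlatPair.rep_mem hq) _
  have hB : ∀ e ∈ charts n M, ∀ q ∈ famDom W e,
      B q = F.A e (famRep W e q) (p δ₁ e q) (p δ₂ e q) := by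
    intro e he q hq
    simp only [B]
    rw [pairing_eq _ _ he hq, F.rep_sharp _ he hq, apply_raise, h₁.rep_covD F he hq,
      h₂.rep_covD F he hq]
    rfl
  have hBs : ContDiff ℝ ∞ B := h₁.contDiff_of_charts hB fun e he =>
    (((F.contDiffOn_A e he).comp (h₁.contDiffOn_famRep he) fun q hq =>
      FlatPair.rep_mem hq).clm_apply (hp h₁ e he)).clm_apply (hp h₂ e he)
  have h3 := (hasDerivAt_integral_line hBs 0 v).neg
  have hj := fun (α : CovectorAlong (W 0)) Z =>
    (FlatPair.smoothPeriodic_pairing α Z).continuous.intervalIntegrable (μ := MeasureTheory.volume)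
      0 1
  have h4 : ∫ x in (0 : ℝ)..1, fderiv ℝ B (0, x) (v, 0)
      = (∫ x in (0 : ℝ)..1, F.loopN Z (F.covD (δ₁ (W 0))) (F.covD (δ₂ (W 0))) x)
        + (∫ x in (0 : ℝ)..1, F.covD (h₁.covAlong F (v, 0)) (x : UnitAddCircle)
            (F.sharp (F.covD (δ₂ (W 0))) (x : UnitAddCircle)))
        - ∫ x in (0 : ℝ)..1, F.covD (h₂.covAlong F (v, 0)) (x : UnitAddCircle)
            (F.sharp (F.covD (δ₁ (W 0))) (x : UnitAddCircle)) := by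
    have h5 := (F.smoothPeriodic_loopN Z (F.covD (δ₁ (W 0)))
      (F.covD (δ₂ (W 0)))).continuous.intervalIntegrable (μ := MeasureTheory.volume) 0 1
    rw [← intervalIntegral.integral_add h5 (hj _ _), ← intervalIntegral.integral_sub
      (h5.add (hj _ _)) (hj _ _)]
    refine intervalIntegral.integral_congr fun x _ => ?_
    obtain ⟨e, he, hx⟩ := FlatPair.exists_chart (W 0) x
    have hN := (h₁.isOpen_famDom e).mem_nhds (x := (0, x)) hx
    have hev : B =ᶠ[nhds (0, x)] fun q => F.A e (famRep W e q) (p δ₁ e q) (p δ₂ e q) := by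
      filter_upwards [hN] with q hq using hB e he q hq
    have hd : ∀ {δ}, IsSmoothAlong W δ → DifferentiableAt ℝ (p δ e) (0, x) := fun h =>
      differentiableAt_of_contDiffOn (h.isOpen_famDom e) (hp h e he) hx
    have h6 := fderiv_bil (Γ := F.Γ e) (γ := famRep W e) (q := (0, x))
      (F.differentiableAt_A he (FlatPair.rep_mem hx))
      (h₁.differentiableAt_famRep he hx) (hd h₁) (hd h₂) (v, 0)
    -- Here flatness enters: the derivative along the family of the covariant derivative in x is the
    -- covariant derivative in x of `covAlong`.
    rw [hev.fderiv_eq, pairing_eq _ _ he hx, pairing_eq _ _ he hx, F.rep_sharp _ he hx,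
      F.rep_sharp _ he hx, apply_raise, apply_raise, F.loopN_eq _ _ _ he hx, ← hv e he x hx,
      h₁.rep_covD_covAlong F he hx, h₂.rep_covD_covAlong F he hx,
      h₁.rep_covD F he (q := (0, x)) hx, h₂.rep_covD F he (q := (0, x)) hx,
      F.skew e he _ (FlatPair.rep_mem hx) (covDir _ _ (covDir _ _ (famCov W δ₂ e) _) _ _),
      sub_neg_eq_add]
    exact h6
  -- Integration by parts moves the covariant derivative in x from `covAlong` to the raised
  -- covector, which becomes the operator.
  have h5 := fun α β : CovectorAlong (W 0) => F.integral_vecD α (F.sharp (F.covD β))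
  refine (h3.congr_deriv ?_).congr_of_eventuallyEq
    (Filter.Eventually.of_forall fun s => F.bracket_operator _ _ _)
  rw [h4]
  simp only [FlatPair.operator]
  rw [h5, h5]
  ring

end IsSmoothAlong

/-- The three iterated brackets are derivatives of brackets along one family of loops. The six
Hessian terms cancel in pairs by symmetry, and the derivatives of the bivector add up to an exact
term. -/
theorem FlatPair.isPoisson : IsPoisson F.operator := by
  refine ⟨fun _ _ δF δG _ _ _ _ => F.bracket_skew δF δG, ?_⟩
  intro f g k δf δg δk δfg δgk δkf hf hg hk hδf hδg hδk hfg hgk hkf u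
  -- Three parameters are needed, with velocities the images of the three variational derivatives
  -- under the operator, so that symmetry of second derivatives applies to each pair of directions.
  obtain ⟨W, hW, rfl, hWZ⟩ := exists_family ![F.operator u (δf u), F.operator u (δg u),
    F.operator u (δk u)]
  have hZ : ∀ i, ∀ e ∈ charts n M, ∀ x ∈ (W 0).dom e,
      fderiv ℝ (famRep W e) (0, x) (Pi.single i 1, 0) = ((![F.operator _ (δf (W 0)),
        F.operator _ (δg (W 0)), F.operator _ (δk (W 0))] : Fin 3 → _) i).rep e x := by
    intro i e he x hx
    have h1 := hasDerivAt_line (t := (0 : Fin 3 → ℝ)) (differentiableAt_of_contDiffOn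
      (isOpen_family_dom hW e) (contDiffOn_family_rep he hW) hx) (Pi.single i (1 : ℝ))
    refine h1.unique ((hWZ i e he x hx).congr_of_eventuallyEq
      (Filter.Eventually.of_forall fun s => ?_))
    simp only [zero_add, ← Pi.single_smul, smul_eq_mul, mul_one]
  have hs : ∀ {f δ}, IsLocalFunctional f → HasVariationalDerivative f δ → IsSmoothAlong W δ :=
    fun hf hδ => ⟨hW, fun e he => hδ.contDiffOn_family_rep hf he hW⟩
  have h0 := hZ 0
  have h1 := hZ 1
  have h2 := hZ 2
  have key : ∀ {δ₁ δ₂ δ₃ δ₁₂ : ∀ u : Loop n M, CovectorAlong u} {v : Fin 3 → ℝ},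
      HasVariationalDerivative (bracket F.operator δ₁ δ₂) δ₁₂ →
      (∀ e ∈ charts n M, ∀ x ∈ (W 0).dom e, fderiv ℝ (famRep W e) (0, x) (v, 0)
        = (F.operator _ (δ₃ (W 0))).rep e x) →
      HasDerivAt (fun s : ℝ => bracket F.operator δ₁ δ₂ (W (0 + s • v)))
        (bracket F.operator δ₁₂ δ₃ (W 0)) 0 := by
    intro δ₁ δ₂ δ₃ δ₁₂ v h hv
    refine h.hasDerivAt_line hW 0 v fun x => ?_
    obtain ⟨e, he, hx⟩ := FlatPair.exists_chart (W 0) x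
    exact ⟨e, he, hx, by rw [pairing_eq _ _ he hx, hv e he x hx]⟩
  have hF := hs hf hδf
  have hG := hs hg hδg
  have hK := hs hk hδk
  have e1 := (key hfg h2).unique (hF.hasDerivAt_bracket F hG h2)
  have e2 := (key hgk h0).unique (hG.hasDerivAt_bracket F hK h0)
  have e3 := (key hkf h1).unique (hK.hasDerivAt_bracket F hF h1)
  have s1 := hF.integral_covAlong_symm F hf hδf h1 h2
  have s2 := hG.integral_covAlong_symm F hg hδg h2 h0
  have s3 := hK.integral_covAlong_symm F hk hδk h0 h1
  -- Taken at the covariant derivatives of the three variational derivatives, the exact term is the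
  -- part of the Jacobi sum in which the bivector has been differentiated.
  have ht := F.integral_loopN (F.covD (δf (W 0))) (F.covD (δg (W 0))) (F.covD (δk (W 0)))
  have hi := fun Z (α β : CovectorAlong (W 0)) =>
    (F.smoothPeriodic_loopN Z α β).continuous.intervalIntegrable (μ := MeasureTheory.volume) 0 1
  rw [intervalIntegral.integral_add ((hi _ _ _).add (hi _ _ _)) (hi _ _ _),
    intervalIntegral.integral_add (hi _ _ _) (hi _ _ _)] at ht
  simp only [Matrix.cons_val] at s1 s2 s3 e1 e2 e3
  simp only [FlatPair.operator] at s1 s2 s3 e1 e2 e3 ht ⊢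
  linarith

end

section

/-! ### The correspondence -/

section

variable {n : ℕ} {T : Set (Model n)} {y : Model n} {K : Coefficients n} {c c' : OpCoeff n}

theorem Coefficients.toOp_A_proj (i j : Fin n) : K.toOp.A y (proj i : Dual n)
    (proj j : Dual n) = K.a i j y := by
  rw [K.toOp_A, sum_sum_proj]
  simp

theorem Coefficients.toOp_B_proj (i j k : Fin n) : K.toOp.B y (single k 1)
    (proj i : Dual n) (proj j : Dual n) = K.b i j k y := by
  rw [K.toOp_B, sum_sum_proj]
  simp

theorem Coefficients.toOp_C₁_proj (i j k : Fin n) : K.toOp.C₁ y (single k 1)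
    (proj i : Dual n) (proj j : Dual n) = K.c₁ i j k y := by
  rw [K.toOp_C₁, sum_sum_proj]
  simp

theorem Coefficients.toOp_C₂_proj (i j k l : Fin n) : K.toOp.C₂ y (single k 1)
    (single l 1) (proj i : Dual n) (proj j : Dual n)
    = K.c₂ i j k l y := by
  rw [K.toOp_C₂, sum_sum_proj]
  simp

/-- B is given by the derivative of `A` and by `C₁`. As every velocity is a raised covector, `S_eq`
determines S on the velocity, hence the value of `C₂` that enters the operator. -/
theorem OpCoeff.IsHamiltonianOn.op_eq (h : c.IsHamiltonianOn T) (h' : c'.IsHamiltonianOn T)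
    (hT : IsOpen T) (hA : Set.EqOn c.A c'.A T) (hC : Set.EqOn c.C₁ c'.C₁ T) (hy : y ∈ T)
    (hinv : (raise (c.A y)).IsInvertible) (v w : Model n) (α α₁ α₂ : Dual n) :
    c.op y v w α α₁ α₂ = c'.op y v w α α₁ α₂ := by
  have hA' := (hA.eventuallyEq_of_mem (hT.mem_nhds hy)).fderiv_eq (𝕜 := ℝ)
  have hC' := (hC.eventuallyEq_of_mem (hT.mem_nhds hy)).fderiv_eq (𝕜 := ℝ)
  refine model_ext fun ξ => ?_
  obtain ⟨s, hs⟩ := hinv.surjective v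
  have hs' : raise (c'.A y) s = v := by rw [← hA hy, hs]
  have h1 := h.S_eq y hy s ξ α v
  have h2 := h'.S_eq y hy s ξ α v
  rw [show c.sharp y s = v from hs] at h1
  rw [show c'.sharp y s = v from hs', ← hC hy, ← h1] at h2
  simp only [S_apply, hC', sub_apply, smul_apply, add_apply, smul_eq_mul] at h2
  rw [apply_op, apply_op, h.B_eq y hy, h'.B_eq y hy, hA hy, hA', hC hy]
  linarith

theorem OpCoeff.Γ_congr (hA : c.A y = c'.A y) (hC : c.C₁ y = c'.C₁ y) : c.Γ y = c'.Γ y := by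
  rw [OpCoeff.Γ, OpCoeff.Γ, hA, hC]

end

variable {n : ℕ} {M : Type*} [TopologicalSpace M] [T2Space M] [ChartedSpace (Model n) M]
  [IsManifold (𝓡 n) ∞ M] {e : OpenPartialHomeomorph M (Model n)} {P : LoopOperator n M}
  {K K' : Coefficients n} {y : Model n}

/-- The transformation laws are applied to the identity change of coordinates, with possibly
different coefficients on the two sides. -/
theorem HasLocalForm.toOp_eq (h : HasLocalForm P e K) (h' : HasLocalForm P e K')
    (he : e ∈ charts n M) (hy : y ∈ e.target) :
    K.toOp.A y = K'.toOp.A y ∧ K.toOp.C₁ y = K'.toOp.C₁ y := by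
  have hev : coordChange e e =ᶠ[nhds y] id := by
    filter_upwards [e.open_target.mem_nhds hy] with z hz using e.right_inv hz
  have h1 : fderiv ℝ (coordChange e e) =ᶠ[nhds y] fun _ => ContinuousLinearMap.id ℝ (Model n) := by
    filter_upwards [hev.eventuallyEq_nhds] with z hz
    rw [hz.fderiv_eq, fderiv_id]
  have h2 : fderiv ℝ (fderiv ℝ (coordChange e e)) y = 0 := by
    rw [h1.fderiv_eq, fderiv_fun_const]
    rfl
  have h3 := h.A_coordChange h' he he hy (e.map_target hy)
  have h4 := h.C₁_coordChange h' he he hy (e.map_target hy)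
  simp only [hev.eq_of_nhds, h1.eq_of_nhds, h2, id_eq, ContinuousLinearMap.comp_id,
    ContinuousLinearMap.id_apply, zero_apply, ContinuousLinearMap.comp_zero, map_zero,
    add_zero] at h3 h4
  constructor
  · ext p q
    exact (h3 p q).symm
  · ext w p q
    exact (h4 w p q).symm

theorem FlatPair.Γ_pairCoeff (F : FlatPair n M) (he : e ∈ charts n M) (hy : y ∈ e.target) :
    (pairCoeff (F.A e) (F.Γ e)).Γ y = F.Γ e y := by
  ext1 v; ext1 w
  obtain ⟨s, rfl⟩ := F.exists_raise he hy v
  refine model_ext fun p => ?_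
  refine (OpCoeff.apply_Γ (c := pairCoeff (F.A e) (F.Γ e))
    (raise_isInvertible (F.nondeg e he y hy)) p s w).trans ?_
  rw [F.symm e he y hy]
  refine Eq.trans ?_ (apply_raise (F.A e y) (p.comp (F.Γ e y w)) s).symm
  rw [F.skew e he y hy]
  rfl

/-- The chosen local coefficients agree with the explicit ones in `A` and `C₁`, and Γ is recovered
from these two. -/
theorem FlatPair.toPair_ofOperator (q : CompatiblePair n M) :
    (FlatPair.ofOperator (FlatPair.ofPair q).operator (FlatPair.ofPair q).isNondegenerateDegreeTwo
      (FlatPair.ofPair q).isPoisson).toPair = q := by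
  set F := FlatPair.ofPair q
  have key : ∀ e ∈ charts n M, ∀ y ∈ e.target, (localCoeff F.operator e).A y = F.A e y ∧
      (localCoeff F.operator e).Γ y = F.Γ e y := by
    intro e he y hy
    obtain ⟨K, hK, h⟩ := exists_localCoeff F.isNondegenerateDegreeTwo he
    obtain ⟨h1, h2⟩ := hK.1.toOp_eq (F.hasLocalForm he) he hy
    rw [OpCoeff.toOp_toCoeff] at h1 h2
    rw [h, OpCoeff.Γ_congr h1 h2, F.Γ_pairCoeff he hy]
    exact ⟨h1, rfl⟩
  refine CompatiblePair.ext_bil (fun e he y hy => ?_) fun e he y hy => ?_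
  · exact (FlatPair.bil_bivector _ he hy).trans (key e he y hy).1
  · exact ((FlatPair.isChris _).chris_connection he hy).trans (key e he y hy).2

/-- Both operators are Hamiltonian with the same `A` and Γ, therefore with the same `C₁`, and
`op_eq` shows that they are equal. -/
theorem FlatPair.operator_ofPair_ofOperator (hnd : IsNondegenerateDegreeTwo P) (hP : IsPoisson P) :
    (FlatPair.ofPair (FlatPair.ofOperator P hnd hP).toPair).operator = P := by
  set F := FlatPair.ofOperator P hnd hP with hF
  set F' := FlatPair.ofPair F.toPair
  funext u α
  refine VectorAlong.ext_rep fun x => ?_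
  obtain ⟨e, he, hx⟩ := FlatPair.exists_chart u x
  refine ⟨e, he, hx, ?_⟩
  obtain ⟨K, hK, h⟩ := exists_localCoeff hnd he
  have hH := hP.isHamiltonianOn hK.1 he
  have hH' := F'.isPoisson.isHamiltonianOn (F'.hasLocalForm he) he
  rw [OpCoeff.toOp_toCoeff] at hH'
  have hA : ∀ y ∈ e.target, F'.A e y = K.toOp.A y := fun y hy =>
    (F.bil_bivector he hy).trans (congrArg (fun c => OpCoeff.A c y) h)
  have hΓ : ∀ y ∈ e.target, F'.Γ e y = K.toOp.Γ y := fun y hy =>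
    (F.isChris.chris_connection he hy).trans (congrArg (fun c => OpCoeff.Γ c y) h)
  rw [F'.rep_operator he u α hx, hK.1.rep_eq he u α hx]
  have hy := FlatPair.rep_mem hx
  refine hH'.op_eq hH e.open_target hA (fun y hy => ?_) hy
    (raise_isInvertible (F'.nondeg e he _ hy)) _ _ _ _ _
  ext w p q
  rw [hH.C₁_eq hy (hK.isInvertible hy), ← hA y hy, ← hΓ y hy]
  rfl

end

section

/-! ### The coefficients of a Hamiltonian operator -/

section

variable {n : ℕ} {T : Set (Model n)} {y : Model n} {K : Coefficients n}

/-- The basis of covectors which is dual to the coordinate vectors with respect to the leading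
coefficient. -/
def Coefficients.lower (K : Coefficients n) (y : Model n) (l : Fin n) : Dual n :=
  ∑ r, (K.leading y)⁻¹ r l • (proj r : Dual n)

theorem Coefficients.raise_lower (hK : (K.leading y).det ≠ 0) (l : Fin n) :
    raise (K.toOp.A y) (K.lower y l) = single l 1 := by
  ext i
  have h1 : (K.leading y * (K.leading y)⁻¹) i l = (1 : Matrix (Fin n) (Fin n) ℝ) i l := by
    rw [Matrix.mul_nonsing_inv _ (Ne.isUnit hK)]
  refine (apply_raise _ (proj i : Dual n) _).trans ?_
  rw [Coefficients.lower, map_sum]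
  simp only [map_smul, toOp_A_proj, smul_eq_mul]
  rw [Matrix.mul_apply] at h1
  simp only [Coefficients.leading, Matrix.of_apply] at h1 ⊢
  rw [Finset.sum_congr rfl fun j _ => mul_comm _ _, h1]
  simp [Matrix.one_apply, eq_comm]

theorem Coefficients.lower_single (l m : Fin n) :
    K.lower y l (single m 1) = (K.leading y)⁻¹ m l := by
  simp [Coefficients.lower, sum_apply]

theorem Coefficients.inv_leading_skew (hs : ∀ p q, K.toOp.A y p q = - K.toOp.A y q p)
    (hK : (K.leading y).det ≠ 0) (l m : Fin n) : (K.leading y)⁻¹ l m = - (K.leading y)⁻¹ m l := by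
  rw [← K.lower_single m l, ← K.lower_single l m, ← K.raise_lower hK l, ← K.raise_lower hK m,
    apply_raise, apply_raise, hs]

/-- The inner vector is expanded in the coordinate basis, each basis vector being a raised covector;
the symmetry of `C₁` then exchanges the roles of the two lowered indices. -/
theorem Coefficients.C₁_lower (hH : K.toOp.IsHamiltonianOn T) (hy : y ∈ T)
    (hK : (K.leading y).det ≠ 0) (i j k l : Fin n) :
    K.toOp.C₁ y (vecOf ((K.toOp.C₁ y (single k 1)).flip
      (proj j : Dual n))) (K.lower y l) (proj i : Dual n)
      = ∑ m, ∑ r, (K.leading y)⁻¹ r m * K.c₁ r i l y * K.c₁ m j k y := by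
  have h1 : vecOf ((K.toOp.C₁ y (single k 1)).flip (proj j : Dual n))
      = ∑ m, K.c₁ m j k y • raise (K.toOp.A y) (K.lower y m) := by
    simp only [K.raise_lower hK]
    rw [eq_sum_single (vecOf _)]
    refine Finset.sum_congr rfl fun m _ => ?_
    congr 1
    have h := apply_vecOf (proj m : Dual n)
      ((K.toOp.C₁ y (single k 1)).flip (proj j : Dual n))
    rw [ContinuousLinearMap.flip_apply, K.toOp_C₁_proj] at h
    exact h
  have h2 := fun m => hH.symm y hy (proj i : Dual n) (K.lower y l) (K.lower y m)
  rw [h1]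
  simp only [map_sum, map_smul, sum_apply, smul_apply, smul_eq_mul]
  refine Finset.sum_congr rfl fun m _ => ?_
  refine (congrArg _ (h2 m)).trans ?_
  rw [show K.toOp.sharp y (K.lower y l) = _ from K.raise_lower hK l, Coefficients.lower, map_sum,
    sum_apply, Finset.mul_sum]
  refine Finset.sum_congr rfl fun r _ => ?_
  rw [map_smul, smul_apply, K.toOp_C₁_proj, smul_eq_mul]
  ring

theorem Coefficients.fderiv_C₁ (hC : DifferentiableAt ℝ K.toOp.C₁ y) (i j k l : Fin n) :
    fderiv ℝ K.toOp.C₁ y (single l 1) (single k 1)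
      (proj i : Dual n) (proj j : Dual n)
      = pderiv l (K.c₁ i j k) y := by
  have h1 : K.c₁ i j k = fun z => K.toOp.C₁ z (single k 1)
      (proj i : Dual n) (proj j : Dual n) :=
    funext fun z => (K.toOp_C₁_proj i j k).symm
  rw [pderiv, h1, (((hC.hasFDerivAt.clm_apply (hasFDerivAt_const _ y)).clm_apply
    (hasFDerivAt_const _ y)).clm_apply (hasFDerivAt_const _ y)).fderiv]
  simp

/-- This is `S_eq` with the covector whose raised vector is the l-th coordinate vector. Skewness of
the inverse matrix turns the difference of the two quadratic terms into the sum in the formula. -/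
theorem Coefficients.c₂_eq (hH : K.toOp.IsHamiltonianOn T) (hK : K.IsRegularOn T) (hT : IsOpen T)
    (hy : y ∈ T) (hdet : (K.leading y).det ≠ 0) (i j k l : Fin n) : K.c₂ i j k l y =
      (pderiv l (K.c₁ i j k) y + pderiv k (K.c₁ i j l) y) / 2
        - ∑ p, ∑ r, (K.leading y)⁻¹ p r *
            ((K.c₁ r i k y * K.c₁ p j l y + K.c₁ r i l y * K.c₁ p j k y) / 2) := by
  have hC := differentiableAt_of_contDiffOn hT hK.contDiffOn_C₁ hy
  have h1 := hH.S_eq y hy (K.lower y l) (proj i : Dual n)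
    (proj j : Dual n) (single k 1)
  rw [show K.toOp.sharp y (K.lower y l) = _ from K.raise_lower hdet l,
    K.C₁_lower hH hy hdet, K.C₁_lower hH hy hdet, OpCoeff.S_apply] at h1
  simp only [sub_apply, smul_apply, add_apply, smul_eq_mul, K.fderiv_C₁ hC, K.toOp_C₂_proj] at h1
  have hν := K.inv_leading_skew (hH.skew y hy) hdet
  have h2 : ∑ m, ∑ r, (K.leading y)⁻¹ r m * K.c₁ r i l y * K.c₁ m j k y
      = - ∑ p, ∑ r, (K.leading y)⁻¹ p r * (K.c₁ r i l y * K.c₁ p j k y) := by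
    simp only [← Finset.sum_neg_distrib]
    exact Finset.sum_congr rfl fun m _ => Finset.sum_congr rfl fun r _ => by rw [hν r m]; ring
  have h3 : ∑ m, ∑ r, (K.leading y)⁻¹ r m * K.c₁ r j l y * K.c₁ m i k y
      = ∑ p, ∑ r, (K.leading y)⁻¹ p r * (K.c₁ r i k y * K.c₁ p j l y) := by
    rw [Finset.sum_comm]
    exact Finset.sum_congr rfl fun m _ => Finset.sum_congr rfl fun r _ => by ring
  have h4 : ∑ p, ∑ r, (K.leading y)⁻¹ p r *
      ((K.c₁ r i k y * K.c₁ p j l y + K.c₁ r i l y * K.c₁ p j k y) / 2)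
      = (∑ p, ∑ r, (K.leading y)⁻¹ p r * (K.c₁ r i k y * K.c₁ p j l y)
        + ∑ p, ∑ r, (K.leading y)⁻¹ p r * (K.c₁ r i l y * K.c₁ p j k y)) / 2 := by
    simp only [← Finset.sum_add_distrib, Finset.sum_div]
    exact Finset.sum_congr rfl fun m _ => Finset.sum_congr rfl fun r _ => by ring
  rw [h2, h3, hK.symm_c₂ i j l k y hy] at h1
  rw [h4]
  linarith

end

variable {n : ℕ} {M : Type*} [TopologicalSpace M] [T2Space M] [ChartedSpace (Model n) M]
  [IsManifold (𝓡 n) ∞ M] {e : OpenPartialHomeomorph M (Model n)} {P : LoopOperator n M}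
  {K : Coefficients n} {y : Model n}

theorem HasLocalForm.coefficients (h : HasLocalForm P e K) (hnd : IsNondegenerateDegreeTwo P)
    (hP : IsPoisson P) (he : e ∈ charts n M) (hy : y ∈ e.target) (i j k l : Fin n) :
    K.a i j y = (FlatPair.ofOperator P hnd hP).bivector.comp e i j y ∧
    K.c₁ i j k y = - ∑ r, (FlatPair.ofOperator P hnd hP).bivector.comp e i r y *
      (FlatPair.ofOperator P hnd hP).isChris.connection.christoffel e r k j y ∧
    K.b i j k y = (FlatPair.ofOperator P hnd hP).isChris.connection.covBivector
      (FlatPair.ofOperator P hnd hP).bivector e k i j y + 2 * K.c₁ i j k y ∧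
    K.c₂ i j k l y = (pderiv l (K.c₁ i j k) y + pderiv k (K.c₁ i j l) y) / 2
      - ∑ p, ∑ r, (K.leading y)⁻¹ p r *
          ((K.c₁ r i k y * K.c₁ p j l y + K.c₁ r i l y * K.c₁ p j k y) / 2) := by
  set F := FlatPair.ofOperator P hnd hP
  set a := F.bivector
  set D := F.isChris.connection
  obtain ⟨K', hK', hl⟩ := exists_localCoeff hnd he
  have hA : ∀ z ∈ e.target, K.toOp.A z = a.bil e z := fun z hz =>
    (h.toOp_eq hK'.1 he hz).1.trans ((F.bil_bivector he hz).trans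
      (congrArg (fun c => OpCoeff.A c z) hl)).symm
  have hΓ : ∀ z ∈ e.target, K.toOp.Γ z = D.chris e z := fun z hz =>
    (OpCoeff.Γ_congr (h.toOp_eq hK'.1 he hz).1 (h.toOp_eq hK'.1 he hz).2).trans
      ((F.isChris.chris_connection he hz).trans (congrArg (fun c => OpCoeff.Γ c z) hl)).symm
  -- The given local form need not be the chosen one; nondegeneracy is transferred by uniqueness of
  -- the leading coefficient.
  have hdet : (K.leading y).det ≠ 0 := by
    rw [show K.leading y = K'.leading y from Matrix.ext fun i j => by
      rw [Coefficients.leading, Coefficients.leading, Matrix.of_apply, Matrix.of_apply,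
        ← K.toOp_A_proj, ← K'.toOp_A_proj, (h.toOp_eq hK'.1 he hy).1]]
    exact hK'.2 y hy
  have hinv := (show IsLocalCoeff P e K' from hK').isInvertible hy
  rw [← (h.toOp_eq hK'.1 he hy).1] at hinv
  have hH := hP.isHamiltonianOn h he
  refine ⟨?_, ?_, ?_, Coefficients.c₂_eq hH h.1 e.open_target hy hdet i j k l⟩
  · rw [← K.toOp_A_proj, hA y hy, a.bil_proj]
  · rw [← K.toOp_C₁_proj, hH.C₁_eq hy hinv, hA y hy, bil_right]
    congr 1
    refine Finset.sum_congr rfl fun r _ => ?_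
    rw [a.bil_proj, mul_comm, ContinuousLinearMap.comp_apply, hH.symm_Γ hy hinv, hΓ y hy,
      ← D.chris_single]
    rfl
  · rw [D.covBivector_eq a he hy, ← nablaA_congr (A := K.toOp.A) (Γ := K.toOp.Γ)
      (Filter.eventually_of_mem (e.open_target.mem_nhds hy) hA)
      (Filter.eventually_of_mem (e.open_target.mem_nhds hy) hΓ), hH.nablaA_eq hy hinv,
      ← K.toOp_B_proj, ← K.toOp_C₁_proj, hH.B_eq y hy]
    ring

end

end DegTwo
end

theorem mainTheorem3 (n : ℕ) (M : Type*) [TopologicalSpace M] [T2Space M]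
    [SecondCountableTopology M] [ChartedSpace (DegTwo.Model n) M] [IsManifold (𝓡 n) ∞ M] :
    ∃ Φ : DegTwo.HamiltonianOperator n M ≃ DegTwo.CompatiblePair n M,
      ∀ (P : DegTwo.HamiltonianOperator n M) (a : DegTwo.Bivector n M)
        (D : DegTwo.Connection n M), (Φ P).1 = (a, D) →
      ∀ e ∈ DegTwo.charts n M, ∀ K : DegTwo.Coefficients n, DegTwo.HasLocalForm P.1 e K →
      ∀ y ∈ e.target, ∀ i j k l : Fin n,
        K.a i j y = a.comp e i j y ∧
        K.c₁ i j k y = - ∑ r, a.comp e i r y * D.christoffel e r k j y ∧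
        K.b i j k y = D.covBivector a e k i j y + 2 * K.c₁ i j k y ∧
        K.c₂ i j k l y =
          (DegTwo.pderiv l (K.c₁ i j k) y + DegTwo.pderiv k (K.c₁ i j l) y) / 2
            - ∑ p, ∑ r, (K.leading y)⁻¹ p r *
                ((K.c₁ r i k y * K.c₁ p j l y + K.c₁ r i l y * K.c₁ p j k y) / 2) := by
  refine ⟨⟨fun P => (DegTwo.FlatPair.ofOperator P.1 P.2.1 P.2.2).toPair,
    fun q => ⟨(DegTwo.FlatPair.ofPair q).operator,
      (DegTwo.FlatPair.ofPair q).isNondegenerateDegreeTwo, (DegTwo.FlatPair.ofPair q).isPoisson⟩,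
    fun P => Subtype.ext (DegTwo.FlatPair.operator_ofPair_ofOperator P.2.1 P.2.2),
    DegTwo.FlatPair.toPair_ofOperator⟩, ?_⟩
  intro P a D h e he K hK y hy i j k l
  obtain ⟨rfl, rfl⟩ := Prod.mk.inj h
  exact hK.coefficients P.2.1 P.2.2 he hy i j k l
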